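/- **Setting.** Let $N,p$ be positive integers, $\varepsilon>0$, $k_1,\dots,k_p\in\mathbb C$ and $\Omega=\{|\mathrm{Re}\,b|<\varepsilon,\ \mathrm{Im}\,b>0\}$, where the half-strips $\Omega+k_j$ are pairwise disjoint ($|\mathrm{Re}\,k_i-\mathrm{Re}\,k_j|\ge 2\varepsilon$ for $i\ne j$). For each $j$ let $H_j$ be an $N\times N$ matrix function on $\Omega+k_j$ that is analytic, has algebraic entries and tends to $I$ as $\mathrm{Im}\,k\to\infty$, and let $L_j$ be its logarithm fixed by continuity from $i\infty$: $L_j$ is analytic on $\Omega+k_j$, $e^{L_j}=H_j$, and $L_j\to0$ as $\mathrm{Im}\,k\to\infty$. For $b\in\Omega$ put $\Gamma_j(b)=(k_j+b,\ k_j+b+i\infty)$ (a vertical half-line; for $b\in(0,i\infty)$ it is $(k_j+b,k_j+i\infty)$). A solution of the Riemann–Hilbert problem with parameter $b$ is a matrix function $U(b,\cdot)$, analytic with non-zero determinant in the plane cut along the closed half-lines $\overline{\Gamma_j(b)}$, such that: on each $\Gamma_j(b)$ it has continuous nonsingular boundary values on the right ($k^+$) and left ($k^-$) shores with $U(b,k^+)=U(b,k^-)H_j(k)$;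 $U(b,k)\to I$ as $|k|\to\infty$; and at each end point $U(b,k)\,(k-(k_j+b))^{-L_j(k)/(2\pi i)}$ tends to a nonsingular matrix as $k\to k_j+b$ (the branch of the power is cut along $\Gamma_j(b)$). For a directed contour $\gamma$ and a matrix function $C$ let $\mathrm{OE}_\gamma[C(\tau)\,d\tau]$ be the value at the end of $\gamma$ of the solution of $dX/d\tau=C(\tau)X$ along $\gamma$ that equals $I$ at the start of $\gamma$ (as a limit, if an end is at infinity). **(a)** Let $U(b,k)$ be a family of solutions, $b\in\Omega$. Then there are matrices $s_1(b),\dots,s_p(b)$, analytic in $\Omega$, such that for all $b\in\Omega$ and all $k$ off the closed cuts $$\frac{\partial}{\partial b}U(b,k)=\Bigl(\sum_{j=1}^p\frac{s_j(b)}{k-(k_j+b)}\Bigr)U(b,k),$$ and $U(i\infty,k)=I$, i.e. for every $k$, $U(b,k)\to I$ as $\mathrm{Im}\,b\to\infty$, $b\in\Omega$. If the family of solutions is only given for $b\in(0,i\infty)$, the same holds on $(0,i\infty)$ with $s_j$ analytic in an open neighbourhood of $(0,i\infty)$ in $\Omega$. For $p=1$ the equation is $\partial_bU=\frac{s_1(b)}{k-(k_1+b)}U$.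 **(b)** Conversely, let $s_1,\dots,s_p$ be matrix functions analytic in $\Omega$ with $s_j(\tau)=O(|\tau|^{-\alpha})$ as $\mathrm{Im}\,\tau\to\infty$ in $\Omega$, for some $\alpha>0$. Suppose that for every $m$ and every $k\in(k_m,k_m+i\infty)$ $$\mathrm{OE}_{\gamma}\Bigl[\sum_{j=1}^p\frac{s_j(\tau)}{k-(\tau+k_j)}\,d\tau\Bigr]=H_m(k),$$ where, for some $b_0\in(0,i\infty)$ with $\mathrm{Im}\,b_0<\mathrm{Im}(k-k_m)$ and some $0<\delta<\varepsilon$ (both may depend on $m$ and $k$), $\gamma$ consists of $\gamma^+$, coming down from $i\infty$ along $\mathrm{Re}\,\tau=-\delta$ and then going horizontally to $b_0$, followed by $\gamma^-$, traversed from $b_0$ horizontally to $\mathrm{Re}\,\tau=\delta$ and then up to $i\infty$; thus $\gamma$ passes around $\tau=k-k_m$ in $\Omega$. Then for every $b\in\Omega$ the Riemann–Hilbert problem with parameter $b$ has exactly one solution, and it is $$U(b,k)=\mathrm{OE}_{\gamma_b}\Bigl[\sum_{j=1}^p\frac{s_j(\tau)}{k-(\tau+k_j)}\,d\tau\Bigr],$$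 where $\gamma_b$ runs from $i\infty$ vertically down to $b$. -/

import Mathlib

open Filter Topology Set
open scoped Matrix

namespace WienerHopfODE

/-- The half-strip `Ω = {|Re b| < ε, Im b > 0}`. -/
def halfStrip (ε : ℝ) : Set ℂ := {b | |b.re| < ε ∧ 0 < b.im}

/-- The half-line `(0, i∞)` of purely imaginary parameters. -/
def imagHalfLine : Set ℂ := {b | b.re = 0 ∧ 0 < b.im}

/-- The translated half-strip `Ω + a`. -/
def halfStripAt (ε : ℝ) (a : ℂ) : Set ℂ := {z | z - a ∈ halfStrip ε}

/-- The filter `Im z → +∞`, `z` staying in `s`. -/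
def toImInfty (s : Set ℂ) : Filter ℂ := comap Complex.im atTop ⊓ 𝓟 s

/-- The open vertical half-line `(a, a + i∞)`. -/
def ray (a : ℂ) : Set ℂ := {z | z.re = a.re ∧ a.im < z.im}

/-- The complex plane cut along the vertical half-lines `(k j + b, k j + b + i∞)`; the end points
`k j + b` are removed as well. For `b` in `(0, i∞)` these are the half-lines
`(k j + b, k j + i∞)`. -/
def cutPlane {p : ℕ} (k : Fin p → ℂ) (b : ℂ) : Set ℂ :=
  {z | ∀ j, z ≠ k j + b ∧ z ∉ ray (k j + b)}

/-- A function that satisfies on `s` a nontrivial polynomial equation `Q (z, f z) = 0`. -/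
def IsAlgebraicOn (f : ℂ → ℂ) (s : Set ℂ) : Prop :=
  ∃ Q : Polynomial (Polynomial ℂ), Q ≠ 0 ∧ ∀ z ∈ s, Q.evalEval z (f z) = 0

/-- A matrix function is holomorphic on (the open set) `s` if its entries are. -/
def MatHolomorphicOn {N : ℕ} (f : ℂ → Matrix (Fin N) (Fin N) ℂ) (s : Set ℂ) : Prop :=
  ∀ a c, DifferentiableOn ℂ (fun z => f z a c) s

/-- Entrywise derivative of a matrix function of a complex variable within a set. -/
def MatHasDerivWithinAt {N : ℕ} (f : ℂ → Matrix (Fin N) (Fin N) ℂ)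
    (f' : Matrix (Fin N) (Fin N) ℂ) (s : Set ℂ) (z : ℂ) : Prop :=
  ∀ a c, HasDerivWithinAt (fun w => f w a c) (f' a c) s z

/-- Entrywise derivative of a matrix function of a complex variable. -/
def MatHasDerivAt {N : ℕ} (f : ℂ → Matrix (Fin N) (Fin N) ℂ)
    (f' : Matrix (Fin N) (Fin N) ℂ) (z : ℂ) : Prop :=
  ∀ a c, HasDerivAt (fun w => f w a c) (f' a c) z

/-- The coefficients `H j` of the family of Riemann–Hilbert problems, together with the branch
`L j` of their logarithms that is fixed by continuity from `L j = 0` at `i∞`. If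
`H j = P j * F j * (P j)⁻¹` with `F j` diagonal, then `L j = P j * log (F j) * (P j)⁻¹`. -/
structure IsJumpData {p N : ℕ} (ε : ℝ) (k : Fin p → ℂ)
    (H L : Fin p → ℂ → Matrix (Fin N) (Fin N) ℂ) : Prop where
  eps_pos : 0 < ε
  /-- The half-strips `Ω + k j` are pairwise disjoint. -/
  disjoint_strips : ∀ i j, i ≠ j → 2 * ε ≤ |(k i).re - (k j).re|
  holomorphic : ∀ j, MatHolomorphicOn (H j) (halfStripAt ε (k j))
  algebraic : ∀ j a c, IsAlgebraicOn (fun z => H j z a c) (halfStripAt ε (k j))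
  tendsto_one : ∀ j, Tendsto (H j) (toImInfty (halfStripAt ε (k j))) (𝓝 1)
  log_holomorphic : ∀ j, MatHolomorphicOn (L j) (halfStripAt ε (k j))
  exp_log : ∀ j, ∀ z ∈ halfStripAt ε (k j), NormedSpace.exp (L j z) = H j z
  log_tendsto_zero : ∀ j, Tendsto (L j) (toImInfty (halfStripAt ε (k j))) (𝓝 0)

/-- The branch of `log z` with the cut `(0, i∞)`, `-3π/2 < arg z < π/2`. -/
noncomputable def logUp (z : ℂ) : ℂ :=
  Complex.log (Complex.I * z) - (Real.pi / 2) * Complex.I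

/-- `z ^ (A / (2πi))` for a matrix `A`, with the branch `logUp` of the logarithm. -/
noncomputable def matCpow {N : ℕ} (z : ℂ) (A : Matrix (Fin N) (Fin N) ℂ) :
    Matrix (Fin N) (Fin N) ℂ :=
  NormedSpace.exp ((logUp z / (2 * Real.pi * Complex.I)) • A)

/-- `U` solves the Riemann–Hilbert problem with parameter `b`. -/
structure IsRHSolution {p N : ℕ} (k : Fin p → ℂ)
    (H L : Fin p → ℂ → Matrix (Fin N) (Fin N) ℂ) (b : ℂ)
    (U : ℂ → Matrix (Fin N) (Fin N) ℂ) : Prop where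
  holomorphic : MatHolomorphicOn U (cutPlane k b)
  det_ne_zero : ∀ z ∈ cutPlane k b, (U z).det ≠ 0
  /-- On the right (`A`) and left (`B`) shores of each cut `U` has continuous, nonsingular
  boundary values, and `U(z⁺) = U(z⁻) H_j(z)`. -/
  jump : ∀ j, ∀ z ∈ ray (k j + b), ∃ A B : Matrix (Fin N) (Fin N) ℂ,
    Tendsto U (𝓝[{w | z.re < w.re}] z) (𝓝 A) ∧ Tendsto U (𝓝[{w | w.re < z.re}] z) (𝓝 B) ∧
      A.det ≠ 0 ∧ B.det ≠ 0 ∧ A = B * H j z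
  tendsto_one : Tendsto U (Bornology.cobounded ℂ ⊓ 𝓟 (cutPlane k b)) (𝓝 1)
  /-- At the end point `k j + b` the function `U` behaves as
  `K * (z - (k j + b)) ^ (L j z / (2πi))` with a nonsingular matrix `K`. -/
  endpoint : ∀ j, ∃ K : Matrix (Fin N) (Fin N) ℂ, K.det ≠ 0 ∧
    Tendsto (fun z => U z * (matCpow (z - (k j + b)) (L j z))⁻¹)
      (𝓝[cutPlane k b] (k j + b)) (𝓝 K)

/-- The coefficient `∑ j, s j b / (z - (k j + b))`. -/
noncomputable def odeCoeff {p N : ℕ} (k : Fin p → ℂ)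
    (s : Fin p → ℂ → Matrix (Fin N) (Fin N) ℂ) (z b : ℂ) : Matrix (Fin N) (Fin N) ℂ :=
  ∑ j, (z - (k j + b))⁻¹ • s j b

/-- `E` is the ordered exponential `OE_γ [C(τ) dτ]` along the directed, piecewise differentiable
contour `γ`: the value at the end of `γ` of the solution of `dX/dτ = C(τ) X` along `γ` that equals
`1` at the start of `γ`. The contour is parametrized by the whole real line and may start or end
at infinity; a finite starting or end point is a stretch on which `γ` is constant. -/
def HasOrderedExp {N : ℕ} (γ : ℝ → ℂ) (C : ℂ → Matrix (Fin N) (Fin N) ℂ)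
    (E : Matrix (Fin N) (Fin N) ℂ) : Prop :=
  ∃ X : ℝ → Matrix (Fin N) (Fin N) ℂ, Continuous X ∧
    Tendsto X atBot (𝓝 1) ∧ Tendsto X atTop (𝓝 E) ∧
    ∃ T : Finset ℝ, ∀ t ∉ T, ∃ γ' : ℂ, HasDerivAt γ γ' t ∧
      ∀ a c, HasDerivAt (fun u => X u a c) ((γ' • (C (γ t) * X t)) a c) t

/-- The contour `γ_b` from `i∞` straight down to `b` (where it stays for `t ≥ 0`). -/
noncomputable def pathTo (b : ℂ) (t : ℝ) : ℂ := b + (max (-t) 0 : ℝ) * Complex.I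

/-- The contour `γ` through `b`: for `t ≤ 0` the part `γ⁺`, from `i∞` down the half-line
`Re τ = Re b - δ` and then horizontally to `b`; for `t ≥ 0` the part `γ⁻` reversed, from `b`
horizontally to the half-line `Re τ = Re b + δ` and then up it to `i∞`. -/
noncomputable def hairpin (b : ℂ) (δ t : ℝ) : ℂ :=
  b + (max (-δ) (min t δ) : ℝ) + (max (|t| - δ) 0 : ℝ) * Complex.I

end WienerHopfODE

open WienerHopfODE

/-!
All analysis takes place in a complex Banach algebra `𝔸`; matrices enter through the algebraicity
of the jumps and through the fact that one-sided inverses of matrices are two-sided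
(`IsDedekindFiniteMonoid`), and the statement is translated at the end (`isRHSolution_iff`).

**The equation in `b`.** Near the cut from `k j + b` a solution is `U = Φ · (z - c) ^ (L / (2πi))`,
`c = k j + b`, with `Φ` (`regPart`) holomorphic and invertible across the whole cut. Fix `b₀` and
put `V = U b * (U b₀)⁻¹`. For `b` near `b₀` the function `V` is holomorphic outside small neighbourhoods
of the cuts, and between a smaller and a larger neighbourhood of the cut of index `j` it equals
`(Φ_b Φ_{b₀}⁻¹) * M`, whose first factor is holomorphic in the larger one, and where `M = Φ_{b₀} exp ((lc (w - (b - b₀)) - lc w) L) Φ_{b₀}⁻¹`,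
`w = z - (k j + b₀)` and `lc w = log w / (2πi)` (`StripData.exists_hairpinProblem`). On hairpins
away from the cuts `M` is holomorphic in `b`, it is `1` for `b = b₀`, and `M - 1` decays up the
hairpin. Such a problem amounts, by Cauchy's formula on two nested hairpins around each cut, to a
linear integral equation with a small operator (`HairpinProblem.representation`,
`HairpinProblem.hpVal_eq`); its Neumann series is holomorphic in `b` (`exists_continuation`). Hence
the family `U` is automatically holomorphic in `b`, and continues holomorphically if it is given on
`(0, i∞)` only. Differentiating at `b₀` leaves the Cauchy integral of `-w⁻¹ Φ L Φ⁻¹ / (2πi)`, a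
function with a simple pole; its residue is the coefficient `sCoef`
(`StripData.exists_hasDerivAt`, `exists_sCoef_continuation`).

**The limit `Im b → ∞`.** An algebraic function that tends to a constant at `i∞` approaches it at
the rate of a power of `z` (`exists_gap`), and solves a linear equation with polynomial
denominators, so that far up it extends to a wider strip (`exists_algebraic_extension`). Thus the
`L j` decay, and for large `Im b` the solution itself satisfies a problem on hairpins of fixed width
with jump `exp (lc w * L j) ≈ 1`; the norm of the integral operators does not depend on the position
of the cuts, and `U → 1` (`FarLog.tendsto_one`).

**The ordered exponential.** Conversely, given residues `s j`, let `flowSol` be the ordered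
exponential along the vertical half-line from `i∞` to `b`, a convergent Picard series. It is jointly
holomorphic off the cuts and solves the equation in `b` (`PoleData.hasDerivAt_flowSol`). On the two
sides of the cut it is transported to a reference point by the equation, which is regular below the
pole; the two transported values are holomorphic in `z`, differ by `H m z` on the centre line
because of the hairpin condition, and so everywhere (`PoleData.connection_jump`). For `z → ∞` and
for `z` near an end point the path is first moved sideways, away from the poles
(`PoleData.flowSol_bounds`). This gives the limit `1` at infinity and, if `Im b` is so large that the
residues are small, the growth at most `‖w‖ ^ (-1/2)` of `flowSol * w ^ (-L / (2πi))` at the end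
point, whose singularity is therefore removable. Removability is passed on to all `b`: the
difference between the function and its Cauchy integral over a small circle is holomorphic in `b`
and vanishes for large `Im b` (`exists_tendsto_of_removable`).

**Uniqueness.** The quotient of two solutions is bounded, continues across the cuts, and is `1` by
Liouville's theorem (`RHSol.unique`).
-/


set_option linter.unusedSectionVars false

namespace WienerHopfODE

open MeasureTheory Complex Metric

variable {𝔸 : Type*} [NormedRing 𝔸] [NormedAlgebra ℂ 𝔸] [CompleteSpace 𝔸]

section

/-! ### Integrals depending on a parameter -/

variable {E : Type*} [NormedAddCommGroup E] [NormedSpace ℂ E]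

/-- Holomorphic dependence of an integral on a parameter, with the derivative under the integral:
a local bound for the integrand suffices, since Cauchy's estimate bounds its derivative. -/
theorem hasDerivAt_integral_param [CompleteSpace E] {X : Type*} [MeasurableSpace X]
    {μ : Measure X} {F : ℂ → X → E} {O : Set ℂ} (hO : IsOpen O)
    (hF : ∀ᵐ x ∂μ, DifferentiableOn ℂ (fun b => F b x) O)
    (hm : ∀ b ∈ O, AEStronglyMeasurable (F b) μ) {b₀ : ℂ} (hb₀ : b₀ ∈ O)
    (hb : ∃ r > 0, ∃ g : X → ℝ, Integrable g μ ∧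
      ∀ᵐ x ∂μ, ∀ b ∈ ball b₀ r ∩ O, ‖F b x‖ ≤ g x) :
    HasDerivAt (fun b => ∫ x, F b x ∂μ) (∫ x, deriv (fun b => F b x) b₀ ∂μ) b₀ := by
  obtain ⟨r₁, hr₁, g, hg, hle⟩ := hb
  obtain ⟨r₂, hr₂, hsub⟩ := Metric.isOpen_iff.1 hO b₀ hb₀
  set r := min r₁ r₂ with hr
  have hr0 : 0 < r := lt_min hr₁ hr₂
  have hbO : ball b₀ r ⊆ O := (ball_subset_ball (min_le_right _ _)).trans hsub
  have hbr : ball b₀ r ⊆ ball b₀ r₁ := ball_subset_ball (min_le_left _ _)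
  have hderiv : ∀ᵐ x ∂μ, ∀ b ∈ ball b₀ (r / 2), HasDerivAt (fun b => F b x)
      (deriv (fun b => F b x) b) b := by
    filter_upwards [hF] with x hx b hbb
    exact ((hx b (hbO (ball_subset_ball (by linarith) hbb))).differentiableAt
      (hO.mem_nhds (hbO (ball_subset_ball (by linarith) hbb)))).hasDerivAt
  have hbound : ∀ᵐ x ∂μ, ∀ b ∈ ball b₀ (r / 2), ‖deriv (fun b => F b x) b‖ ≤ g x / (r / 3) := by
    filter_upwards [hF, hle] with x hx hx2 b hbb
    have hcl : closedBall b (r / 3) ⊆ ball b₀ r := by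
      apply closedBall_subset_ball'
      have := mem_ball.1 hbb
      linarith
    refine Complex.norm_deriv_le_of_forall_mem_sphere_norm_le (by positivity) ?_ ?_
    · exact (hx.mono (hcl.trans hbO)).diffContOnCl_ball subset_rfl
    · intro z hz
      exact hx2 z ⟨hbr (hcl (sphere_subset_closedBall hz)), hbO (hcl (sphere_subset_closedBall hz))⟩
  have hmeas : AEStronglyMeasurable (fun x => deriv (fun b => F b x) b₀) μ := by
    classical
    refine aestronglyMeasurable_of_tendsto_ae (𝓝[≠] b₀)
      (f := fun b x => if b ∈ O then (b - b₀)⁻¹ • (F b x - F b₀ x) else 0) (fun b => ?_) ?_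
    · split_ifs with h
      · exact ((hm _ h).sub (hm _ hb₀)).const_smul _
      · exact aestronglyMeasurable_const
    · filter_upwards [hderiv] with x hx
      refine (hasDerivAt_iff_tendsto_slope.1 (hx b₀ (mem_ball_self (by positivity)))).congr' ?_
      filter_upwards [mem_nhdsWithin_of_mem_nhds (hO.mem_nhds hb₀)] with b hb
      rw [if_pos hb, slope_def_module]
  have := hasDerivAt_integral_of_dominated_loc_of_deriv_le (μ := μ) (𝕜 := ℂ)
    (bound := fun x => g x / (r / 3)) (F := F)
    (F' := fun b x => deriv (fun b => F b x) b) (x₀ := b₀) (ball_mem_nhds b₀ (by positivity : 0 < r / 2))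
    (by filter_upwards [hO.mem_nhds hb₀] with b hb using hm b hb)
    (by
      refine hg.mono' (hm _ hb₀) ?_
      filter_upwards [hle] with x hx
      exact hx b₀ ⟨mem_ball_self hr₁, hb₀⟩)
    hmeas hbound (hg.div_const _) hderiv
  exact this.2

theorem differentiableOn_integral_param [CompleteSpace E] {X : Type*} [MeasurableSpace X]
    {μ : Measure X} {F : ℂ → X → E} {O : Set ℂ} (hO : IsOpen O)
    (hF : ∀ᵐ x ∂μ, DifferentiableOn ℂ (fun b => F b x) O)
    (hm : ∀ b ∈ O, AEStronglyMeasurable (F b) μ)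
    (hb : ∀ b₀ ∈ O, ∃ r > 0, ∃ g : X → ℝ, Integrable g μ ∧
      ∀ᵐ x ∂μ, ∀ b ∈ ball b₀ r ∩ O, ‖F b x‖ ≤ g x) :
    DifferentiableOn ℂ (fun b => ∫ x, F b x ∂μ) O := fun b₀ hb₀ =>
  (hasDerivAt_integral_param hO hF hm hb₀ (hb b₀ hb₀)).differentiableAt.differentiableWithinAt

/-- A continuous function that is holomorphic off a vertical line is holomorphic. -/
theorem differentiableOn_of_continuousOn_off_line [CompleteSpace E] {f : ℂ → E} {S : Set ℂ}
    (hS : IsOpen S) (x₀ : ℝ) (hc : ContinuousOn f S)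
    (hd : ∀ z ∈ S, z.re ≠ x₀ → DifferentiableAt ℂ f z) : DifferentiableOn ℂ f S := by
  have key : ∀ z w : ℂ, Rectangle z w ⊆ S → x₀ ∉ Ioo (min z.re w.re) (max z.re w.re) →
      (∫ x : ℝ in z.re..w.re, f (x + z.im * I)) - (∫ x : ℝ in z.re..w.re, f (x + w.im * I)) +
      I • (∫ y : ℝ in z.im..w.im, f (w.re + y * I)) -
      I • (∫ y : ℝ in z.im..w.im, f (z.re + y * I)) = 0 := by
    intro z w hzw hx
    refine integral_boundary_rect_eq_zero_of_continuousOn_of_differentiableOn f z w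
      (hc.mono hzw) ?_
    intro u hu
    refine (hd u (hzw ?_) ?_).differentiableWithinAt
    · exact ⟨Ioo_subset_Icc_self hu.1, Ioo_subset_Icc_self hu.2⟩
    · rintro rfl
      exact hx hu.1
  intro z hz
  obtain ⟨r, hr, hsub⟩ := Metric.isOpen_iff.1 hS z hz
  have hex : IsExactOn f (ball z r) := by
    refine IsConservativeOn.isExactOn_ball (hc.mono hsub) ?_
    intro a b hab
    rw [← add_eq_zero_iff_eq_neg, wedgeIntegral_add_wedgeIntegral_eq]
    have habS : Rectangle a b ⊆ S := hab.trans hsub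
    by_cases hx : x₀ ∈ Ioo (min a.re b.re) (max a.re b.re)
    · have hx' : x₀ ∈ uIcc a.re b.re := Ioo_subset_Icc_self hx
      have part : ∀ s ∈ uIcc a.re b.re, ∀ t ∈ uIcc a.re b.re, x₀ ∉ Ioo (min s t) (max s t) →
          (∫ x in s..t, f (x + a.im * I)) - (∫ x in s..t, f (x + b.im * I)) +
          I • (∫ y in a.im..b.im, f (t + y * I)) - I • (∫ y in a.im..b.im, f (s + y * I)) = 0 := by
        intro s hs t ht h
        simpa using key (s + a.im * I) (t + b.im * I) (fun u hu => habS
          ⟨uIcc_subset_uIcc hs ht (by simpa using hu.1), by simpa using hu.2⟩) (by simpa using h)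
      have e1 := part a.re left_mem_uIcc x₀ hx' (by rcases le_total a.re x₀ with h | h <;> simp [h])
      have e2 := part x₀ hx' b.re right_mem_uIcc (by rcases le_total b.re x₀ with h | h <;> simp [h])
      have hint : ∀ y ∈ uIcc a.im b.im, ∀ s t, s ∈ uIcc a.re b.re → t ∈ uIcc a.re b.re →
          IntervalIntegrable (fun x : ℝ => f (x + y * I)) volume s t := by
        intro y hy s t hs ht
        refine (hc.comp (by fun_prop) fun x hx => habS ⟨?_, ?_⟩).intervalIntegrable
        · simpa using uIcc_subset_uIcc hs ht hx
        · simpa using hy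
      have i1 := intervalIntegral.integral_add_adjacent_intervals
        (hint a.im left_mem_uIcc a.re x₀ left_mem_uIcc hx')
        (hint a.im left_mem_uIcc x₀ b.re hx' right_mem_uIcc)
      have i2 := intervalIntegral.integral_add_adjacent_intervals
        (hint b.im right_mem_uIcc a.re x₀ left_mem_uIcc hx')
        (hint b.im right_mem_uIcc x₀ b.re hx' right_mem_uIcc)
      rw [← i1, ← i2]
      have := congrArg₂ (· + ·) e1 e2
      simp only [add_zero] at this
      rw [← this]
      abel
    · exact key a b habS hx
  exact ((hex.differentiableOn isOpen_ball).differentiableAt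
    (ball_mem_nhds z hr)).differentiableWithinAt

/-- Liouville's theorem for a bounded function with a known limit along some filter. -/
theorem eq_of_bounded_of_tendsto {f : ℂ → E} (hf : Differentiable ℂ f) {B : ℝ}
    (hB : ∀ z, ‖f z‖ ≤ B) {ι : Type*} {l : Filter ι} [l.NeBot] {u : ι → ℂ} {c : E}
    (h : Tendsto (fun i => f (u i)) l (𝓝 c)) (z : ℂ) : f z = c := by
  have hb : Bornology.IsBounded (range f) :=
    isBounded_iff_forall_norm_le.2 ⟨B, by rintro _ ⟨w, rfl⟩; exact hB w⟩
  simp only [fun i => hf.apply_eq_apply_of_bounded hb (u i) z] at h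
  exact tendsto_nhds_unique tendsto_const_nhds h

end

section

variable {E : Type*} [NormedAddCommGroup E] [NormedSpace ℂ E]

/-! ### Contour integrals over hairpins -/

/-- The three sides of the boundary of the half-infinite box `|Re w| < δ`, `Im w > -δ`:
the bottom side, the right side and the left side. -/
noncomputable def boxPt (δ : ℝ) (s : Fin 3) (y : ℝ) : ℂ :=
  ![(y : ℂ) + (-δ : ℝ) * I, (δ : ℝ) + y * I, (-δ : ℝ) + y * I] s

/-- The parameter intervals of the sides `boxPt δ s`. -/
def boxDom (δ : ℝ) (s : Fin 3) : Set ℝ := ![Ioc (-δ) δ, Ioi (-δ), Ioi (-δ)] s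

/-- The derivatives of the sides, signed so that the boundary is traversed counterclockwise:
down the left side, along the bottom and up the right side. -/
noncomputable def boxCoef (s : Fin 3) : ℂ := ![1, I, -I] s

/-- The contour integral over the boundary of the half-infinite box. -/
noncomputable def boxInt (δ : ℝ) (f : ℂ → E) : E :=
  ∑ s, boxCoef s • ∫ y in boxDom δ s, f (boxPt δ s y)

/-- The open half-infinite box `|Re w| < δ`, `Im w > -δ`. -/
def openBox (δ : ℝ) : Set ℂ := {w | |w.re| < δ ∧ -δ < w.im}

/-- The closed half-infinite box. -/
def closedBox (δ : ℝ) : Set ℂ := {w | |w.re| ≤ δ ∧ -δ ≤ w.im}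

theorem isOpen_openBox (δ : ℝ) : IsOpen (openBox δ) :=
  (isOpen_lt (f := fun w : ℂ => |w.re|) (by fun_prop) continuous_const).inter
    (isOpen_lt (g := fun w : ℂ => w.im) continuous_const (by fun_prop))

theorem isClosed_closedBox (δ : ℝ) : IsClosed (closedBox δ) :=
  (isClosed_le (f := fun w : ℂ => |w.re|) (by fun_prop) continuous_const).inter
    (isClosed_le (g := fun w : ℂ => w.im) continuous_const (by fun_prop))

theorem openBox_subset_closedBox (δ : ℝ) : openBox δ ⊆ closedBox δ := fun _ h => ⟨h.1.le, h.2.le⟩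

theorem closedBox_subset_openBox {δ δ' : ℝ} (h : δ < δ') : closedBox δ ⊆ openBox δ' :=
  fun _ hz => ⟨hz.1.trans_lt h, by have := hz.2; linarith⟩

theorem boxInt_eq {δ : ℝ} (hδ : 0 ≤ δ) (f : ℂ → E) : boxInt δ f =
    (∫ x in -δ..δ, f ((x : ℂ) + (-δ : ℝ) * I)) + I • (∫ y in Ioi (-δ), f ((δ : ℝ) + y * I)) -
      I • ∫ y in Ioi (-δ), f ((-δ : ℝ) + y * I) := by
  rw [intervalIntegral.integral_of_le (by linarith), sub_eq_add_neg, ← neg_smul]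
  simp [boxInt, Fin.sum_univ_three, boxCoef, boxDom, boxPt]

/-- `f` is bounded by a multiple of `(Im z) ^ (-κ)` as `Im z → ∞` in `S`. -/
def DecaysOn (S : Set ℂ) (κ : ℝ) (f : ℂ → E) : Prop :=
  ∃ C R : ℝ, 0 < R ∧ ∀ z ∈ S, R ≤ z.im → ‖f z‖ ≤ C * z.im ^ (-κ)

theorem DecaysOn.mono {S T : Set ℂ} {κ : ℝ} {f : ℂ → E} (h : DecaysOn T κ f) (hST : S ⊆ T) :
    DecaysOn S κ f := by
  obtain ⟨C, R, hR, H⟩ := h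
  exact ⟨C, R, hR, fun z hz => H z (hST hz)⟩

theorem DecaysOn.integrableOn {S : Set ℂ} {κ : ℝ} {f : ℂ → E} (h : DecaysOn S κ f) (hκ : 1 < κ)
    {x y₁ : ℝ} (hc : ContinuousOn f S) (hS : ∀ y, y₁ ≤ y → (x : ℂ) + y * I ∈ S) :
    IntegrableOn (fun y : ℝ => f (x + y * I)) (Ioi y₁) := by
  obtain ⟨C, R, hR, H⟩ := h
  have hcont : ContinuousOn (fun y : ℝ => f (x + y * I)) (Ici y₁) :=
    hc.comp (by fun_prop) fun y hy => hS y hy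
  set R' := max R y₁
  have h1 : IntegrableOn (fun y : ℝ => f (x + y * I)) (Icc y₁ R') :=
    (hcont.mono Icc_subset_Ici_self).integrableOn_Icc
  have h2 : IntegrableOn (fun y : ℝ => f (x + y * I)) (Ioi R') := by
    refine Integrable.mono' (g := fun y => C * y ^ (-κ)) ?_ ?_ ?_
    · exact ((integrableOn_Ioi_rpow_of_lt (by linarith) (lt_max_of_lt_left hR)).const_mul C)
    · exact (hcont.mono fun y hy => (le_max_right R y₁).trans (le_of_lt hy)).aestronglyMeasurable
        measurableSet_Ioi
    · refine ae_restrict_of_forall_mem measurableSet_Ioi fun y hy => ?_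
      have hy1 : y₁ ≤ y := (le_max_right R y₁).trans (le_of_lt hy)
      have hy2 : R ≤ y := (le_max_left R y₁).trans (le_of_lt hy)
      simpa using H _ (hS y hy1) (by simpa using hy2)
  exact (h1.union h2).mono_set (by grind)

/-- Cauchy's theorem for a half-infinite strip. -/
theorem halfStrip_integral_eq_zero {f : ℂ → E} {x₁ x₂ y₁ κ : ℝ} (hx : x₁ ≤ x₂) (hκ : 1 < κ)
    (hf : DifferentiableOn ℂ f {z | x₁ ≤ z.re ∧ z.re ≤ x₂ ∧ y₁ ≤ z.im})
    (hd : DecaysOn {z | x₁ ≤ z.re ∧ z.re ≤ x₂ ∧ y₁ ≤ z.im} κ f) :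
    (∫ x in x₁..x₂, f ((x : ℂ) + y₁ * I)) + I • (∫ y in Ioi y₁, f ((x₂ : ℂ) + y * I)) -
      I • (∫ y in Ioi y₁, f ((x₁ : ℂ) + y * I)) = 0 := by
  set S := {z : ℂ | x₁ ≤ z.re ∧ z.re ≤ x₂ ∧ y₁ ≤ z.im} with hSdef
  have i1 := hd.integrableOn (x := x₁) (y₁ := y₁) hκ hf.continuousOn fun y hy => by
    simp [hSdef, hx, hy]
  have i2 := hd.integrableOn (x := x₂) (y₁ := y₁) hκ hf.continuousOn fun y hy => by
    simp [hSdef, hx, hy]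
  obtain ⟨C, R, hR, H⟩ := hd
  have hrect : ∀ T, y₁ ≤ T → (∫ x in x₁..x₂, f ((x : ℂ) + y₁ * I)) -
      (∫ x in x₁..x₂, f ((x : ℂ) + T * I)) + I • (∫ y in y₁..T, f ((x₂ : ℂ) + y * I)) -
      I • (∫ y in y₁..T, f ((x₁ : ℂ) + y * I)) = 0 := by
    intro T hT
    have := integral_boundary_rect_eq_zero_of_differentiableOn f (x₁ + y₁ * I) (x₂ + T * I) (by
      refine hf.mono fun z hz => ?_
      have h1 := hz.1
      have h2 := hz.2
      simp [hx, hT] at h1 h2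
      exact ⟨h1.1, h1.2, h2.1⟩)
    simpa using this
  have ht : Tendsto (fun T : ℝ => ∫ x in x₁..x₂, f ((x : ℂ) + T * I)) atTop (𝓝 0) := by
    have hlim : Tendsto (fun T : ℝ => C * T ^ (-κ) * |x₂ - x₁|) atTop (𝓝 0) := by
      have := ((tendsto_rpow_neg_atTop (by linarith : 0 < κ)).const_mul C).mul_const |x₂ - x₁|
      simpa using this
    refine squeeze_zero_norm' ?_ hlim
    filter_upwards [eventually_ge_atTop R, eventually_ge_atTop y₁] with T hT hT1
    refine intervalIntegral.norm_integral_le_of_norm_le_const fun x hxx => ?_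
    rw [uIoc_of_le hx] at hxx
    have := H (x + T * I) (by simp [hSdef, hxx.1.le, hxx.2, hT1]) (by simpa using hT)
    simpa using this
  have hlim := (((tendsto_const_nhds (x := ∫ x in x₁..x₂, f ((x : ℂ) + y₁ * I))).sub ht).add
    ((intervalIntegral_tendsto_integral_Ioi y₁ i2 tendsto_id).const_smul I)).sub
    ((intervalIntegral_tendsto_integral_Ioi y₁ i1 tendsto_id).const_smul I)
  rw [sub_zero] at hlim
  exact tendsto_nhds_unique hlim (tendsto_const_nhds.congr'
    ((eventually_ge_atTop y₁).mono fun T hT => (hrect T hT).symm))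

theorem boxInt_eq_zero {f : ℂ → E} {δ κ : ℝ} (hδ : 0 ≤ δ) (hκ : 1 < κ)
    (hf : DifferentiableOn ℂ f (closedBox δ)) (hd : DecaysOn (closedBox δ) κ f) :
    boxInt δ f = 0 := by
  rw [boxInt_eq hδ]
  have hsub : {z : ℂ | -δ ≤ z.re ∧ z.re ≤ δ ∧ -δ ≤ z.im} ⊆ closedBox δ :=
    fun z hz => ⟨abs_le.2 ⟨hz.1, hz.2.1⟩, hz.2.2⟩
  exact halfStrip_integral_eq_zero (by linarith) hκ (hf.mono hsub) (hd.mono hsub)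

/-- Deformation of the contour across a `U`-shaped region. -/
theorem boxInt_deform {f : ℂ → E} {δ₀ δ₁ δ₂ δ₃ κ : ℝ} (h0 : 0 ≤ δ₀) (h01 : δ₀ < δ₁) (h12 : δ₁ ≤ δ₂)
    (h23 : δ₂ < δ₃) (hκ : 1 < κ) (hf : DifferentiableOn ℂ f (openBox δ₃ \ closedBox δ₀))
    (hd : DecaysOn (openBox δ₃ \ closedBox δ₀) κ f) : boxInt δ₁ f = boxInt δ₂ f := by
  have mem : ∀ z : ℂ, |z.re| ≤ δ₂ → -δ₂ ≤ z.im → δ₁ ≤ |z.re| ∨ z.im ≤ -δ₁ →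
      z ∈ openBox δ₃ \ closedBox δ₀ := fun z h1 h2 h3 =>
    ⟨⟨by linarith, by linarith⟩, fun h => by rcases h3 with h3 | h3 <;> linarith [h.1, h.2]⟩
  have sL : {z : ℂ | -δ₂ ≤ z.re ∧ z.re ≤ -δ₁ ∧ -δ₂ ≤ z.im} ⊆ openBox δ₃ \ closedBox δ₀ :=
    fun z ⟨h1, h2, h3⟩ => mem z (abs_le.2 ⟨h1, by linarith⟩) h3 (.inl (le_abs.2 (by grind)))
  have sR : {z : ℂ | δ₁ ≤ z.re ∧ z.re ≤ δ₂ ∧ -δ₂ ≤ z.im} ⊆ openBox δ₃ \ closedBox δ₀ :=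
    fun z ⟨h1, h2, h3⟩ => mem z (abs_le.2 ⟨by linarith, h2⟩) h3 (.inl (le_abs.2 (.inl h1)))
  have sB : {z : ℂ | -δ₂ ≤ z.re ∧ z.re ≤ δ₂ ∧ -δ₂ ≤ z.im ∧ z.im ≤ -δ₁} ⊆
      openBox δ₃ \ closedBox δ₀ := fun z ⟨h1, h2, h3, h4⟩ => mem z (abs_le.2 ⟨h1, h2⟩) h3 (.inr h4)
  have eL := halfStrip_integral_eq_zero (by linarith) hκ (hf.mono sL) (hd.mono sL)
  have eR := halfStrip_integral_eq_zero (by linarith) hκ (hf.mono sR) (hd.mono sR)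
  have eB := integral_boundary_rect_eq_zero_of_differentiableOn f
    ((-δ₁ : ℝ) + (-δ₂ : ℝ) * I) ((δ₁ : ℝ) + (-δ₁ : ℝ) * I) (by
      refine hf.mono fun z hz => sB ?_
      have h1 := hz.1
      have h2 := hz.2
      have e1 : -δ₁ ≤ δ₁ := by linarith
      have e2 : -δ₂ ≤ -δ₁ := by linarith
      simp only [add_re, ofReal_re, mul_re, I_re, mul_zero, ofReal_im, I_im, mul_one, sub_self,
        add_zero, add_im, mul_im, zero_add, mem_preimage, uIcc_of_le e1, uIcc_of_le e2] at h1 h2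
      exact ⟨by linarith [h1.1], by linarith [h1.2], h2.1, h2.2⟩)
  simp only [add_re, ofReal_re, mul_re, I_re, mul_zero, ofReal_im, I_im, mul_one, sub_self,
        add_zero, add_im, mul_im, zero_add] at eB
  have hcB : ∀ s ∈ Icc (-δ₂) δ₂, ∀ t ∈ Icc (-δ₂) δ₂, IntervalIntegrable
      (fun x : ℝ => f ((x : ℂ) + (-δ₂ : ℝ) * I)) volume s t := by
    intro s hs t ht
    refine ContinuousOn.intervalIntegrable (hf.continuousOn.comp (by fun_prop) fun x hx => sB ?_)
    have := (uIcc_subset_Icc hs ht) hx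
    simp [this.1, this.2, h12]
  have j1 := intervalIntegral.integral_add_adjacent_intervals
    (hcB (-δ₂) ⟨le_rfl, by linarith⟩ (-δ₁) ⟨by linarith, by linarith⟩)
    (hcB (-δ₁) ⟨by linarith, by linarith⟩ δ₁ ⟨by linarith, by linarith⟩)
  have j2 := intervalIntegral.integral_add_adjacent_intervals
    (hcB (-δ₂) ⟨le_rfl, by linarith⟩ δ₁ ⟨by linarith, by linarith⟩)
    (hcB δ₁ ⟨by linarith, by linarith⟩ δ₂ ⟨by linarith, by linarith⟩)
  have vsplit : ∀ x : ℝ, (∀ y : ℝ, -δ₂ ≤ y → (x : ℂ) + y * I ∈ openBox δ₃ \ closedBox δ₀) →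
      (∫ y in Ioi (-δ₂), f ((x : ℂ) + y * I)) = (∫ y in (-δ₂)..(-δ₁), f ((x : ℂ) + y * I)) +
        ∫ y in Ioi (-δ₁), f ((x : ℂ) + y * I) := by
    intro x hx
    have hi := hd.integrableOn (x := x) (y₁ := -δ₂) hκ hf.continuousOn hx
    have e2 : -δ₂ ≤ -δ₁ := by linarith
    rw [intervalIntegral.integral_of_le e2, ← setIntegral_union (Ioc_disjoint_Ioi le_rfl)
      measurableSet_Ioi (hi.mono_set Ioc_subset_Ioi_self) (hi.mono_set (Ioi_subset_Ioi e2)),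
      Ioc_union_Ioi_eq_Ioi e2]
  have v1 := vsplit δ₁ fun y hy => sR (by simp [hy, h12])
  have v2 := vsplit (-δ₁) fun y hy => sL (by simp [hy, h12])
  rw [boxInt_eq (by linarith), boxInt_eq (by linarith), ← j2, ← j1]
  rw [v2] at eL
  rw [v1] at eR
  have := congrArg₂ (· + ·) (congrArg₂ (· + ·) eL eR) eB
  simp only [add_zero, smul_add] at this
  rw [← sub_eq_zero, ← neg_eq_zero, ← this]
  abel

theorem hasDerivAt_logUp {w : ℂ} (hw : w.re ≠ 0 ∨ w.im < 0) : HasDerivAt logUp w⁻¹ w := by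
  have hs : I * w ∈ slitPlane := by
    rw [mem_slitPlane_iff]
    rcases hw with h | h
    · exact Or.inr (by simpa using h)
    · exact Or.inl (by simpa using h)
  have h0 : w ≠ 0 := by
    rintro rfl
    simp at hw
  have h1 : HasDerivAt (fun w => I * w) I w := by simpa using (hasDerivAt_id w).const_mul I
  have h2 := ((hasDerivAt_log hs).comp w h1).sub_const ((Real.pi / 2 : ℂ) * I)
  have e : (I * w)⁻¹ * I = w⁻¹ := by
    field_simp [I_ne_zero]
  rw [e] at h2
  exact h2

theorem logUp_sub_log_of_pos {w : ℂ} {y : ℝ} (hy : 0 < y) (hw : w ≠ 0) :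
    logUp w - Real.log y = log (I * w / y) - (Real.pi / 2) * I := by
  have hy' : (y : ℂ) ≠ 0 := by exact_mod_cast hy.ne'
  have : I * w = (y : ℂ) * (I * w / y) := by field_simp
  have h2 : I * w / y ≠ 0 := div_ne_zero (mul_ne_zero I_ne_zero hw) hy'
  rw [logUp, this, log_ofReal_mul hy h2]
  rw [← this]
  ring

theorem tendsto_I_mul_div (w : ℂ) :
    Tendsto (fun y : ℝ => I * (w + y * I) / y) atTop (𝓝 (-1)) := by
  have h1 : Tendsto (fun y : ℝ => ((y⁻¹ : ℝ) : ℂ)) atTop (𝓝 ((0 : ℝ) : ℂ)) :=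
    (continuous_ofReal.tendsto 0).comp tendsto_inv_atTop_zero
  have h2 := (h1.const_mul (I * w)).add_const (-1)
  simp only [ofReal_zero, mul_zero, zero_add] at h2
  refine h2.congr' ?_
  filter_upwards [eventually_gt_atTop 0] with y hy
  have hy' : (y : ℂ) ≠ 0 := by exact_mod_cast hy.ne'
  push_cast
  field_simp
  linear_combination (-(y : ℂ)) * I_mul_I

theorem tendsto_logUp {w m : ℂ} (hw : w.re ≠ 0) {s : Set ℂ} (hs : Tendsto log (𝓝[s] (-1)) (𝓝 m))
    (h : ∀ y : ℝ, 0 < y → I * (w + y * I) / y ∈ s) :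
    Tendsto (fun y : ℝ => logUp (w + y * I) - Real.log y) atTop (𝓝 (m - Real.pi / 2 * I)) := by
  have h1 : Tendsto (fun y : ℝ => I * (w + y * I) / y) atTop (𝓝[s] (-1)) :=
    tendsto_nhdsWithin_iff.2 ⟨tendsto_I_mul_div w, (eventually_gt_atTop 0).mono h⟩
  refine ((hs.comp h1).sub_const _).congr' ((eventually_gt_atTop 0).mono fun y hy => ?_)
  exact (logUp_sub_log_of_pos hy fun h0 => hw (by simpa using congrArg re h0)).symm

theorem tendsto_logUp_right {w : ℂ} (hw : 0 < w.re) :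
    Tendsto (fun y : ℝ => logUp (w + y * I) - Real.log y) atTop (𝓝 ((Real.pi / 2 : ℂ) * I)) := by
  convert tendsto_logUp hw.ne' (tendsto_log_nhdsWithin_im_nonneg_of_re_neg_of_im_zero
    (z := -1) (by simp) (by simp)) fun y hy => ?_ using 2
  · simp; ring
  · simp [div_ofReal_im]; positivity

theorem tendsto_logUp_left {w : ℂ} (hw : w.re < 0) :
    Tendsto (fun y : ℝ => logUp (w + y * I) - Real.log y) atTop
      (𝓝 (-(3 * Real.pi / 2 : ℂ) * I)) := by
  convert tendsto_logUp hw.ne (tendsto_log_nhdsWithin_im_neg_of_re_neg_of_im_zero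
    (z := -1) (by simp) (by simp)) fun y hy => ?_ using 2
  · simp; ring
  · simpa [div_ofReal_im] using div_neg_of_neg_of_pos hw hy

/-- On a half-strip of bounded width the Cauchy kernel decays like `1 / Im w`. -/
theorem decaysOn_sub_inv {S : Set ℂ} (z : ℂ) : DecaysOn S 1 (fun w => (w - z)⁻¹) := by
  refine ⟨2, 2 * |z.im| + 1, by positivity, fun w _ hw => ?_⟩
  have h1 : w.im / 2 ≤ ‖w - z‖ := by
    have h2 := abs_im_le_norm (w - z)
    have h3 := le_abs_self (w - z).im
    rw [sub_im] at h2 h3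
    have := le_abs_self z.im
    linarith
  have h0 : 0 < w.im := by have := abs_nonneg z.im; linarith
  rw [norm_inv, Real.rpow_neg_one]
  calc ‖w - z‖⁻¹ ≤ (w.im / 2)⁻¹ := inv_anti₀ (by positivity) h1
    _ = 2 * w.im⁻¹ := by field_simp

theorem DecaysOn.smul {S : Set ℂ} {κ κ' : ℝ} {f : ℂ → ℂ} {g : ℂ → E} (hf : DecaysOn S κ f)
    (hg : DecaysOn S κ' g) : DecaysOn S (κ + κ') (fun w => f w • g w) := by
  obtain ⟨C, R, hR, H⟩ := hf
  obtain ⟨C', R', hR', H'⟩ := hg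
  refine ⟨C * C', max R R', lt_max_of_lt_left hR, fun w hw hwR => ?_⟩
  have h1 := H w hw ((le_max_left _ _).trans hwR)
  have h2 := H' w hw ((le_max_right _ _).trans hwR)
  have h0 : 0 < w.im := hR.trans_le ((le_max_left _ _).trans hwR)
  calc ‖f w • g w‖ = ‖f w‖ * ‖g w‖ := norm_smul _ _
    _ ≤ (C * w.im ^ (-κ)) * (C' * w.im ^ (-κ')) :=
        mul_le_mul h1 h2 (norm_nonneg _) ((norm_nonneg _).trans h1)
    _ = C * C' * w.im ^ (-(κ + κ')) := by
        rw [show -(κ + κ') = -κ + -κ' by ring, Real.rpow_add h0]; ring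

theorem DecaysOn.sub {S : Set ℂ} {κ : ℝ} {f g : ℂ → E} (hf : DecaysOn S κ f)
    (hg : DecaysOn S κ g) : DecaysOn S κ (fun w => f w - g w) := by
  obtain ⟨C, R, hR, H⟩ := hf
  obtain ⟨C', R', hR', H'⟩ := hg
  refine ⟨C + C', max R R', lt_max_of_lt_left hR, fun w hw hwR => ?_⟩
  have h1 := H w hw ((le_max_left _ _).trans hwR)
  have h2 := H' w hw ((le_max_right _ _).trans hwR)
  rw [add_mul]
  exact (norm_sub_le _ _).trans (add_le_add h1 h2)

theorem DecaysOn.weaken {S : Set ℂ} {κ κ' : ℝ} {f : ℂ → E} (hf : DecaysOn S κ f) (h : κ' ≤ κ) :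
    DecaysOn S κ' f := by
  obtain ⟨C, R, hR, H⟩ := hf
  refine ⟨|C|, max R 1, by positivity, fun w hw hwR => ?_⟩
  have h1 := H w hw ((le_max_left _ _).trans hwR)
  have h2 : 1 ≤ w.im := (le_max_right _ _).trans hwR
  refine h1.trans (mul_le_mul (le_abs_self C) ?_ (by positivity) (abs_nonneg _))
  exact Real.rpow_le_rpow_of_exponent_le h2 (by linarith)

theorem DecaysOn.congr {S : Set ℂ} {κ : ℝ} {f g : ℂ → E} (hf : DecaysOn S κ f) {y : ℝ}
    (h : ∀ z ∈ S, y < z.im → g z = f z) : DecaysOn S κ g := by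
  obtain ⟨C, R, hR, H⟩ := hf
  refine ⟨C, max R (y + 1), lt_max_of_lt_left hR, fun w hw hwR => ?_⟩
  rw [h w hw (by have := (le_max_right R (y + 1)).trans hwR; linarith)]
  exact H w hw ((le_max_left _ _).trans hwR)

theorem decaysOn_kernel_sub {S : Set ℂ} (z a : ℂ) :
    DecaysOn S 2 (fun w => (w - z)⁻¹ - (w - a)⁻¹) := by
  have h := ((decaysOn_sub_inv (S := S) z).smul (decaysOn_sub_inv (S := S) a))
  obtain ⟨C, R, hR, H⟩ := h
  have h1 : DecaysOn S (1 + 1) (fun w => (z - a) * ((w - z)⁻¹ • (w - a)⁻¹)) :=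
    ⟨‖z - a‖ * C, R, hR, fun w hw hwR => by
      rw [norm_mul, mul_assoc]
      exact mul_le_mul_of_nonneg_left (H w hw hwR) (norm_nonneg _)⟩
  have h2 := h1.congr (y := max z.im a.im) (g := fun w => (w - z)⁻¹ - (w - a)⁻¹) (by
    intro w _ hw
    have hz : w - z ≠ 0 := by grind
    have ha : w - a ≠ 0 := by grind
    simp only [smul_eq_mul]
    field_simp
    ring)
  norm_num at h2
  exact h2

/-- The winding number of the hairpin about an interior point `z`; the term with an exterior point
`a` makes the integral absolutely convergent. -/
theorem boxInt_kernel {δ : ℝ} (hδ : 0 < δ) {z a : ℂ} (hz : z ∈ openBox δ) (ha : a.re < -δ) :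
    boxInt δ (fun w => (w - z)⁻¹ - (w - a)⁻¹) = 2 * Real.pi * I := by
  have hzr := abs_lt.1 hz.1
  have hzi := hz.2
  set ℓ : ℂ → ℂ := fun w => logUp (w - z) - logUp (w - a) with hℓ
  have hder : ∀ w : ℂ, -δ ≤ w.re → (w.re ≠ z.re ∨ w.im < z.im) →
      HasDerivAt ℓ ((w - z)⁻¹ - (w - a)⁻¹) w := by
    intro w h1 h2
    refine HasDerivAt.sub ?_ ?_
    · have := hasDerivAt_logUp (w := w - z) (by
        simpa [sub_eq_zero] using h2)
      exact this.comp_sub_const w z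
    · have := hasDerivAt_logUp (w := w - a) (Or.inl (by
        rw [sub_re]; intro h; linarith))
      exact this.comp_sub_const w a
  have hcont : ContinuousOn (fun w => (w - z)⁻¹ - (w - a)⁻¹)
      {w : ℂ | w.re ≠ z.re ∧ w.re ≠ a.re} := by
    refine ContinuousOn.sub ?_ ?_ <;> refine ContinuousOn.inv₀ (by fun_prop) fun w hw h => ?_
    · exact hw.1 (by rw [sub_eq_zero.1 h])
    · exact hw.2 (by rw [sub_eq_zero.1 h])
  have hvert : ∀ (x : ℝ) (m : ℂ), -δ ≤ x → x ≠ z.re →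
      Tendsto (fun y : ℝ => ℓ (x + y * I)) atTop (𝓝 m) →
      I • (∫ y in Ioi (-δ), (((x : ℂ) + y * I - z)⁻¹ - ((x : ℂ) + y * I - a)⁻¹)) =
        m - ℓ (x + (-δ : ℝ) * I) := by
    intro x m hx hxz hm
    have hd : ∀ y : ℝ, HasDerivAt (fun y : ℝ => ℓ (x + y * I))
        (I * ((((x : ℂ) + y * I - z)⁻¹ - ((x : ℂ) + y * I - a)⁻¹))) y := by
      intro y
      have h1 := hder (x + y * I) (by simpa using hx) (by simp [hxz])
      have h2 : HasDerivAt (fun y : ℝ => (x : ℂ) + y * I) I y := by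
        simpa using ((ofRealCLM.hasDerivAt (x := y)).mul_const I).const_add (x : ℂ)
      have := h1.scomp y h2
      rw [smul_eq_mul] at this
      exact this
    rw [smul_eq_mul, ← integral_const_mul]
    refine integral_Ioi_of_hasDerivAt_of_tendsto (hd _).continuousAt.continuousWithinAt
      (fun y _ => hd y) ?_ hm
    refine Integrable.const_mul ?_ _
    have hax : x ≠ a.re := by intro h; linarith
    exact (decaysOn_kernel_sub (S := {w : ℂ | w.re ≠ z.re ∧ w.re ≠ a.re}) z a).integrableOn
      (by norm_num) hcont fun y _ => by simp [hxz, hax]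
  have hR : Tendsto (fun y : ℝ => ℓ ((δ : ℝ) + y * I)) atTop (𝓝 0) := by
    have h1 := tendsto_logUp_right (w := (δ : ℝ) - z) (by simp; linarith)
    have h2 := tendsto_logUp_right (w := (δ : ℝ) - a) (by simp; linarith)
    have := h1.sub h2
    rw [sub_self] at this
    exact this.congr fun y => by simp only [hℓ]; ring_nf
  have hL : Tendsto (fun y : ℝ => ℓ ((-δ : ℝ) + y * I)) atTop (𝓝 (-(2 * Real.pi * I))) := by
    have h1 := tendsto_logUp_left (w := (-δ : ℝ) - z) (by simp; linarith)
    have h2 := tendsto_logUp_right (w := (-δ : ℝ) - a) (by simp; linarith)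
    have := h1.sub h2
    rw [show -(3 * Real.pi / 2 : ℂ) * I - (Real.pi / 2 : ℂ) * I = -(2 * Real.pi * I) by ring] at this
    exact this.congr fun y => by simp only [hℓ]; ring_nf
  have hB : (∫ x in -δ..δ, (((x : ℂ) + (-δ : ℝ) * I - z)⁻¹ - ((x : ℂ) + (-δ : ℝ) * I - a)⁻¹)) =
      ℓ ((δ : ℝ) + (-δ : ℝ) * I) - ℓ ((-δ : ℝ) + (-δ : ℝ) * I) := by
    have hd : ∀ x : ℝ, -δ ≤ x → HasDerivAt (fun x : ℝ => ℓ (x + (-δ : ℝ) * I))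
        ((((x : ℂ) + (-δ : ℝ) * I - z)⁻¹ - ((x : ℂ) + (-δ : ℝ) * I - a)⁻¹)) x := by
      intro x hx
      have h1 := hder (x + (-δ : ℝ) * I) (by simpa using hx) (Or.inr (by simpa using hzi))
      have h2 : HasDerivAt (fun x : ℝ => (x : ℂ) + (-δ : ℝ) * I) 1 x := by
        simpa using ((ofRealCLM.hasDerivAt (x := x))).add_const ((-δ : ℝ) * I)
      have := h1.scomp x h2
      rw [one_smul] at this
      exact this
    refine intervalIntegral.integral_eq_sub_of_hasDerivAt
      (f := fun x : ℝ => ℓ (x + (-δ : ℝ) * I)) ?_ ?_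
    · intro x hx
      rw [uIcc_of_le (by linarith)] at hx
      exact hd x hx.1
    · refine ContinuousOn.intervalIntegrable ?_
      refine ContinuousOn.sub ?_ ?_
      · refine ContinuousOn.inv₀ (by fun_prop) fun x _ h => ?_
        simpa [hzi.ne, sub_eq_zero] using congrArg im h
      · refine ContinuousOn.inv₀ (by fun_prop) fun x hx h => ?_
        rw [uIcc_of_le (by linarith)] at hx
        simpa [(ha.trans_le hx.1).ne', sub_eq_zero] using congrArg re h
  rw [boxInt_eq hδ.le, hB, hvert δ 0 (by linarith) (by linarith) hR,
    hvert (-δ) _ le_rfl (by linarith) hL]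
  ring

theorem boxInt_sub {δ : ℝ} {f g : ℂ → E}
    (hf : ∀ s, IntegrableOn (fun y => f (boxPt δ s y)) (boxDom δ s))
    (hg : ∀ s, IntegrableOn (fun y => g (boxPt δ s y)) (boxDom δ s)) :
    boxInt δ (fun w => f w - g w) = boxInt δ f - boxInt δ g := by
  simp only [boxInt]
  rw [← Finset.sum_sub_distrib]
  refine Finset.sum_congr rfl fun s _ => ?_
  rw [integral_sub (hf s) (hg s), smul_sub]

theorem boxPt_mem_closedBox {δ : ℝ} (hδ : 0 ≤ δ) {s : Fin 3} {y : ℝ} (hy : y ∈ boxDom δ s) :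
    boxPt δ s y ∈ closedBox δ := by
  fin_cases s
  · simp [boxDom, boxPt, closedBox] at hy ⊢
    exact abs_le.2 ⟨hy.1.le, hy.2⟩
  all_goals
    simp [boxDom, boxPt, closedBox] at hy ⊢
    exact ⟨(abs_of_nonneg hδ).le, hy.le⟩

theorem boxPt_notMem_openBox {δ : ℝ} {s : Fin 3} {y : ℝ} :
    boxPt δ s y ∉ openBox δ := by
  fin_cases s <;> simp [boxPt, openBox]
  all_goals exact fun h => absurd h (not_lt.2 (le_abs_self δ))

theorem continuous_boxPt (δ : ℝ) (s : Fin 3) : Continuous (boxPt δ s) := by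
  unfold boxPt
  fin_cases s <;> simp <;> fun_prop

theorem DecaysOn.integrableOn_box {S : Set ℂ} {κ δ : ℝ} {f : ℂ → E} (h : DecaysOn S κ f)
    (hκ : 1 < κ) (hδ : 0 ≤ δ) (hc : ContinuousOn f S) (hS : closedBox δ \ openBox δ ⊆ S)
    (s : Fin 3) : IntegrableOn (fun y : ℝ => f (boxPt δ s y)) (boxDom δ s) := by
  have hmem : ∀ w : ℂ, w ∈ closedBox δ → w ∉ openBox δ → w ∈ S := fun w h1 h2 => hS ⟨h1, h2⟩
  fin_cases s
  · have : ContinuousOn (fun x : ℝ => f ((x : ℂ) + (-δ : ℝ) * I)) (Icc (-δ) δ) := by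
      refine hc.comp (by fun_prop) fun x hx => hmem _ ⟨?_, ?_⟩ ?_
      · simpa using abs_le.2 hx
      · simp
      · simp [openBox]
    exact this.integrableOn_Icc.mono_set Ioc_subset_Icc_self
  all_goals
    refine h.integrableOn hκ hc fun y hy => hmem _ ⟨?_, by simpa using hy⟩ fun h => ?_
    · simp [abs_of_nonneg hδ]
    · simpa [not_lt.2 (le_abs_self δ)] using h.1

end

section

variable {E : Type*} [NormedAddCommGroup E] [NormedSpace ℂ E]

/-- The Cauchy integral of `h` over the boundary of the half-infinite box. -/
noncomputable def cauchyBox (δ : ℝ) (h : ℂ → E) (z : ℂ) : E :=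
  (2 * Real.pi * I : ℂ)⁻¹ • boxInt δ (fun w => (w - z)⁻¹ • h w)

theorem DecaysOn.const (S : Set ℂ) (c : E) : DecaysOn S 0 (fun _ => c) :=
  ⟨‖c‖, 1, one_pos, fun z _ _ => by simp⟩

theorem boxInt_smul_const [CompleteSpace E] (δ : ℝ) (f : ℂ → ℂ) (c : E) :
    boxInt δ (fun w => f w • c) = boxInt δ f • c := by
  simp only [boxInt, Finset.sum_smul]
  refine Finset.sum_congr rfl fun s _ => ?_
  rw [integral_smul_const, smul_smul, smul_eq_mul]

theorem measurableSet_boxDom (δ : ℝ) (s : Fin 3) : MeasurableSet (boxDom δ s) := by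
  fin_cases s
  exacts [measurableSet_Ioc, measurableSet_Ioi, measurableSet_Ioi]

theorem boxInt_congr {δ : ℝ} (hδ : 0 ≤ δ) {f g : ℂ → E}
    (h : ∀ w ∈ closedBox δ \ openBox δ, f w = g w) : boxInt δ f = boxInt δ g := by
  simp only [boxInt]
  refine Finset.sum_congr rfl fun s _ => ?_
  congr 1
  exact setIntegral_congr_fun (measurableSet_boxDom δ s) fun y hy =>
    h _ ⟨boxPt_mem_closedBox hδ hy, boxPt_notMem_openBox⟩

/-- The difference quotient of `h` at `z`, corrected so that it is absolutely integrable over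
hairpins. -/
noncomputable def corrSlope (h : ℂ → E) (z a w : ℂ) : E := dslope h z w + (w - a)⁻¹ • h z

theorem corrSlope_of_ne (h : ℂ → E) {z w : ℂ} (a : ℂ) (hw : w ≠ z) : corrSlope h z a w =
    (w - z)⁻¹ • h w - ((w - z)⁻¹ - (w - a)⁻¹) • h z := by
  rw [corrSlope, dslope_of_ne _ hw, slope_def_module, smul_sub, sub_smul]
  abel

theorem decaysOn_cauchy_kernel {S : Set ℂ} {κ : ℝ} {h : ℂ → E} (hd : DecaysOn S κ h) (z : ℂ) :
    DecaysOn S (1 + κ) (fun w => (w - z)⁻¹ • h w) := (decaysOn_sub_inv z).smul hd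

theorem decaysOn_kernel_smul {S : Set ℂ} {κ : ℝ} (hκ : κ ≤ 1) (z a : ℂ) (c : E) :
    DecaysOn S (1 + κ) (fun w => ((w - z)⁻¹ - (w - a)⁻¹) • c) := by
  have := (decaysOn_kernel_sub (S := S) z a).smul (DecaysOn.const S c)
  exact this.weaken (by linarith)

theorem decaysOn_corrSlope {S : Set ℂ} {κ : ℝ} (hκ : κ ≤ 1) {h : ℂ → E} (hd : DecaysOn S κ h)
    (z a : ℂ) : DecaysOn S (1 + κ) (corrSlope h z a) := by
  refine ((decaysOn_cauchy_kernel hd z).sub (decaysOn_kernel_smul hκ z a (h z))).congr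
    (y := z.im) fun w _ hw => ?_
  exact corrSlope_of_ne h a (by rintro rfl; exact lt_irrefl _ hw)

theorem boxInt_corrSlope [CompleteSpace E] {S : Set ℂ} {κ δ : ℝ} (h0 : 0 < κ) (hκ : κ ≤ 1)
    (hδ : 0 ≤ δ) {h : ℂ → E} (hd : DecaysOn S κ h) (hc : ContinuousOn h S)
    (hS : closedBox δ \ openBox δ ⊆ S) {z a : ℂ} (hz : z ∉ closedBox δ \ openBox δ)
    (ha : a ∉ closedBox δ) :
    boxInt δ (corrSlope h z a) = boxInt δ (fun w => (w - z)⁻¹ • h w) -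
      boxInt δ (fun w => (w - z)⁻¹ - (w - a)⁻¹) • h z := by
  have cz : ContinuousOn (fun w : ℂ => (w - z)⁻¹) (closedBox δ \ openBox δ) :=
    ContinuousOn.inv₀ (by fun_prop) fun w hw h => hz (by rwa [← sub_eq_zero.1 h])
  have ca : ContinuousOn (fun w : ℂ => (w - a)⁻¹) (closedBox δ \ openBox δ) :=
    ContinuousOn.inv₀ (by fun_prop) fun w hw h => ha (by rw [← sub_eq_zero.1 h]; exact hw.1)
  rw [boxInt_congr hδ (g := fun w => (w - z)⁻¹ • h w - ((w - z)⁻¹ - (w - a)⁻¹) • h z)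
    fun w hw => corrSlope_of_ne h a fun h => hz (h ▸ hw), boxInt_sub, boxInt_smul_const]
  · exact fun s => ((decaysOn_cauchy_kernel hd z).mono hS).integrableOn_box (by linarith) hδ
      (cz.smul (hc.mono hS)) subset_rfl s
  · exact fun s => (decaysOn_kernel_smul hκ z a (h z)).integrableOn_box (by linarith) hδ
      ((cz.sub ca).smul continuousOn_const) subset_rfl s

theorem notMem_closedBox_left {δ δ' : ℝ} (h : δ < δ') (hδ : 0 ≤ δ) :
    ((-δ' : ℝ) : ℂ) ∉ closedBox δ := by
  intro h'
  have := h'.1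
  rw [ofReal_re, abs_neg, abs_of_pos (by linarith)] at this
  linarith

theorem boxInt_kernel_eq_zero {δ : ℝ} (hδ : 0 ≤ δ) {z a : ℂ} (hz : z ∉ closedBox δ)
    (ha : a ∉ closedBox δ) : boxInt δ (fun w => (w - z)⁻¹ - (w - a)⁻¹) = 0 := by
  refine boxInt_eq_zero hδ one_lt_two ?_ (decaysOn_kernel_sub z a)
  refine DifferentiableOn.sub ?_ ?_
  · exact DifferentiableOn.inv (by fun_prop) fun w hw h => hz (by rwa [← sub_eq_zero.1 h])
  · exact DifferentiableOn.inv (by fun_prop) fun w hw h => ha (by rwa [← sub_eq_zero.1 h])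

theorem differentiableOn_corrSlope [CompleteSpace E] {S : Set ℂ} {h : ℂ → E} {z a : ℂ}
    (hh : DifferentiableOn ℂ h S) (hz : S ∈ 𝓝 z) (ha : a ∉ S) :
    DifferentiableOn ℂ (corrSlope h z a) S := by
  refine ((differentiableOn_dslope hz).2 hh).add (DifferentiableOn.smul_const ?_ _)
  exact DifferentiableOn.inv (by fun_prop) fun w hw h => ha (by rwa [← sub_eq_zero.1 h])

/-- Cauchy's formula for the `U`-shaped region between two hairpins. -/
theorem cauchyBox_sub_cauchyBox [CompleteSpace E] {h : ℂ → E} {δ₀ δ₁ δ₂ δ₃ κ : ℝ} (h0 : 0 ≤ δ₀)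
    (h01 : δ₀ < δ₁) (h12 : δ₁ < δ₂) (h23 : δ₂ < δ₃) (hκ0 : 0 < κ) (hκ1 : κ ≤ 1)
    (hh : DifferentiableOn ℂ h (openBox δ₃ \ closedBox δ₀))
    (hd : DecaysOn (openBox δ₃ \ closedBox δ₀) κ h) {z : ℂ} (hz2 : z ∈ openBox δ₂)
    (hz1 : z ∉ closedBox δ₁) : cauchyBox δ₂ h z - cauchyBox δ₁ h z = h z := by
  set a : ℂ := ((-(δ₃ + 1) : ℝ) : ℂ) with ha
  have haS : a ∉ openBox δ₃ \ closedBox δ₀ := fun h => notMem_closedBox_left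
    (by linarith : δ₃ < δ₃ + 1) (by linarith) (openBox_subset_closedBox _ h.1)
  have hzS : z ∈ openBox δ₃ \ closedBox δ₀ := ⟨closedBox_subset_openBox h23
    (openBox_subset_closedBox _ hz2), fun h => hz1 (openBox_subset_closedBox _
      (closedBox_subset_openBox h01 h))⟩
  have hopen : IsOpen (openBox δ₃ \ closedBox δ₀) := (isOpen_openBox _).sdiff (isClosed_closedBox _)
  have hdef := boxInt_deform h0 h01 h12.le h23 (by linarith : 1 < 1 + κ)
    (differentiableOn_corrSlope hh (hopen.mem_nhds hzS) haS) (decaysOn_corrSlope hκ1 hd z a)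
  have hsub : ∀ δ, δ₀ < δ → δ < δ₃ → closedBox δ \ openBox δ ⊆ openBox δ₃ \ closedBox δ₀ :=
    fun δ hδ hδ' w hw => ⟨closedBox_subset_openBox hδ' hw.1,
      fun h => hw.2 (closedBox_subset_openBox hδ h)⟩
  rw [boxInt_corrSlope hκ0 hκ1 (by linarith) hd hh.continuousOn (hsub _ h01 (by linarith))
      (fun h => hz1 h.1) (notMem_closedBox_left (by linarith) (by linarith)),
    boxInt_corrSlope hκ0 hκ1 (by linarith) hd hh.continuousOn (hsub _ (by linarith) h23)
      (fun h => h.2 hz2) (notMem_closedBox_left (by linarith) (by linarith)),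
    boxInt_kernel_eq_zero (by linarith) hz1 (notMem_closedBox_left (by linarith) (by linarith)),
    boxInt_kernel (by linarith) hz2 (by rw [ofReal_re]; linarith), zero_smul, sub_zero] at hdef
  rw [cauchyBox, cauchyBox, ← smul_sub, hdef, sub_sub_cancel, smul_smul, inv_mul_cancel₀, one_smul]
  exact two_pi_I_ne_zero

/-- Cauchy's formula for the half-infinite box. -/
theorem cauchyBox_eq [CompleteSpace E] {h : ℂ → E} {δ₂ δ₃ κ : ℝ} (h0 : 0 < δ₂)
    (h23 : δ₂ < δ₃) (hκ0 : 0 < κ) (hκ1 : κ ≤ 1) (hh : DifferentiableOn ℂ h (openBox δ₃))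
    (hd : DecaysOn (openBox δ₃) κ h) {z : ℂ} (hz2 : z ∈ openBox δ₂) : cauchyBox δ₂ h z = h z := by
  set a : ℂ := ((-(δ₃ + 1) : ℝ) : ℂ) with ha
  have haS : a ∉ openBox δ₃ := fun h => notMem_closedBox_left
    (by linarith : δ₃ < δ₃ + 1) (by linarith) (openBox_subset_closedBox _ h)
  have hsub := closedBox_subset_openBox h23
  have hzS : z ∈ openBox δ₃ := hsub (openBox_subset_closedBox _ hz2)
  have hdef := boxInt_eq_zero h0.le (by linarith : 1 < 1 + κ)
    ((differentiableOn_corrSlope hh ((isOpen_openBox _).mem_nhds hzS) haS).mono hsub)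
    ((decaysOn_corrSlope hκ1 hd z a).mono hsub)
  rw [boxInt_corrSlope hκ0 hκ1 h0.le hd hh.continuousOn (sdiff_subset.trans hsub)
      (fun h => h.2 hz2) (notMem_closedBox_left (by linarith) (by linarith)),
    boxInt_kernel h0 hz2 (by rw [ofReal_re]; linarith)] at hdef
  rw [cauchyBox, sub_eq_zero.1 hdef, smul_smul, inv_mul_cancel₀, one_smul]
  exact two_pi_I_ne_zero

theorem cauchyBox_deform {h : ℂ → E} {δ₀ δ₁ δ₂ δ₃ κ : ℝ} (h0 : 0 ≤ δ₀)
    (h01 : δ₀ < δ₁) (h12 : δ₁ ≤ δ₂) (h23 : δ₂ < δ₃) (hκ0 : 0 < κ)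
    (hh : DifferentiableOn ℂ h (openBox δ₃ \ closedBox δ₀))
    (hd : DecaysOn (openBox δ₃ \ closedBox δ₀) κ h) {z : ℂ} (hz : z ∉ openBox δ₃) :
    cauchyBox δ₁ h z = cauchyBox δ₂ h z := by
  rw [cauchyBox, cauchyBox, boxInt_deform h0 h01 h12 h23 (by linarith : 1 < 1 + κ) _
    (decaysOn_cauchy_kernel hd z)]
  exact (DifferentiableOn.inv (by fun_prop) fun w hw h => hz (by rw [← sub_eq_zero.1 h]; exact hw.1)).smul hh

theorem dist_box_of_inside {δ δ' : ℝ} {w z : ℂ} (hw : w ∉ openBox δ') (hz : z ∈ closedBox δ) :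
    δ' - δ ≤ ‖w - z‖ := by
  by_contra! h
  have h1 := abs_re_le_norm (w - z)
  have h2 := (abs_le.1 (abs_im_le_norm (w - z))).1
  rw [sub_re] at h1
  rw [sub_im] at h2
  exact hw ⟨by linarith [abs_sub_abs_le_abs_sub w.re z.re, hz.1], by linarith [hz.2]⟩

theorem dist_box_of_outside {δ δ' : ℝ} {w z : ℂ} (hw : w ∈ closedBox δ) (hz : z ∉ openBox δ') :
    δ' - δ ≤ ‖w - z‖ := by
  rw [norm_sub_rev]
  exact dist_box_of_inside hz hw

/-! ### Bounds for Cauchy integrals over hairpins -/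

/-- The weight on the sides of a hairpin. -/
noncomputable def wt (κ y : ℝ) : ℝ := (1 + |y|) ^ (-κ)

theorem wt_pos (κ y : ℝ) : 0 < wt κ y := Real.rpow_pos_of_pos (by positivity) _

theorem continuous_wt (κ : ℝ) : Continuous (wt κ) :=
  (by fun_prop : Continuous fun y : ℝ => 1 + |y|).rpow_const fun y => Or.inl (by positivity)

theorem wt_mul (κ κ' y : ℝ) : wt κ y * wt κ' y = wt (κ + κ') y := by
  rw [wt, wt, wt, ← Real.rpow_add (by positivity)]
  congr 1
  ring

theorem integrable_wt {κ : ℝ} (hκ : 1 < κ) : Integrable (wt κ) := by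
  exact integrable_one_add_norm (E := ℝ) (by simpa using hκ)

/-- The product of the weight with a translate of `1 / (1 + |y|)` is integrable, with a bound that
does not depend on the translation: Young's inequality. -/
theorem exists_wt_mul_le {κ : ℝ} (h0 : 0 < κ) (h1 : κ ≤ 1) : ∃ (p : ℝ), 1 < p ∧
    ∀ y t, wt κ y * wt 1 (y - t) ≤ wt 2 y + wt p (y - t) := by
  have hq : (1 : ℝ) < 2 / κ := by rw [lt_div_iff₀ h0]; linarith
  have hpq := Real.HolderConjugate.conjExponent hq
  refine ⟨(2 / κ).conjExponent, hpq.symm.lt, fun y t => ?_⟩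
  have := Real.young_inequality_of_nonneg (wt_pos κ y).le (wt_pos 1 (y - t)).le hpq
  refine this.trans (add_le_add ?_ ?_)
  · rw [wt, ← Real.rpow_mul (by positivity), wt]
    rw [show -κ * (2 / κ) = -2 by field_simp]
    exact div_le_self (by positivity) hq.le
  · rw [wt, ← Real.rpow_mul (by positivity), wt, neg_one_mul]
    exact div_le_self (by positivity) hpq.symm.lt.le

/-- Integrals of Cauchy kernels against the weight are bounded uniformly in the position of the pole;
`φ` stands for the distance to a pole of height `t`. -/
theorem exists_kernel_bound {κ : ℝ} (h0 : 0 < κ) (h1 : κ ≤ 1) {d : ℝ} (hd : 0 < d) :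
    ∃ K : ℝ, 0 ≤ K ∧ ∀ (t : ℝ) (T : Set ℝ) (φ : ℝ → ℝ), MeasurableSet T → ContinuousOn φ T →
      (∀ y ∈ T, d ≤ φ y ∧ |y - t| ≤ φ y) →
      IntegrableOn (fun y => (φ y)⁻¹ * wt κ y) T ∧ ∫ y in T, (φ y)⁻¹ * wt κ y ≤ K := by
  obtain ⟨p, hp, hY⟩ := exists_wt_mul_le h0 h1
  refine ⟨(1 / d + 1) * ((∫ y, wt 2 y) + ∫ y, wt p y), ?_, ?_⟩
  · have e1 : 0 ≤ ∫ y, wt 2 y := integral_nonneg fun y => (wt_pos _ _).le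
    have e2 : 0 ≤ ∫ y, wt p y := integral_nonneg fun y => (wt_pos _ _).le
    positivity
  intro t T φ hT hφ hle
  have i1 := integrable_wt (by norm_num : (1 : ℝ) < 2)
  have i2 := (integrable_wt hp).comp_sub_right t
  have i3 : Integrable (fun y => (1 / d + 1) * (wt 2 y + wt p (y - t))) := (i1.add i2).const_mul _
  have hb : ∀ y ∈ T, (φ y)⁻¹ * wt κ y ≤ (1 / d + 1) * (wt 2 y + wt p (y - t)) := by
    intro y hy
    obtain ⟨e1, e2⟩ := hle y hy
    have hφ0 : 0 < φ y := hd.trans_le e1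
    have e3 : (φ y)⁻¹ ≤ (1 / d + 1) * wt 1 (y - t) := by
      rw [wt, Real.rpow_neg_one, ← div_eq_mul_inv, le_div_iff₀ (by positivity),
        inv_mul_le_iff₀ hφ0]
      have : 1 ≤ φ y * (1 / d) := by
        rw [mul_one_div, le_div_iff₀ hd]; linarith
      nlinarith
    calc (φ y)⁻¹ * wt κ y ≤ ((1 / d + 1) * wt 1 (y - t)) * wt κ y :=
          mul_le_mul_of_nonneg_right e3 (wt_pos _ _).le
      _ = (1 / d + 1) * (wt κ y * wt 1 (y - t)) := by ring
      _ ≤ _ := mul_le_mul_of_nonneg_left (hY y t) (by positivity)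
  have hint : IntegrableOn (fun y => (φ y)⁻¹ * wt κ y) T := by
    refine Integrable.mono' i3.integrableOn ?_ ?_
    · refine ContinuousOn.aestronglyMeasurable ?_ hT
      exact (hφ.inv₀ fun y hy => (hd.trans_le (hle y hy).1).ne').mul (continuous_wt κ).continuousOn
    · refine ae_restrict_of_forall_mem hT fun y hy => ?_
      rw [Real.norm_of_nonneg]
      · exact hb y hy
      · exact mul_nonneg (inv_nonneg.2 (hd.le.trans (hle y hy).1)) (wt_pos _ _).le
  refine ⟨hint, ?_⟩
  calc ∫ y in T, (φ y)⁻¹ * wt κ y ≤ ∫ y in T, (1 / d + 1) * (wt 2 y + wt p (y - t)) :=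
        setIntegral_mono_on hint i3.integrableOn hT hb
    _ ≤ ∫ y, (1 / d + 1) * (wt 2 y + wt p (y - t)) := by
        refine setIntegral_le_integral i3 (Eventually.of_forall fun y => ?_)
        exact mul_nonneg (by positivity) (add_nonneg (wt_pos _ _).le (wt_pos _ _).le)
    _ = _ := by
        rw [integral_const_mul, integral_add i1 i2, integral_sub_right_eq_self]

/-- On each side of a hairpin, the distance to `z` controls the distance of the parameter to a
point. -/
theorem exists_boxPt_param (δ : ℝ) (s : Fin 3) (z : ℂ) :
    ∃ t : ℝ, ∀ y, |y - t| ≤ ‖boxPt δ s y - z‖ := by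
  fin_cases s
  · exact ⟨z.re, fun y => by simpa [boxPt] using abs_re_le_norm (boxPt δ 0 y - z)⟩
  · exact ⟨z.im, fun y => by simpa [boxPt] using abs_im_le_norm (boxPt δ 1 y - z)⟩
  · exact ⟨z.im, fun y => by simpa [boxPt] using abs_im_le_norm (boxPt δ 2 y - z)⟩

theorem exists_box_kernel_bound {κ : ℝ} (h0 : 0 < κ) (h1 : κ ≤ 1) {d : ℝ} (hd : 0 < d) :
    ∃ K : ℝ, 0 ≤ K ∧ ∀ (δ : ℝ) (s : Fin 3) (z : ℂ),
      (∀ y ∈ boxDom δ s, d ≤ ‖boxPt δ s y - z‖) →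
      IntegrableOn (fun y => ‖boxPt δ s y - z‖⁻¹ * wt κ y) (boxDom δ s) ∧
      ∫ y in boxDom δ s, ‖boxPt δ s y - z‖⁻¹ * wt κ y ≤ K := by
  obtain ⟨K, hK, H⟩ := exists_kernel_bound h0 h1 hd
  refine ⟨K, hK, fun δ s z hz => ?_⟩
  obtain ⟨t, ht⟩ := exists_boxPt_param δ s z
  exact H t _ _ (measurableSet_boxDom δ s)
    ((continuous_boxPt δ s).sub continuous_const).norm.continuousOn fun y hy => ⟨hz y hy, ht y⟩

theorem norm_boxCoef (s : Fin 3) : ‖boxCoef s‖ = 1 := by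
  fin_cases s <;> simp [boxCoef]

/-- Side functions dominated by the weight. -/
def SideBound (δ κ C : ℝ) (h : ℂ → E) : Prop :=
  (∀ s, AEStronglyMeasurable (fun y => h (boxPt δ s y)) (volume.restrict (boxDom δ s))) ∧
    ∀ s, ∀ y ∈ boxDom δ s, ‖h (boxPt δ s y)‖ ≤ C * wt κ y

theorem SideBound.integrand_le {δ κ C : ℝ} {h : ℂ → E} (hh : SideBound δ κ C h) (s : Fin 3)
    (z : ℂ) {y : ℝ} (hy : y ∈ boxDom δ s) : ‖(boxPt δ s y - z)⁻¹ • h (boxPt δ s y)‖ ≤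
      C * (‖boxPt δ s y - z‖⁻¹ * wt κ y) := by
  rw [norm_smul, norm_inv]
  calc _ ≤ ‖boxPt δ s y - z‖⁻¹ * (C * wt κ y) :=
        mul_le_mul_of_nonneg_left (hh.2 s y hy) (by positivity)
    _ = _ := by ring

theorem norm_two_pi_I_inv_le : ‖(2 * Real.pi * I : ℂ)⁻¹‖ ≤ 1 := by
  rw [norm_inv]
  apply inv_le_one_of_one_le₀
  simp [abs_of_pos Real.pi_pos]
  nlinarith [Real.pi_gt_three]

theorem exists_cauchyBox_bound {κ : ℝ} (h0 : 0 < κ) (h1 : κ ≤ 1) {d : ℝ} (hd : 0 < d) :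
    ∃ K : ℝ, 0 ≤ K ∧ ∀ (δ C : ℝ) (h : ℂ → E) (z : ℂ), 0 ≤ C → SideBound δ κ C h →
      (∀ s, ∀ y ∈ boxDom δ s, d ≤ ‖boxPt δ s y - z‖) → ‖cauchyBox δ h z‖ ≤ K * C := by
  obtain ⟨K, hK, H⟩ := exists_box_kernel_bound h0 h1 hd
  refine ⟨3 * K, by positivity, fun δ C h z hC hh hz => ?_⟩
  have hs : ∀ s, ‖boxCoef s • ∫ y in boxDom δ s, (boxPt δ s y - z)⁻¹ • h (boxPt δ s y)‖ ≤ K * C := by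
    intro s
    obtain ⟨hi, hle⟩ := H δ s z (hz s)
    rw [norm_smul, norm_boxCoef, one_mul]
    refine (norm_integral_le_of_norm_le (hi.const_mul C) (ae_restrict_of_forall_mem
      (measurableSet_boxDom δ s) fun y hy => hh.integrand_le s z hy)).trans ?_
    rw [integral_const_mul, mul_comm]
    exact mul_le_mul_of_nonneg_right hle hC
  rw [cauchyBox, norm_smul, boxInt]
  calc _ ≤ 1 * ∑ s : Fin 3, K * C := by
        refine mul_le_mul norm_two_pi_I_inv_le ?_ (norm_nonneg _) zero_le_one
        exact (norm_sum_le _ _).trans (Finset.sum_le_sum fun s _ => hs s)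
    _ = 3 * K * C := by simp; ring

theorem isClosed_boxBoundary (δ : ℝ) : IsClosed (closedBox δ \ openBox δ) :=
  (isClosed_closedBox δ).sdiff (isOpen_openBox δ)

theorem aestronglyMeasurable_cauchy_integrand {δ κ C : ℝ} {h : ℂ → E} (hh : SideBound δ κ C h)
    (s : Fin 3) (z : ℂ) : AEStronglyMeasurable
      (fun y => (boxPt δ s y - z)⁻¹ • h (boxPt δ s y)) (volume.restrict (boxDom δ s)) := by
  refine AEStronglyMeasurable.smul ?_ (hh.1 s)
  exact (((continuous_boxPt δ s).sub continuous_const).measurable.inv).aestronglyMeasurable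

theorem differentiableOn_cauchyBox [CompleteSpace E] {κ : ℝ} (h0 : 0 < κ) (h1 : κ ≤ 1)
    {δ C : ℝ} (hδ : 0 ≤ δ) {h : ℂ → E} (hh : SideBound δ κ C h) :
    DifferentiableOn ℂ (cauchyBox δ h) (closedBox δ \ openBox δ)ᶜ := by
  have hO := (isClosed_boxBoundary δ).isOpen_compl
  have hmem : ∀ s, ∀ y ∈ boxDom δ s, boxPt δ s y ∈ closedBox δ \ openBox δ := fun s y hy =>
    ⟨boxPt_mem_closedBox hδ hy, boxPt_notMem_openBox⟩
  refine DifferentiableOn.const_smul (DifferentiableOn.fun_sum fun s _ =>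
    DifferentiableOn.const_smul ?_ _) _
  refine differentiableOn_integral_param hO ?_
    (fun z _ => aestronglyMeasurable_cauchy_integrand hh s z) ?_
  · refine ae_restrict_of_forall_mem (measurableSet_boxDom δ s) fun y hy => ?_
    have hne : ∀ z ∈ (closedBox δ \ openBox δ)ᶜ, boxPt δ s y - z ≠ 0 := by
      intro z hz h
      exact hz (by rw [← sub_eq_zero.1 h]; exact hmem s y hy)
    exact DifferentiableOn.smul_const (DifferentiableOn.inv (by fun_prop) hne) _
  · intro z₀ hz₀
    obtain ⟨r, hr, hsub⟩ := Metric.isOpen_iff.1 hO z₀ hz₀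
    obtain ⟨K, hK, H⟩ := exists_box_kernel_bound h0 h1 hr
    have hdist : ∀ y ∈ boxDom δ s, r ≤ ‖boxPt δ s y - z₀‖ := by
      intro y hy
      by_contra! hlt
      exact hsub (mem_ball_iff_norm.2 hlt) (hmem s y hy)
    refine ⟨r / 2, by positivity, _, ((H δ s z₀ hdist).1.const_mul (2 * |C|)), ?_⟩
    refine ae_restrict_of_forall_mem (measurableSet_boxDom δ s) fun y hy z hz => ?_
    refine (hh.integrand_le s z hy).trans ?_
    have h2 : ‖boxPt δ s y - z₀‖ / 2 ≤ ‖boxPt δ s y - z‖ := by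
      have e1 := mem_ball_iff_norm.1 hz.1
      have e2 := norm_sub_le_norm_sub_add_norm_sub (boxPt δ s y) z z₀
      have e3 := hdist y hy
      linarith
    have h3 : 0 < ‖boxPt δ s y - z₀‖ := hr.trans_le (hdist y hy)
    have h4 : ‖boxPt δ s y - z‖⁻¹ ≤ 2 * ‖boxPt δ s y - z₀‖⁻¹ := by
      calc _ ≤ (‖boxPt δ s y - z₀‖ / 2)⁻¹ := inv_anti₀ (by positivity) h2
        _ = _ := by field_simp
    calc C * (‖boxPt δ s y - z‖⁻¹ * wt κ y) ≤ |C| * ((2 * ‖boxPt δ s y - z₀‖⁻¹) * wt κ y) :=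
          mul_le_mul (le_abs_self C) (mul_le_mul_of_nonneg_right h4 (wt_pos _ _).le)
            (mul_nonneg (by positivity) (wt_pos _ _).le) (abs_nonneg _)
      _ = _ := by ring

/-- The Cauchy integral over a hairpin tends to `0` far below the hairpin. -/
theorem tendsto_cauchyBox_below {κ : ℝ} (h0 : 0 < κ) {δ C : ℝ} (hδ : 0 ≤ δ)
    {h : ℂ → E} (hh : SideBound δ κ C h) (c : ℂ) :
    Tendsto (fun T : ℝ => cauchyBox δ h (-T * I - c)) atTop (𝓝 0) := by
  rw [← smul_zero (2 * Real.pi * I : ℂ)⁻¹]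
  refine Tendsto.const_smul ?_ _
  rw [show (0 : E) = ∑ s : Fin 3, boxCoef s • (0 : E) by simp]
  refine tendsto_finsetSum _ fun s _ => Tendsto.const_smul ?_ _
  have him : ∀ y ∈ boxDom δ s, ∀ T : ℝ, δ + 1 - c.im ≤ T →
      (1 + |y|) ≤ (1 + δ) * ‖boxPt δ s y - (-T * I - c)‖ ∧ T + c.im - δ ≤
        ‖boxPt δ s y - (-T * I - c)‖ := by
    intro y hy T hT
    have e1 := (abs_le.1 (abs_im_le_norm (boxPt δ s y - (-T * I - c)))).2
    have e2 : (boxPt δ s y - (-T * I - c)).im = (boxPt δ s y).im + T + c.im := by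
      simp; ring
    rw [e2] at e1
    have e3 := (boxPt_mem_closedBox hδ hy).2
    refine ⟨?_, by linarith⟩
    have hn : 1 + (δ + (boxPt δ s y).im) ≤ ‖boxPt δ s y - (-T * I - c)‖ := by linarith
    have hy1 : |y| ≤ δ + (δ + (boxPt δ s y).im) := by
      fin_cases s
      · simp [boxDom, boxPt] at hy ⊢
        exact abs_le.2 ⟨hy.1.le, hy.2⟩
      all_goals
        simp [boxDom, boxPt] at hy ⊢
        exact abs_le.2 ⟨by linarith, by linarith⟩
    nlinarith
  have hlim := tendsto_integral_filter_of_dominated_convergence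
    (μ := volume.restrict (boxDom δ s)) (l := (atTop : Filter ℝ))
    (F := fun T y => (boxPt δ s y - (-T * I - c))⁻¹ • h (boxPt δ s y)) (f := fun _ => (0 : E))
    (fun y => (|C| * (1 + δ)) * wt (1 + κ) y) ?_ ?_ ?_ ?_
  · simpa using hlim
  · exact Eventually.of_forall fun T => aestronglyMeasurable_cauchy_integrand hh s _
  · filter_upwards [eventually_ge_atTop (δ + 1 - c.im)] with T hT
    refine ae_restrict_of_forall_mem (measurableSet_boxDom δ s) fun y hy => ?_
    refine (hh.integrand_le s _ hy).trans ?_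
    obtain ⟨e1, e2⟩ := him y hy T hT
    have hpos : 0 < ‖boxPt δ s y - (-T * I - c)‖ := by linarith
    have e3 : ‖boxPt δ s y - (-T * I - c)‖⁻¹ ≤ (1 + δ) * wt 1 y := by
      rw [wt, Real.rpow_neg_one, ← div_eq_mul_inv, le_div_iff₀ (by positivity),
        inv_mul_le_iff₀ hpos, mul_comm]
      exact e1
    rw [← wt_mul]
    calc _ ≤ |C| * (((1 + δ) * wt 1 y) * wt κ y) :=
          mul_le_mul (le_abs_self C) (mul_le_mul_of_nonneg_right e3 (wt_pos _ _).le)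
            (mul_nonneg (by positivity) (wt_pos _ _).le) (abs_nonneg _)
      _ = _ := by ring
  · exact ((integrable_wt (by linarith : 1 < 1 + κ)).const_mul _).integrableOn
  · refine ae_restrict_of_forall_mem (measurableSet_boxDom δ s) fun y hy => ?_
    rw [← zero_smul ℂ (h (boxPt δ s y))]
    refine Tendsto.smul_const ?_ _
    rw [tendsto_zero_iff_norm_tendsto_zero]
    simp only [norm_inv]
    refine (tendsto_atTop_mono' _ ?_
      (tendsto_atTop_add_const_right _ (c.im - δ) tendsto_id)).inv_tendsto_atTop
    filter_upwards [eventually_ge_atTop (δ + 1 - c.im)] with T hT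
    linarith [(him y hy T hT).2, id_eq T]

end

section

variable {E : Type*} [NormedAddCommGroup E] [NormedSpace ℂ E]

theorem wt_le_one {κ : ℝ} (hκ : 0 ≤ κ) (y : ℝ) : wt κ y ≤ 1 :=
  Real.rpow_le_one_of_one_le_of_nonpos (by linarith [abs_nonneg y]) (by linarith)

theorem one_le_mul_wt {κ δ y : ℝ} (hκ : 0 ≤ κ) (hy : |y| ≤ δ) : 1 ≤ (1 + δ) ^ κ * wt κ y := by
  have h1 : 0 < 1 + |y| := by positivity
  rw [wt, Real.rpow_neg h1.le, ← div_eq_mul_inv, one_le_div (Real.rpow_pos_of_pos h1 _)]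
  exact Real.rpow_le_rpow h1.le (by linarith) hκ

theorem sideBound_of_le {δ κ C : ℝ} (hδ : 0 ≤ δ) (hκ : 0 ≤ κ) (hC : 0 ≤ C) {h : ℂ → E}
    (hc : ContinuousOn h (closedBox δ \ openBox δ))
    (hle : ∀ w ∈ closedBox δ \ openBox δ, ‖h w‖ ≤ C * wt κ w.im) :
    SideBound δ κ (C * (1 + δ) ^ κ) h := by
  have hmem : ∀ s, ∀ y ∈ boxDom δ s, boxPt δ s y ∈ closedBox δ \ openBox δ := fun s y hy =>
    ⟨boxPt_mem_closedBox hδ hy, boxPt_notMem_openBox⟩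
  refine ⟨fun s => ?_, fun s y hy => (hle _ (hmem s y hy)).trans ?_⟩
  · exact (hc.comp (continuous_boxPt δ s).continuousOn (hmem s)).aestronglyMeasurable
      (measurableSet_boxDom δ s)
  · rw [mul_assoc]
    refine mul_le_mul_of_nonneg_left ?_ hC
    have h1 : (1 : ℝ) ≤ (1 + δ) ^ κ := Real.one_le_rpow (by linarith) hκ
    fin_cases s
    · simp [boxDom] at hy
      exact (wt_le_one hκ _).trans (one_le_mul_wt hκ (abs_le.2 ⟨hy.1.le, hy.2⟩))
    all_goals
      simp [boxPt]
      exact le_mul_of_one_le_left (wt_pos _ _).le h1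

theorem decaysOn_of_le {κ C : ℝ} (hκ : 0 ≤ κ) (hC : 0 ≤ C) {S : Set ℂ} {h : ℂ → E}
    (hle : ∀ w ∈ S, ‖h w‖ ≤ C * wt κ w.im) : DecaysOn S κ h := by
  refine ⟨C, 1, one_pos, fun z hz hz1 => (hle z hz).trans (mul_le_mul_of_nonneg_left ?_ hC)⟩
  exact Real.rpow_le_rpow_of_nonpos (by linarith) (by rw [abs_of_pos (by linarith)]; linarith)
    (by linarith)

/-- Two boxes whose centres are horizontally far apart are disjoint. -/
theorem box_disjoint {c c' z : ℂ} {δ : ℝ} (hsep : 2 * δ ≤ |c.re - c'.re|)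
    (hz : z - c ∈ openBox δ) : z - c' ∉ openBox δ := by
  intro hz'
  have h1 := hz.1
  have h2 := hz'.1
  rw [sub_re] at h1 h2
  grind

/-- The additive Riemann–Hilbert problem on a family of hairpins: a function `V` that is holomorphic
outside the hairpins and functions `W j` that are holomorphic inside are recovered from the
differences `V - W j` on the overlaps. The reason is Liouville's theorem: adding the Cauchy
integrals of the differences to `V` and to the `W j` gives one bounded entire function. -/
theorem additive_representation [CompleteSpace E] {ι : Type*} [Fintype ι] {c : ι → ℂ}
    {δ₀ δ₁ δm δ₂ δ₃ κ : ℝ} (h0 : 0 ≤ δ₀) (h01 : δ₀ < δ₁) (h1m : δ₁ < δm) (hm2 : δm < δ₂)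
    (h23 : δ₂ < δ₃) (hκ0 : 0 < κ) (hκ1 : κ ≤ 1)
    (hsep : ∀ i j, i ≠ j → 2 * δ₃ ≤ |(c i).re - (c j).re|)
    {V : ℂ → E} {W : ι → ℂ → E} {h : ι → ℂ → E} {C B : ℝ} {v : E} (hC : 0 ≤ C)
    (hV : DifferentiableOn ℂ V {z | ∀ j, z - c j ∉ closedBox δ₀})
    (hW : ∀ j, DifferentiableOn ℂ (W j) {z | z - c j ∈ openBox δ₃})
    (hh : ∀ j, ∀ w ∈ openBox δ₃ \ closedBox δ₀, h j w = V (c j + w) - W j (c j + w))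
    (hle : ∀ j, ∀ w ∈ openBox δ₃ \ closedBox δ₀, ‖h j w‖ ≤ C * wt κ w.im)
    (hVB : ∀ z, (∀ j, z - c j ∉ openBox δm) → ‖V z‖ ≤ B)
    (hWB : ∀ j, ∀ z, z - c j ∈ closedBox δm → ‖W j z‖ ≤ B)
    (hlim : Tendsto (fun T : ℝ => V (-T * I)) atTop (𝓝 v)) :
    (∀ z, (∀ j, z - c j ∉ closedBox δ₁) → V z = v - ∑ j, cauchyBox δ₁ (h j) (z - c j)) ∧
    ∀ i z, z - c i ∈ openBox δ₂ → W i z = v - ∑ j, cauchyBox δ₂ (h j) (z - c j) := by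
  have hdis : ∀ i j z, i ≠ j → z - c i ∈ openBox δ₃ → z - c j ∉ openBox δ₃ :=
    fun i j z hij hz => box_disjoint (hsep i j hij) hz
  have sub23 := closedBox_subset_openBox h23
  have sub03 := closedBox_subset_openBox (show δ₀ < δ₃ by linarith)
  have hhd : ∀ j, DifferentiableOn ℂ (h j) (openBox δ₃ \ closedBox δ₀) := by
    intro j
    have hmaps : MapsTo (fun w => c j + w) (openBox δ₃ \ closedBox δ₀)
        {z | ∀ i, z - c i ∉ closedBox δ₀} := by
      intro w hw i
      by_cases hij : j = i
      · subst hij; simpa using hw.2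
      · intro hwi
        exact hdis j i (c j + w) hij (by simpa using hw.1) (sub03 hwi)
    refine DifferentiableOn.congr ?_ (hh j)
    refine DifferentiableOn.sub (hV.comp (by fun_prop) hmaps) ?_
    exact (hW j).comp (by fun_prop) fun w hw => by simpa using hw.1
  have hdec : ∀ j, DecaysOn (openBox δ₃ \ closedBox δ₀) κ (h j) := fun j =>
    decaysOn_of_le hκ0.le hC (hle j)
  have hbd : ∀ δ, δ₀ < δ → δ < δ₃ → closedBox δ \ openBox δ ⊆ openBox δ₃ \ closedBox δ₀ :=
    fun δ hδ hδ' w hw => ⟨closedBox_subset_openBox hδ' hw.1,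
      fun h => hw.2 (closedBox_subset_openBox hδ h)⟩
  have hside : ∀ δ, δ₀ < δ → δ < δ₃ → ∀ j, SideBound δ κ (C * (1 + δ) ^ κ) (h j) :=
    fun δ hδ hδ' j => sideBound_of_le (by linarith) hκ0.le hC
      ((hhd j).continuousOn.mono (hbd δ hδ hδ')) fun w hw => hle j w (hbd δ hδ hδ' hw)
  have s1 := hside δ₁ h01 (by linarith)
  have s2 := hside δ₂ (by linarith) h23
  have d1 := fun j => differentiableOn_cauchyBox hκ0 hκ1 (by linarith : 0 ≤ δ₁) (s1 j)
  have d2 := fun j => differentiableOn_cauchyBox hκ0 hκ1 (by linarith : 0 ≤ δ₂) (s2 j)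
  -- the two expressions agree on the overlaps
  have hoverlap : ∀ i z, z - c i ∈ openBox δ₂ → z - c i ∉ closedBox δ₁ →
      V z + ∑ j, cauchyBox δ₁ (h j) (z - c j) = W i z + ∑ j, cauchyBox δ₂ (h j) (z - c j) := by
    intro i z hz2 hz1
    have e1 := cauchyBox_sub_cauchyBox h0 h01 (by linarith) h23 hκ0 hκ1 (hhd i) (hdec i) hz2 hz1
    rw [hh i (z - c i) ⟨sub23 (openBox_subset_closedBox _ hz2), fun hz =>
      hz1 (openBox_subset_closedBox _ (closedBox_subset_openBox h01 hz))⟩] at e1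
    rw [add_sub_cancel] at e1
    have e2 : ∑ j, cauchyBox δ₂ (h j) (z - c j) - ∑ j, cauchyBox δ₁ (h j) (z - c j) =
        V z - W i z := by
      rw [← Finset.sum_sub_distrib, ← e1]
      refine Finset.sum_eq_single i (fun j _ hj => ?_) (by simp)
      rw [sub_eq_zero]
      exact (cauchyBox_deform h0 h01 (by linarith) h23 hκ0 (hhd j) (hdec j)
        (hdis i j z hj.symm (sub23 (openBox_subset_closedBox _ hz2)))).symm
    rw [← sub_eq_zero, ← neg_eq_zero, ← sub_eq_zero.2 e2]
    abel
  classical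
  set F : ℂ → E := fun z => if hz : ∃ i, z - c i ∈ closedBox δ₁ then
    W hz.choose z + ∑ j, cauchyBox δ₂ (h j) (z - c j) else
    V z + ∑ j, cauchyBox δ₁ (h j) (z - c j) with hF
  have hFin : ∀ i z, z - c i ∈ openBox δ₂ → F z = W i z + ∑ j, cauchyBox δ₂ (h j) (z - c j) := by
    intro i z hz
    by_cases hex : ∃ i, z - c i ∈ closedBox δ₁
    · have : hex.choose = i := by
        by_contra hne
        exact hdis _ _ z hne (closedBox_subset_openBox (by linarith) hex.choose_spec)
          (sub23 (openBox_subset_closedBox _ hz))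
      simp only [hF, dif_pos hex, this]
    · simp only [hF, dif_neg hex]
      exact hoverlap i z hz fun h => hex ⟨i, h⟩
  have hFout : ∀ z, (∀ j, z - c j ∉ closedBox δ₁) →
      F z = V z + ∑ j, cauchyBox δ₁ (h j) (z - c j) := by
    intro z hz
    simp only [hF, dif_neg (not_exists.2 hz)]
  have hopen_in : ∀ i δ, IsOpen {z : ℂ | z - c i ∈ openBox δ} := fun i δ =>
    (isOpen_openBox δ).preimage (by fun_prop : Continuous fun z : ℂ => z - c i)
  have hopen_out : ∀ δ, IsOpen {z : ℂ | ∀ j, z - c j ∉ closedBox δ} := fun δ => by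
    simp only [ofPred_forall]
    exact isOpen_iInter_of_finite fun j => (isClosed_closedBox δ).isOpen_compl.preimage
      (by fun_prop : Continuous fun z : ℂ => z - c j)
  have hFd : Differentiable ℂ F := by
    intro z
    by_cases hex : ∃ i, z - c i ∈ openBox δ₂
    · obtain ⟨i, hi⟩ := hex
      have hO := (hopen_in i δ₂).mem_nhds hi
      have hd : DifferentiableOn ℂ (fun z => W i z + ∑ j, cauchyBox δ₂ (h j) (z - c j))
          {z | z - c i ∈ openBox δ₂} := by
        refine DifferentiableOn.add ((hW i).mono fun z hz =>
          sub23 (openBox_subset_closedBox _ hz)) (DifferentiableOn.fun_sum fun j _ => ?_)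
        refine (d2 j).comp (by fun_prop) fun z hz hzb => ?_
        by_cases hij : i = j
        · subst hij; exact hzb.2 hz
        · exact hdis i j z hij (sub23 (openBox_subset_closedBox _ hz)) (sub23 hzb.1)
      refine (hd.differentiableAt hO).congr_of_eventuallyEq ?_
      filter_upwards [hO] with u hu using hFin i u hu
    · push Not at hex
      have hz : ∀ j, z - c j ∉ closedBox δ₁ := fun j hj =>
        hex j (closedBox_subset_openBox (by linarith) hj)
      have hO := (hopen_out δ₁).mem_nhds hz
      have hd : DifferentiableOn ℂ (fun z => V z + ∑ j, cauchyBox δ₁ (h j) (z - c j))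
          {z | ∀ j, z - c j ∉ closedBox δ₁} := by
        refine DifferentiableOn.add (hV.mono fun z hz j hj => hz j
          (openBox_subset_closedBox _ (closedBox_subset_openBox h01 hj)))
          (DifferentiableOn.fun_sum fun j _ => (d1 j).comp (by fun_prop) fun z hz hzb => hz j hzb.1)
      refine (hd.differentiableAt hO).congr_of_eventuallyEq ?_
      filter_upwards [hO] with u hu using hFout u hu
  obtain ⟨d, hd0, hd⟩ : ∃ d > 0, d ≤ δm - δ₁ ∧ d ≤ δ₂ - δm ∧ d ≤ δ₃ - δ₂ :=
    ⟨min (δm - δ₁) (min (δ₂ - δm) (δ₃ - δ₂)), by grind, by grind⟩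
  obtain ⟨K, hK, hKb⟩ := exists_cauchyBox_bound (E := E) hκ0 hκ1 hd0
  have hC1 : 0 ≤ C * (1 + δ₁) ^ κ := mul_nonneg hC (Real.rpow_nonneg (by linarith) _)
  have hC2 : 0 ≤ C * (1 + δ₂) ^ κ := mul_nonneg hC (Real.rpow_nonneg (by linarith) _)
  have hFb : ∀ z, ‖F z‖ ≤ B + max (∑ j : ι, K * (C * (1 + δ₁) ^ κ)) (∑ j : ι, K * (C * (1 + δ₂) ^ κ)) := by
    intro z
    by_cases hex : ∃ i, z - c i ∈ openBox δm
    · obtain ⟨i, hi⟩ := hex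
      have hi' := openBox_subset_closedBox _ hi
      rw [hFin i z (closedBox_subset_openBox hm2 hi')]
      refine (norm_add_le _ _).trans (add_le_add (hWB i z hi') ((norm_sum_le _ _).trans
        ((Finset.sum_le_sum fun j _ => ?_).trans (le_max_right _ _))))
      refine hKb _ _ _ _ hC2 (s2 j) fun s y hy => ?_
      by_cases hij : i = j
      · subst hij
        exact hd.2.1.trans (dist_box_of_inside boxPt_notMem_openBox hi')
      · exact hd.2.2.trans (dist_box_of_outside (boxPt_mem_closedBox (by linarith) hy)
          (hdis i j z hij (closedBox_subset_openBox (by linarith) hi')))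
    · push Not at hex
      rw [hFout z fun j hj => hex j (closedBox_subset_openBox h1m hj)]
      refine (norm_add_le _ _).trans (add_le_add (hVB z hex) ((norm_sum_le _ _).trans
        ((Finset.sum_le_sum fun j _ => ?_).trans (le_max_left _ _))))
      refine hKb _ _ _ _ hC1 (s1 j) fun s y hy => ?_
      exact hd.1.trans (dist_box_of_outside (boxPt_mem_closedBox (by linarith) hy) (hex j))
  have hFlim : Tendsto (fun T : ℝ => F (-T * I)) atTop (𝓝 v) := by
    have e1 : Tendsto (fun T : ℝ => V (-T * I) + ∑ j, cauchyBox δ₁ (h j) (-T * I - c j)) atTop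
        (𝓝 (v + ∑ j : ι, (0 : E))) := hlim.add (tendsto_finsetSum _ fun j _ =>
          tendsto_cauchyBox_below hκ0 (by linarith) (s1 j) (c j))
    simp only [Finset.sum_const_zero, add_zero] at e1
    refine e1.congr' ?_
    filter_upwards [eventually_all.2 fun j => eventually_gt_atTop (δ₁ - (c j).im)] with T hT
    refine (hFout _ fun j hj => ?_).symm
    have := hj.2
    simp at this
    linarith [hT j]
  have hFv := fun z => eq_of_bounded_of_tendsto hFd hFb hFlim z
  refine ⟨fun z hz => ?_, fun i z hz => ?_⟩
  · rw [eq_sub_iff_add_eq, ← hFout z hz, hFv]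
  · rw [eq_sub_iff_add_eq, ← hFin i z hz, hFv]

end

section

/-! ### Exponentials in a complex Banach algebra -/

/-- `exp (a A)` for a scalar `a`. -/
noncomputable def ex (a : ℂ) (A : 𝔸) : 𝔸 := NormedSpace.exp (a • A)

theorem ex_add (a b : ℂ) (A : 𝔸) : ex (a + b) A = ex a A * ex b A := by
  let _ : NormedAlgebra ℚ 𝔸 := NormedAlgebra.restrictScalars ℚ ℂ 𝔸
  rw [ex, ex, ex, add_smul]
  exact NormedSpace.exp_add_of_commute (((Commute.refl A).smul_left a).smul_right b)

@[simp] theorem ex_zero (A : 𝔸) : ex 0 A = 1 := by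
  let _ : NormedAlgebra ℚ 𝔸 := NormedAlgebra.restrictScalars ℚ ℂ 𝔸
  rw [ex, zero_smul, NormedSpace.exp_zero]

theorem ex_mul_ex_neg (a : ℂ) (A : 𝔸) : ex a A * ex (-a) A = 1 := by
  rw [← ex_add, add_neg_cancel, ex_zero]

theorem ex_neg_mul_ex (a : ℂ) (A : 𝔸) : ex (-a) A * ex a A = 1 := by
  rw [← ex_add, neg_add_cancel, ex_zero]

theorem isUnit_ex (a : ℂ) (A : 𝔸) : IsUnit (ex a A) :=
  ⟨⟨ex a A, ex (-a) A, ex_mul_ex_neg a A, ex_neg_mul_ex a A⟩, rfl⟩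

theorem continuous_exp_complex : Continuous (NormedSpace.exp : 𝔸 → 𝔸) := by
  let _ : NormedAlgebra ℚ 𝔸 := NormedAlgebra.restrictScalars ℚ ℂ 𝔸
  exact NormedSpace.exp_continuous

theorem tendsto_ex {ι : Type*} {l : Filter ι} {a : ι → ℂ} {A : ι → 𝔸} {a₀ : ℂ} {A₀ : 𝔸}
    (ha : Tendsto a l (𝓝 a₀)) (hA : Tendsto A l (𝓝 A₀)) :
    Tendsto (fun i => ex (a i) (A i)) l (𝓝 (ex a₀ A₀)) :=
  (continuous_exp_complex.tendsto _).comp (ha.smul hA)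

theorem differentiableAt_exp_complex (x : 𝔸) : DifferentiableAt ℂ (NormedSpace.exp : 𝔸 → 𝔸) x :=
  (NormedSpace.exp_analytic (𝕂 := ℂ) x).differentiableAt

theorem DifferentiableOn.ex {S : Set ℂ} {a : ℂ → ℂ} {A : ℂ → 𝔸} (ha : DifferentiableOn ℂ a S)
    (hA : DifferentiableOn ℂ A S) : DifferentiableOn ℂ (fun z => ex (a z) (A z)) S :=
  fun z hz => (differentiableAt_exp_complex _).comp_differentiableWithinAt z
    ((ha z hz).smul (hA z hz))

theorem norm_exp_sub_one_le_exp (x : 𝔸) : ‖NormedSpace.exp x - 1‖ ≤ Real.exp ‖x‖ - 1 := by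
  have h := (hasSum_nat_add_iff' 1).2 (NormedSpace.exp_series_hasSum_exp' (𝕂 := ℂ) x)
  have g := (hasSum_nat_add_iff' 1).2 (NormedSpace.exp_series_hasSum_exp' (𝕂 := ℝ) ‖x‖)
  simp only [Finset.range_one, Finset.sum_singleton, Nat.factorial_zero, Nat.cast_one, inv_one,
    pow_zero, one_smul] at h g
  rw [← Real.exp_eq_exp_ℝ] at g
  refine h.norm_le_of_bounded g fun n => ?_
  rw [norm_smul, norm_inv, smul_eq_mul]
  exact mul_le_mul (by simp) (norm_pow_le' x (Nat.succ_pos n)) (norm_nonneg _) (by positivity)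

theorem norm_ex_sub_one_le (a : ℂ) (A : 𝔸) : ‖ex a A - 1‖ ≤ Real.exp (‖a‖ * ‖A‖) - 1 := by
  rw [← norm_smul]
  exact norm_exp_sub_one_le_exp _

theorem real_exp_sub_one_le {x : ℝ} (h0 : 0 ≤ x) (h1 : x ≤ 1) : Real.exp x - 1 ≤ 2 * x := by
  have := Real.norm_exp_sub_one_sub_id_le (x := x) (by rw [Real.norm_of_nonneg h0]; exact h1)
  rw [Real.norm_eq_abs, Real.norm_of_nonneg h0] at this
  have := (abs_le.1 this).2
  nlinarith

theorem norm_logUp_le (w : ℂ) : ‖logUp w‖ ≤ |Real.log ‖w‖| + 5 := by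
  have h1 := Complex.norm_le_abs_re_add_abs_im (Complex.log (I * w))
  rw [Complex.log_re, Complex.log_im, norm_mul, norm_I, one_mul] at h1
  have h2 := abs_arg_le_pi (I * w)
  have h3 : ‖(Real.pi / 2 : ℂ) * I‖ = Real.pi / 2 := by
    rw [norm_mul, norm_I, mul_one, norm_div, norm_real, Real.norm_of_nonneg Real.pi_pos.le]
    norm_num
  have h4 := norm_sub_le (Complex.log (I * w)) ((Real.pi / 2 : ℂ) * I)
  rw [h3] at h4
  have := Real.pi_lt_d2
  rw [logUp]
  linarith

/-- The exponent `log z / (2πi)` of the power `z ^ (A / (2πi))`. -/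
noncomputable def lc (z : ℂ) : ℂ := logUp z / (2 * Real.pi * I)

theorem norm_lc_le (w : ℂ) : ‖lc w‖ ≤ |Real.log ‖w‖| + 5 := by
  rw [lc, div_eq_mul_inv, norm_mul]
  have := mul_le_mul (norm_logUp_le w) norm_two_pi_I_inv_le (norm_nonneg _) (by positivity)
  simpa using this

theorem hasDerivAt_lc {w : ℂ} (hw : w.re ≠ 0 ∨ w.im < 0) :
    HasDerivAt lc (w⁻¹ / (2 * Real.pi * I)) w := (hasDerivAt_logUp hw).div_const _

theorem tendsto_I_mul_neg {z : ℂ} (hre : z.re = 0) (him : 0 < z.im) :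
    (I * z).re < 0 ∧ (I * z).im = 0 ∧ ‖I * z‖ = z.im := by
  refine ⟨by simpa using him, by simpa using hre, ?_⟩
  rw [norm_mul, norm_I, one_mul, ← re_add_im z, hre]
  simp [abs_of_pos him]

/-- The value of `lc` at a point of `(0, i∞)` when approached from the left. -/
noncomputable def lcLeft (z : ℂ) : ℂ :=
  (Real.log z.im - (3 * Real.pi / 2) * I) / (2 * Real.pi * I)

theorem tendsto_lc_left {z : ℂ} (hre : z.re = 0) (him : 0 < z.im) :
    Tendsto lc (𝓝[{w | w.re < 0}] z) (𝓝 (lcLeft z)) := by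
  obtain ⟨h1, h2, h3⟩ := tendsto_I_mul_neg hre him
  have h4 := tendsto_log_nhdsWithin_im_neg_of_re_neg_of_im_zero h1 h2
  have h5 : Tendsto (fun w => I * w) (𝓝[{w | w.re < 0}] z) (𝓝[{w | w.im < 0}] (I * z)) := by
    exact (by fun_prop : ContinuousWithinAt _ _ _).tendsto_nhdsWithin fun w hw => by simpa using hw
  have h6 := ((h4.comp h5).sub_const ((Real.pi / 2 : ℂ) * I)).div_const (2 * Real.pi * I)
  rw [h3] at h6
  convert h6 using 2
  · rfl
  · rw [lcLeft]; ring

theorem tendsto_lc_right {z : ℂ} (hre : z.re = 0) (him : 0 < z.im) :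
    Tendsto lc (𝓝[{w | 0 < w.re}] z) (𝓝 (lcLeft z + 1)) := by
  obtain ⟨h1, h2, h3⟩ := tendsto_I_mul_neg hre him
  have h4 := tendsto_log_nhdsWithin_im_nonneg_of_re_neg_of_im_zero h1 h2
  have h5 : Tendsto (fun w => I * w) (𝓝[{w | 0 < w.re}] z) (𝓝[{w | 0 ≤ w.im}] (I * z)) := by
    exact (by fun_prop : ContinuousWithinAt _ _ _).tendsto_nhdsWithin
      fun w hw => by simpa using le_of_lt hw
  have h6 := ((h4.comp h5).sub_const ((Real.pi / 2 : ℂ) * I)).div_const (2 * Real.pi * I)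
  rw [h3] at h6
  convert h6 using 2
  · rfl
  · rw [lcLeft, div_add_one two_pi_I_ne_zero]; ring

/-! ### The local structure of solutions of the Riemann–Hilbert problem -/

/-- The plane cut along the closed half-lines that start at the points `c j`. -/
def cutC {ι : Type*} (c : ι → ℂ) : Set ℂ := {z | ∀ j, z ≠ c j ∧ z ∉ ray (c j)}

/-- `U` is holomorphic with invertible values off the cuts, and satisfies the jump conditions on
them. -/
structure RHJump {ι : Type*} (c : ι → ℂ) (H : ι → ℂ → 𝔸) (U : ℂ → 𝔸) : Prop where
  holo : DifferentiableOn ℂ U (cutC c)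
  unit : ∀ z ∈ cutC c, IsUnit (U z)
  jump : ∀ j, ∀ z ∈ ray (c j), ∃ A B : 𝔸,
    Tendsto U (𝓝[{w | z.re < w.re}] z) (𝓝 A) ∧ Tendsto U (𝓝[{w | w.re < z.re}] z) (𝓝 B) ∧
      IsUnit A ∧ IsUnit B ∧ A = B * H j z

/-- `U` solves the Riemann–Hilbert problem with the end points `c j`. -/
structure RHSol {ι : Type*} (c : ι → ℂ) (H L : ι → ℂ → 𝔸) (U : ℂ → 𝔸) : Prop
    extends RHJump c H U where
  tendsto_one : Tendsto U (Bornology.cobounded ℂ ⊓ 𝓟 (cutC c)) (𝓝 1)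
  endpoint : ∀ j, ∃ K : 𝔸, IsUnit K ∧
    Tendsto (fun z => U z * ex (-(lc (z - c j))) (L j z)) (𝓝[cutC c] (c j)) (𝓝 K)

variable {ι : Type*} {c : ι → ℂ} {H L : ι → ℂ → 𝔸} {U : ℂ → 𝔸}

theorem mem_cutC_iff {z : ℂ} : z ∈ cutC c ↔ ∀ j, z.re ≠ (c j).re ∨ z.im < (c j).im := by
  refine forall_congr' fun j => ?_
  constructor
  · rintro ⟨h1, h2⟩
    by_contra! h
    rcases h.2.eq_or_lt with h3 | h3
    · exact h1 (Complex.ext h.1 h3.symm)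
    · exact h2 ⟨h.1, h3⟩
  · exact fun h => ⟨by rintro rfl; simp at h, fun h' => h.elim (· h'.1) (lt_asymm h'.2)⟩

theorem notMem_cutC_iff {z : ℂ} : z ∉ cutC c ↔ ∃ j, z.re = (c j).re ∧ (c j).im ≤ z.im := by
  rw [mem_cutC_iff]
  push Not
  rfl

theorem isOpen_cutC [Finite ι] (c : ι → ℂ) : IsOpen (cutC c) := by
  have : cutC c = ⋂ j, ({z | z.re ≠ (c j).re} ∪ {z | z.im < (c j).im}) := by
    ext z
    simp [mem_cutC_iff]
  rw [this]
  refine isOpen_iInter_of_finite fun j => IsOpen.union ?_ ?_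
  · exact isOpen_ne_fun (by fun_prop) continuous_const
  · exact isOpen_lt (by fun_prop) continuous_const

theorem cutC_dense [Finite ι] (c : ι → ℂ) (z : ℂ) : z ∈ closure (cutC c) := by
  have hfin : (range fun j => (c j).re - z.re).Finite := finite_range _
  have h1 : ∀ᶠ t : ℝ in 𝓝[>] 0, t ∉ (range fun j => (c j).re - z.re) \ {0} := by
    refine nhdsWithin_le_nhds ?_
    exact (hfin.subset sdiff_subset).isClosed.isOpen_compl.mem_nhds (by simp)
  have h2 : Tendsto (fun t : ℝ => z + t) (𝓝[>] 0) (𝓝 z) := by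
    exact ((by fun_prop : Continuous fun t : ℝ => z + t).tendsto' 0 z (by simp)).mono_left
      nhdsWithin_le_nhds
  refine mem_closure_of_tendsto h2 ?_
  filter_upwards [h1, self_mem_nhdsWithin] with t ht ht0
  refine mem_cutC_iff.2 fun j => Or.inl fun he => ht ⟨⟨j, ?_⟩, ne_of_gt ht0⟩
  simp at he ⊢
  linarith

instance [Finite ι] (z : ℂ) : (𝓝[cutC c] z).NeBot := mem_closure_iff_nhdsWithin_neBot.1 (cutC_dense c z)

/-- The factor `Φ` in `U = Φ · (z - c j) ^ (L j / (2πi))`, extended by continuity to the cuts. -/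
noncomputable def regPart (c : ι → ℂ) (L : ι → ℂ → 𝔸) (U : ℂ → 𝔸) (j : ι) : ℂ → 𝔸 :=
  extendFrom (cutC c) fun z => U z * ex (-(lc (z - c j))) (L j z)

/-- `S` is a neighbourhood in which the cut `j` is the only one, and `L j` is a logarithm of the
jump `H j` there. -/
structure CutNhd (c : ι → ℂ) (H L : ι → ℂ → 𝔸) (j : ι) (S : Set ℂ) : Prop where
  isOpen : IsOpen S
  only : ∀ z ∈ S, ∀ i, i ≠ j → z.re ≠ (c i).re ∨ z.im < (c i).im
  log_holo : DifferentiableOn ℂ (L j) S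
  exp_log : ∀ z ∈ S, z ∈ ray (c j) → ex 1 (L j z) = H j z

variable [Finite ι]

theorem CutNhd.mem_cutC {j : ι} {S : Set ℂ} (hS : CutNhd c H L j S) {z : ℂ} (hz : z ∈ S)
    (h : z.re ≠ (c j).re ∨ z.im < (c j).im) : z ∈ cutC c := by
  rw [mem_cutC_iff]
  intro i
  by_cases hi : i = j
  · subst hi; exact h
  · exact hS.only z hz i hi

theorem lc_sub_ne {z : ℂ} {j : ι} (h : z ∈ cutC c) : (z - c j).re ≠ 0 ∨ (z - c j).im < 0 := by
  have := mem_cutC_iff.1 h j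
  rw [sub_re, sub_im]
  exact this.imp sub_ne_zero.2 sub_neg.2

theorem differentiableOn_lc_cut (j : ι) : DifferentiableOn ℂ (fun z => lc (z - c j)) (cutC c) :=
  fun z hz => ((hasDerivAt_lc (lc_sub_ne hz)).comp_sub_const z
    (c j)).differentiableAt.differentiableWithinAt

theorem CutNhd.differentiableAt_reg {j : ι} {S : Set ℂ} (hS : CutNhd c H L j S)
    (hU : RHJump c H U) {z : ℂ} (hz : z ∈ S) (hzc : z ∈ cutC c) :
    DifferentiableAt ℂ (fun z => U z * ex (-(lc (z - c j))) (L j z)) z := by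
  have hO : S ∩ cutC c ∈ 𝓝 z := (hS.isOpen.inter (isOpen_cutC c)).mem_nhds ⟨hz, hzc⟩
  refine DifferentiableOn.differentiableAt (s := S ∩ cutC c) ?_ hO
  exact (hU.holo.mono inter_subset_right).mul (DifferentiableOn.ex
    ((differentiableOn_lc_cut j).mono inter_subset_right).neg (hS.log_holo.mono inter_subset_left))

theorem nhdsWithin_cutC_le {j : ι} {z : ℂ} (hz : z ∈ ray (c j)) :
    𝓝[cutC c] z ≤ 𝓝[{w | z.re < w.re}] z ⊔ 𝓝[{w | w.re < z.re}] z := by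
  rw [← nhdsWithin_union]
  have hO : {w : ℂ | (c j).im < w.im} ∈ 𝓝 z :=
    (isOpen_lt continuous_const (by fun_prop)).mem_nhds hz.2
  rw [← nhdsWithin_inter_of_mem' (nhdsWithin_le_nhds hO)]
  refine nhdsWithin_mono _ ?_
  rintro w ⟨hw1, hw2⟩
  have hw3 : (c j).im < w.im := hw2
  rcases (mem_cutC_iff.1 hw1 j) with h | h
  · rw [← hz.1] at h
    exact (lt_or_gt_of_ne h).symm
  · exact absurd hw3 (not_lt.2 h.le)

/-- The local factor continues across the cut: the power has the same jump `H j` as `U`. -/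
theorem CutNhd.exists_tendsto_of_ne {j : ι} {S : Set ℂ} (hS : CutNhd c H L j S)
    (hU : RHJump c H U) {z : ℂ} (hz : z ∈ S) (hzj : z ≠ c j) : ∃ K : 𝔸, IsUnit K ∧
      Tendsto (fun z => U z * ex (-(lc (z - c j))) (L j z)) (𝓝[cutC c] z) (𝓝 K) := by
  by_cases hzc : z ∈ cutC c
  · exact ⟨_, (hU.unit z hzc).mul (isUnit_ex _ _),
      (hS.differentiableAt_reg hU hz hzc).continuousAt.continuousWithinAt⟩
  have hray : z ∈ ray (c j) := by
    obtain ⟨i, hi1, hi2⟩ := notMem_cutC_iff.1 hzc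
    have hij : i = j := by
      by_contra hne
      rcases hS.only z hz i hne with h | h
      · exact h hi1
      · exact absurd hi2 (not_le.2 h)
    subst hij
    refine ⟨hi1, lt_of_le_of_ne hi2 fun h => hzj (Complex.ext hi1 h.symm)⟩
  obtain ⟨A, B, hA, hB, uA, uB, hAB⟩ := hU.jump j z hray
  have hre : (z - c j).re = 0 := by simp [hray.1]
  have him : 0 < (z - c j).im := by simpa using hray.2
  have hL : Tendsto (L j) (𝓝 z) (𝓝 (L j z)) :=
    ((hS.log_holo.differentiableAt (hS.isOpen.mem_nhds hz)).continuousAt)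
  have hsub : Tendsto (fun w => w - c j) (𝓝 z) (𝓝 (z - c j)) :=
    (continuous_id.sub continuous_const).tendsto z
  have hl : Tendsto (fun w => lc (w - c j)) (𝓝[{w | w.re < z.re}] z) (𝓝 (lcLeft (z - c j))) := by
    refine (tendsto_lc_left hre him).comp (tendsto_nhdsWithin_iff.2
      ⟨hsub.mono_left nhdsWithin_le_nhds, ?_⟩)
    filter_upwards [self_mem_nhdsWithin] with w hw
    simpa [hray.1] using hw
  have hr : Tendsto (fun w => lc (w - c j)) (𝓝[{w | z.re < w.re}] z)
      (𝓝 (lcLeft (z - c j) + 1)) := by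
    refine (tendsto_lc_right hre him).comp (tendsto_nhdsWithin_iff.2
      ⟨hsub.mono_left nhdsWithin_le_nhds, ?_⟩)
    filter_upwards [self_mem_nhdsWithin] with w hw
    simpa [hray.1] using hw
  have tl := hB.mul (tendsto_ex hl.neg (hL.mono_left nhdsWithin_le_nhds))
  have tr := hA.mul (tendsto_ex hr.neg (hL.mono_left nhdsWithin_le_nhds))
  have e : A * ex (-(lcLeft (z - c j) + 1)) (L j z) = B * ex (-(lcLeft (z - c j))) (L j z) := by
    rw [hAB, ← hS.exp_log z hz hray, mul_assoc, ← ex_add]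
    congr 2
    ring
  rw [e] at tr
  exact ⟨_, uB.mul (isUnit_ex _ _), (tr.sup tl).mono_left (nhdsWithin_cutC_le hray)⟩

theorem CutNhd.exists_tendsto {j : ι} {S : Set ℂ} (hS : CutNhd c H L j S)
    (hU : RHSol c H L U) {z : ℂ} (hz : z ∈ S) : ∃ K : 𝔸, IsUnit K ∧
      Tendsto (fun z => U z * ex (-(lc (z - c j))) (L j z)) (𝓝[cutC c] z) (𝓝 K) := by
  by_cases hzj : z = c j
  · obtain ⟨K, hK, h⟩ := hU.endpoint j
    exact ⟨K, hK, by rw [hzj]; exact h⟩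
  · exact hS.exists_tendsto_of_ne hU.toRHJump hz hzj

section
variable {j : ι} {S : Set ℂ} (hS : CutNhd c H L j S) (hU : RHJump c H U)
include hS hU

theorem CutNhd.regPart_eq {z : ℂ} (hz : z ∈ S) (hzc : z ∈ cutC c) :
    regPart c L U j z = U z * ex (-(lc (z - c j))) (L j z) :=
  extendFrom_eq (cutC_dense c z) (hS.differentiableAt_reg hU hz hzc).continuousAt.continuousWithinAt

theorem CutNhd.eq_regPart_mul {z : ℂ} (hz : z ∈ S) (hzc : z ∈ cutC c) :
    U z = regPart c L U j z * ex (lc (z - c j)) (L j z) := by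
  rw [hS.regPart_eq hU hz hzc, mul_assoc, ex_neg_mul_ex, mul_one]

theorem CutNhd.differentiableOn_regPart_of {T : Set ℂ} (hT : IsOpen T) (hTS : T ⊆ S)
    (h : ∀ z ∈ T, ∃ K : 𝔸, Tendsto (fun z => U z * ex (-(lc (z - c j))) (L j z)) (𝓝[cutC c] z)
      (𝓝 K)) : DifferentiableOn ℂ (regPart c L U j) T := by
  refine differentiableOn_of_continuousOn_off_line hT (c j).re ?_ ?_
  · exact continuousOn_extendFrom (fun z _ => cutC_dense c z) h
  · intro z hz hre
    have hzc := hS.mem_cutC (hTS hz) (Or.inl hre)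
    refine (hS.differentiableAt_reg hU (hTS hz) hzc).congr_of_eventuallyEq ?_
    filter_upwards [(hS.isOpen.inter (isOpen_cutC c)).mem_nhds ⟨hTS hz, hzc⟩] with w hw
    exact hS.regPart_eq hU hw.1 hw.2

theorem CutNhd.isUnit_regPart_of_ne {z : ℂ} (hz : z ∈ S) (hzj : z ≠ c j) :
    IsUnit (regPart c L U j z) := by
  obtain ⟨K, hK, h⟩ := hS.exists_tendsto_of_ne hU hz hzj
  rwa [regPart, extendFrom_eq (cutC_dense c z) h]

theorem CutNhd.differentiableOn_regPart_of_ne :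
    DifferentiableOn ℂ (regPart c L U j) (S \ {c j}) :=
  hS.differentiableOn_regPart_of hU (hS.isOpen.sdiff isClosed_singleton) sdiff_subset
    fun _ hz => let ⟨K, _, h⟩ := hS.exists_tendsto_of_ne hU hz.1 hz.2; ⟨K, h⟩

end

section
variable {j : ι} {S : Set ℂ} (hS : CutNhd c H L j S) (hU : RHSol c H L U)
include hS hU

theorem CutNhd.isUnit_regPart {z : ℂ} (hz : z ∈ S) : IsUnit (regPart c L U j z) := by
  obtain ⟨K, hK, h⟩ := hS.exists_tendsto hU hz
  rwa [regPart, extendFrom_eq (cutC_dense c z) h]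

theorem CutNhd.differentiableOn_regPart : DifferentiableOn ℂ (regPart c L U j) S :=
  hS.differentiableOn_regPart_of hU.toRHJump hS.isOpen Subset.rfl
    fun _ hz => let ⟨K, _, h⟩ := hS.exists_tendsto hU hz; ⟨K, h⟩

end

theorem mul_inverse_eq_mul_inverse {a b x y g : 𝔸} (hg : IsUnit g) (hb : IsUnit b)
    (hx : x = a * g) (hy : y = b * g) : x * Ring.inverse y = a * Ring.inverse b := by
  obtain ⟨g, rfl⟩ := hg
  obtain ⟨b, rfl⟩ := hb
  rw [hx, hy, ← Units.val_mul, Ring.inverse_unit, Ring.inverse_unit, mul_inv_rev, Units.val_mul]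
  rw [mul_assoc, ← mul_assoc (g : 𝔸), Units.mul_inv, one_mul]

theorem continuousAt_ringInverse {x : 𝔸} (hx : IsUnit x) : ContinuousAt Ring.inverse x := by
  obtain ⟨u, rfl⟩ := hx
  exact NormedRing.inverse_continuousAt u

/-- The Riemann–Hilbert problem has at most one solution: the quotient of two solutions extends to
an entire function. -/
theorem RHSol.unique {V : ℂ → 𝔸} {S : ι → Set ℂ} (hS : ∀ j, CutNhd c H L j (S j))
    (hcov : ∀ j z, z.re = (c j).re → (c j).im ≤ z.im → z ∈ S j)
    (hU : RHSol c H L U) (hV : RHSol c H L V) {z : ℂ} (hz : z ∈ cutC c) : U z = V z := by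
  set Q : ℂ → 𝔸 := fun z => U z * Ring.inverse (V z) with hQ
  have hQc : DifferentiableOn ℂ Q (cutC c) := hU.holo.mul (hV.holo.inverse hV.unit)
  have hQS : ∀ j, ∀ z ∈ S j, z ∈ cutC c →
      Q z = regPart c L U j z * Ring.inverse (regPart c L V j z) := fun j z hz hzc =>
    mul_inverse_eq_mul_inverse (isUnit_ex (lc (z - c j)) (L j z)) ((hS j).isUnit_regPart hV hz)
      ((hS j).eq_regPart_mul hU.toRHJump hz hzc)
      ((hS j).eq_regPart_mul hV.toRHJump hz hzc)
  have hP : ∀ j, DifferentiableOn ℂ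
      (fun z => regPart c L U j z * Ring.inverse (regPart c L V j z)) (S j) := fun j =>
    ((hS j).differentiableOn_regPart hU).mul (((hS j).differentiableOn_regPart hV).inverse
      fun z hz => (hS j).isUnit_regPart hV hz)
  -- near every point, `Q` extends holomorphically across the cuts
  have key : ∀ z, ∃ P : ℂ → 𝔸, ∃ O, IsOpen O ∧ z ∈ O ∧ DifferentiableOn ℂ P O ∧
      ∀ w ∈ O, w ∈ cutC c → Q w = P w := by
    intro z
    by_cases hzc : z ∈ cutC c
    · exact ⟨Q, _, isOpen_cutC c, hzc, hQc, fun _ _ _ => rfl⟩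
    · obtain ⟨j, h1, h2⟩ := notMem_cutC_iff.1 hzc
      exact ⟨_, S j, (hS j).isOpen, hcov j z h1 h2, hP j, hQS j⟩
  choose P O hO hzO hPO hQP using key
  set G : ℂ → 𝔸 := extendFrom (cutC c) Q with hG
  have hlim : ∀ z, ∀ w ∈ O z, Tendsto Q (𝓝[cutC c] w) (𝓝 (P z w)) := fun z w hw => by
    have hw' := (hO z).mem_nhds hw
    refine (((hPO z).continuousOn.continuousAt hw').tendsto.mono_left nhdsWithin_le_nhds).congr' ?_
    filter_upwards [self_mem_nhdsWithin, nhdsWithin_le_nhds hw'] with u h1 h2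
    exact (hQP z u h2 h1).symm
  have hGP : ∀ z, ∀ w ∈ O z, G w = P z w := fun z w hw =>
    extendFrom_eq (cutC_dense c w) (hlim z w hw)
  have hlimG : ∀ z, Tendsto Q (𝓝[cutC c] z) (𝓝 (G z)) := fun z => by
    rw [hGP z z (hzO z)]; exact hlim z z (hzO z)
  have hGd : Differentiable ℂ G := fun z => by
    have hz := (hO z).mem_nhds (hzO z)
    exact ((hPO z).differentiableAt hz).congr_of_eventuallyEq (by
      filter_upwards [hz] with w hw using hGP z w hw)
  have hQ1 : Tendsto Q (Bornology.cobounded ℂ ⊓ 𝓟 (cutC c)) (𝓝 1) := by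
    have h1 : Tendsto (fun z => Ring.inverse (V z)) (Bornology.cobounded ℂ ⊓ 𝓟 (cutC c)) (𝓝 1) := by
      have := (continuousAt_ringInverse (isUnit_one (M := 𝔸))).tendsto.comp hV.tendsto_one
      rwa [Ring.inverse_one] at this
    simpa using hU.tendsto_one.mul h1
  have hG1 : Tendsto G (cocompact ℂ) (𝓝 1) := by
    rw [← Metric.cobounded_eq_cocompact]
    rw [Metric.tendsto_nhds]
    intro e he
    have h1 := (Metric.tendsto_nhds.1 hQ1) (e / 2) (by positivity)
    rw [eventually_inf_principal] at h1
    obtain ⟨R, -, hR⟩ := (Filter.hasBasis_cobounded_norm (E := ℂ)).eventually_iff.1 h1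
    refine (Filter.hasBasis_cobounded_norm (E := ℂ)).eventually_iff.2 ⟨R + 1, trivial, fun z hz => ?_⟩
    have hz' : R + 1 ≤ ‖z‖ := hz
    have hle : dist (G z) 1 ≤ e / 2 := by
      refine le_of_tendsto ((hlimG z).dist tendsto_const_nhds) ?_
      have hO : {w : ℂ | R < ‖w‖} ∈ 𝓝 z :=
        (isOpen_lt continuous_const continuous_norm).mem_nhds (by simp only [mem_ofPred_eq]; linarith)
      filter_upwards [self_mem_nhdsWithin, nhdsWithin_le_nhds hO] with w hw hw2
      exact (hR (le_of_lt hw2) hw).le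
    linarith
  have hfin : G z = 1 := hGd.apply_eq_of_tendsto_cocompact z hG1
  rw [hGP z z (hzO z), ← hQP z z (hzO z) hz, hQ] at hfin
  obtain ⟨v, hv⟩ := hV.unit z hz
  simp only [← hv, Ring.inverse_unit] at hfin ⊢
  exact (Units.mul_inv_eq_one (u := v)).1 hfin

end

section

/-! ### Small linear integral equations depending analytically on a parameter -/

section Neumann

variable {J : Type*} [Fintype J] (T : J → Set ℝ) (k : J → ℝ → J → ℝ → ℂ) (θ : J → ℂ)

/-- An integral operator with scalar kernel `k`, composed with right multiplication by `m`, plus a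
local term. -/
noncomputable def intOp (m w : J → ℝ → 𝔸) (i : J) (t : ℝ) : 𝔸 :=
  (∑ j, ∫ y in T j, k i t j y • (w j y * m j y)) + θ i • (w i t * m i t)

/-- The hypotheses on kernel and coefficient that make `intOp` bounded with norm at most `η`. -/
structure SmallOp (m : J → ℝ → 𝔸) (ρ : J → ℝ → ℝ) (η : ℝ) : Prop where
  meas_dom : ∀ j, MeasurableSet (T j)
  meas_ker : ∀ i j, Measurable fun x : ℝ × ℝ => k i x.1 j x.2
  meas_coef : ∀ j, AEStronglyMeasurable (m j) (volume.restrict (T j))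
  coef_le : ∀ j, ∀ y ∈ T j, ‖m j y‖ ≤ ρ j y
  integrable : ∀ i, ∀ t ∈ T i, ∀ j, IntegrableOn (fun y => ‖k i t j y‖ * ρ j y) (T j)
  small : ∀ i, ∀ t ∈ T i, (∑ j, ∫ y in T j, ‖k i t j y‖ * ρ j y) + ‖θ i‖ * ρ i t ≤ η

variable {T k θ} {m : J → ℝ → 𝔸} {ρ : J → ℝ → ℝ} {η : ℝ}

/-- Measurable families that are bounded by `B` on the domains. -/
def BddFam (T : J → Set ℝ) (w : J → ℝ → 𝔸) (B : ℝ) : Prop :=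
  (∀ j, AEStronglyMeasurable (w j) (volume.restrict (T j))) ∧ ∀ j, ∀ y ∈ T j, ‖w j y‖ ≤ B

theorem BddFam.nonneg {w : J → ℝ → 𝔸} {B : ℝ} (hw : BddFam T w B) {i : J} {t : ℝ}
    (ht : t ∈ T i) : 0 ≤ B := (norm_nonneg _).trans (hw.2 i t ht)

theorem SmallOp.integrand_le (h : SmallOp T k θ m ρ η) {w : J → ℝ → 𝔸} {B : ℝ}
    (hw : BddFam T w B) (a : ℂ) {j : J} {y : ℝ} (hy : y ∈ T j) :
    ‖a • (w j y * m j y)‖ ≤ B * (‖a‖ * ρ j y) := by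
  rw [norm_smul, mul_left_comm]
  exact mul_le_mul_of_nonneg_left (norm_mul_le_of_le (hw.2 j y hy) (h.coef_le j y hy))
    (norm_nonneg _)

theorem SmallOp.integrableOn (h : SmallOp T k θ m ρ η) {w : J → ℝ → 𝔸} {B : ℝ}
    (hw : BddFam T w B) {i : J} {t : ℝ} (ht : t ∈ T i) (j : J) :
    IntegrableOn (fun y => k i t j y • (w j y * m j y)) (T j) := by
  refine Integrable.mono' ((h.integrable i t ht j).const_mul B) ?_ ?_
  · refine AEStronglyMeasurable.smul ?_ ((hw.1 j).mul (h.meas_coef j))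
    exact ((h.meas_ker i j).comp measurable_prodMk_left).aestronglyMeasurable
  · exact ae_restrict_of_forall_mem (h.meas_dom j) fun y hy => h.integrand_le hw _ hy

theorem SmallOp.norm_intOp_le (h : SmallOp T k θ m ρ η) {w : J → ℝ → 𝔸} {B : ℝ}
    (hw : BddFam T w B) {i : J} {t : ℝ} (ht : t ∈ T i) : ‖intOp T k θ m w i t‖ ≤ B * η := by
  have hB := hw.nonneg ht
  have h1 : ∀ j, ‖∫ y in T j, k i t j y • (w j y * m j y)‖ ≤ B * ∫ y in T j, ‖k i t j y‖ * ρ j y := by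
    intro j
    rw [← integral_const_mul]
    exact norm_integral_le_of_norm_le ((h.integrable i t ht j).const_mul B)
      (ae_restrict_of_forall_mem (h.meas_dom j) fun y hy => h.integrand_le hw _ hy)
  calc _ ≤ (∑ j, B * ∫ y in T j, ‖k i t j y‖ * ρ j y) + B * (‖θ i‖ * ρ i t) :=
        (norm_add_le _ _).trans (add_le_add ((norm_sum_le _ _).trans
          (Finset.sum_le_sum fun j _ => h1 j)) (h.integrand_le hw _ ht))
    _ = B * ((∑ j, ∫ y in T j, ‖k i t j y‖ * ρ j y) + ‖θ i‖ * ρ i t) := by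
        rw [← Finset.mul_sum]; ring
    _ ≤ B * η := mul_le_mul_of_nonneg_left (h.small i t ht) hB

theorem SmallOp.intOp_sub (h : SmallOp T k θ m ρ η) {w w' : J → ℝ → 𝔸} {B B' : ℝ}
    (hw : BddFam T w B) (hw' : BddFam T w' B') {i : J} {t : ℝ} (ht : t ∈ T i) :
    intOp T k θ m (fun j y => w j y - w' j y) i t =
      intOp T k θ m w i t - intOp T k θ m w' i t := by
  simp only [intOp, sub_mul, smul_sub]
  have : ∀ j, ∫ y in T j, (k i t j y • (w j y * m j y) - k i t j y • (w' j y * m j y)) =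
      (∫ y in T j, k i t j y • (w j y * m j y)) - ∫ y in T j, k i t j y • (w' j y * m j y) :=
    fun j => integral_sub (h.integrableOn hw ht j) (h.integrableOn hw' ht j)
  simp only [this, Finset.sum_sub_distrib]
  abel

theorem SmallOp.bddFam_intOp (h : SmallOp T k θ m ρ η) {w : J → ℝ → 𝔸} {B : ℝ}
    (hw : BddFam T w B) : BddFam T (intOp T k θ m w) (B * η) := by
  refine ⟨fun i => ?_, fun i t ht => h.norm_intOp_le hw ht⟩
  refine AEStronglyMeasurable.add ?_ (((hw.1 i).mul (h.meas_coef i)).const_smul _)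
  refine Finset.aestronglyMeasurable_fun_sum _ fun j _ => ?_
  refine AEStronglyMeasurable.integral_prod_right' (f := fun x : ℝ × ℝ =>
    k i x.1 j x.2 • (w j x.2 * m j x.2)) ?_
  exact (h.meas_ker i j).aestronglyMeasurable.smul ((hw.1 j).mul (h.meas_coef j)).comp_snd

variable (T k θ) in
/-- The terms of the Neumann series for `w = 1 - intOp m w`. -/
noncomputable def neumannTerm (m : J → ℝ → 𝔸) : ℕ → J → ℝ → 𝔸
  | 0 => fun _ _ => 1
  | n + 1 => fun i t => -intOp T k θ m (neumannTerm m n) i t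

theorem BddFam.neg {w : J → ℝ → 𝔸} {B : ℝ} (hw : BddFam T w B) :
    BddFam T (fun i t => -w i t) B :=
  ⟨fun j => (hw.1 j).neg, fun j y hy => by rw [norm_neg]; exact hw.2 j y hy⟩

theorem SmallOp.bddFam_neumannTerm (h : SmallOp T k θ m ρ η) (n : ℕ) :
    BddFam T (neumannTerm T k θ m n) (‖(1 : 𝔸)‖ * η ^ n) := by
  induction n with
  | zero => exact ⟨fun j => aestronglyMeasurable_const, fun j y _ => by simp [neumannTerm]⟩
  | succ n ih =>
    rw [pow_succ, ← mul_assoc]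
    exact (h.bddFam_intOp ih).neg

theorem SmallOp.summable_neumannTerm (h : SmallOp T k θ m ρ η) (h0 : 0 ≤ η) (h1 : η < 1)
    {i : J} {t : ℝ} (ht : t ∈ T i) : Summable fun n => neumannTerm T k θ m n i t :=
  Summable.of_norm_bounded ((summable_geometric_of_lt_one h0 h1).mul_left ‖(1 : 𝔸)‖)
    fun n => (h.bddFam_neumannTerm n).2 i t ht

/-- Any bounded solution of `w = 1 - intOp m w` is the sum of the Neumann series. -/
theorem SmallOp.hasSum_neumannTerm (h : SmallOp T k θ m ρ η) (h0 : 0 ≤ η) (h1 : η < 1)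
    {w : J → ℝ → 𝔸} {B : ℝ} (hw : BddFam T w B)
    (heq : ∀ i, ∀ t ∈ T i, w i t = 1 - intOp T k θ m w i t) {i : J} {t : ℝ} (ht : t ∈ T i) :
    HasSum (fun n => neumannTerm T k θ m n i t) (w i t) := by
  have key : ∀ n, ∃ r : J → ℝ → 𝔸, BddFam T r (B * η ^ n) ∧ ∀ i, ∀ t ∈ T i,
      w i t = (∑ l ∈ Finset.range n, neumannTerm T k θ m l i t) + r i t ∧
      r i t = neumannTerm T k θ m n i t - intOp T k θ m r i t := by
    intro n
    induction n with
    | zero => exact ⟨w, by simpa using hw, fun i t ht => ⟨by simp, heq i t ht⟩⟩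
    | succ n ih =>
      obtain ⟨r, hr, hrw⟩ := ih
      refine ⟨fun i t => -intOp T k θ m r i t, ?_, fun i t ht => ⟨?_, ?_⟩⟩
      · rw [pow_succ, ← mul_assoc]
        exact (h.bddFam_intOp hr).neg
      · rw [Finset.sum_range_succ, add_assoc]
        exact (hrw i t ht).1.trans (congrArg _ ((hrw i t ht).2.trans (sub_eq_add_neg _ _)))
      · have e : intOp T k θ m r i t = intOp T k θ m (neumannTerm T k θ m n) i t -
            intOp T k θ m (intOp T k θ m r) i t := by
          rw [← h.intOp_sub (h.bddFam_neumannTerm n) (h.bddFam_intOp hr) ht]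
          have : ∀ j, ∀ y ∈ T j, r j y = neumannTerm T k θ m n j y - intOp T k θ m r j y :=
            fun j y hy => (hrw j y hy).2
          simp only [intOp]
          congr 1
          · refine Finset.sum_congr rfl fun j _ => ?_
            refine setIntegral_congr_fun (h.meas_dom j) fun y hy => ?_
            exact congrArg (fun u => k i t j y • (u * m j y)) (this j y hy)
          · exact congrArg (fun u => θ i • (u * m i t)) (this i t ht)
        have e2 : intOp T k θ m (fun i t => -intOp T k θ m r i t) i t =
            -intOp T k θ m (intOp T k θ m r) i t := by
          simp only [intOp, neg_mul, smul_neg, integral_neg, Finset.sum_neg_distrib]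
          abel
        rw [e2, neumannTerm]
        exact (congrArg Neg.neg e).trans (by rw [neg_sub, sub_neg_eq_add, neg_add_eq_sub])
  have hs := h.summable_neumannTerm h0 h1 ht
  have hlim := hs.hasSum.tendsto_sum_nat
  have hlim2 : Tendsto (fun n => ∑ l ∈ Finset.range n, neumannTerm T k θ m l i t) atTop
      (𝓝 (w i t)) := by
    rw [tendsto_iff_norm_sub_tendsto_zero]
    refine squeeze_zero (fun _ => norm_nonneg _) (fun n => ?_)
      (by simpa using (tendsto_pow_atTop_nhds_zero_of_lt_one h0 h1).const_mul B)
    obtain ⟨r, hr, hrw⟩ := key n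
    rw [norm_sub_rev, (hrw i t ht).1, add_sub_cancel_left]
    exact hr.2 i t ht
  rw [← tendsto_nhds_unique hlim hlim2]
  exact hs.hasSum

/-- The sum of the Neumann series depends analytically on parameters. -/
theorem differentiableOn_tsum_neumannTerm {O : Set ℂ} (hO : IsOpen O) {m : ℂ → J → ℝ → 𝔸}
    (h : ∀ b ∈ O, SmallOp T k θ (m b) ρ η) (h0 : 0 ≤ η) (h1 : η < 1)
    (hm : ∀ j, ∀ y ∈ T j, DifferentiableOn ℂ (fun b => m b j y) O) {i : J} {t : ℝ} (ht : t ∈ T i) :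
    DifferentiableOn ℂ (fun b => ∑' n, neumannTerm T k θ (m b) n i t) O := by
  have hn : ∀ n i, ∀ t ∈ T i, DifferentiableOn ℂ (fun b => neumannTerm T k θ (m b) n i t) O := by
    intro n
    induction n with
    | zero => exact fun i t _ => differentiableOn_const _
    | succ n ih =>
      intro i t ht
      simp only [neumannTerm, intOp]
      refine DifferentiableOn.neg (DifferentiableOn.add (DifferentiableOn.fun_sum fun j _ => ?_)
        (((ih i t ht).fun_mul (hm i t ht)).fun_const_smul _))
      refine differentiableOn_integral_param hO ?_ ?_ ?_
      · rcases O.eq_empty_or_nonempty with rfl | ⟨b, hb⟩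
        · exact Eventually.of_forall fun _ => differentiableOn_empty
        · exact ae_restrict_of_forall_mem ((h b hb).meas_dom j) fun y hy =>
            ((ih j y hy).fun_mul (hm j y hy)).fun_const_smul _
      · exact fun b hb => ((h b hb).integrableOn ((h b hb).bddFam_neumannTerm n) ht
          j).aestronglyMeasurable
      · intro b₀ hb₀
        refine ⟨1, one_pos, _, ((h b₀ hb₀).integrable i t ht j).const_mul (‖(1 : 𝔸)‖ * η ^ n), ?_⟩
        exact ae_restrict_of_forall_mem ((h b₀ hb₀).meas_dom j) fun y hy b hb =>
          (h b hb.2).integrand_le ((h b hb.2).bddFam_neumannTerm n) _ hy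
  exact differentiableOn_tsum_of_summable_norm
    ((summable_geometric_of_lt_one h0 h1).mul_left ‖(1 : 𝔸)‖) (fun n => hn n i t ht) hO
    fun n b hb => ((h b hb).bddFam_neumannTerm n).2 i t ht

end Neumann

/-! ### The integral equation on hairpins -/

section Hairpin

variable {ι : Type*} [Fintype ι]

/-- The half-widths of the two hairpins about each cut. -/
def lev (δ₁ δ₂ : ℝ) (l : Bool) : ℝ := if l then δ₂ else δ₁

theorem lev_mem_Icc {δ₁ δ₂ : ℝ} (h : δ₁ ≤ δ₂) (l : Bool) : lev δ₁ δ₂ l ∈ Icc δ₁ δ₂ := by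
  cases l <;> simp [lev, h]

/-- The points of the hairpins; `x` lists the cut, the hairpin and the side. -/
noncomputable def hpPt (c : ι → ℂ) (δ₁ δ₂ : ℝ) (x : ι × Bool × Fin 3) (y : ℝ) : ℂ :=
  c x.1 + boxPt (lev δ₁ δ₂ x.2.1) x.2.2 y

/-- The parameter domains of the sides. -/
def hpDom (δ₁ δ₂ : ℝ) (x : ι × Bool × Fin 3) : Set ℝ := boxDom (lev δ₁ δ₂ x.2.1) x.2.2

open Classical in
/-- The Cauchy kernel between hairpins of different levels. -/
noncomputable def hpKer (c : ι → ℂ) (δ₁ δ₂ : ℝ) (x : ι × Bool × Fin 3) (t : ℝ)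
    (x' : ι × Bool × Fin 3) (y : ℝ) : ℂ :=
  if x.2.1 = x'.2.1 then 0 else
    (2 * Real.pi * I)⁻¹ * boxCoef x'.2.2 * (hpPt c δ₁ δ₂ x' y - hpPt c δ₁ δ₂ x t)⁻¹

/-- The local term is present on the outer hairpins only. -/
def hpLoc (x : ι × Bool × Fin 3) : ℂ := if x.2.1 then 1 else 0

theorem continuous_hpPt (c : ι → ℂ) (δ₁ δ₂ : ℝ) (x : ι × Bool × Fin 3) :
    Continuous (hpPt c δ₁ δ₂ x) := continuous_const.add (continuous_boxPt _ _)

theorem measurable_hpKer (c : ι → ℂ) (δ₁ δ₂ : ℝ) (x x' : ι × Bool × Fin 3) :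
    Measurable fun u : ℝ × ℝ => hpKer c δ₁ δ₂ x u.1 x' u.2 := by
  unfold hpKer
  split_ifs
  · exact measurable_const
  · refine Measurable.const_mul (Measurable.inv ?_) _
    exact (((continuous_hpPt c δ₁ δ₂ x').comp continuous_snd).sub
      ((continuous_hpPt c δ₁ δ₂ x).comp continuous_fst)).measurable

theorem norm_hpKer_le (c : ι → ℂ) (δ₁ δ₂ : ℝ) (x x' : ι × Bool × Fin 3) (t y : ℝ) :
    ‖hpKer c δ₁ δ₂ x t x' y‖ ≤ ‖hpPt c δ₁ δ₂ x' y - hpPt c δ₁ δ₂ x t‖⁻¹ := by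
  unfold hpKer
  split_ifs
  · simp
  · rw [norm_mul, norm_mul, norm_boxCoef, mul_one, norm_inv]
    have := norm_two_pi_I_inv_le
    rw [norm_inv] at this
    rw [norm_inv]
    exact mul_le_of_le_one_left (by positivity) this

/-- Points of hairpins of different levels keep a fixed distance. -/
theorem hp_dist {c : ι → ℂ} {δ₁ δ₂ δ₃ : ℝ} (h1 : 0 ≤ δ₁) (h12 : δ₁ < δ₂) (h23 : δ₂ < δ₃)
    (hsep : ∀ i j, i ≠ j → 2 * δ₃ ≤ |(c i).re - (c j).re|) {x x' : ι × Bool × Fin 3}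
    (hl : x.2.1 ≠ x'.2.1) {t y : ℝ} (ht : t ∈ hpDom δ₁ δ₂ x) (hy : y ∈ hpDom δ₁ δ₂ x') :
    min (δ₂ - δ₁) (δ₃ - δ₂) ≤ ‖hpPt c δ₁ δ₂ x' y - hpPt c δ₁ δ₂ x t‖ := by
  have hlev := lev_mem_Icc h12.le
  have hsub : ∀ l, closedBox (lev δ₁ δ₂ l) ⊆ openBox δ₃ := fun l =>
    closedBox_subset_openBox ((hlev l).2.trans_lt h23)
  obtain ⟨i, l, s⟩ := x
  obtain ⟨j, l', s'⟩ := x'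
  have m1 : boxPt (lev δ₁ δ₂ l) s t ∈ closedBox (lev δ₁ δ₂ l) := boxPt_mem_closedBox (h1.trans (hlev l).1) ht
  have m2 : boxPt (lev δ₁ δ₂ l') s' y ∈ closedBox (lev δ₁ δ₂ l') :=
    boxPt_mem_closedBox (h1.trans (hlev l').1) hy
  by_cases hij : i = j
  · subst hij
    refine (min_le_left _ _).trans ?_
    have e : hpPt c δ₁ δ₂ (i, l', s') y - hpPt c δ₁ δ₂ (i, l, s) t =
      boxPt (lev δ₁ δ₂ l') s' y - boxPt (lev δ₁ δ₂ l) s t := by simp [hpPt]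
    rw [e]
    cases l <;> cases l'
    · simp at hl
    · exact dist_box_of_inside boxPt_notMem_openBox m1
    · rw [norm_sub_rev]
      exact dist_box_of_inside boxPt_notMem_openBox m2
    · simp at hl
  · refine (min_le_right _ _).trans ?_
    have e : hpPt c δ₁ δ₂ (j, l', s') y - hpPt c δ₁ δ₂ (i, l, s) t =
      boxPt (lev δ₁ δ₂ l') s' y - (c i + boxPt (lev δ₁ δ₂ l) s t - c j) := by simp [hpPt]; ring
    rw [e]
    have hout : c i + boxPt (lev δ₁ δ₂ l) s t - c j ∉ openBox δ₃ := by
      refine box_disjoint (hsep i j hij) ?_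
      simpa using hsub l m1
    have := dist_box_of_outside m2 hout
    linarith [(hlev l').2]

/-- A uniform bound for the integral operators on hairpins. -/
theorem exists_hp_bound (ι : Type*) [Fintype ι] {κ : ℝ} (hκ0 : 0 < κ) (hκ1 : κ ≤ 1) {δ₁ δ₂ δ₃ : ℝ}
    (h1 : 0 ≤ δ₁) (h12 : δ₁ < δ₂) (h23 : δ₂ < δ₃) : ∃ K₀ : ℝ, 0 < K₀ ∧
    ∀ (c : ι → ℂ), (∀ i j, i ≠ j → 2 * δ₃ ≤ |(c i).re - (c j).re|) →
    ∀ (m : ι × Bool × Fin 3 → ℝ → 𝔸) (η : ℝ), 0 ≤ η →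
      (∀ x, AEStronglyMeasurable (m x) (volume.restrict (hpDom δ₁ δ₂ x))) →
      (∀ x, ∀ y ∈ hpDom δ₁ δ₂ x, ‖m x y‖ ≤ η * wt κ y) →
      SmallOp (hpDom δ₁ δ₂) (hpKer c δ₁ δ₂) hpLoc m (fun _ y => η * wt κ y) (K₀ * η) := by
  have hd : 0 < min (δ₂ - δ₁) (δ₃ - δ₂) := lt_min (by linarith) (by linarith)
  obtain ⟨K, hK, H⟩ := exists_box_kernel_bound hκ0 hκ1 hd
  refine ⟨(∑ _x : ι × Bool × Fin 3, K) + 1, by positivity, fun c hsep m η hη hmm hm => ?_⟩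
  have hbound : ∀ (x : ι × Bool × Fin 3), ∀ t ∈ hpDom δ₁ δ₂ x, ∀ x' : ι × Bool × Fin 3,
      IntegrableOn (fun y => ‖hpKer c δ₁ δ₂ x t x' y‖ * (η * wt κ y)) (hpDom δ₁ δ₂ x') ∧
      ∫ y in hpDom δ₁ δ₂ x', ‖hpKer c δ₁ δ₂ x t x' y‖ * (η * wt κ y) ≤ K * η := by
    intro x t ht x'
    by_cases hl : x.2.1 = x'.2.1
    · have : ∀ y, hpKer c δ₁ δ₂ x t x' y = 0 := fun y => by simp [hpKer, hl]
      simp only [this, norm_zero, zero_mul, integral_zero]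
      exact ⟨integrableOn_zero, mul_nonneg hK hη⟩
    · have e : ∀ y, hpPt c δ₁ δ₂ x' y - hpPt c δ₁ δ₂ x t =
        boxPt (lev δ₁ δ₂ x'.2.1) x'.2.2 y - (hpPt c δ₁ δ₂ x t - c x'.1) := fun y => by
          simp only [hpPt]; ring
      obtain ⟨i1, i2⟩ := H (lev δ₁ δ₂ x'.2.1) x'.2.2 (hpPt c δ₁ δ₂ x t - c x'.1) fun y hy => by
        rw [← e]
        exact hp_dist h1 h12 h23 hsep hl ht hy
      have hmeas : MeasurableSet (hpDom δ₁ δ₂ x') := measurableSet_boxDom _ _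
      have hle : ∀ y, ‖hpKer c δ₁ δ₂ x t x' y‖ * (η * wt κ y) ≤
          η * (‖boxPt (lev δ₁ δ₂ x'.2.1) x'.2.2 y - (hpPt c δ₁ δ₂ x t - c x'.1)‖⁻¹ * wt κ y) := by
        intro y
        rw [← e]
        have h3 := mul_le_mul_of_nonneg_right (norm_hpKer_le c δ₁ δ₂ x x' t y)
          (mul_nonneg hη (wt_pos κ y).le)
        linarith
      have hi : IntegrableOn (fun y => ‖hpKer c δ₁ δ₂ x t x' y‖ * (η * wt κ y))
          (hpDom δ₁ δ₂ x') := by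
        refine Integrable.mono' (i1.const_mul η) ?_ (Eventually.of_forall fun y => ?_)
        · refine (Measurable.mul ?_ ((continuous_wt κ).measurable.const_mul _)).aestronglyMeasurable
          exact ((measurable_hpKer c δ₁ δ₂ x x').comp measurable_prodMk_left).norm
        · rw [Real.norm_of_nonneg (mul_nonneg (norm_nonneg _) (mul_nonneg hη (wt_pos _ _).le))]
          exact hle y
      refine ⟨hi, ?_⟩
      calc _ ≤ ∫ y in hpDom δ₁ δ₂ x', η * (‖boxPt (lev δ₁ δ₂ x'.2.1) x'.2.2 y -
            (hpPt c δ₁ δ₂ x t - c x'.1)‖⁻¹ * wt κ y) :=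
            setIntegral_mono_on hi (i1.const_mul η) hmeas fun y _ => hle y
        _ ≤ K * η := by
            rw [integral_const_mul, mul_comm]
            exact mul_le_mul_of_nonneg_right i2 hη
  refine ⟨fun x => measurableSet_boxDom _ _, measurable_hpKer c δ₁ δ₂, hmm, hm,
    fun x t ht x' => (hbound x t ht x').1, fun x t ht => ?_⟩
  rw [add_mul, one_mul, Finset.sum_mul]
  refine add_le_add (Finset.sum_le_sum fun x' _ => (hbound x t ht x').2) ?_
  have h3 : ‖hpLoc x‖ ≤ 1 := by
    unfold hpLoc
    split_ifs <;> simp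
  have h4 : η * wt κ t ≤ η := mul_le_of_le_one_right hη (wt_le_one hκ0.le t)
  calc _ ≤ 1 * (η * wt κ t) := mul_le_mul_of_nonneg_right h3 (mul_nonneg hη (wt_pos _ _).le)
    _ ≤ η := by linarith

/-- The integrals of the integral operator are Cauchy integrals over hairpins. -/
theorem sum_hpKer_eq {c : ι → ℂ} {δ₁ δ₂ : ℝ}
    (g : ι → ℂ → 𝔸) {w m : ι × Bool × Fin 3 → ℝ → 𝔸}
    (hg : ∀ x y, y ∈ hpDom δ₁ δ₂ x →
      w x y * m x y = g x.1 (boxPt (lev δ₁ δ₂ x.2.1) x.2.2 y))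
    (x : ι × Bool × Fin 3) (t : ℝ) :
    ∑ x', ∫ y in hpDom δ₁ δ₂ x', hpKer c δ₁ δ₂ x t x' y • (w x' y * m x' y) =
      ∑ j, cauchyBox (lev δ₁ δ₂ (!x.2.1)) (g j) (hpPt c δ₁ δ₂ x t - c j) := by
  rw [Fintype.sum_prod_type]
  refine Finset.sum_congr rfl fun j _ => ?_
  rw [Fintype.sum_prod_type, cauchyBox, boxInt, Finset.smul_sum]
  rw [Finset.sum_eq_single (!x.2.1)]
  · refine Finset.sum_congr rfl fun s _ => ?_
    rw [← integral_smul, ← integral_smul]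
    refine setIntegral_congr_fun (measurableSet_boxDom _ _) fun y hy => ?_
    have hne : x.2.1 ≠ !x.2.1 := by simp
    simp only [hpKer, if_neg hne, hg _ y hy]
    rw [smul_smul, smul_smul]
    congr 2
    simp only [hpPt]
    ring
  · intro l _ hl
    have hl' : x.2.1 = l := by
      revert hl
      cases x.2.1 <;> cases l <;> simp
    refine Finset.sum_eq_zero fun s _ => ?_
    simp [hpKer, hl']
  · simp

end Hairpin

end

section

/-! ### Riemann–Hilbert problems on hairpins -/

theorem exists_bound_of_tendsto {E : Type*} [NormedAddCommGroup E] {K : Set ℂ} (hK : IsClosed K)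
    {f : ℂ → E} {v : E} (hc : ContinuousOn f K)
    (hf : Tendsto f (Bornology.cobounded ℂ ⊓ 𝓟 K) (𝓝 v)) : ∃ B, ∀ z ∈ K, ‖f z‖ ≤ B := by
  have h1 : ∀ᶠ z in Bornology.cobounded ℂ ⊓ 𝓟 K, ‖f z‖ < ‖v‖ + 1 :=
    hf.norm.eventually_lt_const (by linarith)
  rw [eventually_inf_principal] at h1
  obtain ⟨R, -, hR⟩ := (Filter.hasBasis_cobounded_norm (E := ℂ)).eventually_iff.1 h1
  obtain ⟨C, hC⟩ := ((isCompact_closedBall (0 : ℂ) R).inter_left hK).exists_bound_of_continuousOn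
    (hc.mono inter_subset_left)
  refine ⟨max C (‖v‖ + 1), fun z hz => ?_⟩
  rcases le_total R ‖z‖ with h | h
  · exact (hR h hz).le.trans (le_max_right _ _)
  · exact (hC z ⟨hz, by simpa using h⟩).trans (le_max_left _ _)

/-- A multiplicative Riemann–Hilbert problem with jumps `M j` on hairpins about the points `c j`:
`V` is holomorphic outside, `W j` inside, and `V = W j * M j` on the overlaps. The jumps are
functions of `w = z - c j`, and `M j - 1` has size `η` relative to the weight. -/
structure HairpinProblem {ι : Type*} (c : ι → ℂ) (δ₀ δ₁ δ₂ δ₃ κ η : ℝ) (V : ℂ → 𝔸)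
    (W M : ι → ℂ → 𝔸) : Prop where
  nonneg : 0 ≤ δ₀
  lt01 : δ₀ < δ₁
  lt12 : δ₁ < δ₂
  lt23 : δ₂ < δ₃
  pos : 0 < κ
  le_one : κ ≤ 1
  eta : 0 ≤ η
  sep : ∀ i j, i ≠ j → 2 * δ₃ ≤ |(c i).re - (c j).re|
  outer : DifferentiableOn ℂ V {z | ∀ j, z - c j ∉ closedBox δ₀}
  inner : ∀ j, DifferentiableOn ℂ (W j) {z | z - c j ∈ openBox δ₃}
  jump : ∀ j, ∀ w ∈ openBox δ₃ \ closedBox δ₀, V (c j + w) = W j (c j + w) * M j w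
  cont : ∀ j, ContinuousOn (M j) (openBox δ₃ \ closedBox δ₀)
  small : ∀ j, ∀ w ∈ openBox δ₃ \ closedBox δ₀, ‖M j w - 1‖ ≤ η * wt κ w.im
  outer_bdd : ∃ B, ∀ z, (∀ j, z - c j ∉ openBox δ₁) → ‖V z‖ ≤ B
  inner_bdd : ∀ j, ∃ B, ∀ z, z - c j ∈ openBox δ₃ → ‖W j z‖ ≤ B
  lim : Tendsto (fun T : ℝ => V (-T * I)) atTop (𝓝 1)

section

variable {ι : Type*} [Fintype ι] {c : ι → ℂ} {δ₀ δ₁ δ₂ δ₃ κ η : ℝ} {V : ℂ → 𝔸} {W M : ι → ℂ → 𝔸}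

theorem HairpinProblem.lev_mem (h : HairpinProblem c δ₀ δ₁ δ₂ δ₃ κ η V W M) (l : Bool) :
    δ₀ < lev δ₁ δ₂ l ∧ lev δ₁ δ₂ l < δ₃ := by
  have := h.lt01
  have := h.lt12
  have := h.lt23
  cases l <;> simp [lev] <;> constructor <;> linarith

theorem HairpinProblem.boxPt_mem (h : HairpinProblem c δ₀ δ₁ δ₂ δ₃ κ η V W M) {l : Bool} {s : Fin 3}
    {y : ℝ} (hy : y ∈ boxDom (lev δ₁ δ₂ l) s) :
    boxPt (lev δ₁ δ₂ l) s y ∈ openBox δ₃ \ closedBox δ₀ :=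
  ⟨closedBox_subset_openBox (h.lev_mem l).2
    (boxPt_mem_closedBox (h.nonneg.trans (h.lev_mem l).1.le) hy),
    fun h' => boxPt_notMem_openBox (closedBox_subset_openBox (h.lev_mem l).1 h')⟩

theorem HairpinProblem.exists_inner_bound (h : HairpinProblem c δ₀ δ₁ δ₂ δ₃ κ η V W M) :
    ∃ B, 0 ≤ B ∧ ∀ j z, z - c j ∈ openBox δ₃ → ‖W j z‖ ≤ B := by
  choose B hB using h.inner_bdd
  refine ⟨∑ j, |B j|, Finset.sum_nonneg fun j _ => abs_nonneg _, fun j z hz => ?_⟩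
  exact ((hB j z hz).trans (le_abs_self _)).trans
    (Finset.single_le_sum (f := fun j => |B j|) (fun j _ => abs_nonneg _) (Finset.mem_univ j))

/-- A multiplicative problem is an additive one with the differences `V - W = W (M - 1)`. -/
theorem HairpinProblem.representation (h : HairpinProblem c δ₀ δ₁ δ₂ δ₃ κ η V W M) :
    (∀ z, (∀ j, z - c j ∉ closedBox δ₁) →
      V z = 1 - ∑ j, cauchyBox δ₁ (fun w => W j (c j + w) * (M j w - 1)) (z - c j)) ∧
    ∀ i z, z - c i ∈ openBox δ₂ →
      W i z = 1 - ∑ j, cauchyBox δ₂ (fun w => W j (c j + w) * (M j w - 1)) (z - c j) := by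
  obtain ⟨B, hB0, hB⟩ := h.exists_inner_bound
  obtain ⟨B', hB'⟩ := h.outer_bdd
  have l1 := h.lt12
  refine additive_representation (δm := (δ₁ + δ₂) / 2) (C := B * η) (B := max B B') h.nonneg h.lt01
    (by linarith) (by linarith) h.lt23 h.pos h.le_one h.sep (mul_nonneg hB0 h.eta) h.outer h.inner
    (fun j w hw => ?_) (fun j w hw => ?_) (fun z hz => ?_) (fun j z hz => ?_) h.lim
  · rw [h.jump j w hw, mul_sub, mul_one]
  · rw [mul_assoc]
    refine (norm_mul_le _ _).trans (mul_le_mul (hB j _ (by simpa using hw.1)) (h.small j w hw)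
      (norm_nonneg _) hB0)
  · refine (hB' z fun j hj => hz j ?_).trans (le_max_right _ _)
    exact closedBox_subset_openBox (by linarith) (openBox_subset_closedBox _ hj)
  · refine (hB j z ?_).trans (le_max_left _ _)
    exact closedBox_subset_openBox (by linarith [h.lt23]) hz

/-- The values of the inner solutions on the hairpins. -/
noncomputable def hpVal (c : ι → ℂ) (δ₁ δ₂ : ℝ) (W : ι → ℂ → 𝔸) (x : ι × Bool × Fin 3) (y : ℝ) : 𝔸 :=
  W x.1 (hpPt c δ₁ δ₂ x y)

/-- The values of the jumps, diminished by `1`, on the hairpins. -/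
noncomputable def hpCoef (δ₁ δ₂ : ℝ) (M : ι → ℂ → 𝔸) (x : ι × Bool × Fin 3) (y : ℝ) : 𝔸 :=
  M x.1 (boxPt (lev δ₁ δ₂ x.2.1) x.2.2 y) - 1

theorem HairpinProblem.measurable_hpCoef (h : HairpinProblem c δ₀ δ₁ δ₂ δ₃ κ η V W M)
    (x : ι × Bool × Fin 3) :
    AEStronglyMeasurable (hpCoef δ₁ δ₂ M x) (volume.restrict (hpDom δ₁ δ₂ x)) := by
  refine ContinuousOn.aestronglyMeasurable ?_ (measurableSet_boxDom _ _)
  exact ((h.cont x.1).comp (continuous_boxPt _ _).continuousOn fun y hy =>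
    h.boxPt_mem hy).sub continuousOn_const

theorem HairpinProblem.exists_bddFam (h : HairpinProblem c δ₀ δ₁ δ₂ δ₃ κ η V W M) :
    ∃ B, BddFam (hpDom δ₁ δ₂) (hpVal c δ₁ δ₂ W) B := by
  obtain ⟨B, -, hB⟩ := h.exists_inner_bound
  have hmem : ∀ x : ι × Bool × Fin 3, ∀ y ∈ hpDom δ₁ δ₂ x, hpPt c δ₁ δ₂ x y - c x.1 ∈ openBox δ₃ := by
    intro x y hy
    simpa [hpPt] using (h.boxPt_mem hy).1
  refine ⟨B, fun x => ?_, fun x y hy => hB _ _ (hmem x y hy)⟩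
  refine ContinuousOn.aestronglyMeasurable ?_ (measurableSet_boxDom _ _)
  exact (h.inner x.1).continuousOn.comp (continuous_hpPt _ _ _ _).continuousOn (hmem x)

/-- The values of `W` on both hairpins solve the integral equation. On the inner hairpins this is the
representation of `W`; on the outer ones it is that of `V`, rewritten by `V = W + W (M - 1)`. -/
theorem HairpinProblem.hpVal_eq (h : HairpinProblem c δ₀ δ₁ δ₂ δ₃ κ η V W M) (x : ι × Bool × Fin 3)
    {t : ℝ} (ht : t ∈ hpDom δ₁ δ₂ x) : hpVal c δ₁ δ₂ W x t =
      1 - intOp (hpDom δ₁ δ₂) (hpKer c δ₁ δ₂) hpLoc (hpCoef δ₁ δ₂ M) (hpVal c δ₁ δ₂ W) x t := by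
  obtain ⟨hout, hin⟩ := h.representation
  have hsum := sum_hpKer_eq (c := c) (δ₁ := δ₁) (δ₂ := δ₂)
    (fun j w => W j (c j + w) * (M j w - 1)) (w := hpVal c δ₁ δ₂ W) (m := hpCoef δ₁ δ₂ M)
    (fun x y _ => rfl) x t
  have hl1 := h.lt12
  have hl0 := h.nonneg
  have hl01 := h.lt01
  have hl23 := h.lt23
  rw [intOp, hsum]
  obtain ⟨i, l, s⟩ := x
  cases l
  · have hz : hpPt c δ₁ δ₂ (i, false, s) t - c i ∈ openBox δ₂ := by
      simp only [hpPt, add_sub_cancel_left]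
      exact closedBox_subset_openBox hl1 (boxPt_mem_closedBox (by linarith) ht)
    simp only [hpVal, hpLoc, hin i _ hz]
    simp [lev]
  · have hmem := h.boxPt_mem ht
    have hz : ∀ j, hpPt c δ₁ δ₂ (i, true, s) t - c j ∉ closedBox δ₁ := by
      intro j hj
      by_cases hij : i = j
      · subst hij
        simp only [hpPt, add_sub_cancel_left] at hj
        exact boxPt_notMem_openBox (closedBox_subset_openBox hl1 hj)
      · refine box_disjoint (h.sep i j hij) (z := hpPt c δ₁ δ₂ (i, true, s) t) ?_
          (closedBox_subset_openBox (by linarith) hj)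
        simpa [hpPt] using hmem.1
    have e1 := hout _ hz
    have e2 := h.jump i _ hmem
    have e3 : hpPt c δ₁ δ₂ (i, true, s) t = c i + boxPt (lev δ₁ δ₂ true) s t := rfl
    rw [e3, e2] at e1
    simp only [hpVal, hpLoc, hpCoef, e3, if_true, one_smul]
    rw [mul_sub, mul_one, ← sub_sub, show lev δ₁ δ₂ (!true) = δ₁ from rfl, ← e1]
    abel

end

end

section

section

variable {ι : Type*} [Fintype ι] {c : ι → ℂ} {δ₀ δ₁ δ₂ δ₃ κ η : ℝ}

/-- Cauchy integrals over the hairpins of one level, of densities given on the sides. -/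
noncomputable def hpCauchy (c : ι → ℂ) (δ₁ δ₂ : ℝ) (l : Bool) (u : ι × Bool × Fin 3 → ℝ → 𝔸)
    (ζ : ℂ) : 𝔸 :=
  ∑ j, ∑ s, ((2 * Real.pi * I : ℂ)⁻¹ * boxCoef s) • ∫ y in boxDom (lev δ₁ δ₂ l) s,
    (boxPt (lev δ₁ δ₂ l) s y - (ζ - c j))⁻¹ • u (j, l, s) y

theorem sum_cauchyBox_eq_hpCauchy {l : Bool} {u : ι × Bool × Fin 3 → ℝ → 𝔸} {g : ι → ℂ → 𝔸}
    (h : ∀ j s, ∀ y ∈ boxDom (lev δ₁ δ₂ l) s, g j (boxPt (lev δ₁ δ₂ l) s y) = u (j, l, s) y)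
    (ζ : ℂ) : ∑ j, cauchyBox (lev δ₁ δ₂ l) (g j) (ζ - c j) = hpCauchy c δ₁ δ₂ l u ζ := by
  refine Finset.sum_congr rfl fun j _ => ?_
  rw [cauchyBox, boxInt, Finset.smul_sum]
  refine Finset.sum_congr rfl fun s _ => ?_
  rw [smul_smul]
  congr 1
  refine setIntegral_congr_fun (measurableSet_boxDom _ _) fun y hy => ?_
  exact congrArg (_ • ·) (h j s y hy)

theorem hasDerivAt_hpCauchy (hκ0 : 0 < κ) (hκ1 : κ ≤ 1) {O : Set ℂ} (hO : IsOpen O) {l : Bool}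
    {u : ℂ → ι × Bool × Fin 3 → ℝ → 𝔸} {C d : ℝ} (hd : 0 < d)
    (hm : ∀ b ∈ O, ∀ x, AEStronglyMeasurable (u b x) (volume.restrict (hpDom δ₁ δ₂ x)))
    (hu : ∀ b ∈ O, ∀ x, ∀ y ∈ hpDom δ₁ δ₂ x, ‖u b x y‖ ≤ C * wt κ y)
    (hh : ∀ x, ∀ y ∈ hpDom δ₁ δ₂ x, DifferentiableOn ℂ (fun b => u b x y) O)
    {ζ : ℂ → ℂ} (hζ : DifferentiableOn ℂ ζ O)
    (hdist : ∀ b ∈ O, ∀ j s, ∀ y ∈ boxDom (lev δ₁ δ₂ l) s,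
      d ≤ ‖boxPt (lev δ₁ δ₂ l) s y - (ζ b - c j)‖) {b₀ : ℂ} (hb₀ : b₀ ∈ O) :
    HasDerivAt (fun b => hpCauchy c δ₁ δ₂ l (u b) (ζ b))
      (∑ j, ∑ s, ((2 * Real.pi * I : ℂ)⁻¹ * boxCoef s) • ∫ y in boxDom (lev δ₁ δ₂ l) s,
        deriv (fun b => (boxPt (lev δ₁ δ₂ l) s y - (ζ b - c j))⁻¹ • u b (j, l, s) y) b₀) b₀ := by
  unfold hpCauchy
  refine HasDerivAt.fun_sum fun j _ => HasDerivAt.fun_sum fun s _ => HasDerivAt.fun_const_smul _ ?_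
  have hmeas : MeasurableSet (boxDom (lev δ₁ δ₂ l) s) := measurableSet_boxDom _ _
  have hne : ∀ b ∈ O, ∀ y ∈ boxDom (lev δ₁ δ₂ l) s, boxPt (lev δ₁ δ₂ l) s y - (ζ b - c j) ≠ 0 := by
    intro b hb y hy h
    have := hdist b hb j s y hy
    rw [h, norm_zero] at this
    linarith
  refine hasDerivAt_integral_param hO ?_ ?_ hb₀ ?_
  · refine ae_restrict_of_forall_mem hmeas fun y hy => ?_
    refine DifferentiableOn.smul (DifferentiableOn.inv ?_ fun b hb => hne b hb y hy)
      (hh (j, l, s) y hy)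
    exact (differentiableOn_const _).sub (hζ.sub (differentiableOn_const _))
  · intro b hb
    refine AEStronglyMeasurable.smul ?_ (hm b hb (j, l, s))
    exact (((continuous_boxPt _ s).sub continuous_const).measurable.inv).aestronglyMeasurable
  -- the kernels near `b₀` are comparable with the kernel at `b₀`
  obtain ⟨K, -, H⟩ := exists_box_kernel_bound hκ0 hκ1 hd
  have hcont : ContinuousAt ζ b₀ := (hζ.differentiableAt (hO.mem_nhds hb₀)).continuousAt
  obtain ⟨r, hr, hball⟩ := Metric.continuousAt_iff.1 hcont (d / 2) (by positivity)
  refine ⟨r, hr, fun y => 2 * C * (‖boxPt (lev δ₁ δ₂ l) s y - (ζ b₀ - c j)‖⁻¹ * wt κ y),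
    (H _ s _ (hdist b₀ hb₀ j s)).1.const_mul _, ?_⟩
  refine ae_restrict_of_forall_mem hmeas fun y hy b hb => ?_
  have h1 := hball hb.1
  rw [dist_eq_norm] at h1
  have h2 := hdist b₀ hb₀ j s y hy
  have h3 := hdist b hb.2 j s y hy
  have h4 : ‖boxPt (lev δ₁ δ₂ l) s y - (ζ b₀ - c j)‖ ≤
      2 * ‖boxPt (lev δ₁ δ₂ l) s y - (ζ b - c j)‖ := by
    have h5 : boxPt (lev δ₁ δ₂ l) s y - (ζ b₀ - c j) =
      (boxPt (lev δ₁ δ₂ l) s y - (ζ b - c j)) + (ζ b - ζ b₀) := by ring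
    have h6 := norm_add_le (boxPt (lev δ₁ δ₂ l) s y - (ζ b - c j)) (ζ b - ζ b₀)
    rw [← h5] at h6
    linarith
  rw [norm_smul, norm_inv]
  have h5 : ‖boxPt (lev δ₁ δ₂ l) s y - (ζ b - c j)‖⁻¹ ≤
      2 * ‖boxPt (lev δ₁ δ₂ l) s y - (ζ b₀ - c j)‖⁻¹ := by
    rw [← div_eq_mul_inv, le_div_iff₀ (by linarith), inv_mul_le_iff₀ (by linarith)]
    linarith
  calc _ ≤ (2 * ‖boxPt (lev δ₁ δ₂ l) s y - (ζ b₀ - c j)‖⁻¹) * (C * wt κ y) :=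
        mul_le_mul h5 (hu b hb.2 (j, l, s) y hy) (norm_nonneg _) (by positivity)
    _ = _ := by ring

theorem wt_boxPt_le {δ : ℝ} (hδ : 0 ≤ δ) (hκ : 0 ≤ κ) {s : Fin 3} {y : ℝ} (hy : y ∈ boxDom δ s) :
    wt κ (boxPt δ s y).im ≤ (1 + δ) ^ κ * wt κ y := by
  have h1 : (1 : ℝ) ≤ (1 + δ) ^ κ := Real.one_le_rpow (by linarith) hκ
  fin_cases s
  · simp [boxDom] at hy
    exact (wt_le_one hκ _).trans (one_le_mul_wt hκ (abs_le.2 ⟨hy.1.le, hy.2⟩))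
  all_goals
    simp [boxPt]
    exact le_mul_of_one_le_left (wt_pos _ _).le h1

theorem boxPt_mem_diff (h0 : 0 ≤ δ₀) (h01 : δ₀ < δ₁) (h12 : δ₁ < δ₂) (h23 : δ₂ < δ₃)
    {x : ι × Bool × Fin 3} {y : ℝ} (hy : y ∈ hpDom δ₁ δ₂ x) :
    boxPt (lev δ₁ δ₂ x.2.1) x.2.2 y ∈ openBox δ₃ \ closedBox δ₀ :=
  have hl := lev_mem_Icc h12.le x.2.1
  ⟨closedBox_subset_openBox (hl.2.trans_lt h23) (boxPt_mem_closedBox (by linarith [hl.1]) hy),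
    fun h' => boxPt_notMem_openBox (closedBox_subset_openBox (h01.trans_le hl.1) h')⟩

theorem norm_hpCoef_le {M : ι → ℂ → 𝔸} (h0 : 0 ≤ δ₀) (h01 : δ₀ < δ₁) (h12 : δ₁ < δ₂) (h23 : δ₂ < δ₃)
    (hκ : 0 ≤ κ) (hη : 0 ≤ η)
    (h : ∀ j, ∀ w ∈ openBox δ₃ \ closedBox δ₀, ‖M j w - 1‖ ≤ η * wt κ w.im) (x : ι × Bool × Fin 3)
    {y : ℝ} (hy : y ∈ hpDom δ₁ δ₂ x) : ‖hpCoef δ₁ δ₂ M x y‖ ≤ η * (1 + δ₂) ^ κ * wt κ y := by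
  have hl := lev_mem_Icc h12.le x.2.1
  have hl0 : 0 ≤ lev δ₁ δ₂ x.2.1 := by linarith [hl.1]
  refine (h x.1 _ (boxPt_mem_diff h0 h01 h12 h23 hy)).trans ?_
  rw [mul_assoc]
  refine mul_le_mul_of_nonneg_left ((wt_boxPt_le hl0 hκ hy).trans ?_) hη
  exact mul_le_mul_of_nonneg_right (Real.rpow_le_rpow (by linarith) (by linarith [hl.2]) hκ)
    (wt_pos _ _).le

end

section

variable {J : Type*} [Fintype J] {T : J → Set ℝ} {k : J → ℝ → J → ℝ → ℂ} {θ : J → ℂ}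
  {m : J → ℝ → 𝔸} {ρ : J → ℝ → ℝ} {η : ℝ}

variable (T k θ) in
/-- The sum of the Neumann series. -/
noncomputable def neumannSum (m : J → ℝ → 𝔸) (i : J) (t : ℝ) : 𝔸 := ∑' n, neumannTerm T k θ m n i t

theorem SmallOp.bddFam_neumannSum (h : SmallOp T k θ m ρ η) (h0 : 0 ≤ η)
    (h1 : η ≤ 1 / 2) : BddFam T (neumannSum T k θ m) (2 * ‖(1 : 𝔸)‖) := by
  have hs : ∀ i, ∀ t ∈ T i, HasSum (fun n => neumannTerm T k θ m n i t) (neumannSum T k θ m i t) :=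
    fun i t ht => (h.summable_neumannTerm h0 (by linarith) ht).hasSum
  refine ⟨fun i => ?_, fun i t ht => ?_⟩
  · refine aestronglyMeasurable_of_tendsto_ae atTop
      (f := fun n t => ∑ l ∈ Finset.range n, neumannTerm T k θ m l i t) (fun n => ?_) ?_
    · exact Finset.aestronglyMeasurable_fun_sum _ fun l _ => (h.bddFam_neumannTerm l).1 i
    · exact ae_restrict_of_forall_mem (h.meas_dom i) fun t ht => (hs i t ht).tendsto_sum_nat
  · have hg := (hasSum_geometric_of_lt_one (by norm_num : (0 : ℝ) ≤ 1 / 2) (by norm_num)).mul_left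
      ‖(1 : 𝔸)‖
    norm_num at hg
    rw [mul_comm] at hg
    refine (hs i t ht).norm_le_of_bounded hg fun n => ((h.bddFam_neumannTerm n).2 i t ht).trans ?_
    exact mul_le_mul_of_nonneg_left (pow_le_pow_left₀ h0 h1 n) (norm_nonneg _)

theorem SmallOp.neumannSum_eq (h : SmallOp T k θ m ρ η) (h0 : 0 ≤ η)
    (h1 : η ≤ 1 / 2) {w : J → ℝ → 𝔸} {B : ℝ} (hw : BddFam T w B)
    (heq : ∀ i, ∀ t ∈ T i, w i t = 1 - intOp T k θ m w i t) {i : J} {t : ℝ} (ht : t ∈ T i) :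
    neumannSum T k θ m i t = w i t := (h.hasSum_neumannTerm h0 (by linarith) hw heq ht).tsum_eq

end

section

variable {ι : Type*} [Fintype ι] {c : ι → ℂ} {δ₀ δ₁ δ₂ δ₃ κ η : ℝ}

/-- The outer solution is close to `1` if the jumps are, uniformly in the positions of the cuts. -/
theorem exists_outer_estimate (𝔸 : Type*) [NormedRing 𝔸] [NormedAlgebra ℂ 𝔸] [CompleteSpace 𝔸]
    (ι : Type*) [Fintype ι] {δ₁ δ₂ δ₃ κ : ℝ} (hκ0 : 0 < κ) (hκ1 : κ ≤ 1)
    (h1 : 0 ≤ δ₁) (h12 : δ₁ < δ₂) (h23 : δ₂ < δ₃) : ∃ K > 0, ∀ (c : ι → ℂ) (δ₀ η : ℝ) (V : ℂ → 𝔸)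
      (W M : ι → ℂ → 𝔸), HairpinProblem c δ₀ δ₁ δ₂ δ₃ κ η V W M → K * η ≤ 1 →
      ∀ z, (∀ j, z - c j ∉ openBox δ₂) → ‖V z - 1‖ ≤ K * η := by
  obtain ⟨K₀, hK₀, H⟩ := exists_hp_bound (𝔸 := 𝔸) ι hκ0 hκ1 h1 h12 h23
  obtain ⟨K₁, hK₁, H1⟩ := exists_cauchyBox_bound (E := 𝔸) hκ0 hκ1 (sub_pos.2 h12)
  set D := (1 + δ₂) ^ κ with hD
  have hD0 : 0 < D := Real.rpow_pos_of_pos (by linarith) _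
  refine ⟨2 * (K₀ * D) + ∑ _j : ι, K₁ * (2 * ‖(1 : 𝔸)‖ * D), by positivity,
    fun c δ₀ η V W M h hη z hz => ?_⟩
  have hη0 := h.eta
  have hpos : 0 ≤ ∑ _j : ι, K₁ * (2 * ‖(1 : 𝔸)‖ * D) := by positivity
  have hK : K₀ * (η * D) ≤ 1 / 2 := by
    have := mul_nonneg hpos h.eta
    linarith
  have hcoef : ∀ x, ∀ y ∈ hpDom δ₁ δ₂ x, ‖hpCoef δ₁ δ₂ M x y‖ ≤ η * D * wt κ y := fun x y hy =>
    norm_hpCoef_le h.nonneg h.lt01 h12 h23 hκ0.le h.eta h.small x hy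
  have hop := H c h.sep (hpCoef δ₁ δ₂ M) (η * D) (by positivity) h.measurable_hpCoef hcoef
  obtain ⟨B, hB⟩ := h.exists_bddFam
  have hb := fun j s y (hy : y ∈ boxDom δ₁ s) => hop.neumannSum_eq (by positivity) hK hB
    (fun x t ht => h.hpVal_eq x ht) (i := (j, false, s)) hy ▸
      (hop.bddFam_neumannSum (by positivity) hK).2 (j, false, s) y hy
  rw [h.representation.1 z fun j hj => hz j (closedBox_subset_openBox h12 hj), sub_sub_cancel_left,
    norm_neg]
  have hsum : ‖∑ j, cauchyBox δ₁ (fun w => W j (c j + w) * (M j w - 1)) (z - c j)‖ ≤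
      ∑ _j : ι, K₁ * (2 * ‖(1 : 𝔸)‖ * (η * D)) := by
    refine (norm_sum_le _ _).trans (Finset.sum_le_sum fun j _ => ?_)
    refine H1 _ _ _ _ (by positivity) ⟨fun s => ?_, fun s y hy => ?_⟩
      fun s y hy => dist_box_of_outside (boxPt_mem_closedBox h1 hy) (hz j)
    · exact (hB.1 (j, false, s)).mul (h.measurable_hpCoef (j, false, s))
    · rw [mul_assoc]
      exact norm_mul_le_of_le (hb j s y hy) (hcoef (j, false, s) y hy)
  refine hsum.trans ?_
  rw [add_mul, Finset.sum_mul]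
  have : 0 ≤ 2 * (K₀ * D) * η := by positivity
  have e : ∑ _j : ι, K₁ * (2 * ‖(1 : 𝔸)‖ * (η * D)) = ∑ _j : ι, K₁ * (2 * ‖(1 : 𝔸)‖ * D) * η :=
    Finset.sum_congr rfl fun j _ => by ring
  linarith

/-- Local analytic continuation, with respect to a parameter `b`, of solutions of problems with
fixed hairpins and small jumps depending analytically on `b`. The solutions need only be given for
the parameters in a set `B`: on the hairpins they are sums of Neumann series, which are analytic. -/
theorem exists_continuation (𝔸 : Type*) [NormedRing 𝔸] [NormedAlgebra ℂ 𝔸] [CompleteSpace 𝔸]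
    (ι : Type*) [Fintype ι] {δ₀ δ₁ δ₂ δ₃ κ : ℝ} (hκ0 : 0 < κ) (hκ1 : κ ≤ 1)
    (h0 : 0 ≤ δ₀) (h01 : δ₀ < δ₁) (h12 : δ₁ < δ₂) (h23 : δ₂ < δ₃) : ∃ η₀ > 0, ∀ (c : ι → ℂ)
      (V : ℂ → ℂ → 𝔸) (W M : ℂ → ι → ℂ → 𝔸) (O B : Set ℂ), IsOpen O → B ⊆ O →
      (∀ i j, i ≠ j → 2 * δ₃ ≤ |(c i).re - (c j).re|) →
      (∀ b ∈ O, ∀ j, ContinuousOn (M b j) (openBox δ₃ \ closedBox δ₀)) →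
      (∀ b ∈ O, ∀ j, ∀ w ∈ openBox δ₃ \ closedBox δ₀, ‖M b j w - 1‖ ≤ η₀ * wt κ w.im) →
      (∀ j, ∀ w ∈ openBox δ₃ \ closedBox δ₀, DifferentiableOn ℂ (fun b => M b j w) O) →
      (∀ b ∈ B, HairpinProblem c δ₀ δ₁ δ₂ δ₃ κ η₀ (V b) (W b) (M b)) →
      (∀ z, (∀ j, z - c j ∉ openBox δ₂) → ∃ V' : ℂ → 𝔸, (∀ b ∈ B, V' b = V b z) ∧
        ∀ b₀ ∈ B, (∀ j, ∀ w ∈ openBox δ₃ \ closedBox δ₀, M b₀ j w = 1) → HasDerivAt V'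
          (-∑ j, cauchyBox δ₁ (fun w => deriv (fun b => M b j w) b₀) (z - c j)) b₀) ∧
      ∀ i, ∀ ζ : ℂ → ℂ, DifferentiableOn ℂ ζ O → (∀ b ∈ O, ζ b - c i ∈ closedBox δ₁) →
        ∃ W' : ℂ → 𝔸, DifferentiableOn ℂ W' O ∧ ∀ b ∈ B, W' b = W b i (ζ b) := by
  obtain ⟨K₀, hK₀, H⟩ := exists_hp_bound (𝔸 := 𝔸) ι hκ0 hκ1 (h0.trans h01.le) h12 h23
  set D := (1 + δ₂) ^ κ with hD
  have hD0 : 0 < D := Real.rpow_pos_of_pos (by linarith) _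
  refine ⟨1 / (2 * (K₀ * D)), by positivity, ?_⟩
  have hη0 : K₀ * (1 / (2 * (K₀ * D)) * D) ≤ 1 / 2 := by
    refine le_of_eq ?_
    field_simp
  have hηpos : 0 < 1 / (2 * (K₀ * D)) := by positivity
  generalize 1 / (2 * (K₀ * D)) = η at hη0 hηpos
  intro c V W M O B hO hBO hsep hcont hsmall hholo hP
  have hmem : ∀ (x : ι × Bool × Fin 3), ∀ y ∈ hpDom δ₁ δ₂ x,
      boxPt (lev δ₁ δ₂ x.2.1) x.2.2 y ∈ openBox δ₃ \ closedBox δ₀ :=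
    fun x y hy => boxPt_mem_diff h0 h01 h12 h23 hy
  have hcoef : ∀ b ∈ O, ∀ x, ∀ y ∈ hpDom δ₁ δ₂ x, ‖hpCoef δ₁ δ₂ (M b) x y‖ ≤ η * D * wt κ y :=
    fun b hb x y hy => norm_hpCoef_le h0 h01 h12 h23 hκ0.le hηpos.le (hsmall b hb) x hy
  have hcm : ∀ b ∈ O, ∀ x, AEStronglyMeasurable (hpCoef δ₁ δ₂ (M b) x)
      (volume.restrict (hpDom δ₁ δ₂ x)) := fun b hb x =>
    ContinuousOn.aestronglyMeasurable (((hcont b hb x.1).comp (continuous_boxPt _ _).continuousOn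
      (hmem x)).sub continuousOn_const) (measurableSet_boxDom _ _)
  have hop := fun b (hb : b ∈ O) =>
    H c hsep (hpCoef δ₁ δ₂ (M b)) (η * D) (by positivity) (hcm b hb) (hcoef b hb)
  set S : ℂ → ι × Bool × Fin 3 → ℝ → 𝔸 := fun b =>
    neumannSum (hpDom δ₁ δ₂) (hpKer c δ₁ δ₂) hpLoc (hpCoef δ₁ δ₂ (M b)) with hSdef
  have hSb : ∀ b ∈ O, BddFam (hpDom δ₁ δ₂) (S b) (2 * ‖(1 : 𝔸)‖) := fun b hb =>
    (hop b hb).bddFam_neumannSum (by positivity) hη0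
  have hSB : ∀ b ∈ B, ∀ x, ∀ y ∈ hpDom δ₁ δ₂ x, S b x y = hpVal c δ₁ δ₂ (W b) x y := by
    intro b hb x y hy
    obtain ⟨C, hC⟩ := (hP b hb).exists_bddFam
    exact (hop b (hBO hb)).neumannSum_eq (by positivity) hη0 hC
      (fun x t ht => (hP b hb).hpVal_eq x ht) hy
  have hmh : ∀ x, ∀ y ∈ hpDom δ₁ δ₂ x, DifferentiableOn ℂ (fun b => hpCoef δ₁ δ₂ (M b) x y) O :=
    fun x y hy => (hholo x.1 _ (hmem x y hy)).sub_const 1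
  have hSh : ∀ x, ∀ y ∈ hpDom δ₁ δ₂ x, DifferentiableOn ℂ (fun b => S b x y) O :=
    fun x y hy => differentiableOn_tsum_neumannTerm hO hop (by positivity) (by linarith)
      hmh hy
  set u : ℂ → ι × Bool × Fin 3 → ℝ → 𝔸 := fun b x y => S b x y * hpCoef δ₁ δ₂ (M b) x y with hu
  have hum : ∀ b ∈ O, ∀ x, AEStronglyMeasurable (u b x) (volume.restrict (hpDom δ₁ δ₂ x)) :=
    fun b hb x => ((hSb b hb).1 x).mul (hcm b hb x)
  have hub : ∀ b ∈ O, ∀ x, ∀ y ∈ hpDom δ₁ δ₂ x,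
      ‖u b x y‖ ≤ 2 * ‖(1 : 𝔸)‖ * (η * D) * wt κ y := by
    intro b hb x y hy
    rw [mul_assoc]
    exact norm_mul_le_of_le ((hSb b hb).2 x y hy) (hcoef b hb x y hy)
  have huh : ∀ x, ∀ y ∈ hpDom δ₁ δ₂ x, DifferentiableOn ℂ (fun b => u b x y) O :=
    fun x y hy => (hSh x y hy).fun_mul (hmh x y hy)
  have hrep : ∀ b ∈ B, ∀ l ζ, ∑ j, cauchyBox (lev δ₁ δ₂ l)
      (fun w => W b j (c j + w) * (M b j w - 1)) (ζ - c j) = hpCauchy c δ₁ δ₂ l (u b) ζ := by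
    intro b hb l ζ
    refine sum_cauchyBox_eq_hpCauchy (fun j s y hy => ?_) ζ
    simp only [hu]
    rw [hSB b hb (j, l, s) y hy]
    rfl
  refine ⟨fun z hz => ⟨fun b => 1 - hpCauchy c δ₁ δ₂ false (u b) z, fun b hb => ?_,
    fun b₀ hb₀ hM1 => ?_⟩, fun i ζ hζ hζi => ⟨fun b => 1 - hpCauchy c δ₁ δ₂ true (u b) (ζ b), ?_,
    fun b hb => ?_⟩⟩
  · rw [(hP b hb).representation.1 z fun j hj => hz j (closedBox_subset_openBox h12 hj)]
    exact congrArg _ (hrep b hb false z).symm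
  · have hd := hasDerivAt_hpCauchy (c := c) hκ0 hκ1 hO (l := false) (sub_pos.2 h12) hum hub huh
      (ζ := fun _ => z) (differentiableOn_const z)
      (fun b hb j s y hy => dist_box_of_outside (boxPt_mem_closedBox (by linarith) hy) (hz j))
      (hBO hb₀)
    refine (hd.const_sub 1).congr_deriv (congrArg _ ?_)
    refine Eq.symm ((sum_cauchyBox_eq_hpCauchy (l := false)
      (u := fun x y => deriv (fun b => M b x.1 (boxPt (lev δ₁ δ₂ x.2.1) x.2.2 y)) b₀)
      (fun j s y _ => rfl) z).trans ?_)
    refine Finset.sum_congr rfl fun j _ => Finset.sum_congr rfl fun s _ => ?_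
    congr 1
    refine setIntegral_congr_fun (measurableSet_boxDom _ _) fun y hy => ?_
    have d1 := ((hSh (j, false, s) y hy).differentiableAt (hO.mem_nhds (hBO hb₀))).hasDerivAt
    have d2 := ((hmh (j, false, s) y hy).differentiableAt (hO.mem_nhds (hBO hb₀))).hasDerivAt
    have d3 := ((d1.mul d2).const_smul (boxPt (lev δ₁ δ₂ false) s y - (z - c j))⁻¹).deriv
    have hc0 : ∀ x, ∀ y ∈ hpDom δ₁ δ₂ x, hpCoef δ₁ δ₂ (M b₀) x y = 0 := fun x y hy => by
      rw [hpCoef, hM1 _ _ (hmem x y hy), sub_self]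
    have hS1 : S b₀ (j, false, s) y = 1 := by
      have e := (hP b₀ hb₀).hpVal_eq (j, false, s) hy
      have e2 : intOp (hpDom δ₁ δ₂) (hpKer c δ₁ δ₂) hpLoc (hpCoef δ₁ δ₂ (M b₀))
          (hpVal c δ₁ δ₂ (W b₀)) (j, false, s) y = 0 := by
        rw [intOp, hc0 (j, false, s) y hy, mul_zero, smul_zero, add_zero]
        refine Finset.sum_eq_zero fun x _ => ?_
        refine (setIntegral_congr_fun (measurableSet_boxDom _ _) (g := fun _ => (0 : 𝔸))
          fun t ht => ?_).trans (by simp)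
        simp only [hc0 x t ht, mul_zero, smul_zero]
      rw [hSB b₀ hb₀ (j, false, s) y hy, e, e2, sub_zero]
    rw [hc0 (j, false, s) y hy, mul_zero, zero_add, hS1, one_mul] at d3
    refine Eq.trans ?_ d3.symm
    simp only [hpCoef, deriv_sub_const]
  · intro b hb
    refine ((hasDerivAt_hpCauchy (c := c) hκ0 hκ1 hO (l := true)
      (lt_min (sub_pos.2 h12) (sub_pos.2 h23)) hum hub huh
      hζ ?_ hb).differentiableAt.const_sub 1).differentiableWithinAt
    intro b hb j s y hy
    by_cases hij : i = j
    · subst hij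
      exact (min_le_left _ _).trans (dist_box_of_inside boxPt_notMem_openBox (hζi b hb))
    · refine (min_le_right _ _).trans (dist_box_of_outside (δ := δ₂)
        (boxPt_mem_closedBox (by linarith) hy) (box_disjoint (hsep i j hij)
        (closedBox_subset_openBox (by linarith) (hζi b hb))))
  · rw [(hP b hb).representation.2 i (ζ b) (closedBox_subset_openBox h12 (hζi b (hBO hb)))]
    exact congrArg _ (hrep b hb true (ζ b)).symm

end

end

section

/-! ### Behaviour of the local factors far up the cuts -/

/-- Half of the decay of the weight absorbs the logarithm. -/
theorem exists_log_mul_wt_le {κ δ d : ℝ} (hκ : 0 < κ) (hd : 0 < d) (hδ : 0 ≤ δ) : ∃ C, 0 ≤ C ∧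
    ∀ w : ℂ, |w.re| ≤ δ → d ≤ ‖w‖ → (|Real.log ‖w‖| + 5) * wt κ w.im ≤ C * wt (κ / 2) w.im := by
  refine ⟨|Real.log d| + Real.log (1 + δ) + 1 / (κ / 2) + 5, ?_, fun w hw hdw => ?_⟩
  · have := Real.log_nonneg (by linarith : (1 : ℝ) ≤ 1 + δ)
    positivity
  have h1 : ‖w‖ ≤ (1 + δ) * (1 + |w.im|) := by
    have := Complex.norm_le_abs_re_add_abs_im w
    have h2 := mul_nonneg hδ (abs_nonneg w.im)
    nlinarith
  set Y := 1 + |w.im| with hY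
  have hY1 : 1 ≤ Y := by have := abs_nonneg w.im; linarith
  have hw0 : 0 < ‖w‖ := hd.trans_le hdw
  have h2 : Real.log ‖w‖ ≤ Real.log (1 + δ) + Real.log Y := by
    rw [← Real.log_mul (by positivity) (by positivity)]
    exact Real.log_le_log hw0 h1
  have h3 : Real.log d ≤ Real.log ‖w‖ := Real.log_le_log hd hdw
  have h4 : Real.log Y ≤ Y ^ (κ / 2) / (κ / 2) := Real.log_le_rpow_div (by linarith) (by positivity)
  have h5 : 1 ≤ Y ^ (κ / 2) := Real.one_le_rpow hY1 (by positivity)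
  have hlδ := Real.log_nonneg (by linarith : (1 : ℝ) ≤ 1 + δ)
  have hlY := Real.log_nonneg hY1
  have h6 : |Real.log ‖w‖| ≤ |Real.log d| + Real.log (1 + δ) + Real.log Y := by
    rw [abs_le]
    have := neg_abs_le (Real.log d)
    have := abs_nonneg (Real.log d)
    constructor <;> linarith
  have h7 : |Real.log ‖w‖| + 5 ≤ (|Real.log d| + Real.log (1 + δ) + 1 / (κ / 2) + 5) * Y ^ (κ / 2) := by
    have e : Y ^ (κ / 2) / (κ / 2) = 1 / (κ / 2) * Y ^ (κ / 2) := by ring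
    have := abs_nonneg (Real.log d)
    nlinarith
  have h8 : wt κ w.im = wt (κ / 2) w.im * wt (κ / 2) w.im := by rw [wt_mul, add_halves]
  have h9 : Y ^ (κ / 2) * wt (κ / 2) w.im = 1 := by
    rw [wt, ← hY, ← Real.rpow_add (by linarith), add_neg_cancel, Real.rpow_zero]
  calc _ ≤ ((|Real.log d| + Real.log (1 + δ) + 1 / (κ / 2) + 5) * Y ^ (κ / 2)) * wt κ w.im :=
        mul_le_mul_of_nonneg_right h7 (wt_pos _ _).le
    _ = (|Real.log d| + Real.log (1 + δ) + 1 / (κ / 2) + 5) *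
          (Y ^ (κ / 2) * wt (κ / 2) w.im) * wt (κ / 2) w.im := by rw [h8]; ring
    _ = _ := by rw [h9, mul_one]

theorem tendsto_wt_closedBox {κ δ : ℝ} (hκ : 0 < κ) :
    Tendsto (fun w : ℂ => wt κ w.im) (Bornology.cobounded ℂ ⊓ 𝓟 (closedBox δ)) (𝓝 0) := by
  have h1 : Tendsto (fun w : ℂ => 1 + |w.im|) (Bornology.cobounded ℂ ⊓ 𝓟 (closedBox δ)) atTop := by
    refine tendsto_atTop_mono' (f₁ := fun w : ℂ => ‖w‖ - δ) _ ?_ ?_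
    · refine Filter.mem_inf_of_right fun w hw => ?_
      have := Complex.norm_le_abs_re_add_abs_im w
      have := hw.1
      simp only [mem_ofPred_eq]
      linarith
    · exact tendsto_atTop_add_const_right _ _ (tendsto_norm_cobounded_atTop.mono_left inf_le_left)
  exact (tendsto_rpow_neg_atTop hκ).comp h1

section

variable {ι : Type*} [Finite ι] {c : ι → ℂ} {H L : ι → ℂ → 𝔸} {U : ℂ → 𝔸} {j : ι} {S : Set ℂ}

/-- Off the cut the power tends to `1` up the cut, since the decay of `L j` beats the logarithm; on the
cut the values are limits of values off the cut. -/
theorem CutNhd.tendsto_regPart_one (hS : CutNhd c H L j S) (hU : RHSol c H L U) {κ δ C : ℝ}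
    (hκ : 0 < κ) (hδ : 0 < δ) (hsub : ∀ w ∈ closedBox δ, c j + w ∈ S)
    (hL : ∀ w ∈ closedBox δ, ‖L j (c j + w)‖ ≤ C * wt κ w.im) :
    Tendsto (fun w => regPart c L U j (c j + w)) (Bornology.cobounded ℂ ⊓ 𝓟 (closedBox δ))
      (𝓝 1) := by
  obtain ⟨C', hC', hlog⟩ := exists_log_mul_wt_le hκ one_pos hδ.le
  set l := Bornology.cobounded ℂ ⊓ 𝓟 (closedBox δ) with hl
  set T : Set ℂ := {w | c j + w ∈ cutC c} with hT
  have hC0 : 0 ≤ C := by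
    have := hL 0 ⟨by simpa using hδ.le, by simpa using hδ.le⟩
    have h1 := (norm_nonneg _).trans this
    exact nonneg_of_mul_nonneg_left h1 (wt_pos _ _)
  have hadd : Tendsto (fun w => c j + w) (l ⊓ 𝓟 T) (Bornology.cobounded ℂ ⊓ 𝓟 (cutC c)) := by
    refine tendsto_inf.2 ⟨?_, tendsto_principal.2 (Filter.mem_inf_of_right fun w hw => hw)⟩
    rw [← tendsto_norm_atTop_iff_cobounded]
    refine tendsto_atTop_mono (f := fun w : ℂ => ‖w‖ - ‖c j‖) (fun w => ?_) ?_
    · have := norm_sub_le (c j + w) (c j)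
      rw [add_sub_cancel_left] at this
      linarith
    · exact tendsto_atTop_add_const_right _ _ (tendsto_norm_cobounded_atTop.mono_left
        (inf_le_left.trans inf_le_left))
  have h1 := hU.tendsto_one.comp hadd
  have hbig : ∀ᶠ w in l, 1 ≤ ‖w‖ :=
    (tendsto_norm_cobounded_atTop.mono_left inf_le_left).eventually_ge_atTop 1
  have h2 : Tendsto (fun w => ex (-(lc w)) (L j (c j + w))) l (𝓝 1) := by
    rw [tendsto_iff_norm_sub_tendsto_zero]
    have h3 : Tendsto (fun w : ℂ => Real.exp (C * (C' * wt (κ / 2) w.im)) - 1) l (𝓝 0) := by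
      have := ((tendsto_wt_closedBox (δ := δ) (half_pos hκ)).const_mul C').const_mul C
      rw [mul_zero, mul_zero] at this
      have := ((Real.continuous_exp.tendsto 0).comp this).sub_const 1
      rw [Real.exp_zero, sub_self] at this
      exact this
    refine squeeze_zero' (Eventually.of_forall fun _ => norm_nonneg _) ?_ h3
    filter_upwards [hbig, (mem_inf_of_right (mem_principal_self _) : closedBox δ ∈ l)] with w hw hwb
    refine (norm_ex_sub_one_le _ _).trans (sub_le_sub_right (Real.exp_le_exp.2 ?_) 1)
    rw [norm_neg]
    calc _ ≤ (|Real.log ‖w‖| + 5) * (C * wt κ w.im) :=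
          mul_le_mul (norm_lc_le w) (hL w hwb) (norm_nonneg _) (by positivity)
      _ = C * ((|Real.log ‖w‖| + 5) * wt κ w.im) := by ring
      _ ≤ _ := mul_le_mul_of_nonneg_left (hlog w hwb.1 hw) hC0
  have h3 : Tendsto (fun w => regPart c L U j (c j + w)) (l ⊓ 𝓟 T) (𝓝 1) := by
    refine (mul_one (1 : 𝔸) ▸ h1.mul (h2.mono_left (inf_le_left : l ⊓ 𝓟 T ≤ l))).congr' ?_
    filter_upwards [mem_inf_of_left (mem_inf_of_right (mem_principal_self _) : closedBox δ ∈ l),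
      mem_inf_of_right (mem_principal_self _)] with w hw hwT
    rw [hS.regPart_eq hU.toRHJump (hsub w hw) hwT]
    simp
  -- the values on the cut are limits of values off the cut
  rw [Metric.tendsto_nhds]
  intro e he
  have h4 := Metric.tendsto_nhds.1 h3 (e / 2) (by positivity)
  rw [eventually_inf_principal, hl, eventually_inf_principal] at h4
  obtain ⟨R, -, hR⟩ := (Filter.hasBasis_cobounded_norm (E := ℂ)).eventually_iff.1 h4
  rw [hl, eventually_inf_principal]
  refine (Filter.hasBasis_cobounded_norm (E := ℂ)).eventually_iff.2 ⟨R + 1, trivial, fun w hw hwb => ?_⟩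
  have hw' : R + 1 ≤ ‖w‖ := hw
  by_cases hwT : w ∈ T
  · exact (hR (by simp only [mem_ofPred_eq]; linarith) hwb hwT).trans (by linarith)
  have hwo : w ∈ openBox δ := by
    have h5 : ¬((c j + w).re ≠ (c j).re ∨ (c j + w).im < (c j).im) := fun h =>
      hwT (hS.mem_cutC (hsub w hwb) h)
    push Not at h5
    simp at h5
    exact ⟨by rw [h5.1]; simpa using hδ, by linarith⟩
  have hcont : Tendsto (fun w => regPart c L U j (c j + w)) (𝓝 w) (𝓝 (regPart c L U j (c j + w))) :=
    ((hS.differentiableOn_regPart hU).differentiableAt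
      (hS.isOpen.mem_nhds (hsub w hwb))).continuousAt.tendsto.comp
        ((continuous_const.add continuous_id).tendsto w)
  have hne : (𝓝[T] w).NeBot := by
    rw [← mem_closure_iff_nhdsWithin_neBot]
    have := cutC_dense c (c j + w)
    rw [mem_closure_iff_seq_limit] at this ⊢
    obtain ⟨x, hx, hlim⟩ := this
    refine ⟨fun n => x n - c j, fun n => by simpa [hT] using hx n, ?_⟩
    simpa using hlim.sub_const (c j)
  have hle : dist (regPart c L U j (c j + w)) 1 ≤ e / 2 := by
    refine le_of_tendsto (((hcont.mono_left nhdsWithin_le_nhds) :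
      Tendsto _ (𝓝[T] w) _).dist tendsto_const_nhds) ?_
    have hO : {w : ℂ | R < ‖w‖} ∈ 𝓝 w :=
      (isOpen_lt continuous_const continuous_norm).mem_nhds (by simp only [mem_ofPred_eq]; linarith)
    filter_upwards [self_mem_nhdsWithin, nhdsWithin_le_nhds hO,
      nhdsWithin_le_nhds ((isOpen_openBox δ).mem_nhds hwo)] with v hv hv2 hv3
    exact (hR (le_of_lt hv2) (openBox_subset_closedBox _ hv3) hv).le
  linarith

/-- The local factor and its inverse are bounded near the whole cut. -/
theorem CutNhd.exists_regPart_bound (hS : CutNhd c H L j S) (hU : RHSol c H L U) {κ δ C : ℝ}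
    (hκ : 0 < κ) (hδ : 0 < δ) (hsub : ∀ w ∈ closedBox δ, c j + w ∈ S)
    (hL : ∀ w ∈ closedBox δ, ‖L j (c j + w)‖ ≤ C * wt κ w.im) :
    ∃ B, ∀ w ∈ closedBox δ, ‖regPart c L U j (c j + w)‖ ≤ B ∧
      ‖Ring.inverse (regPart c L U j (c j + w))‖ ≤ B := by
  have h1 := hS.tendsto_regPart_one hU hκ hδ hsub hL
  have hc : ContinuousOn (fun w => regPart c L U j (c j + w)) (closedBox δ) :=
    (hS.differentiableOn_regPart hU).continuousOn.comp (by fun_prop) hsub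
  have h2 := (continuousAt_ringInverse (isUnit_one (M := 𝔸))).tendsto.comp h1
  have hc2 : ContinuousOn (fun w => Ring.inverse (regPart c L U j (c j + w))) (closedBox δ) :=
    fun w hw => ContinuousAt.comp_continuousWithinAt (g := Ring.inverse)
      (f := fun w => regPart c L U j (c j + w))
      (continuousAt_ringInverse (hS.isUnit_regPart hU (hsub w hw))) (hc w hw)
  obtain ⟨B, hB⟩ := exists_bound_of_tendsto (isClosed_closedBox δ) hc h1
  obtain ⟨B', hB'⟩ := exists_bound_of_tendsto (isClosed_closedBox δ) hc2 h2
  exact ⟨max B B', fun w hw => ⟨(hB w hw).trans (le_max_left _ _),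
    (hB' w hw).trans (le_max_right _ _)⟩⟩

end

/-- Away from the cut `lc` is Lipschitz: the segment from `w` to `w - β` avoids the cut and its end point. -/
theorem norm_lc_sub_le {δ : ℝ} (hδ : 0 < δ) {w β : ℂ} (hw : w ∉ closedBox δ) (hβ : ‖β‖ ≤ δ / 2) :
    ‖lc (w - β) - lc w‖ ≤ 2 / δ * ‖β‖ := by
  have hnot : ∀ t ∈ Icc (0 : ℝ) 1, w - t * β ∉ closedBox (δ / 2) := by
    intro t ht h
    apply hw
    have h1 : ‖(t : ℂ) * β‖ ≤ δ / 2 := by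
      rw [norm_mul, norm_real, Real.norm_of_nonneg ht.1]
      exact (mul_le_of_le_one_left (norm_nonneg _) ht.2).trans hβ
    have h2 := (abs_re_le_norm ((t : ℂ) * β)).trans h1
    have h3 := (abs_im_le_norm ((t : ℂ) * β)).trans h1
    have h4 := h.1
    have h5 := h.2
    rw [sub_re] at h4
    rw [sub_im] at h5
    exact ⟨by grind, by grind⟩
  have hd : ∀ t ∈ Icc (0 : ℝ) 1, HasDerivAt (fun t : ℝ => lc (w - t * β))
      ((w - t * β)⁻¹ / (2 * Real.pi * I) * (-β)) t := by
    intro t ht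
    have h1 : (w - t * β).re ≠ 0 ∨ (w - t * β).im < 0 := by
      by_contra! h
      exact hnot t ht ⟨by rw [h.1]; simpa using (half_pos hδ).le, by linarith [h.2]⟩
    have h2 : HasDerivAt (fun t : ℝ => w - t * β) (-β) t := by
      simpa using (((hasDerivAt_id t).ofReal_comp).mul_const β).const_sub w
    exact (hasDerivAt_lc h1).comp t h2
  have hb : ∀ t ∈ Icc (0 : ℝ) 1, ‖(w - t * β)⁻¹ / (2 * Real.pi * I) * (-β)‖ ≤ 2 / δ * ‖β‖ := by
    intro t ht
    have h1 : δ / 2 ≤ ‖w - t * β‖ := by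
      by_contra! h
      exact hnot t ht ⟨(abs_re_le_norm _).trans h.le, by
        have := (abs_le.1 ((abs_im_le_norm (w - t * β)).trans h.le)).1; linarith⟩
    rw [norm_mul, norm_neg, div_eq_mul_inv, norm_mul]
    refine mul_le_mul_of_nonneg_right ?_ (norm_nonneg _)
    have h2 : ‖(w - t * β)⁻¹‖ ≤ 2 / δ := by
      rw [norm_inv, inv_le_comm₀ (by linarith) (by positivity), inv_div]
      exact h1
    calc _ ≤ 2 / δ * 1 := mul_le_mul h2 norm_two_pi_I_inv_le (norm_nonneg _) (by positivity)
      _ = _ := mul_one _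
  have := norm_image_sub_le_of_norm_deriv_le_segment_01' (f := fun t : ℝ => lc (w - t * β))
    (fun t ht => (hd t ht).hasDerivWithinAt) (fun t ht => hb t (Ico_subset_Icc_self ht))
  simpa using this

end

section

/-! ### Solutions for neighbouring parameters -/

/-- A function with power decay is dominated by a multiple of the weight on boxes. -/
theorem DecaysOn.exists_wt_bound {E : Type*} [NormedAddCommGroup E] {S : Set ℂ} {f : ℂ → E}
    {κ δ : ℝ} (h : DecaysOn S κ f) (hκ : 0 ≤ κ) (hf : ContinuousOn f S) {a : ℂ}
    (ha : ∀ w ∈ closedBox δ, a + w ∈ S) :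
    ∃ C, 0 ≤ C ∧ ∀ w ∈ closedBox δ, ‖f (a + w)‖ ≤ C * wt κ w.im := by
  obtain ⟨C, R, hR, H⟩ := h
  set R' := max (R + |a.im|) (2 * |a.im| + 1) with hR'
  have hR1 : R + |a.im| ≤ R' := le_max_left _ _
  have hR2 : 2 * |a.im| + 1 ≤ R' := le_max_right _ _
  have ha0 := abs_nonneg a.im
  obtain ⟨C', hC'⟩ := ((isCompact_closedBall (0 : ℂ) (δ + δ + R')).inter_left
    (isClosed_closedBox δ)).exists_bound_of_continuousOn
    (f := fun w => f (a + w)) (hf.comp (by fun_prop) fun w hw => ha w hw.1)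
  have e1 : 0 < (1 + (|δ| + R')) ^ κ := by positivity
  refine ⟨max (|C'| * (1 + (|δ| + R')) ^ κ) (|C| * 4 ^ κ), by positivity, fun w hw => ?_⟩
  rcases le_total w.im R' with h1 | h1
  · have h2 := hC' w ⟨hw, by
      rw [mem_closedBall_zero_iff]
      have := Complex.norm_le_abs_re_add_abs_im w
      have h3 : |w.im| ≤ δ + R' := by
        have hδ : 0 ≤ δ := (abs_nonneg _).trans hw.1
        rw [abs_le]; constructor <;> linarith [hw.2]
      linarith [hw.1]⟩
    have h3 : |w.im| ≤ |δ| + R' := by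
      have := le_abs_self δ
      rw [abs_le]; constructor <;> linarith [hw.2, abs_nonneg δ]
    calc _ ≤ |C'| * 1 := by rw [mul_one]; exact h2.trans (le_abs_self _)
      _ ≤ |C'| * ((1 + (|δ| + R')) ^ κ * wt κ w.im) :=
          mul_le_mul_of_nonneg_left (one_le_mul_wt hκ h3) (abs_nonneg _)
      _ = (|C'| * (1 + (|δ| + R')) ^ κ) * wt κ w.im := by ring
      _ ≤ _ := mul_le_mul_of_nonneg_right (le_max_left _ _) (wt_pos _ _).le
  · have h2 := H (a + w) (ha w hw) (by rw [add_im]; linarith [neg_abs_le a.im])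
    have h3 : (1 + |w.im|) / 4 ≤ (a + w).im := by
      rw [abs_of_nonneg (by linarith), add_im]
      linarith [neg_abs_le a.im]
    have h4 : (a + w).im ^ (-κ) ≤ 4 ^ κ * wt κ w.im := by
      calc _ ≤ ((1 + |w.im|) / 4) ^ (-κ) :=
            Real.rpow_le_rpow_of_nonpos (by positivity) h3 (by linarith)
        _ = _ := by
            rw [Real.div_rpow (by positivity) (by norm_num), wt, Real.rpow_neg (by norm_num : (0:ℝ) ≤ 4)]
            field_simp
    have h0 : 0 ≤ (a + w).im ^ (-κ) := Real.rpow_nonneg (by grind) _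
    calc _ ≤ |C| * (a + w).im ^ (-κ) := h2.trans (mul_le_mul_of_nonneg_right (le_abs_self _) h0)
      _ ≤ |C| * (4 ^ κ * wt κ w.im) := mul_le_mul_of_nonneg_left h4 (abs_nonneg _)
      _ = (|C| * 4 ^ κ) * wt κ w.im := by ring
      _ ≤ _ := mul_le_mul_of_nonneg_right (le_max_right _ _) (wt_pos _ _).le

/-- The data of the family of Riemann–Hilbert problems: logarithms `L j` of the jumps on disjoint
half-strips, with power decay at infinity. -/
structure StripData {ι : Type*} (ε κ : ℝ) (k : ι → ℂ) (H L : ι → ℂ → 𝔸) : Prop where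
  eps_pos : 0 < ε
  sep : ∀ i j, i ≠ j → 2 * ε ≤ |(k i).re - (k j).re|
  log_holo : ∀ j, DifferentiableOn ℂ (L j) (halfStripAt ε (k j))
  exp_log : ∀ j, ∀ z ∈ halfStripAt ε (k j), ex 1 (L j z) = H j z
  pos : 0 < κ
  le_one : κ ≤ 1
  decay : ∀ j, DecaysOn (halfStripAt ε (k j)) κ (L j)

theorem isOpen_halfStripAt (ε : ℝ) (a : ℂ) : IsOpen (halfStripAt ε a) := by
  have h1 : IsOpen {z : ℂ | |(z - a).re| < ε} := isOpen_lt (by fun_prop) continuous_const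
  have h2 : IsOpen {z : ℂ | 0 < (z - a).im} := isOpen_lt continuous_const (by fun_prop)
  exact h1.inter h2

section

variable {ι : Type*} {ε κ : ℝ} {k : ι → ℂ} {H L : ι → ℂ → 𝔸}

theorem StripData.cutNhd (h : StripData ε κ k H L) {b : ℂ} (hb : b ∈ halfStrip ε) (j : ι) :
    CutNhd (fun j => k j + b) H L j (halfStripAt ε (k j)) := by
  refine ⟨isOpen_halfStripAt _ _, fun z hz i hij => Or.inl fun hre => ?_, h.log_holo j,
    fun z hz _ => h.exp_log j z hz⟩
  have h1 := h.sep i j hij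
  have h2 := hz.1
  have h3 := hb.1
  rw [add_re] at hre
  rw [sub_re, hre] at h2
  grind

theorem add_mem_closedBox {δ δ' δ'' : ℝ} {w β : ℂ} (hw : w ∈ closedBox δ) (hβ : ‖β‖ ≤ δ')
    (h : δ + δ' ≤ δ'') : w + β ∈ closedBox δ'' := by
  have := (abs_le.1 (abs_im_le_norm β)).1
  exact ⟨by rw [add_re]; linarith [abs_add_le w.re β.re, hw.1, abs_re_le_norm β],
    by rw [add_im]; linarith [hw.2]⟩

theorem lc_ne_of_notMem_closedBox {δ : ℝ} {w β : ℂ} (hw : w ∉ closedBox δ) (hβ : ‖β‖ ≤ δ) :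
    (w - β).re ≠ 0 ∨ (w - β).im < 0 := by
  by_contra! h
  have h1 := (abs_re_le_norm β).trans hβ
  have h2 := (abs_le.1 ((abs_im_le_norm β).trans hβ)).1
  rw [sub_re, sub_im] at h
  exact hw ⟨by rwa [sub_eq_zero.1 h.1], by linarith [h.2]⟩

theorem notMem_closedBox_of_sep {δ δ' : ℝ} (hsep : ∀ i j, i ≠ j → 2 * δ ≤ |(k i).re - (k j).re|)
    {b w : ℂ} {j : ι} (hw : w ∈ openBox δ) (hw' : w ∉ closedBox δ') (hδ : δ' < δ) (i : ι) :
    k j + b + w - (k i + b) ∉ closedBox δ' := fun hi => by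
  rcases eq_or_ne j i with rfl | hij
  · exact hw' (by simpa using hi)
  · exact box_disjoint (c := k j + b) (c' := k i + b) (z := k j + b + w)
      (by simpa using hsep j i hij) (by simpa using hw) (closedBox_subset_openBox hδ hi)

theorem mem_halfStripAt_of_closedBox {ε δ : ℝ} {a b w : ℂ} (h1 : |b.re| + δ < ε) (h2 : δ < b.im)
    (hw : w ∈ closedBox δ) : a + b + w ∈ halfStripAt ε a := by
  have e : a + b + w - a = b + w := by ring
  have h3 := abs_add_le b.re w.re
  refine ⟨?_, ?_⟩
  · rw [e, add_re]; linarith [hw.1]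
  · rw [e, add_im]; linarith [hw.2]

theorem cutC_of_notMem_closedBox {δ : ℝ} {b b₀ z : ℂ} (hb : ‖b - b₀‖ ≤ δ)
    (hz : ∀ j, z - (k j + b₀) ∉ closedBox δ) : z ∈ cutC fun j => k j + b := by
  refine mem_cutC_iff.2 fun j => ?_
  have := lc_ne_of_notMem_closedBox (hz j) hb
  rwa [show z - (k j + b₀) - (b - b₀) = z - (k j + b) by ring, sub_re, sub_im, sub_ne_zero,
    sub_neg] at this

/-- A quotient of two local factorizations with the same logarithm: the powers combine to one whose
exponent `a - a₀` is small, conjugated by the local factor of the denominator. -/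
theorem jump_factorization {x y Φ Φ₀ A : 𝔸} {a a₀ : ℂ} (hΦ₀ : IsUnit Φ₀) (hx : x = Φ * ex a A)
    (hy : y = Φ₀ * ex a₀ A) : x * Ring.inverse y =
      Φ * Ring.inverse Φ₀ * (Φ₀ * ex (a - a₀) A * Ring.inverse Φ₀) := by
  obtain ⟨u, rfl⟩ := hΦ₀
  have hyu : y = (u * ⟨ex a₀ A, ex (-a₀) A, ex_mul_ex_neg a₀ A, ex_neg_mul_ex a₀ A⟩ : 𝔸ˣ) := by
    rw [hy]; rfl
  rw [hyu, Ring.inverse_unit, Ring.inverse_unit, mul_inv_rev, hx, sub_eq_add_neg, ex_add]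
  have : (↑(⟨ex a₀ A, ex (-a₀) A, ex_mul_ex_neg a₀ A, ex_neg_mul_ex a₀ A⟩ : 𝔸ˣ)⁻¹ : 𝔸) =
    ex (-a₀) A := rfl
  rw [Units.val_mul, this]
  simp only [mul_assoc, Units.inv_mul_cancel_left]

theorem norm_conj_sub_one_le {u A : 𝔸} {a : ℂ} (hu : IsUnit u) {B x : ℝ} (h1 : ‖u‖ ≤ B)
    (h2 : ‖Ring.inverse u‖ ≤ B) (hx : ‖a‖ * ‖A‖ ≤ x) (hx1 : x ≤ 1) :
    ‖u * ex a A * Ring.inverse u - 1‖ ≤ B * B * (2 * x) := by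
  have e : u * ex a A * Ring.inverse u - 1 = u * (ex a A - 1) * Ring.inverse u := by
    rw [mul_sub, sub_mul, mul_one, Ring.mul_inverse_cancel u hu]
  have hB : 0 ≤ B := (norm_nonneg _).trans h1
  have hx0 : 0 ≤ x := (by positivity : 0 ≤ ‖a‖ * ‖A‖).trans hx
  have h3 : ‖ex a A - 1‖ ≤ 2 * x := (norm_ex_sub_one_le a A).trans
    ((sub_le_sub_right (Real.exp_le_exp.2 hx) 1).trans (real_exp_sub_one_le hx0 hx1))
  rw [e]
  calc _ ≤ ‖u‖ * ‖ex a A - 1‖ * ‖Ring.inverse u‖ :=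
        (norm_mul_le _ _).trans (mul_le_mul_of_nonneg_right (norm_mul_le _ _) (norm_nonneg _))
    _ ≤ B * (2 * x) * B := by gcongr
    _ = _ := by ring

theorem RHSol.tendsto_down [Finite ι] {c : ι → ℂ} {U : ℂ → 𝔸} (hU : RHSol c H L U) :
    Tendsto (fun T : ℝ => U (-T * I)) atTop (𝓝 1) := by
  refine hU.tendsto_one.comp (tendsto_inf.2 ⟨?_, tendsto_principal.2 ?_⟩)
  · rw [← tendsto_norm_atTop_iff_cobounded]
    refine tendsto_atTop_mono (f := fun T : ℝ => T) (fun T => ?_) tendsto_id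
    simpa using le_abs_self T
  · filter_upwards [eventually_all.2 fun j => eventually_gt_atTop (-(c j).im)] with T hT
    rw [mem_cutC_iff]
    intro j
    have := hT j
    right
    simp
    linarith

theorem isClosed_outer [Finite ι] (c : ι → ℂ) (δ : ℝ) : IsClosed {z | ∀ j, z - c j ∉ openBox δ} := by
  simp only [ofPred_forall]
  exact isClosed_iInter fun j => (isOpen_openBox δ).isClosed_compl.preimage (by fun_prop)

theorem RHSol.inverse_tendsto_one {c : ι → ℂ} {U : ℂ → 𝔸} (hU : RHSol c H L U) :
    Tendsto (fun z => Ring.inverse (U z)) (Bornology.cobounded ℂ ⊓ 𝓟 (cutC c)) (𝓝 1) := by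
  simpa [Function.comp_def] using
    (continuousAt_ringInverse (isUnit_one (M := 𝔸))).tendsto.comp hU.tendsto_one

variable [Fintype ι]

/-- Near `b₀` the quotients of the solutions for the parameters `b` and `b₀` form a family of
problems with small jumps on fixed hairpins of width proportional to `Δ`. -/
theorem StripData.exists_hairpinProblem (h : StripData ε κ k H L) {B : Set ℂ}
    (hB : B ⊆ halfStrip ε) {U : ℂ → ℂ → 𝔸} (hU : ∀ b ∈ B, RHSol (fun j => k j + b) H L (U b))
    {b₀ : ℂ} (hb₀ : b₀ ∈ B) {Δ η : ℝ} (hΔ : 0 < Δ) (hΔ1 : |b₀.re| + 5 * Δ < ε) (hΔ2 : 5 * Δ < b₀.im)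
    (hη : 0 < η) (Φ : ℂ → ι → ℂ → 𝔸)
    (hΦ : Φ = fun b j => regPart (fun j => k j + b) L (U b) j) (M : ℂ → ι → ℂ → 𝔸)
    (hM : M = fun b j w => Φ b₀ j (k j + b₀ + w) *
      ex (lc (w - (b - b₀)) - lc w) (L j (k j + b₀ + w)) * Ring.inverse (Φ b₀ j (k j + b₀ + w))) :
    ∃ r > 0, r ≤ Δ / 2 ∧
      (∀ b ∈ ball b₀ r, ∀ j, ContinuousOn (M b j) (openBox (4 * Δ) \ closedBox Δ)) ∧
      (∀ b ∈ ball b₀ r, ∀ j, ∀ w ∈ openBox (4 * Δ) \ closedBox Δ,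
        ‖M b j w - 1‖ ≤ η * wt κ w.im) ∧
      (∀ j, ∀ w ∈ openBox (4 * Δ) \ closedBox Δ,
        DifferentiableOn ℂ (fun b => M b j w) (ball b₀ r)) ∧
      ∀ b ∈ B ∩ ball b₀ r, HairpinProblem (fun j => k j + b₀) Δ (2 * Δ) (3 * Δ) (4 * Δ) κ η
        (fun z => U b z * Ring.inverse (U b₀ z))
        (fun j z => Φ b j z * Ring.inverse (Φ b₀ j z)) (M b) := by
  have hmem : ∀ j, ∀ w ∈ closedBox (5 * Δ), k j + b₀ + w ∈ halfStripAt ε (k j) := fun j w hw =>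
    mem_halfStripAt_of_closedBox hΔ1 hΔ2 hw
  have hsub4 : openBox (4 * Δ) ⊆ closedBox (5 * Δ) := (openBox_subset_closedBox _).trans
    ((closedBox_subset_openBox (by linarith)).trans (openBox_subset_closedBox _))
  have hsub : openBox (4 * Δ) \ closedBox Δ ⊆ closedBox (5 * Δ) := sdiff_subset.trans hsub4
  have hmem4 : ∀ j z, z - (k j + b₀) ∈ openBox (4 * Δ) → z ∈ halfStripAt ε (k j) := by
    intro j z hz
    simpa using hmem j _ (hsub4 hz)
  have hcut := fun b (hb : b ∈ B) j => h.cutNhd (hB hb) j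
  choose C hC0 hC using fun j => (h.decay j).exists_wt_bound h.pos.le (h.log_holo j).continuousOn
    (hmem j)
  choose BΦ hBΦ using fun j => (hcut b₀ hb₀ j).exists_regPart_bound (hU b₀ hb₀) h.pos
    (by linarith : 0 < 5 * Δ) (hmem j) (hC j)
  have hunit : ∀ b ∈ B, ∀ j, ∀ z ∈ halfStripAt ε (k j), IsUnit (Φ b j z) := fun b hb j z hz => by
    rw [hΦ]; exact (hcut b hb j).isUnit_regPart (hU b hb) hz
  have hhol : ∀ b ∈ B, ∀ j, DifferentiableOn ℂ (Φ b j) (halfStripAt ε (k j)) := fun b hb j => by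
    rw [hΦ]; exact (hcut b hb j).differentiableOn_regPart (hU b hb)
  have hBΦ' : ∀ j, ∀ w ∈ closedBox (5 * Δ), ‖Φ b₀ j (k j + b₀ + w)‖ ≤ BΦ j ∧
      ‖Ring.inverse (Φ b₀ j (k j + b₀ + w))‖ ≤ BΦ j := fun j w hw => by
    rw [hΦ]; exact hBΦ j w hw
  -- `r` is so small that the exponents stay below `1` and the jumps below `η`
  have hev : ∀ {f : ℝ → ℝ} {c : ℝ}, Continuous f → f 0 < c → ∀ᶠ r in 𝓝[>] 0, f r ≤ c :=
    fun hf h0 => nhdsWithin_le_nhds ((hf.tendsto 0).eventually_le_const h0)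
  obtain ⟨r, ⟨⟨hr1, hr2⟩, hr3⟩, hr0 : 0 < r⟩ := ((((hev continuous_id (half_pos hΔ)).and
    (eventually_all.2 fun j => hev (f := fun r => 2 / Δ * r * C j) (by fun_prop)
      (by simp : _ < (1 : ℝ)))).and (eventually_all.2 fun j =>
    hev (f := fun r => BΦ j * BΦ j * (2 * (2 / Δ * r * C j))) (by fun_prop)
      (by simpa using hη))).and (self_mem_nhdsWithin (s := Ioi 0))).exists
  have hβ : ∀ b ∈ ball b₀ r, ‖b - b₀‖ ≤ Δ / 2 := fun b hb => by
    rw [← dist_eq_norm]; exact (mem_ball.1 hb).le.trans hr1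
  have hcl : ∀ {w b}, w ∉ closedBox Δ → b ∈ ball b₀ r → (w - (b - b₀)).re ≠ 0 ∨
    (w - (b - b₀)).im < 0 := fun hw hb =>
      lc_ne_of_notMem_closedBox hw ((hβ _ hb).trans (half_le_self hΔ.le))
  have hcont : ∀ b ∈ ball b₀ r, ∀ j, ContinuousOn (M b j) (openBox (4 * Δ) \ closedBox Δ) := by
    intro b hb j
    have h1 : ContinuousOn (fun w => Φ b₀ j (k j + b₀ + w)) (openBox (4 * Δ) \ closedBox Δ) :=
      (hhol b₀ hb₀ j).continuousOn.comp (by fun_prop) fun w hw => hmem j w (hsub hw)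
    have h2 : ContinuousOn (fun w => L j (k j + b₀ + w)) (openBox (4 * Δ) \ closedBox Δ) :=
      (h.log_holo j).continuousOn.comp (by fun_prop) fun w hw => hmem j w (hsub hw)
    have h3 : ContinuousOn (fun w => Ring.inverse (Φ b₀ j (k j + b₀ + w)))
        (openBox (4 * Δ) \ closedBox Δ) := fun w hw =>
      ContinuousAt.comp_continuousWithinAt (g := Ring.inverse)
        (f := fun w => Φ b₀ j (k j + b₀ + w))
        (continuousAt_ringInverse (hunit b₀ hb₀ j _ (hmem j w (hsub hw)))) (h1 w hw)
    have h4 : ContinuousOn (fun w => lc (w - (b - b₀)) - lc w) (openBox (4 * Δ) \ closedBox Δ) := by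
      intro w hw
      have e1 := (hasDerivAt_lc (hcl hw.2 hb)).continuousAt
      have e2 := (hasDerivAt_lc (by simpa using hcl hw.2 (mem_ball_self hr0) :
        w.re ≠ 0 ∨ w.im < 0)).continuousAt
      exact ((ContinuousAt.comp (f := fun w : ℂ => w - (b - b₀)) e1
        (by fun_prop)).sub e2).continuousWithinAt
    rw [hM]
    exact (h1.mul (continuous_exp_complex.comp_continuousOn (h4.smul h2))).mul h3
  have hsmall : ∀ b ∈ ball b₀ r, ∀ j, ∀ w ∈ openBox (4 * Δ) \ closedBox Δ,
        ‖M b j w - 1‖ ≤ η * wt κ w.im := by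
    intro b hb j w hw
    have hbr : ‖b - b₀‖ ≤ r := by rw [← dist_eq_norm]; exact (mem_ball.1 hb).le
    obtain ⟨h1, h2⟩ := hBΦ' j w (hsub hw)
    have h3 : ‖lc (w - (b - b₀)) - lc w‖ * ‖L j (k j + b₀ + w)‖ ≤
        2 / Δ * r * C j * wt κ w.im := by
      calc _ ≤ (2 / Δ * r) * (C j * wt κ w.im) := by
            refine mul_le_mul ((norm_lc_sub_le hΔ hw.2 (hβ b hb)).trans ?_) (hC j w (hsub hw))
              (norm_nonneg _) (by positivity)
            exact mul_le_mul_of_nonneg_left hbr (by positivity)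
        _ = _ := by ring
    have hx0 : 0 ≤ 2 / Δ * r * C j := mul_nonneg (by positivity) (hC0 j)
    have h4 : 2 / Δ * r * C j * wt κ w.im ≤ 1 :=
      (mul_le_of_le_one_right hx0 (wt_le_one h.pos.le _)).trans (hr2 j)
    rw [hM]
    refine (norm_conj_sub_one_le (hunit b₀ hb₀ j _ (hmem j w (hsub hw))) h1 h2 h3 h4).trans ?_
    calc _ = BΦ j * BΦ j * (2 * (2 / Δ * r * C j)) * wt κ w.im := by ring
      _ ≤ _ := mul_le_mul_of_nonneg_right (hr3 j) (wt_pos _ _).le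
  refine ⟨r, hr0, hr1, hcont, hsmall, fun j w hw => ?_, fun b hb => ?_⟩
  · rw [hM]
    refine ((differentiableOn_const _).mul (DifferentiableOn.ex ?_ (differentiableOn_const _))).mul
      (differentiableOn_const _)
    intro b hb
    have e1 := (hasDerivAt_lc (hcl hw.2 hb)).differentiableAt
    exact ((DifferentiableAt.comp (f := fun b : ℂ => w - (b - b₀)) b e1
      (by fun_prop)).sub_const _).differentiableWithinAt
  have hbn : ‖b - b₀‖ ≤ Δ := (hβ b hb.2).trans (by linarith)
  have hsub0 : {z | ∀ j, z - (k j + b₀) ∉ closedBox Δ} ⊆ cutC fun j => k j + b := fun z hz =>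
    cutC_of_notMem_closedBox hbn hz
  have hsub1 : {z | ∀ j, z - (k j + b₀) ∉ closedBox Δ} ⊆ cutC fun j => k j + b₀ := fun z hz =>
    cutC_of_notMem_closedBox (by simpa using hΔ.le) hz
  have hVd : DifferentiableOn ℂ (fun z => U b z * Ring.inverse (U b₀ z))
      {z | ∀ j, z - (k j + b₀) ∉ closedBox Δ} :=
    ((hU b hb.1).holo.mono hsub0).mul (((hU b₀ hb₀).holo.mono hsub1).inverse
      fun z hz => (hU b₀ hb₀).unit z (hsub1 hz))
  have hV1 : {z | ∀ j, z - (k j + b₀) ∉ openBox (2 * Δ)} ⊆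
      {z | ∀ j, z - (k j + b₀) ∉ closedBox Δ} := fun z hz j hj =>
    hz j (closedBox_subset_openBox (by linarith) hj)
  refine ⟨hΔ.le, by linarith, by linarith, by linarith, h.pos, h.le_one, hη.le,
    fun i j hij => ?_, hVd, fun j => ?_, fun j w hw => ?_, hcont b hb.2, hsmall b hb.2, ?_,
    fun j => ?_, ?_⟩
  · rw [add_re, add_re, add_sub_add_right_eq_sub]
    have := h.sep i j hij
    linarith [abs_nonneg b₀.re]
  · exact ((hhol b hb.1 j).mono (hmem4 j)).mul (((hhol b₀ hb₀ j).mono (hmem4 j)).inverse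
      fun z hz => hunit b₀ hb₀ j z (hmem4 j z hz))
  · have hz : k j + b₀ + w ∈ {z | ∀ j, z - (k j + b₀) ∉ closedBox Δ} :=
      notMem_closedBox_of_sep (δ := 4 * Δ) (fun i j hij => by linarith [h.sep i j hij, abs_nonneg b₀.re])
        hw.1 hw.2 (by linarith)
    have hs := hmem j w (hsub hw)
    rw [hM]
    refine jump_factorization (hunit b₀ hb₀ j _ hs) ?_ ?_
    · rw [hΦ, (hcut b hb.1 j).eq_regPart_mul (hU b hb.1).toRHJump hs (hsub0 hz)]
      congr 3
      ring
    · rw [hΦ, (hcut b₀ hb₀ j).eq_regPart_mul (hU b₀ hb₀).toRHJump hs (hsub1 hz)]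
      congr 3
      ring
  · refine exists_bound_of_tendsto (v := 1) (isClosed_outer _ _) (hVd.continuousOn.mono hV1) ?_
    have h1 := (hU b hb.1).tendsto_one.mono_left (inf_le_inf_left (Bornology.cobounded ℂ)
      (principal_mono.2 (hV1.trans hsub0)))
    have h2 := (hU b₀ hb₀).inverse_tendsto_one.mono_left (inf_le_inf_left (Bornology.cobounded ℂ)
      (principal_mono.2 (hV1.trans hsub1)))
    simpa using h1.mul h2
  · -- a box about `k j + b₀` lies in a slightly larger one about `k j + b`
    have hmb : ∀ w ∈ closedBox (9 / 2 * Δ), k j + b + w ∈ halfStripAt ε (k j) := fun w hw => by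
      convert hmem j _ (add_mem_closedBox hw (hβ b hb.2) (by linarith)) using 1; ring
    obtain ⟨C', -, hC'⟩ := (h.decay j).exists_wt_bound h.pos.le (h.log_holo j).continuousOn hmb
    obtain ⟨B', hB'⟩ := (hcut b hb.1 j).exists_regPart_bound (hU b hb.1) h.pos (by positivity) hmb hC'
    refine ⟨|B'| * |BΦ j|, fun z hz => ?_⟩
    have h1 : z - (k j + b) ∈ closedBox (9 / 2 * Δ) := by
      convert add_mem_closedBox (δ'' := 9 / 2 * Δ) (openBox_subset_closedBox _ hz)
        ((norm_sub_rev b₀ b).trans_le (hβ b hb.2)) (by linarith) using 1; ring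
    have h2 := (hB' _ h1).1
    have h3 := (hBΦ' j (z - (k j + b₀)) (hsub4 hz)).2
    rw [add_sub_cancel] at h2 h3
    refine norm_mul_le_of_le ?_ (h3.trans (le_abs_self _))
    rw [hΦ]
    exact h2.trans (le_abs_self _)
  · simpa [Function.comp_def] using (hU b hb.1).tendsto_down.mul
      ((continuousAt_ringInverse (isUnit_one (M := 𝔸))).tendsto.comp (hU b₀ hb₀).tendsto_down)

end

end

section

/-! ### The differential equation with respect to the parameter -/

theorem cauchyBox_congr {E : Type*} [NormedAddCommGroup E] [NormedSpace ℂ E] {δ : ℝ} (hδ : 0 ≤ δ)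
    {f g : ℂ → E} (h : ∀ w ∈ closedBox δ \ openBox δ, f w = g w) (z : ℂ) :
    cauchyBox δ f z = cauchyBox δ g z := by
  rw [cauchyBox, cauchyBox, boxInt_congr hδ fun w hw => by rw [h w hw]]

/-- The Cauchy integral of a function with a simple pole inside the contour, at an outer point. -/
theorem cauchyBox_inv_smul {E : Type*} [NormedAddCommGroup E] [NormedSpace ℂ E] [CompleteSpace E]
    {G : ℂ → E} {δ₁ δ₂ κ : ℝ} (h1 : 0 < δ₁) (h12 : δ₁ < δ₂) (hκ0 : 0 < κ) (hκ1 : κ ≤ 1)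
    (hG : DifferentiableOn ℂ G (openBox δ₂)) (hd : DecaysOn (openBox δ₂) κ G) {u : ℂ}
    (hu : u ∉ closedBox δ₁) : cauchyBox δ₁ (fun w => w⁻¹ • G w) u = -(u⁻¹ • G 0) := by
  have hu0 : u ≠ 0 := by
    rintro rfl
    exact hu ⟨by simpa using h1.le, by simpa using h1.le⟩
  have h0mem : (0 : ℂ) ∈ openBox δ₁ := ⟨by simpa using h1, by simpa using h1⟩
  have hsub := closedBox_subset_openBox h12
  have hbd : ∀ w ∈ closedBox δ₁ \ openBox δ₁, w ≠ 0 ∧ w - u ≠ 0 := fun w hw =>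
    ⟨fun h => hw.2 (h ▸ h0mem), fun h => hu ((sub_eq_zero.1 h) ▸ hw.1)⟩
  have hdec : ∀ z, DecaysOn (closedBox δ₁) (1 + κ) (fun w => (w - z)⁻¹ • G w) := fun z =>
    (decaysOn_cauchy_kernel hd z).mono hsub
  have hhol : DifferentiableOn ℂ (fun w => (w - u)⁻¹ • G w) (closedBox δ₁) :=
    (DifferentiableOn.inv (by fun_prop) fun w hw h =>
      hu (by rwa [← sub_eq_zero.1 (h : w - u = 0)])).smul (hG.mono hsub)
  have e1 : boxInt δ₁ (fun w => (w - u)⁻¹ • w⁻¹ • G w) =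
      boxInt δ₁ (fun w => u⁻¹ • ((w - u)⁻¹ • G w) - u⁻¹ • ((w - 0)⁻¹ • G w)) := by
    refine boxInt_congr h1.le fun w hw => ?_
    obtain ⟨a, b⟩ := hbd w hw
    rw [sub_zero, smul_smul, smul_smul, smul_smul, ← sub_smul]
    congr 1
    field_simp
    ring
  have e2 := boxInt_eq_zero h1.le (by linarith : 1 < 1 + κ) hhol (hdec u)
  have e3 := cauchyBox_eq h1 h12 hκ0 hκ1 hG hd h0mem
  have c0 : ContinuousOn (fun w => (w - 0)⁻¹ • G w) (closedBox δ₁ \ openBox δ₁) :=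
    (ContinuousOn.inv₀ (by fun_prop) fun w hw h => (hbd w hw).1 (by simpa using h)).smul
      (hG.continuousOn.mono (sdiff_subset.trans hsub))
  have i1 : ∀ s, IntegrableOn (fun y => u⁻¹ • ((boxPt δ₁ s y - u)⁻¹ • G (boxPt δ₁ s y)))
      (boxDom δ₁ s) := fun s => Integrable.smul _ <|
    DecaysOn.integrableOn_box ((hdec u).mono sdiff_subset) (by linarith) h1.le
      (hhol.continuousOn.mono sdiff_subset) subset_rfl s
  have i2 : ∀ s, IntegrableOn (fun y => u⁻¹ • ((boxPt δ₁ s y - 0)⁻¹ • G (boxPt δ₁ s y)))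
      (boxDom δ₁ s) := fun s => Integrable.smul _ <|
    DecaysOn.integrableOn_box ((hdec 0).mono sdiff_subset) (by linarith) h1.le c0 subset_rfl s
  have e4 : ∀ z, boxInt δ₁ (fun w => u⁻¹ • ((w - z)⁻¹ • G w)) =
      u⁻¹ • boxInt δ₁ (fun w => (w - z)⁻¹ • G w) := by
    intro z
    simp only [boxInt, integral_smul, Finset.smul_sum]
    exact Finset.sum_congr rfl fun s _ => smul_comm _ _ _
  rw [cauchyBox, e1, boxInt_sub i1 i2, e4, e4, e2, smul_zero, zero_sub, smul_neg, ← e3, cauchyBox,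
    smul_comm]

section

variable {ι : Type*} [Fintype ι] {ε κ : ℝ} {k : ι → ℂ} {H L : ι → ℂ → 𝔸}

/-- The coefficients of the differential equation: `-Φ L Φ⁻¹ / (2πi)` at the end point of the
cut. -/
noncomputable def sCoef (k : ι → ℂ) (L : ι → ℂ → 𝔸) (U : ℂ → ℂ → 𝔸) (j : ι) (b : ℂ) : 𝔸 :=
  -((2 * Real.pi * I : ℂ)⁻¹ • (regPart (fun j => k j + b) L (U b) j (k j + b) * L j (k j + b) *
    Ring.inverse (regPart (fun j => k j + b) L (U b) j (k j + b))))

theorem eventually_small_box {b₀ : ℂ} (hb₀ : b₀ ∈ halfStrip ε) :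
    ∀ᶠ Δ : ℝ in 𝓝[>] 0, |b₀.re| + 5 * Δ < ε ∧ 5 * Δ < b₀.im := by
  have h1 : IsOpen {Δ : ℝ | |b₀.re| + 5 * Δ < ε} := isOpen_lt (by fun_prop) continuous_const
  have h2 : IsOpen {Δ : ℝ | 5 * Δ < b₀.im} := isOpen_lt (by fun_prop) continuous_const
  exact nhdsWithin_le_nhds (inter_mem (h1.mem_nhds (by simpa using hb₀.1))
    (h2.mem_nhds (by simpa using hb₀.2)))

theorem eventually_outside_box {c : ι → ℂ} {z : ℂ} (hz : z ∈ cutC c) :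
    ∀ᶠ Δ : ℝ in 𝓝[>] 0, ∀ j, z - c j ∉ openBox (3 * Δ) := by
  refine nhdsWithin_le_nhds (eventually_all.2 fun j => ?_)
  have hc : ContinuousAt (fun Δ : ℝ => 3 * Δ) 0 := by fun_prop
  rcases mem_cutC_iff.1 hz j with h | h
  · have h1 : 0 < |(z - c j).re| := abs_pos.2 (by rw [sub_re]; exact sub_ne_zero.2 h)
    filter_upwards [hc.eventually_lt (g := fun _ => |(z - c j).re|) continuousAt_const
      (by simp only [mul_zero]; exact h1)] with Δ hΔ hmem
    exact lt_asymm hmem.1 hΔ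
  · have h1 : 0 < (c j).im - z.im := by linarith
    filter_upwards [hc.eventually_lt (g := fun _ => (c j).im - z.im) continuousAt_const
      (by simp only [mul_zero]; exact h1)] with Δ hΔ hmem
    have := hmem.2
    rw [sub_im] at this
    linarith

/-- The differential equation with respect to the parameter, for the local analytic continuation
of a family of solutions. -/
theorem StripData.exists_hasDerivAt (h : StripData ε κ k H L) {B : Set ℂ}
    (hB : B ⊆ halfStrip ε) {U : ℂ → ℂ → 𝔸} (hU : ∀ b ∈ B, RHSol (fun j => k j + b) H L (U b))
    {b₀ : ℂ} (hb₀ : b₀ ∈ B) {z : ℂ} (hz : z ∈ cutC fun j => k j + b₀) :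
    ∃ U' : ℂ → 𝔸, (∀ᶠ b in 𝓝[B] b₀, U b z = U' b) ∧ HasDerivAt U'
      ((∑ j, (z - (k j + b₀))⁻¹ • sCoef k L U j b₀) * U b₀ z) b₀ := by
  obtain ⟨Δ, ⟨⟨hΔ1, hΔ2⟩, hΔ3⟩, hΔ⟩ := (((eventually_small_box (hB hb₀)).and
    (eventually_outside_box hz)).and self_mem_nhdsWithin).exists
  replace hΔ : 0 < Δ := hΔ
  obtain ⟨η, hη, Hη⟩ := exists_continuation 𝔸 ι h.pos h.le_one hΔ.le (by linarith : Δ < 2 * Δ)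
    (by linarith : 2 * Δ < 3 * Δ) (by linarith : 3 * Δ < 4 * Δ)
  obtain ⟨r, hr, hrΔ, hcont, hsmall, hholo, hP⟩ := h.exists_hairpinProblem hB hU hb₀ hΔ hΔ1 hΔ2 hη
    _ rfl _ rfl
  obtain ⟨V', hV'⟩ := (Hη (fun j => k j + b₀) _ _ _ (ball b₀ r) (B ∩ ball b₀ r) isOpen_ball
    inter_subset_right (fun i j hij => by
      rw [add_re, add_re, add_sub_add_right_eq_sub]
      linarith [h.sep i j hij, abs_nonneg b₀.re]) hcont hsmall hholo hP).1 z hΔ3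
  obtain ⟨hV'1, hV'2⟩ := hV'
  have hb₀' : b₀ ∈ B ∩ ball b₀ r := ⟨hb₀, mem_ball_self hr⟩
  have hmem : ∀ j, ∀ w ∈ closedBox (5 * Δ), k j + b₀ + w ∈ halfStripAt ε (k j) := fun j w hw =>
    mem_halfStripAt_of_closedBox hΔ1 hΔ2 hw
  have hcut := fun j => h.cutNhd (hB hb₀) j
  set Φ : ι → ℂ → 𝔸 := fun j => regPart (fun j => k j + b₀) L (U b₀) j with hΦ
  have hunit : ∀ j, ∀ w ∈ closedBox (5 * Δ), IsUnit (Φ j (k j + b₀ + w)) := fun j w hw =>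
    (hcut j).isUnit_regPart (hU b₀ hb₀) (hmem j w hw)
  have hsub : openBox (4 * Δ) ⊆ closedBox (5 * Δ) := fun w hw =>
    openBox_subset_closedBox _ (closedBox_subset_openBox (by linarith)
      (openBox_subset_closedBox _ hw))
  have hz' : ∀ j, z - (k j + b₀) ∉ closedBox (2 * Δ) := fun j hj =>
    hΔ3 j (closedBox_subset_openBox (by linarith) hj)
  refine ⟨fun b => V' b * U b₀ z, ?_, ?_⟩
  · filter_upwards [self_mem_nhdsWithin, nhdsWithin_le_nhds (ball_mem_nhds b₀ hr)] with b hb hbr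
    rw [hV'1 b ⟨hb, hbr⟩, mul_assoc, Ring.inverse_mul_cancel _ ((hU b₀ hb₀).unit z hz), mul_one]
  · refine ((hV'2 b₀ hb₀' fun j w hw => ?_).mul_const (U b₀ z)).congr_deriv (congrArg (· * _) ?_)
    · simp only [sub_self, sub_zero, ex_zero, mul_one]
      exact Ring.mul_inverse_cancel _ (hunit j w (hsub hw.1))
    rw [← Finset.sum_neg_distrib]
    refine Finset.sum_congr rfl fun j _ => ?_
    set G : ℂ → 𝔸 := fun w => -((2 * Real.pi * I : ℂ)⁻¹ • (Φ j (k j + b₀ + w) *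
      L j (k j + b₀ + w) * Ring.inverse (Φ j (k j + b₀ + w)))) with hG
    have hGd : DifferentiableOn ℂ G (openBox (4 * Δ)) := by
      have d1 : DifferentiableOn ℂ (fun w => Φ j (k j + b₀ + w)) (openBox (4 * Δ)) :=
        ((hcut j).differentiableOn_regPart (hU b₀ hb₀)).comp (by fun_prop)
          fun w hw => hmem j w (hsub hw)
      have d2 : DifferentiableOn ℂ (fun w => L j (k j + b₀ + w)) (openBox (4 * Δ)) :=
        (h.log_holo j).comp (by fun_prop) fun w hw => hmem j w (hsub hw)
      exact (((d1.mul d2).mul (d1.inverse fun w hw => hunit j w (hsub hw))).const_smul (2 * Real.pi * I : ℂ)⁻¹).neg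
    have hGdec : DecaysOn (openBox (4 * Δ)) κ G := by
      obtain ⟨C, hC0, hC⟩ := (h.decay j).exists_wt_bound h.pos.le (h.log_holo j).continuousOn
        (hmem j)
      obtain ⟨D, hD⟩ := (hcut j).exists_regPart_bound (hU b₀ hb₀) h.pos (by positivity) (hmem j) hC
      refine decaysOn_of_le (C := |D| * C * |D|) h.pos.le (by positivity) fun w hw => ?_
      obtain ⟨h1, h2⟩ := hD w (hsub hw)
      rw [hG, norm_neg, norm_smul]
      have h3 : ‖Φ j (k j + b₀ + w) * L j (k j + b₀ + w) * Ring.inverse (Φ j (k j + b₀ + w))‖ ≤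
          |D| * (C * wt κ w.im) * |D| := by
        exact norm_mul_le_of_le (norm_mul_le_of_le (h1.trans (le_abs_self _)) (hC w (hsub hw)))
          (h2.trans (le_abs_self _))
      calc _ ≤ 1 * (|D| * (C * wt κ w.im) * |D|) :=
            mul_le_mul norm_two_pi_I_inv_le h3 (norm_nonneg _) zero_le_one
        _ = _ := by ring
    have hG0 : G 0 = sCoef k L U j b₀ := by simp [hG, sCoef, hΦ]
    rw [cauchyBox_congr (g := fun w => w⁻¹ • G w) (by linarith) fun w hw => ?_,
      cauchyBox_inv_smul (by linarith) (by linarith : 2 * Δ < 4 * Δ) h.pos h.le_one hGd hGdec (hz' j),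
      neg_neg, hG0]
    have hwb : w ∉ closedBox Δ := fun h => hw.2 (closedBox_subset_openBox (by linarith) h)
    have hw0 : w.re ≠ 0 ∨ w.im < 0 := by
      by_contra! hcon
      exact hwb ⟨by rw [hcon.1]; simpa using hΔ.le, by linarith [hcon.2]⟩
    have d1 : HasDerivAt (fun b => lc (w - (b - b₀)) - lc w) (-(w⁻¹ / (2 * Real.pi * I))) b₀ := by
      have e1 : HasDerivAt lc (w⁻¹ / (2 * Real.pi * I)) (w - (b₀ - b₀)) := by
        rw [sub_self, sub_zero]; exact hasDerivAt_lc hw0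
      have e2 : HasDerivAt (fun b : ℂ => w - (b - b₀)) (-1) b₀ :=
        ((hasDerivAt_id b₀).sub_const b₀).const_sub w
      have e3 := (e1.comp b₀ e2).sub_const (lc w)
      rw [mul_neg, mul_one] at e3
      exact e3
    have d2 : HasDerivAt (fun b => ex (lc (w - (b - b₀)) - lc w) (L j (k j + b₀ + w)))
        (-(w⁻¹ / (2 * Real.pi * I)) • L j (k j + b₀ + w)) b₀ := by
      have e1 := hasDerivAt_exp_smul_const (𝕂 := ℂ) (L j (k j + b₀ + w)) (0 : ℂ)
      have e2 : lc (w - (b₀ - b₀)) - lc w = 0 := by simp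
      rw [← e2] at e1
      have e3 := e1.scomp b₀ d1
      simp only [e2, zero_smul] at e3
      rw [NormedSpace.exp_zero, one_mul] at e3
      exact e3
    have d3 := (((d2.const_mul (Φ j (k j + b₀ + w))).mul_const
      (Ring.inverse (Φ j (k j + b₀ + w))))).deriv
    refine d3.trans ?_
    rw [hG]
    simp only [mul_neg, neg_mul, mul_smul_comm, smul_mul_assoc, neg_smul, smul_neg, smul_smul, div_eq_mul_inv]

/-- The coefficients of the differential equation continue analytically. -/
theorem StripData.exists_sCoef_continuation (h : StripData ε κ k H L) {B : Set ℂ}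
    (hB : B ⊆ halfStrip ε) {U : ℂ → ℂ → 𝔸} (hU : ∀ b ∈ B, RHSol (fun j => k j + b) H L (U b))
    {b₀ : ℂ} (hb₀ : b₀ ∈ B) (i : ι) : ∃ r > 0, ∃ s : ℂ → 𝔸, ball b₀ r ⊆ halfStrip ε ∧
      DifferentiableOn ℂ s (ball b₀ r) ∧ ∀ b ∈ B ∩ ball b₀ r, s b = sCoef k L U i b := by
  obtain ⟨Δ, ⟨hΔ1, hΔ2⟩, hΔ⟩ := ((eventually_small_box (hB hb₀)).and self_mem_nhdsWithin).exists
  replace hΔ : 0 < Δ := hΔ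
  obtain ⟨η, hη, Hη⟩ := exists_continuation 𝔸 ι h.pos h.le_one hΔ.le (by linarith : Δ < 2 * Δ)
    (by linarith : 2 * Δ < 3 * Δ) (by linarith : 3 * Δ < 4 * Δ)
  obtain ⟨r, hr, hrΔ, hcont, hsmall, hholo, hP⟩ := h.exists_hairpinProblem hB hU hb₀ hΔ hΔ1 hΔ2 hη
    _ rfl _ rfl
  have hball : ∀ b ∈ ball b₀ r, b - b₀ ∈ closedBox (2 * Δ) := by
    intro b hb
    have h1 : ‖b - b₀‖ ≤ 2 * Δ := by
      rw [← dist_eq_norm]; linarith [(mem_ball.1 hb).le]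
    exact ⟨(abs_re_le_norm _).trans h1, (abs_le.1 ((abs_im_le_norm (b - b₀)).trans h1)).1⟩
  obtain ⟨X, hX, hXB⟩ := (Hη (fun j => k j + b₀) _ _ _ (ball b₀ r) (B ∩ ball b₀ r) isOpen_ball
    inter_subset_right (fun i j hij => by
      rw [add_re, add_re, add_sub_add_right_eq_sub]
      linarith [h.sep i j hij, abs_nonneg b₀.re]) hcont hsmall hholo hP).2 i (fun b => k i + b)
      (by fun_prop) (fun b hb => by simpa using hball b hb)
  have hstrip : ∀ b ∈ ball b₀ r, k i + b ∈ halfStripAt ε (k i) := fun b hb => by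
    have := mem_halfStripAt_of_closedBox (a := k i) hΔ1 hΔ2 (w := b - b₀)
      (openBox_subset_closedBox _ (closedBox_subset_openBox (by linarith) (hball b hb)))
    rwa [add_assoc, add_sub_cancel] at this
  have hcut := h.cutNhd (hB hb₀) i
  set Φ : ℂ → 𝔸 := regPart (fun j => k j + b₀) L (U b₀) i with hΦ
  set Y : ℂ → 𝔸 := fun b => X b * Φ (k i + b) with hY
  have hYd : DifferentiableOn ℂ Y (ball b₀ r) := hX.mul
    ((hcut.differentiableOn_regPart (hU b₀ hb₀)).comp (by fun_prop) hstrip)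
  have hYB : ∀ b ∈ B ∩ ball b₀ r, Y b = regPart (fun j => k j + b) L (U b) i (k i + b) := by
    intro b hb
    rw [hY]
    simp only [hXB b hb]
    rw [mul_assoc, Ring.inverse_mul_cancel _ (hcut.isUnit_regPart (hU b₀ hb₀) (hstrip b hb.2)),
      mul_one]
  have hb₀' : b₀ ∈ ball b₀ r := mem_ball_self hr
  have hunit : ∀ᶠ b in 𝓝 b₀, IsUnit (Y b) := by
    refine (hYd.differentiableAt (isOpen_ball.mem_nhds hb₀')).continuousAt.eventually
      (Units.isOpen.mem_nhds ?_)
    rw [mem_ofPred_eq, hYB b₀ ⟨hb₀, hb₀'⟩]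
    exact hcut.isUnit_regPart (hU b₀ hb₀) (hstrip b₀ hb₀')
  obtain ⟨r', hr', hr'u⟩ := Metric.eventually_nhds_iff_ball.1 hunit
  have hs1 : ball b₀ (min r r') ⊆ ball b₀ r := ball_subset_ball (min_le_left _ _)
  refine ⟨min r r', lt_min hr hr', fun b => -((2 * Real.pi * I : ℂ)⁻¹ •
    (Y b * L i (k i + b) * Ring.inverse (Y b))), fun b hb => ?_, ?_, fun b hb => ?_⟩
  · have := hstrip b (hs1 hb)
    rwa [halfStripAt, mem_ofPred_eq, add_sub_cancel_left] at this
  · have d1 := hYd.mono hs1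
    have d2 : DifferentiableOn ℂ (fun b => L i (k i + b)) (ball b₀ (min r r')) :=
      (h.log_holo i).comp (by fun_prop) fun b hb => hstrip b (hs1 hb)
    exact (((d1.mul d2).mul (d1.inverse fun b hb =>
      hr'u b (ball_subset_ball (min_le_right _ _) hb))).const_smul (2 * Real.pi * I : ℂ)⁻¹).neg
  · simp only [sCoef, hYB b ⟨hb.1, hs1 hb.2⟩]

/-- Local analytic continuations of a function on the line `Re b = 0` fit together. -/
theorem exists_continuation_line {E : Type*} [NormedAddCommGroup E] [NormedSpace ℂ E]
    [CompleteSpace E] {f : ℂ → E} {S : Set ℂ}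
    (h : ∀ b₀ ∈ imagHalfLine, ∃ r > 0, ∃ s : ℂ → E, ball b₀ r ⊆ S ∧
      DifferentiableOn ℂ s (ball b₀ r) ∧ ∀ b ∈ imagHalfLine ∩ ball b₀ r, s b = f b)
    (hS : ∀ b ∈ S, 0 < b.im) :
    ∃ O, IsOpen O ∧ imagHalfLine ⊆ O ∧ O ⊆ S ∧ ∃ s : ℂ → E, DifferentiableOn ℂ s O ∧
      ∀ b ∈ imagHalfLine, s b = f b := by
  choose! r hr s hrS hs hsf using h
  set O : Set ℂ := ⋃ b₀ ∈ imagHalfLine, ball b₀ (r b₀) with hO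
  have hOo : IsOpen O := isOpen_biUnion fun _ _ => isOpen_ball
  have hagree : ∀ a ∈ imagHalfLine, ∀ b ∈ imagHalfLine, ∀ z ∈ ball a (r a) ∩ ball b (r b),
      s a z = s b z := by
    intro a ha b hb z hz
    have hopen : IsOpen (ball a (r a) ∩ ball b (r b)) := isOpen_ball.inter isOpen_ball
    have hconn : IsPreconnected (ball a (r a) ∩ ball b (r b)) :=
      ((convex_ball a _).inter (convex_ball b _)).isPreconnected
    set x : ℂ := (z.im : ℂ) * I with hx
    have hproj : ∀ c ∈ imagHalfLine, z ∈ ball c (r c) → x ∈ ball c (r c) := by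
      intro c hc hzc
      rw [mem_ball, dist_eq_norm] at hzc ⊢
      refine lt_of_le_of_lt ?_ hzc
      have e : x - c = ((z - c).im : ℂ) * I := by
        apply Complex.ext <;> simp [hx, hc.1]
      rw [e, norm_mul, norm_I, mul_one, norm_real]
      exact abs_im_le_norm _
    have hxm : x ∈ ball a (r a) ∩ ball b (r b) := ⟨hproj a ha hz.1, hproj b hb hz.2⟩
    have hxl : ∀ t : ℝ, x + t * I ∈ ball a (r a) → x + t * I ∈ imagHalfLine := by
      intro t ht
      refine ⟨by simp [hx], hS _ (hrS a ha ht)⟩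
    have hfreq : ∃ᶠ w in 𝓝[≠] x, s a w = s b w := by
      have ht : Tendsto (fun t : ℝ => x + t * I) (𝓝[≠] 0) (𝓝[≠] x) := by
        refine tendsto_nhdsWithin_iff.2 ⟨?_, ?_⟩
        · have : Tendsto (fun t : ℝ => x + t * I) (𝓝 0) (𝓝 (x + (0 : ℝ) * I)) :=
            (by fun_prop : Continuous fun t : ℝ => x + t * I).tendsto 0
          simp only [ofReal_zero, zero_mul, add_zero] at this
          exact this.mono_left nhdsWithin_le_nhds
        · filter_upwards [self_mem_nhdsWithin] with t ht
          simpa using ht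
      have hev : ∀ᶠ w in 𝓝[≠] x, w ∈ ball a (r a) ∩ ball b (r b) :=
        nhdsWithin_le_nhds (hopen.mem_nhds hxm)
      refine ht.frequently ((ht.eventually hev).mono fun t ht => ?_).frequently
      have hl := hxl t ht.1
      rw [hsf a ha _ ⟨hl, ht.1⟩, hsf b hb _ ⟨hl, ht.2⟩]
    exact ((((hs a ha).mono inter_subset_left).analyticOnNhd hopen)).eqOn_of_preconnected_of_frequently_eq
      (((hs b hb).mono inter_subset_right).analyticOnNhd hopen) hconn hxm hfreq hz
  classical
  set F : ℂ → E := fun z => if hz : ∃ b ∈ imagHalfLine, z ∈ ball b (r b) then s hz.choose z else 0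
    with hF
  have hFb : ∀ b ∈ imagHalfLine, ∀ z ∈ ball b (r b), F z = s b z := by
    intro b hb z hz
    have hex : ∃ b ∈ imagHalfLine, z ∈ ball b (r b) := ⟨b, hb, hz⟩
    simp only [hF, dif_pos hex]
    exact hagree _ hex.choose_spec.1 b hb z ⟨hex.choose_spec.2, hz⟩
  refine ⟨O, hOo, fun b hb => mem_biUnion hb (mem_ball_self (hr b hb)),
    iUnion₂_subset hrS, F, fun z hz => ?_, fun b hb => ?_⟩
  · obtain ⟨b, hb, hzb⟩ := mem_iUnion₂.1 hz
    have := ((hs b hb).differentiableAt (isOpen_ball.mem_nhds hzb)).congr_of_eventuallyEq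
      (by filter_upwards [isOpen_ball.mem_nhds hzb] with w hw using hFb b hb w hw)
    exact this.differentiableWithinAt
  · rw [hFb b hb b (mem_ball_self (hr b hb))]
    exact hsf b hb b ⟨hb, mem_ball_self (hr b hb)⟩

end

end

section

/-! ### Linear differential equations on a half-line -/

section Tail

variable {E : Type*} [NormedAddCommGroup E] [NormedSpace ℝ E] [CompleteSpace E]

/-- The integral of `f` over `(u, ∞)`. -/
noncomputable def tail (f : ℝ → E) (u : ℝ) : E := ∫ v in Ioi u, f v

variable {f : ℝ → E} (hi : IntegrableOn f (Ioi 0))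
include hi

theorem tail_eq {u : ℝ} (hu : 0 ≤ u) : tail f u = tail f 0 - ∫ v in (0)..u, f v := by
  have := intervalIntegral.integral_interval_add_Ioi hi (hi.mono_set (Ioi_subset_Ioi hu))
  rw [tail, tail, ← this, add_sub_cancel_left]

theorem hasDerivAt_tail (hc : ContinuousOn f (Ici 0)) {u : ℝ} (hu : 0 < u) :
    HasDerivAt (tail f) (-f u) u := by
  have hcu : ContinuousAt f u := hc.continuousAt (Ici_mem_nhds hu)
  have h1 : HasDerivAt (fun u => ∫ v in (0)..u, f v) (f u) u := by
    refine intervalIntegral.integral_hasDerivAt_right ?_ ?_ hcu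
    · exact (hc.mono (by rw [uIcc_of_le hu.le]; exact Icc_subset_Ici_self)).intervalIntegrable
    · exact (hc.mono Ioi_subset_Ici_self).stronglyMeasurableAtFilter isOpen_Ioi _ hu
  refine ((h1.const_sub (tail f 0)).congr_of_eventuallyEq ?_)
  filter_upwards [Ioi_mem_nhds hu] with v hv using tail_eq hi (le_of_lt hv)

theorem continuousOn_tail : ContinuousOn (tail f) (Ici 0) := by
  intro u hu
  have hu' : (0 : ℝ) ≤ u := hu
  have h1 : ContinuousOn (fun x => ∫ t in (0)..x, f t) (uIcc 0 (u + 1)) := by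
    refine intervalIntegral.continuousOn_primitive_interval ?_
    rw [uIcc_of_le (by linarith), integrableOn_Icc_iff_integrableOn_Ioc]
    exact hi.mono_set Ioc_subset_Ioi_self
  rw [uIcc_of_le (by linarith)] at h1
  have h2 : ContinuousWithinAt (tail f) (Icc 0 (u + 1)) u := by
    refine ContinuousWithinAt.congr ((h1 u ⟨hu', by linarith⟩).const_sub (tail f 0))
      (fun v hv => tail_eq hi hv.1) (tail_eq hi hu')
  refine h2.mono_of_mem_nhdsWithin ?_
  refine mem_nhdsWithin.2 ⟨Iio (u + 1), isOpen_Iio, by simp, fun v hv => ⟨hv.2, le_of_lt hv.1⟩⟩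

theorem tendsto_tail : Tendsto (tail f) atTop (𝓝 0) := by
  have h1 := intervalIntegral_tendsto_integral_Ioi 0 hi tendsto_id
  have h2 := h1.const_sub (tail f 0)
  rw [show tail f 0 - ∫ x in Ioi 0, f x = 0 from sub_self _] at h2
  refine h2.congr' ?_
  filter_upwards [eventually_ge_atTop 0] with u hu using (tail_eq hi hu).symm

end Tail

/-- The coefficient of a linear equation on `[0, ∞)`, dominated by an integrable function. -/
structure VolBound (a : ℝ → 𝔸) (g : ℝ → ℝ) : Prop where
  cont : ContinuousOn a (Ici 0)
  gcont : ContinuousOn g (Ici 0)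
  gint : IntegrableOn g (Ioi 0)
  le : ∀ v, 0 ≤ v → ‖a v‖ ≤ g v

/-- The terms of the Picard series for `X' = a X`, `X(∞) = 1`. -/
noncomputable def volTerm (a : ℝ → 𝔸) : ℕ → ℝ → 𝔸
  | 0 => fun _ => 1
  | n + 1 => fun u => -tail (fun v => a v * volTerm a n v) u

/-- The solution of `X' = a X` with `X(∞) = 1`, as the sum of the Picard series. -/
noncomputable def volSol (a : ℝ → 𝔸) (u : ℝ) : 𝔸 := ∑' n, volTerm a n u

theorem tail_le {g : ℝ → ℝ} (hg : IntegrableOn g (Ioi 0)) (h0 : ∀ v, 0 ≤ v → 0 ≤ g v) {u : ℝ}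
    (hu : 0 ≤ u) : 0 ≤ tail g u ∧ tail g u ≤ tail g 0 :=
  ⟨setIntegral_nonneg measurableSet_Ioi fun w hw => h0 w (hu.trans (le_of_lt hw)),
    setIntegral_mono_set hg (ae_restrict_of_forall_mem measurableSet_Ioi fun w hw =>
      h0 w (le_of_lt hw)) (Ioi_subset_Ioi hu).eventuallyLE⟩

/-- `tail g ^ (n + 1) / (n + 1)!` is a primitive of `-g * tail g ^ n / n!`. -/
theorem integral_tail_pow {g : ℝ → ℝ} (hg : IntegrableOn g (Ioi 0)) (hc : ContinuousOn g (Ici 0))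
    (h0 : ∀ v, 0 ≤ v → 0 ≤ g v) (n : ℕ) {u : ℝ} (hu : 0 ≤ u) :
    IntegrableOn (fun v => g v * (tail g v ^ n / n.factorial)) (Ioi u) ∧
      ∫ v in Ioi u, g v * (tail g v ^ n / n.factorial) = tail g u ^ (n + 1) / (n + 1).factorial := by
  have hct := continuousOn_tail hg
  have hint : IntegrableOn (fun v => g v * (tail g v ^ n / n.factorial)) (Ioi u) := by
    refine Integrable.mono' ((hg.mono_set (Ioi_subset_Ioi hu)).mul_const
      (tail g 0 ^ n / n.factorial)) ?_ ?_
    · refine ContinuousOn.aestronglyMeasurable ?_ measurableSet_Ioi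
      exact ((hc.mul ((hct.pow n).div_const _))).mono fun v hv => hu.trans (le_of_lt hv)
    · refine ae_restrict_of_forall_mem measurableSet_Ioi fun v hv => ?_
      have hv0 : 0 ≤ v := hu.trans (le_of_lt hv)
      obtain ⟨h1, h2⟩ := tail_le hg h0 hv0
      have := h0 v hv0
      rw [Real.norm_of_nonneg (by positivity)]
      gcongr
  refine ⟨hint, ?_⟩
  have hd : ∀ v ∈ Ioi u, HasDerivAt (fun v => -(tail g v ^ (n + 1) / (n + 1).factorial))
      (g v * (tail g v ^ n / n.factorial)) v := by
    intro v hv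
    have h1 := (((hasDerivAt_tail hg hc (hu.trans_lt hv)).pow (n + 1)).div_const
      ((n + 1).factorial : ℝ)).neg
    refine h1.congr_deriv ?_
    rw [Nat.factorial_succ]
    push_cast
    field_simp
  have hlim : Tendsto (fun v => -(tail g v ^ (n + 1) / (n + 1).factorial)) atTop (𝓝 0) := by
    simpa using (((tendsto_tail hg).pow (n + 1)).div_const ((n + 1).factorial : ℝ)).neg
  have hcu : ContinuousWithinAt (fun v => -(tail g v ^ (n + 1) / (n + 1).factorial)) (Ici u) u :=
    (((hct.pow (n + 1)).div_const _).neg u hu).mono (Ici_subset_Ici.2 hu)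
  rw [integral_Ioi_of_hasDerivAt_of_tendsto hcu hd hint hlim]
  ring

namespace VolBound

variable {a : ℝ → 𝔸} {g : ℝ → ℝ} (h : VolBound a g)
include h

theorem nonneg : ∀ v, 0 ≤ v → 0 ≤ g v := fun v hv => (norm_nonneg _).trans (h.le v hv)

theorem volTerm_props (n : ℕ) : ContinuousOn (volTerm a n) (Ici 0) ∧
    ∀ u, 0 ≤ u → ‖volTerm a n u‖ ≤ ‖(1 : 𝔸)‖ * (tail g u ^ n / n.factorial) := by
  induction n with
  | zero => exact ⟨continuousOn_const, fun u _ => by simp [volTerm]⟩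
  | succ n ih =>
    obtain ⟨ih1, ih2⟩ := ih
    have hp : ∀ u, 0 ≤ u → ∀ᵐ v ∂volume.restrict (Ioi u), ‖a v * volTerm a n v‖ ≤
        ‖(1 : 𝔸)‖ * (g v * (tail g v ^ n / n.factorial)) := fun u hu =>
      ae_restrict_of_forall_mem measurableSet_Ioi fun v hv => by
        have hv0 : 0 ≤ v := hu.trans (le_of_lt hv)
        exact (norm_mul_le_of_le (h.le v hv0) (ih2 v hv0)).trans_eq (mul_left_comm _ _ _)
    have hint := fun u (hu : 0 ≤ u) => integral_tail_pow h.gint h.gcont h.nonneg n hu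
    refine ⟨(continuousOn_tail (Integrable.mono' ((hint 0 le_rfl).1.const_mul _)
      (((h.cont.mul ih1).mono Ioi_subset_Ici_self).aestronglyMeasurable measurableSet_Ioi)
      (hp 0 le_rfl))).neg, fun u hu => ?_⟩
    rw [volTerm, norm_neg, ← (hint u hu).2, ← integral_const_mul]
    exact norm_integral_le_of_norm_le ((hint u hu).1.const_mul _) (hp u hu)

theorem norm_volTerm_le (n : ℕ) {u : ℝ} (hu : 0 ≤ u) :
    ‖volTerm a n u‖ ≤ ‖(1 : 𝔸)‖ * (tail g 0 ^ n / n.factorial) := by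
  refine ((h.volTerm_props n).2 u hu).trans ?_
  obtain ⟨h1, h2⟩ := tail_le h.gint h.nonneg hu
  gcongr

theorem summable_bound : Summable fun n : ℕ => ‖(1 : 𝔸)‖ * (tail g 0 ^ n / n.factorial) :=
  (Real.summable_pow_div_factorial _).mul_left _

theorem hasSum_volTerm {u : ℝ} (hu : 0 ≤ u) : HasSum (fun n => volTerm a n u) (volSol a u) :=
  (Summable.of_norm_bounded h.summable_bound fun n => h.norm_volTerm_le n hu).hasSum

theorem continuousOn_volSol : ContinuousOn (volSol a) (Ici 0) :=
  continuousOn_tsum (fun n => (h.volTerm_props n).1) h.summable_bound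
    fun n _ hu => h.norm_volTerm_le n hu

theorem norm_volSol_sub_one_le {u : ℝ} (hu : 0 ≤ u) :
    ‖volSol a u - 1‖ ≤ ‖(1 : 𝔸)‖ * (Real.exp (tail g u) - 1) := by
  have h1 := (hasSum_nat_add_iff' 1).2 (h.hasSum_volTerm hu)
  have g1 := NormedSpace.exp_series_hasSum_exp' (𝕂 := ℝ) (tail g u)
  rw [← Real.exp_eq_exp_ℝ] at g1
  have g2 := ((hasSum_nat_add_iff' 1).2 g1).mul_left ‖(1 : 𝔸)‖
  simp only [Finset.range_one, Finset.sum_singleton, Nat.factorial_zero, Nat.cast_one, inv_one,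
    pow_zero, one_smul] at g2 h1
  refine h1.norm_le_of_bounded g2 fun n => ((h.volTerm_props (n + 1)).2 u hu).trans (le_of_eq ?_)
  rw [smul_eq_mul, div_eq_inv_mul]

theorem integrableOn_mul {f : ℝ → 𝔸} (hf : ContinuousOn f (Ici 0)) {C : ℝ}
    (hC : ∀ v, 0 ≤ v → ‖f v‖ ≤ C) : IntegrableOn (fun v => a v * f v) (Ioi 0) := by
  refine Integrable.mono' (h.gint.mul_const C) (((h.cont.mul hf).mono
    Ioi_subset_Ici_self).aestronglyMeasurable measurableSet_Ioi) ?_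
  exact ae_restrict_of_forall_mem measurableSet_Ioi fun v hv =>
    norm_mul_le_of_le (h.le v (le_of_lt hv)) (hC v (le_of_lt hv))

theorem norm_volSol_le {u : ℝ} (hu : 0 ≤ u) :
    ‖volSol a u‖ ≤ ‖(1 : 𝔸)‖ * Real.exp (tail g u) := by
  have h1 := h.norm_volSol_sub_one_le hu
  have h2 := norm_add_le (volSol a u - 1) 1
  rw [sub_add_cancel] at h2
  linarith

theorem norm_volSol_le_zero {u : ℝ} (hu : 0 ≤ u) :
    ‖volSol a u‖ ≤ ‖(1 : 𝔸)‖ * Real.exp (tail g 0) :=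
  (h.norm_volSol_le hu).trans (mul_le_mul_of_nonneg_left (Real.exp_le_exp.2
    (tail_le h.gint h.nonneg hu).2) (norm_nonneg _))

theorem integrableOn_volSol : IntegrableOn (fun v => a v * volSol a v) (Ioi 0) :=
  h.integrableOn_mul h.continuousOn_volSol fun _ hv => h.norm_volSol_le_zero hv

theorem volSol_eq {u : ℝ} (hu : 0 ≤ u) :
    volSol a u = 1 - tail (fun v => a v * volSol a v) u := by
  have hint : ∀ n, IntegrableOn (fun v => a v * volTerm a n v) (Ioi u) := fun n =>
    (h.integrableOn_mul (h.volTerm_props n).1 fun v hv => h.norm_volTerm_le n hv).mono_set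
      (Ioi_subset_Ioi hu)
  have hsum := hasSum_integral_of_summable_integral_norm (μ := volume.restrict (Ioi u))
    (F := fun n v => a v * volTerm a n v) hint ?_
  · have e : ∫ v in Ioi u, ∑' n, a v * volTerm a n v = tail (fun v => a v * volSol a v) u := by
      refine setIntegral_congr_fun measurableSet_Ioi fun v hv => ?_
      exact ((h.hasSum_volTerm (hu.trans (le_of_lt hv))).mul_left (a v)).tsum_eq
    rw [e] at hsum
    have h1 := (hasSum_nat_add_iff' 1).2 (h.hasSum_volTerm hu)
    simp only [Finset.range_one, Finset.sum_singleton] at h1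
    have h2 := h1.unique hsum.neg
    rw [show volTerm a 0 u = 1 from rfl] at h2
    rw [← sub_add_cancel (volSol a u) 1, h2]
    abel
  · refine Summable.of_nonneg_of_le (fun n => integral_nonneg fun _ => norm_nonneg _) (fun n => ?_)
      (h.summable_bound.mul_left (tail g u))
    rw [tail, ← integral_mul_const]
    refine setIntegral_mono_on (hint n).norm ((h.gint.mono_set (Ioi_subset_Ioi hu)).mul_const _)
      measurableSet_Ioi fun v hv =>
        have hv0 : 0 ≤ v := hu.trans (le_of_lt hv)
        norm_mul_le_of_le (h.le v hv0) (h.norm_volTerm_le n hv0)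

theorem hasDerivAt_volSol {u : ℝ} (hu : 0 < u) : HasDerivAt (volSol a) (a u * volSol a u) u := by
  have h1 := (hasDerivAt_tail h.integrableOn_volSol (h.cont.mul h.continuousOn_volSol) hu).const_sub
    (1 : 𝔸)
  rw [neg_neg] at h1
  refine h1.congr_of_eventuallyEq ?_
  filter_upwards [Ioi_mem_nhds hu] with v hv using h.volSol_eq (le_of_lt hv)

theorem tendsto_volSol : Tendsto (volSol a) atTop (𝓝 1) := by
  have h1 := (tendsto_tail h.integrableOn_volSol).const_sub (1 : 𝔸)
  rw [sub_zero] at h1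
  refine h1.congr' ?_
  filter_upwards [eventually_ge_atTop 0] with u hu using (h.volSol_eq hu).symm

end VolBound

/-- A continuous function whose derivative vanishes off a finite set is constant. -/
theorem eq_of_hasDerivAt_zero {E : Type*} [NormedAddCommGroup E] [NormedSpace ℝ E] [CompleteSpace E]
    {f : ℝ → E} {s t : ℝ} (hst : s ≤ t) (hc : ContinuousOn f (Icc s t)) (T : Finset ℝ)
    (hd : ∀ x ∈ Ioo s t, x ∉ T → HasDerivAt f 0 x) : f s = f t := by
  have := integral_eq_of_hasDerivAt_off_countable_of_le f (fun _ => 0) hst T.countable_toSet hc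
    (fun x hx => hd x hx.1 hx.2) (by simp)
  rw [intervalIntegral.integral_zero] at this
  exact (sub_eq_zero.1 this.symm).symm

/-- The solution of the adjoint equation `Z' = -Z a`, `Z(∞) = 1`: the solution of a linear equation
in the opposite algebra. -/
noncomputable def volInv (a : ℝ → 𝔸) (u : ℝ) : 𝔸 :=
  MulOpposite.unop (volSol (fun v => MulOpposite.op (-a v)) u)

namespace VolBound

variable {a : ℝ → 𝔸} {g : ℝ → ℝ} (h : VolBound a g)
include h

theorem op : VolBound (fun v => MulOpposite.op (-a v)) g :=
  ⟨MulOpposite.continuous_op.comp_continuousOn h.cont.neg, h.gcont, h.gint, fun v hv => by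
    rw [MulOpposite.norm_op, norm_neg]; exact h.le v hv⟩

theorem continuousOn_volInv : ContinuousOn (volInv a) (Ici 0) :=
  MulOpposite.continuous_unop.comp_continuousOn h.op.continuousOn_volSol

theorem tendsto_volInv : Tendsto (volInv a) atTop (𝓝 1) :=
  (MulOpposite.continuous_unop.tendsto _).comp h.op.tendsto_volSol

theorem hasDerivAt_volInv {u : ℝ} (hu : 0 < u) :
    HasDerivAt (volInv a) (-(volInv a u * a u)) u := by
  refine ((MulOpposite.opContinuousLinearEquiv ℝ
    (M := 𝔸)).symm.toContinuousLinearMap.hasFDerivAt.comp_hasDerivAt u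
      (h.op.hasDerivAt_volSol hu)).congr_deriv ?_
  simp [volInv]

theorem norm_volInv_le {u : ℝ} (hu : 0 ≤ u) :
    ‖volInv a u‖ ≤ ‖(1 : 𝔸)‖ * Real.exp (tail g u) := by
  have := h.op.norm_volSol_le hu
  rwa [← MulOpposite.op_one, MulOpposite.norm_op] at this

/-- A solution that has a limit at infinity is determined by it. -/
theorem volInv_mul_eq {s : ℝ} (hs : 0 ≤ s) {Y : ℝ → 𝔸} {E : 𝔸} (hY : ContinuousOn Y (Ici s))
    (T : Finset ℝ) (hd : ∀ u, s < u → u ∉ T → HasDerivAt Y (a u * Y u) u)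
    (hlim : Tendsto Y atTop (𝓝 E)) : volInv a s * Y s = E := by
  have hconst : ∀ t, s ≤ t → volInv a s * Y s = volInv a t * Y t := by
    intro t hst
    refine eq_of_hasDerivAt_zero (f := fun t => volInv a t * Y t) hst
      ((h.continuousOn_volInv.mono fun v hv => hs.trans hv.1).mul (hY.mono Icc_subset_Ici_self))
      T fun x hx hxT => ?_
    refine ((h.hasDerivAt_volInv (hs.trans_lt hx.1)).mul (hd x hx.1 hxT)).congr_deriv ?_
    rw [neg_mul, mul_assoc, neg_add_cancel]
  have h1 : Tendsto (fun t => volInv a t * Y t) atTop (𝓝 (1 * E)) := h.tendsto_volInv.mul hlim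
  rw [one_mul] at h1
  refine tendsto_nhds_unique (tendsto_const_nhds.congr' ?_) h1
  filter_upwards [eventually_ge_atTop s] with t ht using hconst t ht

theorem volInv_mul_volSol {u : ℝ} (hu : 0 ≤ u) : volInv a u * volSol a u = 1 :=
  h.volInv_mul_eq hu (h.continuousOn_volSol.mono (Ici_subset_Ici.2 hu)) ∅
    (fun _ hv _ => h.hasDerivAt_volSol (hu.trans_lt hv)) h.tendsto_volSol

variable [IsDedekindFiniteMonoid 𝔸]

theorem volSol_mul_volInv {u : ℝ} (hu : 0 ≤ u) : volSol a u * volInv a u = 1 :=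
  mul_eq_one_symm (h.volInv_mul_volSol hu)

theorem isUnit_volSol {u : ℝ} (hu : 0 ≤ u) : IsUnit (volSol a u) :=
  ⟨⟨_, _, h.volSol_mul_volInv hu, h.volInv_mul_volSol hu⟩, rfl⟩

theorem eq_volSol_mul {s : ℝ} (hs : 0 ≤ s) {Y : ℝ → 𝔸} {E : 𝔸} (hY : ContinuousOn Y (Ici s))
    (T : Finset ℝ) (hd : ∀ u, s < u → u ∉ T → HasDerivAt Y (a u * Y u) u)
    (hlim : Tendsto Y atTop (𝓝 E)) : Y s = volSol a s * E := by
  rw [← h.volInv_mul_eq hs hY T hd hlim, ← mul_assoc, h.volSol_mul_volInv hs, one_mul]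

end VolBound

/-- Holomorphic dependence on a parameter. -/
theorem differentiableOn_volSol {O : Set ℂ} (hO : IsOpen O) {a : ℂ → ℝ → 𝔸} {g : ℝ → ℝ}
    (h : ∀ b ∈ O, VolBound (a b) g) (hd : ∀ v, 0 ≤ v → DifferentiableOn ℂ (fun b => a b v) O)
    {u : ℝ} (hu : 0 ≤ u) : DifferentiableOn ℂ (fun b => volSol (a b) u) O := by
  rcases O.eq_empty_or_nonempty with rfl | ⟨b₁, hb₁⟩
  · exact differentiableOn_empty
  have hn : ∀ n u, 0 ≤ u → DifferentiableOn ℂ (fun b => volTerm (a b) n u) O := by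
    intro n
    induction n with
    | zero => exact fun u _ => differentiableOn_const _
    | succ n ih =>
      intro u hu
      refine DifferentiableOn.neg (differentiableOn_integral_param hO ?_ ?_ ?_)
      · exact ae_restrict_of_forall_mem measurableSet_Ioi fun v hv =>
          (hd v (hu.trans (le_of_lt hv))).fun_mul (ih v (hu.trans (le_of_lt hv)))
      · exact fun b hb => ((((h b hb).cont.mul ((h b hb).volTerm_props n).1).mono
          fun v hv => hu.trans (le_of_lt hv)).aestronglyMeasurable measurableSet_Ioi)
      · intro b₀ hb₀
        refine ⟨1, one_pos, fun v => g v * (‖(1 : 𝔸)‖ * (tail g 0 ^ n / n.factorial)),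
          ((h b₀ hb₀).gint.mono_set (Ioi_subset_Ioi hu)).mul_const _, ?_⟩
        exact ae_restrict_of_forall_mem measurableSet_Ioi fun v hv b hb =>
          norm_mul_le_of_le ((h b hb.2).le v (hu.trans (le_of_lt hv)))
            ((h b hb.2).norm_volTerm_le n (hu.trans (le_of_lt hv)))
  exact differentiableOn_tsum_of_summable_norm (h b₁ hb₁).summable_bound (fun n => hn n u hu) hO
    fun n b hb => (h b hb).norm_volTerm_le n hu

end

section

/-! ### Linear differential equations on the unit interval -/

/-- The substitution `t = exp (-v)` turns `dX/dt = φ t * X` on `(0, 1]` into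
`dX/dv = expCoef φ v * X` on `[0, ∞)`. -/
noncomputable def expCoef (φ : ℝ → 𝔸) (v : ℝ) : 𝔸 := -(Real.exp (-v) • φ (Real.exp (-v)))

/-- The value at `t = 1` of the solution of `dX/dt = φ t * X` with `X 0 = 1`. -/
noncomputable def segSol (φ : ℝ → 𝔸) : 𝔸 := volSol (expCoef φ) 0

theorem exp_neg_mem_Icc {v : ℝ} (hv : 0 ≤ v) : Real.exp (-v) ∈ Icc (0 : ℝ) 1 :=
  ⟨(Real.exp_pos _).le, Real.exp_le_one_iff.2 (by linarith)⟩

theorem integrableOn_mul_exp_neg (M : ℝ) :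
    IntegrableOn (fun v : ℝ => M * Real.exp (-v)) (Ioi 0) :=
  (integrableOn_exp_neg_Ioi 0).const_mul M

theorem volBound_expCoef {φ : ℝ → 𝔸} {M : ℝ} (hc : ContinuousOn φ (Icc 0 1))
    (hM : ∀ t ∈ Icc (0 : ℝ) 1, ‖φ t‖ ≤ M) :
    VolBound (expCoef φ) (fun v => M * Real.exp (-v)) where
  cont := ((by fun_prop : Continuous fun v : ℝ => Real.exp (-v)).continuousOn.smul
    (hc.comp (by fun_prop) fun _ hv => exp_neg_mem_Icc hv)).neg
  gcont := by fun_prop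
  gint := integrableOn_mul_exp_neg M
  le v hv := by
    rw [expCoef, norm_neg, norm_smul, Real.norm_of_nonneg (Real.exp_pos _).le, mul_comm]
    exact mul_le_mul_of_nonneg_right (hM _ (exp_neg_mem_Icc hv)) (Real.exp_pos _).le

theorem exists_volBound_expCoef {φ : ℝ → 𝔸} (hc : ContinuousOn φ (Icc 0 1)) :
    ∃ M, VolBound (expCoef φ) (fun v => M * Real.exp (-v)) := by
  obtain ⟨M, hM⟩ := isCompact_Icc.exists_bound_of_continuousOn hc
  exact ⟨M, volBound_expCoef hc hM⟩

theorem differentiableOn_segSol {O : Set ℂ} (hO : IsOpen O) {F : ℂ → ℝ → 𝔸}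
    (hc : ContinuousOn (fun q : ℂ × ℝ => F q.1 q.2) (O ×ˢ Icc 0 1))
    (hd : ∀ t ∈ Icc (0 : ℝ) 1, DifferentiableOn ℂ (fun x => F x t) O) :
    DifferentiableOn ℂ (fun x => segSol (F x)) O := by
  intro x₀ hx₀
  obtain ⟨r, hr, hrO⟩ := Metric.nhds_basis_closedBall.mem_iff.1 (hO.mem_nhds hx₀)
  obtain ⟨M, hM⟩ := ((isCompact_closedBall x₀ r).prod isCompact_Icc).exists_bound_of_continuousOn
    (hc.mono (prod_mono hrO Subset.rfl))
  have hsub : ball x₀ r ⊆ O := ball_subset_closedBall.trans hrO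
  refine (DifferentiableOn.differentiableAt (s := ball x₀ r) ?_
    (ball_mem_nhds x₀ hr)).differentiableWithinAt
  refine differentiableOn_volSol isOpen_ball (g := fun v => M * Real.exp (-v))
    (fun x hx => volBound_expCoef ?_ fun t ht => hM (x, t) ⟨ball_subset_closedBall hx, ht⟩)
    (fun v hv => ?_) le_rfl
  · exact hc.comp (f := fun t => (x, t)) (by fun_prop) fun t ht => ⟨hsub hx, ht⟩
  · exact (((hd _ (exp_neg_mem_Icc hv)).mono hsub).const_smul (Real.exp (-v))).neg

theorem norm_segSol_sub_one_le {φ : ℝ → 𝔸} {M : ℝ} (hc : ContinuousOn φ (Icc 0 1))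
    (hM : ∀ t ∈ Icc (0 : ℝ) 1, ‖φ t‖ ≤ M) :
    ‖segSol φ - 1‖ ≤ ‖(1 : 𝔸)‖ * (Real.exp M - 1) := by
  have := (volBound_expCoef hc hM).norm_volSol_sub_one_le le_rfl
  rwa [tail, integral_const_mul, integral_exp_neg_Ioi_zero, mul_one] at this

variable [IsDedekindFiniteMonoid 𝔸]

theorem isUnit_segSol {φ : ℝ → 𝔸} (hc : ContinuousOn φ (Icc 0 1)) : IsUnit (segSol φ) := by
  obtain ⟨M, hM⟩ := exists_volBound_expCoef hc
  exact hM.isUnit_volSol le_rfl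

theorem eq_segSol_mul {φ : ℝ → 𝔸} (hc : ContinuousOn φ (Icc 0 1)) {Y : ℝ → 𝔸}
    (hY : ContinuousOn Y (Icc 0 1)) (T : Finset ℝ)
    (hd : ∀ t ∈ Ioo (0 : ℝ) 1, t ∉ T → HasDerivAt Y (φ t * Y t) t) :
    Y 1 = segSol φ * Y 0 := by
  obtain ⟨M, hM⟩ := exists_volBound_expCoef hc
  have he : ∀ v : ℝ, HasDerivAt (fun v : ℝ => Real.exp (-v)) (-Real.exp (-v)) v := fun v => by
    simpa using (hasDerivAt_neg v).exp
  have h1 := hM.eq_volSol_mul le_rfl (Y := fun v => Y (Real.exp (-v))) (E := Y 0)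
    (hY.comp (by fun_prop) fun v hv => exp_neg_mem_Icc hv)
    (T.image fun t => -Real.log t) ?_ ?_
  · simpa [segSol] using h1
  · intro u hu huT
    have hT : Real.exp (-u) ∉ T := fun h => huT (Finset.mem_image.2 ⟨_, h, by simp⟩)
    have hmem : Real.exp (-u) ∈ Ioo (0 : ℝ) 1 :=
      ⟨Real.exp_pos _, by rw [← Real.exp_zero]; exact Real.exp_lt_exp.2 (by simpa using hu)⟩
    refine ((hd _ hmem hT).scomp u (he u)).congr_deriv ?_
    rw [expCoef, neg_smul, neg_mul, smul_mul_assoc]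
  · have h0 : ContinuousWithinAt Y (Icc 0 1) 0 := hY 0 ⟨le_rfl, zero_le_one⟩
    refine h0.tendsto.comp (tendsto_nhdsWithin_iff.2
      ⟨Real.tendsto_exp_atBot.comp tendsto_neg_atTop_atBot, ?_⟩)
    filter_upwards [eventually_ge_atTop 0] with v hv using exp_neg_mem_Icc hv

/-- The solution of `dX/dz = G z * X` at `z` along the segment from `z₀`, with the value `1` at
`z₀`. -/
noncomputable def starSol (G : ℂ → 𝔸) (z₀ z : ℂ) : 𝔸 :=
  segSol fun t => (z - z₀) • G (z₀ + t * (z - z₀))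

theorem continuousOn_starCoef {D : Set ℂ} (hD : Convex ℝ D) {G : ℂ → 𝔸} (hG : ContinuousOn G D)
    {z₀ : ℂ} (h₀ : z₀ ∈ D) :
    ContinuousOn (fun q : ℂ × ℝ => (q.1 - z₀) • G (z₀ + q.2 * (q.1 - z₀))) (D ×ˢ Icc 0 1) := by
  refine ContinuousOn.smul (by fun_prop) (hG.comp (by fun_prop) fun q hq => ?_)
  have := hD.add_smul_sub_mem h₀ hq.1 hq.2
  rwa [real_smul] at this

theorem isUnit_starSol {D : Set ℂ} (hD : Convex ℝ D) {G : ℂ → 𝔸} (hG : ContinuousOn G D)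
    {z₀ z : ℂ} (h₀ : z₀ ∈ D) (hz : z ∈ D) : IsUnit (starSol G z₀ z) :=
  isUnit_segSol ((continuousOn_starCoef hD hG h₀).comp (f := fun t : ℝ => (z, t)) (by fun_prop)
    fun _ ht => ⟨hz, ht⟩)

theorem eq_starSol_mul {D : Set ℂ} (hD : Convex ℝ D) {G : ℂ → 𝔸} (hG : ContinuousOn G D)
    {z₀ z : ℂ} (h₀ : z₀ ∈ D) (hz : z ∈ D) {X : ℂ → 𝔸}
    (hX : ∀ w ∈ D, HasDerivAt X (G w * X w) w) : X z = starSol G z₀ z * X z₀ := by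
  have hmem : ∀ t ∈ Icc (0 : ℝ) 1, z₀ + t * (z - z₀) ∈ D := fun t ht => by
    have := hD.add_smul_sub_mem h₀ hz ht
    rwa [real_smul] at this
  have hl : ∀ t : ℝ, HasDerivAt (fun t : ℝ => z₀ + (t : ℂ) * (z - z₀)) (z - z₀) t := fun t => by
    simpa using ((hasDerivAt_id t).ofReal_comp.mul_const (z - z₀)).const_add z₀
  have := eq_segSol_mul (Y := fun t : ℝ => X (z₀ + t * (z - z₀)))
    ((continuousOn_starCoef hD hG h₀).comp (f := fun t : ℝ => (z, t)) (by fun_prop)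
      fun _ ht => ⟨hz, ht⟩)
    (fun t ht => ((hX _ (hmem t ht)).scomp t (hl t)).continuousAt.continuousWithinAt) ∅
    (fun t ht _ => ((hX _ (hmem t (Ioo_subset_Icc_self ht))).scomp t (hl t)).congr_deriv
      (smul_mul_assoc _ _ _).symm)
  simpa [starSol, Function.comp_def] using this

theorem differentiableOn_starSol {D : Set ℂ} (hO : IsOpen D) (hD : Convex ℝ D) {G : ℂ → 𝔸}
    (hG : DifferentiableOn ℂ G D) {z₀ : ℂ} (h₀ : z₀ ∈ D) :
    DifferentiableOn ℂ (starSol G z₀) D := by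
  refine differentiableOn_segSol hO (continuousOn_starCoef hD hG.continuousOn h₀) fun t ht => ?_
  have hl : Differentiable ℂ fun z : ℂ => z₀ + (t : ℂ) * (z - z₀) := by fun_prop
  refine (differentiableOn_id.sub_const z₀).smul (hG.comp hl.differentiableOn fun z hz => ?_)
  have := hD.add_smul_sub_mem h₀ hz ht
  rwa [real_smul] at this

end

section

/-! ### Algebraic functions -/

section MatrixNorm

attribute [local instance] Matrix.linftyOpNormedRing Matrix.linftyOpNormedAlgebra

variable {N : ℕ}

theorem hasDerivAt_matrix_iff {f : ℂ → Matrix (Fin N) (Fin N) ℂ} {f' : Matrix (Fin N) (Fin N) ℂ}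
    {z : ℂ} : HasDerivAt f f' z ↔ MatHasDerivAt f f' z :=
  (hasDerivAt_pi (φ := f)).trans (forall_congr' fun _ => hasDerivAt_pi)

theorem matHolomorphicOn_iff {f : ℂ → Matrix (Fin N) (Fin N) ℂ} {s : Set ℂ} :
    MatHolomorphicOn f s ↔ DifferentiableOn ℂ f s :=
  ((differentiableOn_pi (Φ := f)).trans (forall_congr' fun _ => differentiableOn_pi)).symm

theorem norm_matrix_le {A : Matrix (Fin N) (Fin N) ℂ} {K : ℝ} (h : ∀ a c, ‖A a c‖ ≤ K)
    (hK : 0 ≤ K) : ‖A‖ ≤ N * K := by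
  lift K to NNReal using hK
  rw [Matrix.linfty_opNorm_def]
  norm_cast
  exact Finset.sup_le fun i _ => (Finset.sum_le_card_nsmul _ _ K fun j _ => h i j).trans (by simp)

end MatrixNorm

open Polynomial in
theorem evalEval_swap (P : ℂ[X][X]) (z w : ℂ) :
    (Bivariate.swap P).evalEval w z = P.evalEval z w := by
  induction P using Polynomial.induction_on' with
  | add p q hp hq => rw [map_add, evalEval_add, evalEval_add, hp, hq]
  | monomial n a =>
    rw [← C_mul_X_pow_eq_monomial, map_mul, map_pow, Bivariate.swap_Y, Bivariate.swap_C]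
    simp [evalEval_C, evalEval_mul, evalEval_pow, evalEval_map_C]

open Polynomial in
/-- Small roots `w` of `P (z, w) = 0` decay like a power of `z`: in `P (z, w) = ∑ j ≤ d, t j w * z ^ j`
the term with `j = d` is at least a multiple of `‖w‖ ^ m * ‖z‖ ^ d`. -/
theorem exists_gap_zero {P : ℂ[X][X]} (hP : P ≠ 0) : ∃ η > 0, ∃ α > 0, ∃ C ≥ 0, ∃ R ≥ 1,
    ∀ z w : ℂ, R ≤ ‖z‖ → ‖w‖ ≤ η → P.evalEval z w = 0 → ‖w‖ ≤ C * ‖z‖ ^ (-α : ℝ) := by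
  set T := Bivariate.swap P with hT
  have hT0 : T ≠ 0 := by rwa [hT, ne_eq, EmbeddingLike.map_eq_zero_iff]
  set d := T.natDegree with hd
  obtain ⟨r, hr, hr0⟩ := exists_eq_pow_rootMultiplicity_mul_and_not_dvd T.leadingCoeff
    (leadingCoeff_ne_zero.2 hT0) 0
  set m := rootMultiplicity 0 T.leadingCoeff with hm
  rw [dvd_iff_isRoot, IsRoot.def] at hr0
  have hrc : ∀ᶠ w in 𝓝 (0 : ℂ), ‖r.eval 0‖ / 2 < ‖r.eval w‖ :=
    (r.continuous.norm.tendsto 0).eventually_const_lt (half_lt_self (norm_pos_iff.2 hr0))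
  obtain ⟨η, hη, hηr⟩ := Metric.eventually_nhds_iff_ball.1 hrc
  have hcont : ∀ j, ∃ A ≥ 0, ∀ w : ℂ, ‖w‖ ≤ 1 → ‖(T.coeff j).eval w‖ ≤ A := fun j => by
    obtain ⟨A, hA⟩ := (isCompact_closedBall (0 : ℂ) 1).exists_bound_of_continuousOn
      (T.coeff j).continuous.continuousOn
    exact ⟨max A 0, le_max_right _ _, fun w hw => (hA w (by simpa using hw)).trans (le_max_left _ _)⟩
  choose A hA0 hA using hcont
  set c := ‖r.eval 0‖ / 2 with hc
  have hcpos : 0 < c := by have := norm_pos_iff.2 hr0; positivity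
  set B := (∑ j ∈ Finset.range d, A j) / c with hB
  have hB0 : 0 ≤ B := div_nonneg (Finset.sum_nonneg fun j _ => hA0 j) hcpos.le
  set M : ℕ := m + 1 with hM
  refine ⟨min (η / 2) 1, by positivity, 1 / M, by positivity, B ^ (1 / M : ℝ), by positivity, 1,
    le_rfl, fun z w hz hw h0 => ?_⟩
  have hw1 : ‖w‖ ≤ 1 := hw.trans (min_le_right _ _)
  have hwη : w ∈ ball (0 : ℂ) η := by
    rw [mem_ball_zero_iff]; exact (hw.trans (min_le_left _ _)).trans_lt (by linarith)
  have hzp : 0 < ‖z‖ := by linarith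
  have h0' : T.evalEval w z = 0 := by rwa [hT, evalEval_swap]
  rw [evalEval, eval_eq_sum_range (p := T), eval_finsetSum, Finset.sum_range_succ] at h0'
  simp only [eval_mul, eval_pow, eval_C] at h0'
  have hlead : (T.coeff T.natDegree).eval w = w ^ m * r.eval w := by
    simpa using congrArg (eval w) hr
  have h1 : ‖w‖ ^ m * c * ‖z‖ ^ d ≤ ∑ j ∈ Finset.range d, A j * ‖z‖ ^ j := by
    have h2 : ‖(T.coeff T.natDegree).eval w * z ^ T.natDegree‖ ≤
        ∑ j ∈ Finset.range d, ‖(T.coeff j).eval w * z ^ j‖ := by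
      rw [eq_neg_of_add_eq_zero_right h0', norm_neg]
      exact norm_sum_le _ _
    rw [hlead, norm_mul, norm_mul, norm_pow, norm_pow, ← hd] at h2
    refine le_trans ?_ (h2.trans (Finset.sum_le_sum fun j _ => ?_))
    · gcongr
      exact (hηr w hwη).le
    · rw [norm_mul, norm_pow]
      gcongr
      exact hA j w hw1
  have h3 : ∑ j ∈ Finset.range d, A j * ‖z‖ ^ j ≤ (∑ j ∈ Finset.range d, A j) * (‖z‖ ^ d * ‖z‖⁻¹) := by
    rw [Finset.sum_mul]
    refine Finset.sum_le_sum fun j hj => mul_le_mul_of_nonneg_left ?_ (hA0 j)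
    have hj' : j + 1 ≤ d := Finset.mem_range.1 hj
    rw [← div_eq_mul_inv, le_div_iff₀ hzp, ← pow_succ]
    exact pow_le_pow_right₀ hz hj'
  have h4 : ‖w‖ ^ m ≤ B * ‖z‖⁻¹ := by
    rw [hB, div_mul_eq_mul_div, le_div_iff₀ hcpos]
    exact le_of_mul_le_mul_right ((h1.trans h3).trans_eq (by ring)) (by positivity : 0 < ‖z‖ ^ d)
  have h6 : ‖w‖ ^ M ≤ B * ‖z‖⁻¹ := (pow_le_pow_of_le_one (norm_nonneg _) hw1 (Nat.le_succ m)).trans h4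
  have hM0 : (M : ℝ) ≠ 0 := by positivity
  calc ‖w‖ = (‖w‖ ^ M) ^ (1 / M : ℝ) := by
        rw [← Real.rpow_natCast, ← Real.rpow_mul (norm_nonneg _), mul_one_div_cancel hM0, Real.rpow_one]
    _ ≤ (B * ‖z‖⁻¹) ^ (1 / M : ℝ) := by gcongr
    _ = _ := by
        rw [Real.mul_rpow hB0 (by positivity), Real.inv_rpow (by positivity), Real.rpow_neg (by positivity)]

open Polynomial in
theorem exists_gap {P : ℂ[X][X]} (hP : P ≠ 0) (c : ℂ) : ∃ η > 0, ∃ α > 0, ∃ C ≥ 0, ∃ R ≥ 1,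
    ∀ z w : ℂ, R ≤ ‖z‖ → ‖w - c‖ ≤ η → P.evalEval z w = 0 → ‖w - c‖ ≤ C * ‖z‖ ^ (-α : ℝ) := by
  obtain ⟨η, hη, α, hα, K, hK, R, hR, h⟩ :=
    exists_gap_zero (P := taylor (C c) P) (by rwa [ne_eq, taylor_eq_zero])
  refine ⟨η, hη, α, hα, K, hK, R, hR, fun z w hz hw hP0 => h z (w - c) hz hw ?_⟩
  rwa [evalEval, taylor_eval, ← C_add, sub_add_cancel]

end

section

section Algebraic

open Polynomial

/-- The chain rule for `z ↦ T (z, f z)`. -/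
theorem exists_hasDerivAt_evalEval (T : ℂ[X][X]) : ∃ Tz : ℂ[X][X], ∀ (f : ℂ → ℂ) (f' z : ℂ),
    HasDerivAt f f' z → HasDerivAt (fun z => T.evalEval z (f z))
      (Tz.evalEval z (f z) + T.derivative.evalEval z (f z) * f') z := by
  induction T using Polynomial.induction_on' with
  | add p q hp hq =>
    obtain ⟨a, ha⟩ := hp
    obtain ⟨b, hb⟩ := hq
    refine ⟨a + b, fun f f' z h => ?_⟩
    simp only [evalEval_add, derivative_add]
    refine ((ha f f' z h).fun_add (hb f f' z h)).congr_deriv ?_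
    ring
  | monomial n a =>
    refine ⟨C (derivative a) * X ^ n, fun f f' z h => ?_⟩
    rw [derivative_monomial, ← C_mul_X_pow_eq_monomial, ← C_mul_X_pow_eq_monomial]
    simp only [evalEval_mul, evalEval_pow, evalEval_C, evalEval_X]
    refine ((a.hasDerivAt z).fun_mul (h.fun_pow n)).congr_deriv ?_
    simp only [eval_mul, eval_natCast]
    ring

/-- Division with remainder by `Q`, after multiplication with a polynomial in `z`. -/
theorem exists_dvd_sub {Q : ℂ[X][X]} (hn : 0 < Q.natDegree) (T : ℂ[X][X]) :
    ∃ q : ℂ[X], q ≠ 0 ∧ ∃ R : ℂ[X][X], R.degree < (Q.natDegree : ℕ) ∧ Q ∣ C q * T - R := by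
  have hl : Q.leadingCoeff ≠ 0 := by
    rw [ne_eq, leadingCoeff_eq_zero]
    rintro rfl
    simp at hn
  induction T using Polynomial.induction_on with
  | C a =>
    exact ⟨1, one_ne_zero, C a, degree_C_le.trans_lt (by exact_mod_cast hn), by simp⟩
  | add p q hp hq =>
    obtain ⟨a, ha, R, hR, hRd⟩ := hp
    obtain ⟨b, hb, R', hR', hRd'⟩ := hq
    refine ⟨a * b, mul_ne_zero ha hb, C b * R + C a * R', ?_, ?_⟩
    · refine (degree_add_le _ _).trans_lt (max_lt ?_ ?_)
      · rwa [degree_C_mul hb]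
      · rwa [degree_C_mul ha]
    · convert dvd_add (hRd.mul_left (C b)) (hRd'.mul_left (C a)) using 1
      rw [C_mul]; ring
  | monomial k a ih =>
    obtain ⟨q, hq, R, hR, hRd⟩ := ih
    obtain ⟨n, hn'⟩ : ∃ n, Q.natDegree = n + 1 := ⟨Q.natDegree - 1, by omega⟩
    refine ⟨Q.leadingCoeff * q, mul_ne_zero hl hq,
      C Q.leadingCoeff * (R * X) - C (R.coeff n) * Q, ?_, ?_⟩
    · rw [degree_lt_iff_coeff_zero]
      intro j hj
      obtain ⟨j, rfl⟩ : ∃ i, j = i + 1 := ⟨j - 1, by omega⟩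
      rw [coeff_sub, coeff_C_mul, coeff_mul_X, coeff_C_mul]
      rcases (show n = j ∨ n < j by omega) with rfl | hj'
      · rw [← hn', coeff_natDegree, mul_comm, sub_self]
      · rw [(degree_lt_iff_coeff_zero _ _).1 hR j (by omega), coeff_eq_zero_of_natDegree_lt (p := Q) (by omega)]
        simp
    · convert dvd_add (hRd.mul_left (C Q.leadingCoeff * X)) (dvd_mul_left Q (C (R.coeff n))) using 1
      rw [C_mul, pow_succ]; ring

theorem eq_sum_fin {R : ℂ[X][X]} {n : ℕ} (hn : 0 < n) (h : R.degree < (n : ℕ)) :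
    R = ∑ l : Fin n, C (R.coeff l) * X ^ (l : ℕ) := by
  have hlt : R.natDegree < n := by
    rcases eq_or_ne R 0 with rfl | h0
    · simpa using hn
    · exact (natDegree_lt_iff_degree_lt h0).2 h
  rw [Fin.sum_univ_eq_sum_range (fun l => C (R.coeff l) * X ^ l) n]
  exact R.as_sum_range_C_mul_X_pow' hlt

variable {S : Set ℂ} {f : ℂ → ℂ}

theorem eq_zero_of_evalEval_C (hS : IsOpen S) (hne : S.Nonempty) {p : ℂ[X]}
    (h : ∀ z ∈ S, p.eval z = 0) : p = 0 := by
  obtain ⟨x, hx⟩ := hne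
  exact eq_zero_of_infinite_isRoot p ((infinite_of_mem_nhds x (hS.mem_nhds hx)).mono h)

/-- The powers of an algebraic function solve a linear system with rational coefficients. With the
minimal polynomial `Q` of `f` one has `f' = -Q_z / Q_w`, and `1 / Q_w` is a polynomial in `f`
because multiplication with `Q_w` is injective on the span of `1, …, f ^ (n - 1)`. -/
theorem exists_linear_ode (hS : IsOpen S) (hpre : IsPreconnected S) (hne : S.Nonempty)
    (hf : DifferentiableOn ℂ f S) (halg : IsAlgebraicOn f S) :
    ∃ m : ℕ, ∃ D : ℂ[X], D ≠ 0 ∧ ∃ G : ℂ → Matrix (Fin (m + 2)) (Fin (m + 2)) ℂ,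
      (∀ i l, DifferentiableOn ℂ (fun z => G z i l) {z | D.eval z ≠ 0}) ∧
      ∀ z ∈ S, D.eval z ≠ 0 → ∀ i : Fin (m + 2),
        HasDerivAt (fun z => f z ^ (i : ℕ)) (∑ l, G z i l * f z ^ (l : ℕ)) z := by
  classical
  have hex : ∃ n : ℕ, ∃ Q : ℂ[X][X], Q ≠ 0 ∧ Q.natDegree = n ∧ ∀ z ∈ S, Q.evalEval z (f z) = 0 := by
    obtain ⟨Q, hQ, h⟩ := halg
    exact ⟨_, Q, hQ, rfl, h⟩
  obtain ⟨Q, hQ0, hQn, hQ⟩ := Nat.find_spec hex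
  have hmin : ∀ T : ℂ[X][X], T ≠ 0 → T.degree < (Q.natDegree : ℕ) →
      ¬ ∀ z ∈ S, T.evalEval z (f z) = 0 := fun T hT hd h => by
    refine Nat.find_min hex (m := T.natDegree) ?_ ⟨T, hT, rfl, h⟩
    rw [← hQn]
    exact (natDegree_lt_iff_degree_lt hT).2 hd
  have hpos : 0 < Q.natDegree := by
    by_contra! h
    obtain ⟨p, rfl⟩ := natDegree_eq_zero.1 (Nat.le_zero.1 h)
    refine absurd (eq_zero_of_evalEval_C hS hne fun z hz => ?_) (by simpa using hQ0)
    rw [← hQ z hz, evalEval_C]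
  have hder : ∀ z ∈ S, HasDerivAt f (deriv f z) z := fun z hz =>
    (hf.differentiableAt (hS.mem_nhds hz)).hasDerivAt
  have han : ∀ T : ℂ[X][X], AnalyticOnNhd ℂ (fun z => T.evalEval z (f z)) S := fun T => by
    obtain ⟨Tz, hTz⟩ := exists_hasDerivAt_evalEval T
    exact DifferentiableOn.analyticOnNhd (fun z hz =>
      (hTz f _ z (hder z hz)).differentiableAt.differentiableWithinAt) hS
  have hprime : ∀ T T' : ℂ[X][X], (∀ z ∈ S, (T * T').evalEval z (f z) = 0) →
      (∀ z ∈ S, T.evalEval z (f z) = 0) ∨ ∀ z ∈ S, T'.evalEval z (f z) = 0 := fun T T' h =>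
    (han T).eq_zero_or_eq_zero_of_mul_eq_zero (han T')
      (fun z hz => by simpa [evalEval_mul] using h z hz) hpre
  obtain ⟨m, hm⟩ : ∃ m, Q.natDegree = m + 1 := ⟨Q.natDegree - 1, by omega⟩
  rw [hm] at hmin
  have hcoef : ∀ (v : Fin (m + 1) → ℂ[X]) (l : Fin (m + 1)),
      (∑ i, C (v i) * X ^ (i : ℕ)).coeff l = v l := fun v l => by
    simp [coeff_X_pow, Fin.val_inj]
  set Q' := derivative Q with hQ'
  have hQ'0 : Q' ≠ 0 := fun h => by
    have := derivative_eq_zero.1 h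
    omega
  have hQ'd : Q'.degree < (m + 1 : ℕ) := by
    rw [← hm, ← degree_eq_natDegree hQ0]
    exact degree_derivative_lt hQ0
  choose p hp R hR hRd using fun i : Fin (m + 1) => exists_dvd_sub hpos (X ^ (i : ℕ) * Q')
  set M : Matrix (Fin (m + 1)) (Fin (m + 1)) ℂ[X] := Matrix.of fun i l => (R i).coeff l with hM
  have hRsum : ∀ i, R i = ∑ l : Fin (m + 1), C (M i l) * X ^ (l : ℕ) := fun i => by
    rw [hm] at hR
    exact eq_sum_fin (Nat.succ_pos _) (hR i)
  have hdvd : ∀ v : Fin (m + 1) → ℂ[X],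
      Q ∣ (∑ i, C (v i * p i) * X ^ (i : ℕ)) * Q' - ∑ i, C (v i) * R i := fun v => by
    rw [Finset.sum_mul, ← Finset.sum_sub_distrib]
    refine Finset.dvd_sum fun i _ => ?_
    convert (hRd i).mul_left (C (v i)) using 1
    rw [C_mul]; ring
  have hvM : ∀ v : Fin (m + 1) → ℂ[X],
      ∑ i, C (v i) * R i = ∑ l : Fin (m + 1), C ((v ᵥ* M) l) * X ^ (l : ℕ) := fun v => by
    simp_rw [hRsum, Finset.mul_sum]
    rw [Finset.sum_comm]
    refine Finset.sum_congr rfl fun l _ => ?_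
    rw [Matrix.vecMul, dotProduct, map_sum, Finset.sum_mul]
    refine Finset.sum_congr rfl fun i _ => ?_
    rw [C_mul, mul_assoc]
  have heval : ∀ {T T' : ℂ[X][X]}, Q ∣ T - T' → ∀ z ∈ S, T.evalEval z (f z) = T'.evalEval z (f z) := by
    intro T T' h z hz
    obtain ⟨W, hW⟩ := h
    have := congrArg (evalEval z (f z)) hW
    rwa [evalEval_sub, evalEval_mul, hQ z hz, zero_mul, sub_eq_zero] at this
  have hdet : M.det ≠ 0 := fun h => by
    obtain ⟨v, hv, hv0⟩ := Matrix.exists_vecMul_eq_zero_iff.2 h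
    have h1 := hdvd v
    rw [hvM v, hv0] at h1
    simp only [Pi.zero_apply, C_0, zero_mul, Finset.sum_const_zero] at h1
    have h3 : ∀ z ∈ S, ((∑ i, C (v i * p i) * X ^ (i : ℕ)) * Q').evalEval z (f z) = 0 :=
      fun z hz => (heval h1 z hz).trans (evalEval_zero _ _)
    rcases hprime _ _ h3 with h2 | h2
    · refine hmin _ (fun h0 => hv ?_) (degree_sum_fin_lt fun i => v i * p i) h2
      funext i
      have := hcoef (fun i => v i * p i) i
      rw [h0, coeff_zero] at this
      exact (mul_eq_zero.1 this.symm).resolve_right (hp i)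
    · exact hmin _ hQ'0 hQ'd h2
  obtain ⟨d, hd⟩ : ∃ d, d = M.det := ⟨_, rfl⟩
  rw [← hd] at hdet
  set B : ℂ[X][X] := ∑ i, C (M.adjugate 0 i * p i) * X ^ (i : ℕ) with hB
  have hBQ : ∀ z ∈ S, B.evalEval z (f z) * Q'.evalEval z (f z) = d.eval z := by
    intro z hz
    have h1 := hdvd (M.adjugate 0)
    rw [hvM] at h1
    have h3 : ∑ l : Fin (m + 1), C ((M.adjugate 0 ᵥ* M) l) * X ^ (l : ℕ) = C d := by
      simp [← Matrix.mul_apply_eq_vecMul, Matrix.adjugate_mul, ← hd, Matrix.one_apply,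
        Finset.sum_ite_eq, apply_ite C, ite_mul]
    rw [h3] at h1
    have := heval h1 z hz
    rwa [evalEval_mul, evalEval_C] at this
  obtain ⟨Qz, hQz⟩ := exists_hasDerivAt_evalEval Q
  have hf' : ∀ z ∈ S, d.eval z * deriv f z = -(B * Qz).evalEval z (f z) := by
    intro z hz
    have h0 : HasDerivAt (fun z => Q.evalEval z (f z)) 0 z := by
      refine (hasDerivAt_const z (0 : ℂ)).congr_of_eventuallyEq ?_
      filter_upwards [hS.mem_nhds hz] with w hw using hQ w hw
    have h1 := (hQz f _ z (hder z hz)).unique h0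
    rw [← hBQ z hz, evalEval_mul]
    linear_combination B.evalEval z (f z) * h1
  choose q hq W hW hWd using fun i : Fin (m + 2) =>
    exists_dvd_sub hpos (-(C ((i : ℕ) : ℂ[X]) * X ^ ((i : ℕ) - 1) * (B * Qz)))
  refine ⟨m, d * ∏ i, q i, mul_ne_zero hdet (Finset.prod_ne_zero_iff.2 fun i _ => hq i),
    fun z => Matrix.of fun i l => ((W i).coeff l).eval z / ((q i).eval z * d.eval z), ?_, ?_⟩
  · intro i l z hz
    simp only [mem_ofPred_eq, eval_mul, eval_prod] at hz
    have h1 := Finset.prod_ne_zero_iff.1 (right_ne_zero_of_mul hz) i (Finset.mem_univ i)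
    have h2 := left_ne_zero_of_mul hz
    simp only [Matrix.of_apply]
    exact (((W i).coeff l).differentiableAt.div
      ((q i).differentiableAt.mul d.differentiableAt) (mul_ne_zero h1 h2)).differentiableWithinAt
  · intro z hz hDz i
    simp only [eval_mul, eval_prod] at hDz
    have h1 := Finset.prod_ne_zero_iff.1 (right_ne_zero_of_mul hDz) i (Finset.mem_univ i)
    have h2 := left_ne_zero_of_mul hDz
    refine ((hder z hz).fun_pow (i : ℕ)).congr_deriv ?_
    have h3 : W i = ∑ l : Fin (m + 2), C ((W i).coeff l) * X ^ (l : ℕ) := by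
      refine eq_sum_fin (Nat.succ_pos _) ((hW i).trans ?_)
      rw [hm]
      exact_mod_cast Nat.lt_succ_self (m + 1)
    have h4 := heval (hWd i) z hz
    rw [h3] at h4
    simp only [evalEval_mul, evalEval_neg, evalEval_finsetSum, evalEval_C, evalEval_pow, evalEval_X,
      eval_natCast] at h4
    have h5 : ∑ l : Fin (m + 2), ((W i).coeff l).eval z / ((q i).eval z * d.eval z) * f z ^ (l : ℕ) =
        (∑ l : Fin (m + 2), ((W i).coeff l).eval z * f z ^ (l : ℕ)) / ((q i).eval z * d.eval z) := by
      rw [Finset.sum_div]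
      exact Finset.sum_congr rfl fun l _ => by ring
    simp only [Matrix.of_apply]
    rw [h5, ← h4, eq_div_iff (mul_ne_zero h1 h2)]
    have h6 := hf' z hz
    rw [evalEval_mul] at h6
    linear_combination (↑↑i * f z ^ ((i : ℕ) - 1)) * (q i).eval z * h6

end Algebraic

end

section

/-! ### Extension of the jumps -/

theorem exists_le_of_finite {ι : Type*} [Finite ι] (f : ι → ℝ) : ∃ R, 1 ≤ R ∧ ∀ i, f i ≤ R := by
  cases nonempty_fintype ι
  refine ⟨1 + ∑ i, |f i|, le_add_of_nonneg_right (Finset.sum_nonneg fun i _ => abs_nonneg _),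
    fun i => ?_⟩
  have := Finset.single_le_sum (f := fun i => |f i|) (fun i _ => abs_nonneg _) (Finset.mem_univ i)
  have := le_abs_self (f i)
  linarith

/-- The part above the height `R` of the strip of half-width `2 * ε` around `Re a`. -/
def farStrip (ε : ℝ) (a : ℂ) (R : ℝ) : Set ℂ := {z | |z.re - a.re| < 2 * ε ∧ R < z.im}

theorem isOpen_farStrip (ε : ℝ) (a : ℂ) (R : ℝ) : IsOpen (farStrip ε a R) :=
  (isOpen_lt (by fun_prop : Continuous fun z : ℂ => |z.re - a.re|) continuous_const).inter
    (isOpen_lt continuous_const Complex.continuous_im)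

theorem convex_reStrip (c r : ℝ) : Convex ℝ {z : ℂ | |z.re - c| < r} := by
  exact (convex_ball c r).linear_preimage reLm

theorem convex_farStrip (ε : ℝ) (a : ℂ) (R : ℝ) : Convex ℝ (farStrip ε a R) :=
  (convex_reStrip a.re (2 * ε)).inter (convex_halfSpace_im_gt R)

theorem convex_halfStripAt (ε : ℝ) (a : ℂ) : Convex ℝ (halfStripAt ε a) := by
  have h : halfStripAt ε a = {z : ℂ | |z.re - a.re| < ε} ∩ {z : ℂ | a.im < z.im} := by
    ext z
    simp [halfStripAt, halfStrip]
  rw [h]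
  exact (convex_reStrip a.re ε).inter (convex_halfSpace_im_gt _)

theorem eventually_toImInfty {s : Set ℂ} {P : ℂ → Prop} (h : ∀ᶠ z in toImInfty s, P z) :
    ∃ R : ℝ, ∀ z ∈ s, R ≤ z.im → P z := by
  rw [toImInfty, eventually_inf_principal, eventually_comap] at h
  obtain ⟨R, hR⟩ := eventually_atTop.1 h
  exact ⟨R, fun z hz hz' => hR z.im hz' z rfl hz⟩

section Extension

attribute [local instance] Matrix.linftyOpNormedRing Matrix.linftyOpNormedAlgebra

open Polynomial in
theorem exists_eval_ne_zero {D : ℂ[X]} (hD : D ≠ 0) : ∃ R : ℝ, ∀ z : ℂ, R < ‖z‖ → D.eval z ≠ 0 := by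
  obtain ⟨R, hR⟩ := (D.roots.toFinset.finite_toSet).isBounded.exists_norm_le
  refine ⟨R, fun z hz h => ?_⟩
  have := hR z (by simpa using ⟨hD, h⟩)
  linarith

/-- An algebraic function on a half-strip that tends to `c` at `i∞` extends to a strip twice as
wide, above some height, by means of its linear differential equation; and it approaches `c` there
at the rate of a power. -/
theorem exists_algebraic_extension {ε : ℝ} (hε : 0 < ε) {a c : ℂ} {f : ℂ → ℂ}
    (hf : DifferentiableOn ℂ f (halfStripAt ε a)) (halg : IsAlgebraicOn f (halfStripAt ε a))
    (hlim : Tendsto f (toImInfty (halfStripAt ε a)) (𝓝 c)) :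
    ∃ R α C : ℝ, 0 < α ∧ 0 ≤ C ∧ ∃ g : ℂ → ℂ, DifferentiableOn ℂ g (farStrip ε a R) ∧
      (∀ z ∈ halfStripAt ε a, R < z.im → g z = f z) ∧
      ∀ z ∈ farStrip ε a R, ‖g z - c‖ ≤ C * z.im ^ (-α) := by
  have hSo : IsOpen (halfStripAt ε a) := isOpen_halfStripAt ε a
  have hSc := convex_halfStripAt ε a
  have hSne : (halfStripAt ε a).Nonempty := ⟨a + I, by simp [halfStripAt, halfStrip, hε]⟩
  obtain ⟨m, D, hD0, G, hG, hode⟩ := exists_linear_ode hSo hSc.isPreconnected hSne hf halg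
  obtain ⟨R₁, hR₁⟩ := exists_eval_ne_zero hD0
  obtain ⟨Q, hQ0, hQ⟩ := halg
  obtain ⟨η, hη, α, hα, C, hC, R₂, hR₂, hgap⟩ := exists_gap hQ0 c
  obtain ⟨R₃, hR₃⟩ := eventually_toImInfty
    (hlim.eventually (Metric.closedBall_mem_nhds c (half_pos hη)))
  have htend : Tendsto (fun y : ℝ => C * y ^ (-α)) atTop (𝓝 0) := by
    simpa using (tendsto_rpow_neg_atTop hα).const_mul C
  obtain ⟨R₄, hR₄⟩ := eventually_atTop.1 (htend.eventually_lt_const (half_pos hη))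
  obtain ⟨R, h6, hR⟩ := exists_le_of_finite ![R₁, R₂, R₃, R₄, a.im]
  have h1 : R₁ ≤ R := hR 0
  have h2 : R₂ ≤ R := hR 1
  have h3 : R₃ ≤ R := hR 2
  have h4 : R₄ ≤ R := hR 3
  have h5 : a.im ≤ R := hR 4
  set W := farStrip ε a R with hW
  have hWo : IsOpen W := isOpen_farStrip ε a R
  have hWc : Convex ℝ W := convex_farStrip ε a R
  have hnorm : ∀ z ∈ W, R < ‖z‖ := fun z hz => hz.2.trans_le
    ((le_abs_self _).trans (Complex.abs_im_le_norm z))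
  have hDW : ∀ z ∈ W, D.eval z ≠ 0 := fun z hz => hR₁ z (h1.trans_lt (hnorm z hz))
  set z₀ : ℂ := ⟨a.re, R + 1⟩ with hz₀
  have hz₀W : z₀ ∈ W := ⟨by simp [hz₀, hε], by simp [hz₀]⟩
  have hz₀S : z₀ ∈ halfStripAt ε a :=
    ⟨by simp [hz₀, hε], by simp only [hz₀, sub_im]; linarith⟩
  have hsub : ∀ z ∈ halfStripAt ε a, R < z.im → z ∈ W := fun z hz hzR => ⟨by
    have := hz.1; rw [sub_re] at this; linarith, hzR⟩
  have hGW : DifferentiableOn ℂ G W := by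
    rw [← matHolomorphicOn_iff]
    exact fun i l => (hG i l).mono hDW
  set X : ℂ → Matrix (Fin (m + 2)) (Fin (m + 2)) ℂ := fun z => Matrix.of fun i _ => f z ^ (i : ℕ)
    with hX
  set g : ℂ → ℂ := fun z => (starSol G z₀ z * X z₀) 1 0 with hg
  have hgd : DifferentiableOn ℂ g W := by
    have := (differentiableOn_starSol hWo hWc hGW hz₀W).mul (differentiableOn_const (X z₀))
    exact (matHolomorphicOn_iff.2 this) 1 0
  have hgf : ∀ z ∈ halfStripAt ε a, R < z.im → g z = f z := by
    intro z hz hzR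
    have h := eq_starSol_mul (D := W ∩ halfStripAt ε a) (hWc.inter hSc) (G := G) (X := X)
      (hGW.continuousOn.mono inter_subset_left) ⟨hz₀W, hz₀S⟩ ⟨hsub z hz hzR, hz⟩ fun w hw => by
        refine hasDerivAt_matrix_iff.2 fun i l => ?_
        simpa [hX, Matrix.mul_apply] using hode w hw.2 (hDW w hw.1) i
    change (starSol G z₀ z * X z₀) 1 0 = f z
    rw [← h]
    simp [hX]
  have hQg : ∀ z ∈ W, Q.evalEval z (g z) = 0 := by
    obtain ⟨Qz, hQz⟩ := exists_hasDerivAt_evalEval Q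
    have han : AnalyticOnNhd ℂ (fun z => Q.evalEval z (g z)) W :=
      DifferentiableOn.analyticOnNhd (fun z hz => (hQz g _ z
        (hgd.differentiableAt (hWo.mem_nhds hz)).hasDerivAt).differentiableAt.differentiableWithinAt) hWo
    refine han.eqOn_zero_of_preconnected_of_eventuallyEq_zero hWc.isPreconnected hz₀W ?_
    filter_upwards [hWo.mem_nhds hz₀W, hSo.mem_nhds hz₀S] with z hzW hzS
    rw [hgf z hzS hzW.2]
    exact hQ z hzS
  have hsmall : ∀ z ∈ W, C * z.im ^ (-α) < η / 2 := fun z hz => hR₄ z.im (h4.trans hz.2.le)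
  have hdecay : ∀ z ∈ W, ‖g z - c‖ ≤ η → ‖g z - c‖ ≤ C * z.im ^ (-α) := by
    intro z hz hzη
    have him : 0 < z.im := by linarith [hz.2]
    refine (hgap z (g z) (h2.trans (hnorm z hz).le) hzη (hQg z hz)).trans ?_
    refine mul_le_mul_of_nonneg_left (Real.rpow_le_rpow_of_nonpos him ?_ (by linarith)) hC
    exact (le_abs_self _).trans (Complex.abs_im_le_norm z)
  refine ⟨R, α, C, hα, hC, g, hgd, hgf, fun z hz => hdecay z hz ?_⟩
  by_contra! hcon
  have h0 : ‖g z₀ - c‖ ≤ η := by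
    rw [hgf z₀ hz₀S hz₀W.2, ← dist_eq_norm]
    have : dist (f z₀) c ≤ η / 2 := hR₃ z₀ hz₀S (h3.trans hz₀W.2.le)
    linarith
  obtain ⟨w, hw, hwη⟩ := hWc.isPreconnected.intermediate_value hz₀W hz
    (f := fun z => ‖g z - c‖) (hgd.continuousOn.sub continuousOn_const).norm ⟨h0, hcon.le⟩
  have hwη' : ‖g w - c‖ = η := hwη
  have := hdecay w hw hwη'.le
  have := hsmall w hw
  linarith

end Extension

section Log

/-- A holomorphic logarithm near `1`. -/
theorem exists_local_log (𝔸 : Type*) [NormedRing 𝔸] [NormedAlgebra ℂ 𝔸] [CompleteSpace 𝔸] :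
    ∃ r > 0, ∃ K ≥ 0, ∃ ℓ : 𝔸 → 𝔸, (∀ x ∈ ball (1 : 𝔸) r, DifferentiableAt ℂ ℓ x ∧
      ‖ℓ x‖ ≤ K * ‖x - 1‖) ∧ ∀ᶠ y in 𝓝 (0 : 𝔸), ℓ (NormedSpace.exp y) = y := by
  have hcd : ContDiffAt ℂ 1 (NormedSpace.exp : 𝔸 → 𝔸) 0 :=
    (NormedSpace.exp_analytic (𝕂 := ℂ) (0 : 𝔸)).contDiffAt
  have hd : HasFDerivAt (NormedSpace.exp : 𝔸 → 𝔸)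
      ((ContinuousLinearEquiv.refl ℂ 𝔸 : 𝔸 ≃L[ℂ] 𝔸) : 𝔸 →L[ℂ] 𝔸) 0 :=
    (hasStrictFDerivAt_exp_zero (𝕂 := ℂ) (𝔸 := 𝔸)).hasFDerivAt
  have hloc := hcd.to_localInverse hd one_ne_zero
  have h0 := hcd.localInverse_apply_image hd one_ne_zero
  rw [NormedSpace.exp_zero] at hloc h0
  have hev := (hloc.eventually (by simp)).mono fun x hx => hx.differentiableAt one_ne_zero
  obtain ⟨K, hK⟩ := (hloc.differentiableAt one_ne_zero).isBigO_sub.bound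
  obtain ⟨r, hr, hball⟩ := Metric.eventually_nhds_iff_ball.1 (hev.and hK)
  refine ⟨r, hr, |K|, abs_nonneg K, _, fun x hx => ⟨(hball x hx).1, ?_⟩,
    (hcd.hasStrictFDerivAt' hd one_ne_zero).eventually_left_inverse⟩
  have := (hball x hx).2
  rw [h0, sub_zero] at this
  exact this.trans (mul_le_mul_of_nonneg_right (le_abs_self K) (norm_nonneg _))

theorem exists_pos_le_of_finite {ι : Type*} [Finite ι] (f : ι → ℝ) (h : ∀ i, 0 < f i) :
    ∃ κ > 0, κ ≤ 1 ∧ ∀ i, κ ≤ f i := by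
  obtain ⟨R, hR, hfR⟩ := exists_le_of_finite fun i => (f i)⁻¹
  exact ⟨R⁻¹, by positivity, inv_le_one_of_one_le₀ hR, fun i => inv_le_of_inv_le₀ (h i) (hfR i)⟩

/-- Logarithms of the jumps, decaying at `i∞`, on strips wider than those of the data. -/
structure FarLog {ι : Type*} (ε κ R C : ℝ) (k : ι → ℂ) (L Lt : ι → ℂ → 𝔸) : Prop where
  pos : 0 < κ
  le_one : κ ≤ 1
  one_le : 1 ≤ R
  nonneg : 0 ≤ C
  holo : ∀ j, DifferentiableOn ℂ (Lt j) (farStrip ε (k j) R)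
  le : ∀ j, ∀ z ∈ farStrip ε (k j) R, ‖Lt j z‖ ≤ C * z.im ^ (-κ)
  eq : ∀ j, ∀ z ∈ halfStripAt ε (k j), R < z.im → Lt j z = L j z

end Log

section MatrixLog

attribute [local instance] Matrix.linftyOpNormedRing Matrix.linftyOpNormedAlgebra

theorem rpow_neg_le_of_le {y α κ : ℝ} (hy : 1 ≤ y) (h : κ ≤ α) : y ^ (-α) ≤ y ^ (-κ) :=
  Real.rpow_le_rpow_of_exponent_le hy (by linarith)

/-- Far up, the jumps extend to wider strips with a common rate of decay of `H j - 1`. -/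
theorem IsJumpData.exists_jump_extension {p N : ℕ} {ε : ℝ} {k : Fin p → ℂ}
    {H L : Fin p → ℂ → Matrix (Fin N) (Fin N) ℂ} (h : IsJumpData ε k H L) :
    ∃ R κ C : ℝ, 1 ≤ R ∧ 0 < κ ∧ κ ≤ 1 ∧ 0 ≤ C ∧ ∃ Ht : Fin p → ℂ → Matrix (Fin N) (Fin N) ℂ,
      ∀ j, DifferentiableOn ℂ (Ht j) (farStrip ε (k j) R) ∧
      (∀ z ∈ halfStripAt ε (k j), R < z.im → Ht j z = H j z) ∧
      ∀ z ∈ farStrip ε (k j) R, ‖Ht j z - 1‖ ≤ C * z.im ^ (-κ) := by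
  have hent : ∀ q : Fin p × Fin N × Fin N, Tendsto (fun z => H q.1 z q.2.1 q.2.2)
      (toImInfty (halfStripAt ε (k q.1))) (𝓝 ((1 : Matrix (Fin N) (Fin N) ℂ) q.2.1 q.2.2)) :=
    fun q => ((continuous_apply_apply q.2.1 q.2.2).tendsto _).comp (h.tendsto_one q.1)
  choose R α C hα hC g hg hgf hgd using fun q : Fin p × Fin N × Fin N =>
    exists_algebraic_extension h.eps_pos (h.holomorphic q.1 q.2.1 q.2.2)
      (h.algebraic q.1 q.2.1 q.2.2) (hent q)
  obtain ⟨R', hR'1, hR'⟩ := exists_le_of_finite R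
  obtain ⟨κ, hκ, hκ1, hκα⟩ := exists_pos_le_of_finite α hα
  obtain ⟨C', hC'1, hC'⟩ := exists_le_of_finite C
  have hsub : ∀ q, farStrip ε (k q.1) R' ⊆ farStrip ε (k q.1) (R q) := fun q z hz =>
    ⟨hz.1, (hR' q).trans_lt hz.2⟩
  refine ⟨R', κ, N * C', hR'1, hκ, hκ1, by positivity, fun j z => Matrix.of fun a c => g (j, a, c) z,
    fun j => ⟨?_, fun z hz hzR => ?_, fun z hz => ?_⟩⟩
  · rw [← matHolomorphicOn_iff]
    exact fun a c => (hg (j, a, c)).mono (hsub (j, a, c))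
  · ext a c
    exact hgf (j, a, c) z hz ((hR' _).trans_lt hzR)
  · have hz1 : 1 ≤ z.im := hR'1.trans hz.2.le
    rw [mul_assoc]
    refine norm_matrix_le (fun a c => ?_) (by positivity)
    refine (hgd (j, a, c) z (hsub (j, a, c) hz)).trans ?_
    gcongr
    · exact hC' _
    · exact hκα _

/-- The logarithm of the extended jump is given by a local logarithm of the Banach algebra near `1`; it
agrees with `L j` far up because `L j → 0`. -/
theorem IsJumpData.exists_farLog {p N : ℕ} {ε : ℝ} {k : Fin p → ℂ}
    {H L : Fin p → ℂ → Matrix (Fin N) (Fin N) ℂ} (h : IsJumpData ε k H L) :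
    ∃ κ R C : ℝ, ∃ Lt, FarLog ε κ R C k L Lt := by
  obtain ⟨R, κ, C, hR, hκ, hκ1, hC, Ht, hHt⟩ := h.exists_jump_extension
  obtain ⟨r, hr, K, hK, ℓ, hℓ, hℓe⟩ := exists_local_log (Matrix (Fin N) (Fin N) ℂ)
  have htend : Tendsto (fun y : ℝ => C * y ^ (-κ)) atTop (𝓝 0) := by
    simpa using (tendsto_rpow_neg_atTop hκ).const_mul C
  obtain ⟨R₁, hR₁⟩ := eventually_atTop.1 (htend.eventually_lt_const hr)
  choose R₂ hR₂ using fun j => eventually_toImInfty ((h.log_tendsto_zero j).eventually hℓe)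
  obtain ⟨R₃, -, hR₃⟩ := exists_le_of_finite R₂
  obtain ⟨R', hR'1, hR'⟩ := exists_le_of_finite ![R, R₁, R₃]
  have e1 : R ≤ R' := hR' 0
  have e2 : R₁ ≤ R' := hR' 1
  have e3 : R₃ ≤ R' := hR' 2
  have hsub : ∀ j, farStrip ε (k j) R' ⊆ farStrip ε (k j) R := fun j z hz =>
    ⟨hz.1, e1.trans_lt hz.2⟩
  have hball : ∀ j, ∀ z ∈ farStrip ε (k j) R', Ht j z ∈ ball 1 r := fun j z hz => by
    rw [mem_ball, dist_eq_norm]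
    exact ((hHt j).2.2 z (hsub j hz)).trans_lt (hR₁ z.im (e2.trans hz.2.le))
  refine ⟨κ, R', K * C, fun j z => ℓ (Ht j z), hκ, hκ1, hR'1, by positivity,
    fun j z hz => ?_, fun j z hz => ?_, fun j z hz hzR => ?_⟩
  · exact (hℓ _ (hball j z hz)).1.comp_differentiableWithinAt z (((hHt j).1.mono (hsub j)) z hz)
  · refine (hℓ _ (hball j z hz)).2.trans ?_
    rw [mul_assoc]
    exact mul_le_mul_of_nonneg_left ((hHt j).2.2 z (hsub j hz)) hK
  · rw [(hHt j).2.1 z hz (e1.trans_lt hzR), ← h.exp_log j z hz]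
    exact hR₂ j z hz ((hR₃ j).trans (e3.trans hzR.le))

end MatrixLog

end

section

/-! ### Solutions with a far away parameter -/

section
variable {ι : Type*} {ε κ R C : ℝ} {k : ι → ℂ} {H L Lt : ι → ℂ → 𝔸}

theorem tendsto_toImInfty_im (s : Set ℂ) : Tendsto Complex.im (toImInfty s) atTop :=
  tendsto_comap.mono_left inf_le_left

theorem eventually_mem_toImInfty (s : Set ℂ) : ∀ᶠ b in toImInfty s, b ∈ s :=
  mem_inf_of_right (mem_principal_self s)

theorem RHSol.congr_log {c : ι → ℂ} {U : ℂ → 𝔸} (hU : RHSol c H L U)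
    (h : ∀ j, Lt j =ᶠ[𝓝 (c j)] L j) : RHSol c H Lt U := by
  refine ⟨hU.toRHJump, hU.tendsto_one, fun j => ?_⟩
  obtain ⟨K, hK, hlim⟩ := hU.endpoint j
  refine ⟨K, hK, hlim.congr' ?_⟩
  filter_upwards [nhdsWithin_le_nhds (h j)] with z hz
  rw [hz]

/-- The neighbourhood of the cut `j` on which the far logarithm is defined. -/
theorem FarLog.cutNhd (h : StripData ε κ k H L) (hF : FarLog ε κ R C k L Lt) {b : ℂ}
    (hb : b ∈ halfStrip ε) (j : ι) :
    CutNhd (fun j => k j + b) H Lt j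
      (farStrip ε (k j) R ∩ {z | |z.re - (k j + b).re| < 2 * ε}) := by
  refine ⟨(isOpen_farStrip _ _ _).inter (isOpen_lt
    (by fun_prop : Continuous fun z : ℂ => |z.re - (k j + b).re|) continuous_const),
    fun z hz i hij => Or.inl fun hre => ?_, (hF.holo j).mono inter_subset_left, fun z hz hray => ?_⟩
  · have h1 := h.sep i j hij
    have h2 : |z.re - (k j + b).re| < 2 * ε := hz.2
    rw [hre, add_re, add_re, add_sub_add_right_eq_sub] at h2
    linarith
  · have hzS : z ∈ halfStripAt ε (k j) := by
      have h1 := hray.1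
      have h2 := hray.2
      rw [add_re] at h1
      rw [add_im] at h2
      refine ⟨?_, ?_⟩
      · rw [sub_re, h1, add_sub_cancel_left]; exact hb.1
      · rw [sub_im]; linarith [hb.2]
    rw [hF.eq j z hzS hz.1.2]
    exact h.exp_log j z hzS

theorem FarLog.congr (hF : FarLog ε κ R C k L Lt) {b : ℂ} (hb : b ∈ halfStrip ε)
    (hR : ∀ j, R < (k j).im + b.im) (j : ι) : Lt j =ᶠ[𝓝 (k j + b)] L j := by
  have h1 : k j + b ∈ halfStripAt ε (k j) := by
    simp only [halfStripAt, mem_ofPred_eq, add_sub_cancel_left]; exact hb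
  have h2 : {z : ℂ | R < z.im} ∈ 𝓝 (k j + b) :=
    (isOpen_lt continuous_const Complex.continuous_im).mem_nhds (by simpa using hR j)
  filter_upwards [(isOpen_halfStripAt _ _).mem_nhds h1, h2] with z hz hz2 using hF.eq j z hz hz2

theorem FarLog.decaysOn (hF : FarLog ε κ R C k L Lt) (hε : 0 < ε) (j : ι) :
    DecaysOn (halfStripAt ε (k j)) κ (L j) := by
  have hR := hF.one_le
  refine ⟨C, R + 1, by linarith, fun z hz hzR => ?_⟩
  rw [← hF.eq j z hz (by linarith)]
  refine hF.le j z ⟨?_, by linarith⟩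
  have := hz.1
  rw [sub_re] at this
  linarith

theorem le_norm_of_notMem_closedBox {δ : ℝ} {w : ℂ} (h : w ∉ closedBox δ) : δ ≤ ‖w‖ := by
  by_contra! hcon
  exact h ⟨(abs_re_le_norm w).trans hcon.le, (abs_le.1 ((abs_im_le_norm w).trans hcon.le)).1⟩

variable [Fintype ι]

/-- The solutions tend to `1` as the parameter goes to `i∞`: on hairpins around the cuts the jump
is close to `1`, uniformly in the parameter. -/
theorem FarLog.tendsto_one (h : StripData ε κ k H L) (hF : FarLog ε κ R C k L Lt) {B : Set ℂ}
    (hB : B ⊆ halfStrip ε) {U : ℂ → ℂ → 𝔸} (hU : ∀ b ∈ B, RHSol (fun j => k j + b) H L (U b))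
    (z : ℂ) : Tendsto (fun b => U b z) (toImInfty B) (𝓝 1) := by
  have hε := h.eps_pos
  have hκ := hF.pos
  have hC := hF.nonneg
  obtain ⟨A, -, hA⟩ := exists_le_of_finite fun j => |(k j).im|
  obtain ⟨C', hC', hlog⟩ := exists_log_mul_wt_le (half_pos hκ) (by positivity : 0 < ε / 4) hε.le
  obtain ⟨K, hK, hest⟩ := exists_outer_estimate 𝔸 ι (δ₁ := ε / 2) (δ₂ := 3 * ε / 4) (δ₃ := ε)
    (κ := κ / 2 / 2) (by positivity) (by linarith [hF.le_one]) (by positivity) (by linarith)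
    (by linarith)
  set Y : ℂ → ℝ := fun b => b.im - A - ε with hY
  set η : ℂ → ℝ := fun b => 2 * (C * C' * Y b ^ (-(κ / 2))) with hη
  have hYlim : Tendsto Y (toImInfty B) atTop :=
    tendsto_atTop_add_const_right _ _ (tendsto_atTop_add_const_right _ _ (tendsto_toImInfty_im B))
  have hηlim : Tendsto η (toImInfty B) (𝓝 0) := by
    have := (((tendsto_rpow_neg_atTop (half_pos hκ)).comp hYlim).const_mul (C * C')).const_mul 2
    simpa using this
  have hKη : Tendsto (fun b => K * η b) (toImInfty B) (𝓝 0) := by simpa using hηlim.const_mul K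
  rw [tendsto_iff_norm_sub_tendsto_zero]
  refine squeeze_zero' (Eventually.of_forall fun _ => norm_nonneg _) ?_ hKη
  filter_upwards [eventually_mem_toImInfty B, hKη.eventually_le_const one_pos,
    hηlim.eventually_le_const one_pos, hYlim.eventually_ge_atTop (R + 2 + 2 * ε),
    hYlim.eventually_gt_atTop z.im] with b hb hb1 hb2 hb3 hb4
  have hbS := hB hb
  have hR1 := hF.one_le
  have hAj : ∀ j, -A ≤ (k j).im := fun j => (abs_le.1 (hA j)).1
  have hYj : ∀ j, Y b ≤ (k j).im + b.im - ε := fun j => by have := hAj j; simp only [hY]; linarith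
  have hRj : ∀ j, R < (k j).im + b.im := fun j => by have := hYj j; linarith
  have hY0 : 0 < Y b := by linarith
  refine hest (fun j => k j + b) (ε / 4) (η b) (U b) (fun j => regPart (fun j => k j + b) Lt (U b) j)
    (fun j w => ex (lc w) (Lt j (k j + b + w))) ?_ hb1 z fun j hj => ?_
  swap
  · have h1 := hj.2
    rw [sub_im, add_im] at h1
    have := hYj j
    linarith
  have hU' := (hU b hb).congr_log fun j => hF.congr hbS hRj j
  have hcut := fun j => FarLog.cutNhd h hF hbS j
  have him : ∀ j, ∀ w ∈ closedBox ε, Y b ≤ (k j + b + w).im ∧ 1 + |w.im| ≤ (k j + b + w).im := by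
    intro j w hw
    have h1 := hYj j
    have h2 := hw.2
    rw [add_im, add_im]
    refine ⟨by linarith, ?_⟩
    rcases abs_cases w.im with ⟨h3, _⟩ | ⟨h3, _⟩ <;> rw [h3] <;> linarith
  have hmem : ∀ j, ∀ w ∈ closedBox ε, k j + b + w ∈
      farStrip ε (k j) R ∩ {z | |z.re - (k j + b).re| < 2 * ε} := by
    intro j w hw
    have h1 := hbS.1
    have h2 := hw.1
    have h3 := abs_add_le b.re w.re
    refine ⟨⟨?_, by linarith [(him j w hw).1]⟩, ?_⟩
    · rw [add_re, add_re, add_assoc, add_sub_cancel_left]; linarith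
    · change |(k j + b + w).re - (k j + b).re| < 2 * ε
      rw [add_re (k j + b) w, add_sub_cancel_left]; linarith
  have hLt : ∀ j, ∀ w ∈ closedBox ε, ‖Lt j (k j + b + w)‖ ≤ C * wt κ w.im := fun j w hw =>
    (hF.le j _ (hmem j w hw).1).trans (mul_le_mul_of_nonneg_left
      (Real.rpow_le_rpow_of_nonpos (by positivity) (him j w hw).2 (by linarith)) hC)
  have hLt2 : ∀ j, ∀ w ∈ closedBox ε,
      ‖Lt j (k j + b + w)‖ ≤ C * (Y b ^ (-(κ / 2)) * wt (κ / 2) w.im) := fun j w hw => by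
    refine (hF.le j _ (hmem j w hw).1).trans (mul_le_mul_of_nonneg_left ?_ hC)
    have h1 : 0 < (k j + b + w).im := hY0.trans_le (him j w hw).1
    rw [show -κ = -(κ / 2) + -(κ / 2) by ring, Real.rpow_add h1]
    exact mul_le_mul (Real.rpow_le_rpow_of_nonpos hY0 (him j w hw).1 (by linarith))
      (Real.rpow_le_rpow_of_nonpos (by positivity) (him j w hw).2 (by linarith))
      (by positivity) (by positivity)
  have hcutC : ∀ z, (∀ j, z - (k j + b) ∉ closedBox (ε / 4)) → z ∈ cutC fun j => k j + b :=
    fun z hz => cutC_of_notMem_closedBox (by simpa using (by positivity : 0 ≤ ε / 4)) hz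
  have hsub : openBox ε \ closedBox (ε / 4) ⊆ closedBox ε := fun w hw =>
    openBox_subset_closedBox _ hw.1
  refine ⟨by positivity, by linarith, by linarith, by linarith, by positivity,
    by linarith [hF.le_one], by simp only [hη]; positivity, fun i j hij => ?_,
    hU'.holo.mono fun z hz => hcutC z hz, fun j => ?_, fun j w hw => ?_, fun j => ?_,
    fun j w hw => ?_, ?_, fun j => ?_, hU'.tendsto_down⟩
  · simpa using h.sep i j hij
  · refine ((hcut j).differentiableOn_regPart hU').mono fun z hz => ?_
    have := hmem j _ (openBox_subset_closedBox _ hz)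
    rwa [add_sub_cancel] at this
  · have hz : k j + b + w ∈ cutC fun j => k j + b := by
      exact hcutC _ (notMem_closedBox_of_sep h.sep hw.1 hw.2 (by linarith))
    have := (hcut j).eq_regPart_mul hU'.toRHJump (hmem j w (hsub hw)) hz
    rwa [add_sub_cancel_left] at this
  · intro w hw
    have h1 : ContinuousAt lc w := by
      refine (hasDerivAt_lc ?_).continuousAt
      by_contra! hcon
      exact hw.2 ⟨by rw [hcon.1, abs_zero]; positivity, by linarith [hcon.2]⟩
    have h2 : ContinuousAt (fun w => Lt j (k j + b + w)) w :=
      ((((hF.holo j).differentiableAt ((isOpen_farStrip _ _ _).mem_nhds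
        (hmem j w (hsub hw)).1)).continuousAt).comp (f := fun w => k j + b + w) (by fun_prop))
    exact (continuous_exp_complex.continuousAt.comp (h1.smul h2)).continuousWithinAt
  · have hx : ‖lc w‖ * ‖Lt j (k j + b + w)‖ ≤ C * C' * Y b ^ (-(κ / 2)) * wt (κ / 2 / 2) w.im := by
      have hYp : 0 ≤ Y b ^ (-(κ / 2)) := by positivity
      calc _ ≤ (|Real.log ‖w‖| + 5) * (C * (Y b ^ (-(κ / 2)) * wt (κ / 2) w.im)) :=
            mul_le_mul (norm_lc_le w) (hLt2 j w (hsub hw)) (norm_nonneg _) (by positivity)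
        _ = C * Y b ^ (-(κ / 2)) * ((|Real.log ‖w‖| + 5) * wt (κ / 2) w.im) := by ring
        _ ≤ C * Y b ^ (-(κ / 2)) * (C' * wt (κ / 2 / 2) w.im) :=
            mul_le_mul_of_nonneg_left (hlog w (hsub hw).1
              (le_norm_of_notMem_closedBox hw.2)) (by positivity)
        _ = _ := by ring
    have hx0 : 0 ≤ C * C' * Y b ^ (-(κ / 2)) := by positivity
    have hx1 : C * C' * Y b ^ (-(κ / 2)) * wt (κ / 2 / 2) w.im ≤ 1 := by
      have := mul_le_of_le_one_right hx0 (wt_le_one (κ := κ / 2 / 2) (by positivity) w.im)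
      simp only [hη] at hb2
      linarith
    refine (norm_ex_sub_one_le _ _).trans ((sub_le_sub_right (Real.exp_le_exp.2 hx) 1).trans
      ((real_exp_sub_one_le (mul_nonneg hx0 (wt_pos _ _).le) hx1).trans ?_))
    simp only [hη]
    linarith
  · have hV1 : {z | ∀ j, z - (k j + b) ∉ openBox (ε / 2)} ⊆ cutC fun j => k j + b :=
      fun z hz => hcutC z fun j hj => hz j (closedBox_subset_openBox (by linarith) hj)
    exact exists_bound_of_tendsto (v := 1) (isClosed_outer _ _) (hU'.holo.continuousOn.mono hV1)
      (hU'.tendsto_one.mono_left (inf_le_inf_left _ (principal_mono.2 hV1)))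
  · obtain ⟨B', hB'⟩ := (hcut j).exists_regPart_bound hU' hκ hε (hmem j) (hLt j)
    refine ⟨B', fun z hz => ?_⟩
    have := (hB' _ (openBox_subset_closedBox _ hz)).1
    rwa [add_sub_cancel] at this

end

end

section

/-! ### Linear differential equations in convex domains -/
section
variable [IsDedekindFiniteMonoid 𝔸]

theorem VolBound.shift {a : ℝ → 𝔸} {g : ℝ → ℝ} (h : VolBound a g) {s : ℝ} (hs : 0 ≤ s) :
    VolBound (fun v => a (s + v)) (fun v => g (s + v)) where
  cont := h.cont.comp (by fun_prop) fun _ hv => add_nonneg hs hv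
  gcont := h.gcont.comp (by fun_prop) fun _ hv => add_nonneg hs hv
  gint := by
    have h1 : IntegrableOn g (Ioi s) := h.gint.mono_set (Ioi_subset_Ioi hs)
    have := (measurePreserving_add_left volume s).integrableOn_comp_preimage
      (measurableEmbedding_addLeft s) (f := g) (s := Ioi s)
    simpa [Function.comp_def] using this.2 h1
  le v hv := h.le _ (add_nonneg hs hv)

theorem VolBound.volSol_shift {a : ℝ → 𝔸} {g : ℝ → ℝ} (h : VolBound a g) {s : ℝ} (hs : 0 ≤ s) :
    volSol (fun v => a (s + v)) 0 = volSol a s := by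
  have := (h.shift hs).eq_volSol_mul le_rfl (Y := fun v => volSol a (s + v)) (E := 1)
    (h.continuousOn_volSol.comp (by fun_prop) fun _ hv => add_nonneg hs hv) ∅
    (fun u hu _ => (h.hasDerivAt_volSol (by linarith)).comp_const_add s u)
    (h.tendsto_volSol.comp (tendsto_atTop_add_const_left _ _ tendsto_id))
  simpa using this.symm

/-- By construction the equation holds along rays from `z₀`; holomorphy gives the complex derivative. -/
theorem hasDerivAt_starSol {D : Set ℂ} (hO : IsOpen D) (hD : Convex ℝ D) {G : ℂ → 𝔸}
    (hG : DifferentiableOn ℂ G D) {z₀ z : ℂ} (h₀ : z₀ ∈ D) (hz : z ∈ D) :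
    HasDerivAt (starSol G z₀) (G z * starSol G z₀ z) z := by
  have hd := differentiableOn_starSol hO hD hG h₀
  have key : ∀ z ∈ D, z ≠ z₀ → deriv (starSol G z₀) z = G z * starSol G z₀ z := by
    intro z hz hne
    -- `z` lies on the open segment from `z₀` to `z₀ + exp u • (z - z₀)` for small `u > 0`
    have hcont : Tendsto (fun u : ℝ => z₀ + (Real.exp u : ℂ) * (z - z₀)) (𝓝[>] 0) (𝓝 z) :=
      ((by fun_prop : Continuous fun u : ℝ => z₀ + (Real.exp u : ℂ) * (z - z₀)).tendsto' _ _
        (by simp)).mono_left nhdsWithin_le_nhds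
    obtain ⟨u, hu1, hu : 0 < u⟩ :=
      ((hcont.eventually (hO.mem_nhds hz)).and self_mem_nhdsWithin).exists
    set z₁ := z₀ + (Real.exp u : ℂ) * (z - z₀) with hz₁
    have hsub : z₁ - z₀ = (Real.exp u : ℂ) * (z - z₀) := by rw [hz₁]; ring
    set φ : ℝ → 𝔸 := fun t => (z₁ - z₀) • G (z₀ + t * (z₁ - z₀)) with hφ
    obtain ⟨M, hM⟩ := exists_volBound_expCoef (φ := φ)
      ((continuousOn_starCoef hD hG.continuousOn h₀).comp (f := fun t : ℝ => (z₁, t))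
        (by fun_prop) fun _ ht => ⟨hu1, ht⟩)
    have hl : ∀ v : ℝ, HasDerivAt (fun v : ℝ => z₀ + (Real.exp (-v) : ℂ) * (z₁ - z₀))
        (-(Real.exp (-v) : ℂ) * (z₁ - z₀)) v := fun v => by
      have h1 : HasDerivAt (fun v : ℝ => Real.exp (-v)) (-Real.exp (-v)) v := by
        simpa using (hasDerivAt_neg v).exp
      simpa using (h1.ofReal_comp.mul_const (z₁ - z₀)).const_add z₀
    have hflow : ∀ v, 0 ≤ v → starSol G z₀ (z₀ + (Real.exp (-v) : ℂ) * (z₁ - z₀)) =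
        volSol (expCoef φ) v := by
      intro v hv
      rw [← hM.volSol_shift hv, starSol, segSol]
      congr 1
      funext x
      simp only [expCoef, hφ, add_sub_cancel_left, neg_add, Real.exp_add, ofReal_mul]
      rw [← coe_smul, ← coe_smul, smul_smul, smul_smul, ofReal_mul]
      congr 2
      · ring
      · congr 1; ring
    have hzu : z₀ + (Real.exp (-u) : ℂ) * (z₁ - z₀) = z := by
      rw [hsub, ← mul_assoc, ← ofReal_mul, ← Real.exp_add]; simp
    have h1 : HasDerivAt (fun v : ℝ => starSol G z₀ (z₀ + (Real.exp (-v) : ℂ) * (z₁ - z₀)))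
        (expCoef φ u * volSol (expCoef φ) u) u := by
      refine (hM.hasDerivAt_volSol hu).congr_of_eventuallyEq ?_
      filter_upwards [eventually_gt_nhds hu] with v hv using hflow v hv.le
    have h2 : HasDerivAt (starSol G z₀) (deriv (starSol G z₀) z)
        (z₀ + (Real.exp (-u) : ℂ) * (z₁ - z₀)) := by
      rw [hzu]; exact (hd.differentiableAt (hO.mem_nhds hz)).hasDerivAt
    have h3 := (HasDerivAt.scomp (g₁ := starSol G z₀) u h2 (hl u)).unique h1
    rw [← hflow u hu.le, hzu, expCoef, hφ] at h3
    simp only [hzu] at h3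
    rw [← coe_smul, smul_smul, ← neg_smul, smul_mul_assoc, neg_mul] at h3
    refine smul_right_injective 𝔸 (r := -((Real.exp (-u) : ℂ) * (z₁ - z₀))) ?_ h3
    rw [neg_ne_zero, hsub]
    exact mul_ne_zero (ofReal_ne_zero.2 (Real.exp_pos _).ne')
      (mul_ne_zero (ofReal_ne_zero.2 (Real.exp_pos _).ne') (sub_ne_zero.2 hne))
  suffices h : deriv (starSol G z₀) z = G z * starSol G z₀ z by
    rw [← h]; exact (hd.differentiableAt (hO.mem_nhds hz)).hasDerivAt
  rcases eq_or_ne z z₀ with rfl | hne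
  · have h1 := ((hd.deriv hO).continuousOn.continuousAt (hO.mem_nhds hz)).tendsto
    have h2 := ((hG.mul hd).continuousOn.continuousAt (hO.mem_nhds hz)).tendsto
    refine tendsto_nhds_unique (l := 𝓝[≠] z) (h1.mono_left nhdsWithin_le_nhds)
      ((h2.mono_left nhdsWithin_le_nhds).congr' ?_)
    filter_upwards [self_mem_nhdsWithin, nhdsWithin_le_nhds (hO.mem_nhds hz)] with w hw hwD
    exact (key w hwD hw).symm
  · exact key z hz hne

theorem differentiableOn_starSol_param {O D : Set ℂ} (hO : IsOpen O) (hD : Convex ℝ D)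
    {G : ℂ → ℂ → 𝔸} (hc : ContinuousOn (fun q : ℂ × ℂ => G q.1 q.2) (O ×ˢ D))
    (hG : ∀ b ∈ D, DifferentiableOn ℂ (fun x => G x b) O) {b₀ b : ℂ} (h₀ : b₀ ∈ D) (hb : b ∈ D) :
    DifferentiableOn ℂ (fun x => starSol (G x) b₀ b) O := by
  have hmem : ∀ t ∈ Icc (0 : ℝ) 1, b₀ + t * (b - b₀) ∈ D := fun t ht => by
    have := hD.add_smul_sub_mem h₀ hb ht
    rwa [real_smul] at this
  refine differentiableOn_segSol hO (ContinuousOn.const_smul ?_ _) fun t ht =>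
    (hG _ (hmem t ht)).fun_const_smul _
  exact hc.comp (f := fun q : ℂ × ℝ => (q.1, b₀ + q.2 * (b - b₀))) (by fun_prop)
    fun q hq => ⟨hq.1, hmem q.2 hq.2⟩

end

end

section

/-! ### The ordered exponential along vertical half-lines -/

/-- The sum `∑ j, s j b / (z - (k j + b))`, in a Banach algebra. -/
noncomputable def poleSum {ι : Type*} [Fintype ι] (k : ι → ℂ) (s : ι → ℂ → 𝔸) (z b : ℂ) : 𝔸 :=
  ∑ j, (z - (k j + b))⁻¹ • s j b

/-- The coefficient of the differential equation along the half-line `b + i v`, `v ≥ 0`. -/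
noncomputable def flowCoef {ι : Type*} [Fintype ι] (k : ι → ℂ) (s : ι → ℂ → 𝔸) (b z : ℂ) (v : ℝ) :
    𝔸 := I • poleSum k s z (b + v * I)

/-- The ordered exponential of `poleSum` along the vertical half-line from `i∞` down to `b`. -/
noncomputable def flowSol {ι : Type*} [Fintype ι] (k : ι → ℂ) (s : ι → ℂ → 𝔸) (b z : ℂ) : 𝔸 :=
  volSol (flowCoef k s b z) 0

/-- The conditions on the residues `s j`. -/
structure PoleData {ι : Type*} (ε κ : ℝ) (k : ι → ℂ) (s : ι → ℂ → 𝔸) : Prop where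
  eps_pos : 0 < ε
  sep : ∀ i j, i ≠ j → 2 * ε ≤ |(k i).re - (k j).re|
  pos : 0 < κ
  le_one : κ ≤ 1
  holo : ∀ j, DifferentiableOn ℂ (s j) (halfStrip ε)
  decay : ∀ j, DecaysOn (halfStrip ε) κ (s j)

section
variable {ι : Type*} [Fintype ι] {ε κ : ℝ} {k : ι → ℂ} {s : ι → ℂ → 𝔸}

theorem isOpen_halfStrip (ε : ℝ) : IsOpen (halfStrip ε) := by
  simpa [halfStripAt] using isOpen_halfStripAt ε 0

theorem halfStrip_add {b : ℂ} (hb : b ∈ halfStrip ε) {v : ℝ} (hv : 0 ≤ v) :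
    b + v * I ∈ halfStrip ε := ⟨by simpa using hb.1, by have := hb.2; simp; linarith⟩

theorem sub_ne_zero_of_cutC {b z : ℂ} (hz : z ∈ cutC fun j => k j + b) {v : ℝ} (hv : 0 ≤ v) (j : ι) :
    z - (k j + (b + v * I)) ≠ 0 := by
  intro h
  rw [sub_eq_zero] at h
  have := mem_cutC_iff.1 hz j
  rw [h] at this
  simp at this
  linarith

/-- The residues on vertical half-lines starting near `b₀`. -/
theorem PoleData.exists_bound_box (h : PoleData ε κ k s) {b₀ : ℂ} {δ : ℝ} (hδ : 0 ≤ δ)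
    (hb : ∀ w ∈ closedBox δ, b₀ + w ∈ halfStrip ε) : ∃ M, 0 ≤ M ∧ ∀ x : ℂ, |x.re| ≤ δ → |x.im| ≤ δ →
      ∀ j, ∀ v : ℝ, 0 ≤ v → ‖s j (b₀ + x + v * I)‖ ≤ M * wt κ v := by
  choose C hC0 hC using fun j => (h.decay j).exists_wt_bound h.pos.le (h.holo j).continuousOn hb
  obtain ⟨C', hC'1, hC'⟩ := exists_le_of_finite C
  refine ⟨C' * (1 + δ) ^ κ, by positivity, fun x hx1 hx2 j v hv => ?_⟩
  have hx := abs_le.1 hx2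
  have hmem : x + v * I ∈ closedBox δ := ⟨by simpa using hx1, by simp; linarith⟩
  rw [add_assoc, mul_assoc]
  refine (hC j _ hmem).trans (mul_le_mul (hC' j) ?_ (wt_pos _ _).le (by linarith))
  have e1 : (x + v * I).im = x.im + v := by simp
  rw [e1, wt, wt, Real.rpow_neg (by positivity), Real.rpow_neg (by positivity), ← div_eq_mul_inv,
    ← one_div, div_le_div_iff₀ (by positivity) (by positivity), one_mul,
    ← Real.mul_rpow (by positivity) (by positivity), abs_of_nonneg hv]
  refine Real.rpow_le_rpow (by positivity) ?_ h.pos.le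
  have := abs_nonneg (x.im + v)
  nlinarith [le_abs_self (x.im + v), mul_nonneg hδ this]

/-- The residues far away. -/
theorem PoleData.exists_bound_far (h : PoleData ε κ k s) {η : ℝ} (hη : 0 < η) : ∃ R, 1 ≤ R ∧
    ∀ b ∈ halfStrip ε, R ≤ b.im → ∀ j, ∀ v : ℝ, 0 ≤ v → ‖s j (b + v * I)‖ ≤ η * wt (κ / 2) v := by
  have hκ := h.pos
  choose C R hR hC using h.decay
  obtain ⟨C', hC'1, hC'⟩ := exists_le_of_finite C
  obtain ⟨R', hR'1, hR'⟩ := exists_le_of_finite R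
  have htend : Tendsto (fun y : ℝ => C' * y ^ (-(κ / 2))) atTop (𝓝 0) := by
    simpa using (tendsto_rpow_neg_atTop (half_pos hκ)).const_mul C'
  obtain ⟨R₁, hR₁⟩ := eventually_atTop.1 (htend.eventually_le_const hη)
  refine ⟨max R' R₁, hR'1.trans (le_max_left _ _), fun b hb hbR j v hv => ?_⟩
  have h1 : R' ≤ b.im := (le_max_left _ _).trans hbR
  have him : (b + v * I).im = b.im + v := by simp
  have h0 : 0 < b.im + v := by linarith
  refine (hC j _ (halfStrip_add hb hv) (by rw [him]; linarith [hR' j])).trans ?_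
  rw [him, show -κ = -(κ / 2) + -(κ / 2) by ring, Real.rpow_add h0, ← mul_assoc]
  refine mul_le_mul (le_trans ?_ (hR₁ b.im ((le_max_right _ _).trans hbR))) ?_ (by positivity) hη.le
  · exact mul_le_mul (hC' j) (Real.rpow_le_rpow_of_nonpos (by linarith) (by linarith)
      (by linarith)) (by positivity) (by linarith)
  · rw [wt, abs_of_nonneg hv]
    exact Real.rpow_le_rpow_of_nonpos (by linarith) (by linarith) (by linarith)

/-- The distance from a point off the cut to the points `i v` of the cut grows linearly in `v`, locally
uniformly. -/
theorem eventually_le_norm_sub {u₀ : ℂ} (h : u₀.re ≠ 0 ∨ u₀.im < 0) : ∃ d > 0, ∀ᶠ u in 𝓝 u₀,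
    ∀ v : ℝ, 0 ≤ v → d * (1 + v) ≤ ‖u - v * I‖ := by
  obtain ⟨m, hm, hle⟩ : ∃ m > 0, ∀ v : ℝ, 0 ≤ v → m ≤ ‖u₀ - v * I‖ := by
    rcases h with h | h
    · refine ⟨|u₀.re|, abs_pos.2 h, fun v _ => ?_⟩
      simpa using abs_re_le_norm (u₀ - v * I)
    · refine ⟨-u₀.im, by linarith, fun v hv => le_trans ?_ (abs_im_le_norm _)⟩
      simp only [sub_im, mul_im, ofReal_re, I_im, ofReal_im, I_re]
      exact le_trans (by linarith) (neg_le_abs _)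
  set D := (1 + ‖u₀‖) / m + 1 with hD
  have hDp : 0 < D := by positivity
  refine ⟨1 / (2 * D), by positivity, ?_⟩
  filter_upwards [Metric.ball_mem_nhds u₀ (by positivity : 0 < 1 / (2 * D))] with u hu v hv
  have h1 := hle v hv
  have h2 : v ≤ ‖u₀‖ + ‖u₀ - v * I‖ := by
    have := norm_sub_le u₀ (u₀ - v * I)
    rw [sub_sub_cancel, norm_mul, norm_I, mul_one, norm_real, Real.norm_of_nonneg hv] at this
    exact this
  have h3 : 1 + v ≤ D * ‖u₀ - v * I‖ := by
    have : (1 + ‖u₀‖) / m * m ≤ (1 + ‖u₀‖) / m * ‖u₀ - v * I‖ := by gcongr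
    rw [div_mul_cancel₀ _ hm.ne'] at this
    rw [hD]; linarith
  have h4 : ‖u₀ - v * I‖ ≤ ‖u - v * I‖ + 1 / (2 * D) := by
    have := norm_sub_le (u - v * I) (u - u₀)
    rw [show u - v * I - (u - u₀) = u₀ - v * I by ring] at this
    have h5 : ‖u - u₀‖ < 1 / (2 * D) := by rw [← dist_eq_norm]; exact hu
    linarith
  have h6 : (1 + v) / D ≤ ‖u₀ - v * I‖ := by rw [div_le_iff₀ hDp]; linarith
  have h7 : 1 / (2 * D) ≤ 1 / (2 * D) * (1 + v) := le_mul_of_one_le_right (by positivity) (by linarith)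
  have h8 : (1 + v) / D = 1 / (2 * D) * (1 + v) + 1 / (2 * D) * (1 + v) := by field_simp; ring
  linarith

theorem norm_flowCoef_le {b z : ℂ} {v M κ' : ℝ} (hM : ∀ j, ‖s j (b + v * I)‖ ≤ M * wt κ' v) :
    ‖flowCoef k s b z v‖ ≤ ∑ j, M * (‖z - (k j + b) - v * I‖⁻¹ * wt κ' v) := by
  rw [flowCoef, norm_smul, norm_I, one_mul]
  refine (norm_sum_le _ _).trans (Finset.sum_le_sum fun j _ => ?_)
  rw [norm_smul, norm_inv, show z - (k j + (b + v * I)) = z - (k j + b) - v * I by ring]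
  calc _ ≤ ‖z - (k j + b) - v * I‖⁻¹ * (M * wt κ' v) := by gcongr; exact hM j
    _ = _ := by ring

theorem PoleData.continuousOn_flowCoef (h : PoleData ε κ k s) {b z : ℂ} (hb : b ∈ halfStrip ε)
    (hz : z ∈ cutC fun j => k j + b) : ContinuousOn (flowCoef k s b z) (Ici 0) := by
  refine ContinuousOn.const_smul (continuousOn_finsetSum _ fun j _ => ContinuousOn.smul ?_ ?_) I
  · exact ContinuousOn.inv₀ (by fun_prop) fun v hv => sub_ne_zero_of_cutC hz hv j
  · exact (h.holo j).continuousOn.comp (by fun_prop) fun v hv => halfStrip_add hb hv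

/-- Near a regular pair of parameters the differential equations have a common integrable
majorant. -/
theorem PoleData.exists_volBound (h : PoleData ε κ k s) {b₀ z₀ : ℂ} (hb₀ : b₀ ∈ halfStrip ε)
    (hz₀ : z₀ ∈ cutC fun j => k j + b₀) : ∃ g, ∀ᶠ q : ℂ × ℂ in 𝓝 (b₀, z₀), q.1 ∈ halfStrip ε ∧
      q.2 ∈ (cutC fun j => k j + q.1) ∧ VolBound (flowCoef k s q.1 q.2) g := by
  obtain ⟨δ, hδ, hδ1, hδ2⟩ : ∃ δ > 0, |b₀.re| + δ < ε ∧ δ < b₀.im := by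
    have h1 := hb₀.1
    have h2 := hb₀.2
    exact ⟨min (ε - |b₀.re|) b₀.im / 2, by grind, by grind, by grind⟩
  have hbox : ∀ w ∈ closedBox δ, b₀ + w ∈ halfStrip ε := fun w hw =>
    ⟨by rw [add_re]; linarith [abs_add_le b₀.re w.re, hw.1], by rw [add_im]; linarith [hw.2]⟩
  obtain ⟨M, hM0, hM⟩ := h.exists_bound_box hδ.le hbox
  choose d hd hdle using fun j => eventually_le_norm_sub (lc_sub_ne hz₀ (j := j))
  have hev : ∀ᶠ q : ℂ × ℂ in 𝓝 (b₀, z₀), ∀ j, ∀ v : ℝ, 0 ≤ v →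
      d j * (1 + v) ≤ ‖q.2 - (k j + q.1) - v * I‖ := by
    exact eventually_all.2 fun j => ((by fun_prop : Continuous fun q : ℂ × ℂ =>
      q.2 - (k j + q.1)).tendsto (b₀, z₀)).eventually (hdle j)
  have hball : ∀ᶠ q : ℂ × ℂ in 𝓝 (b₀, z₀), ‖q.1 - b₀‖ < δ :=
    ((by fun_prop : Continuous fun q : ℂ × ℂ => ‖q.1 - b₀‖).tendsto' _ 0
      (by simp)).eventually_lt_const hδ
  refine ⟨fun v => ∑ j, M * (d j)⁻¹ * wt (1 + κ) v, ?_⟩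
  filter_upwards [hev, hball] with q hq hqb
  have hq1 : q.1 ∈ halfStrip ε := by
    have := hbox (q.1 - b₀) ⟨(abs_re_le_norm _).trans hqb.le,
      (abs_le.1 ((abs_im_le_norm _).trans hqb.le)).1⟩
    rwa [add_sub_cancel] at this
  have hq2 : q.2 ∈ cutC fun j => k j + q.1 := by
    rw [mem_cutC_iff]
    intro j
    by_contra! hcon
    have h1 := hq j (q.2.im - (k j + q.1).im) (by linarith [hcon.2])
    have h2 : q.2 - (k j + q.1) - ((q.2.im - (k j + q.1).im : ℝ) : ℂ) * I = 0 :=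
      Complex.ext (by simp only [sub_re, hcon.1]; simp) (by simp)
    rw [h2, norm_zero] at h1
    have := mul_pos (hd j) (by linarith [hcon.2] : 0 < 1 + (q.2.im - (k j + q.1).im))
    linarith
  refine ⟨hq1, hq2, h.continuousOn_flowCoef hq1 hq2, ?_, ?_, fun v hv => ?_⟩
  · exact (continuous_finsetSum _ fun j _ => (continuous_wt _).const_mul _).continuousOn
  · exact integrable_finsetSum _ fun j _ => (integrable_wt (by linarith [h.pos])).integrableOn.const_mul _
  · refine (norm_flowCoef_le (M := M) (κ' := κ) fun j => ?_).trans (Finset.sum_le_sum fun j _ => ?_)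
    · have := hM (q.1 - b₀) ((abs_re_le_norm _).trans hqb.le) ((abs_im_le_norm _).trans hqb.le) j v hv
      rwa [add_sub_cancel] at this
    · rw [mul_assoc, ← wt_mul, ← mul_assoc (d j)⁻¹]
      refine mul_le_mul_of_nonneg_left (mul_le_mul_of_nonneg_right ?_ (wt_pos _ _).le) hM0
      rw [wt, abs_of_nonneg hv, Real.rpow_neg_one, ← mul_inv]
      exact inv_anti₀ (mul_pos (hd j) (by linarith)) (hq j v hv)

theorem PoleData.exists_volBound_self (h : PoleData ε κ k s) {b z : ℂ} (hb : b ∈ halfStrip ε)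
    (hz : z ∈ cutC fun j => k j + b) : ∃ g, VolBound (flowCoef k s b z) g := by
  obtain ⟨g, hg⟩ := h.exists_volBound hb hz
  exact ⟨g, hg.self_of_nhds.2.2⟩

theorem PoleData.differentiableAt_flowSol (h : PoleData ε κ k s) {β ζ : ℂ → ℂ} {x : ℂ}
    (hβ : ∀ᶠ y in 𝓝 x, DifferentiableAt ℂ β y) (hζ : ∀ᶠ y in 𝓝 x, DifferentiableAt ℂ ζ y)
    (hb : β x ∈ halfStrip ε) (hz : ζ x ∈ cutC fun j => k j + β x) :
    DifferentiableAt ℂ (fun y => flowSol k s (β y) (ζ y)) x := by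
  obtain ⟨g, hg⟩ := h.exists_volBound hb hz
  have hcont : Tendsto (fun y => (β y, ζ y)) (𝓝 x) (𝓝 (β x, ζ x)) :=
    hβ.self_of_nhds.continuousAt.prodMk hζ.self_of_nhds.continuousAt
  obtain ⟨r, hr, hball⟩ := Metric.eventually_nhds_iff_ball.1 ((hcont.eventually hg).and (hβ.and hζ))
  refine (differentiableOn_volSol isOpen_ball (g := g) (fun y hy => (hball y hy).1.2.2)
    (fun v hv => ?_) le_rfl).differentiableAt (ball_mem_nhds x hr)
  refine DifferentiableOn.fun_const_smul (DifferentiableOn.fun_sum fun j _ =>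
    fun y hy => DifferentiableAt.differentiableWithinAt ?_) I
  obtain ⟨⟨h1, h2, -⟩, h3, h4⟩ := hball y hy
  refine DifferentiableAt.smul (f := s j ∘ fun y => β y + v * I)
    (c := fun y => (ζ y - (k j + (β y + v * I)))⁻¹) ?_ ?_
  · exact (h4.sub ((differentiableAt_const _).add (h3.add (differentiableAt_const _)))).inv
      (sub_ne_zero_of_cutC h2 hv j)
  · exact ((h.holo j).differentiableAt ((isOpen_halfStrip ε).mem_nhds (halfStrip_add h1 hv))).comp
      (f := fun y => β y + v * I) y (h3.add (differentiableAt_const _))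

variable [IsDedekindFiniteMonoid 𝔸]

theorem PoleData.isUnit_flowSol (h : PoleData ε κ k s) {b z : ℂ} (hb : b ∈ halfStrip ε)
    (hz : z ∈ cutC fun j => k j + b) : IsUnit (flowSol k s b z) := by
  obtain ⟨g, hg⟩ := h.exists_volBound_self hb hz
  exact hg.isUnit_volSol le_rfl

/-- By construction the equation holds along vertical lines; holomorphy gives the complex derivative. -/
theorem PoleData.hasDerivAt_flowSol (h : PoleData ε κ k s) {b z : ℂ} (hb : b ∈ halfStrip ε)
    (hz : z ∈ cutC fun j => k j + b) :
    HasDerivAt (fun b => flowSol k s b z) (poleSum k s z b * flowSol k s b z) b := by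
  obtain ⟨g, hg⟩ := h.exists_volBound hb hz
  have hcont : Tendsto (fun t : ℝ => (b - t * I, z)) (𝓝[>] 0) (𝓝 (b, z)) :=
    ((by fun_prop : Continuous fun t : ℝ => (b - t * I, z)).tendsto' _ _
      (by simp)).mono_left nhdsWithin_le_nhds
  obtain ⟨t, ⟨-, -, hvb⟩, ht : 0 < t⟩ := ((hcont.eventually hg).and self_mem_nhdsWithin).exists
  have hflow : ∀ v : ℝ, 0 ≤ v → flowSol k s (b - t * I + v * I) z = volSol (flowCoef k s (b - t * I) z) v := by
    intro v hv
    rw [← hvb.volSol_shift hv, flowSol]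
    congr 1
    funext x
    simp only [flowCoef]
    congr 2
    push_cast
    ring
  have hd := (h.differentiableAt_flowSol (β := id) (ζ := fun _ => z) (x := b)
    (Eventually.of_forall fun _ => differentiableAt_id)
    (Eventually.of_forall fun _ => differentiableAt_const _) hb hz).hasDerivAt
  have e : b - t * I + t * I = b := by ring
  have h1 : HasDerivAt (fun v : ℝ => flowSol k s (b - t * I + v * I) z)
      (I • poleSum k s z b * flowSol k s b z) t := by
    have := (hvb.hasDerivAt_volSol ht).congr_of_eventuallyEq
      (f₁ := fun v : ℝ => flowSol k s (b - t * I + v * I) z) (by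
        filter_upwards [eventually_gt_nhds ht] with v hv using hflow v hv.le)
    rwa [← hflow t ht.le, flowCoef, e] at this
  have h2 : HasDerivAt (fun v : ℝ => b - t * I + v * I) I t := by
    simpa using ((hasDerivAt_id t).ofReal_comp.mul_const I).const_add (b - t * I)
  have hd' : HasDerivAt (fun b => flowSol k s b z) (deriv (fun b => flowSol k s b z) b)
      (b - t * I + t * I) := by rw [e]; exact hd
  have h3 := (HasDerivAt.scomp (g₁ := fun b => flowSol k s b z) t hd' h2).unique h1
  rw [smul_mul_assoc] at h3
  rw [← smul_right_injective 𝔸 I_ne_zero h3]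
  exact hd

end

end

section

/-! ### The jump of the ordered exponential -/

/-- The ordered exponential along `γ`, in a Banach algebra. -/
def HasOrderedExpIn (γ : ℝ → ℂ) (C : ℂ → 𝔸) (E : 𝔸) : Prop :=
  ∃ X : ℝ → 𝔸, Continuous X ∧ Tendsto X atBot (𝓝 1) ∧ Tendsto X atTop (𝓝 E) ∧
    ∃ T : Finset ℝ, ∀ t ∉ T, ∃ γ' : ℂ, HasDerivAt γ γ' t ∧
      HasDerivAt X (γ' • (C (γ t) * X t)) t

/-- The part of the half-strip below the height `y`. -/
def lowStrip (ε y : ℝ) : Set ℂ := {b | b ∈ halfStrip ε ∧ b.im < y}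

theorem convex_halfStrip (ε : ℝ) : Convex ℝ (halfStrip ε) := by
  simpa [halfStripAt] using convex_halfStripAt ε 0

theorem convex_lowStrip (ε y : ℝ) : Convex ℝ (lowStrip ε y) :=
  (convex_halfStrip ε).inter (convex_halfSpace_im_lt y)

theorem isOpen_lowStrip (ε y : ℝ) : IsOpen (lowStrip ε y) :=
  (isOpen_halfStrip ε).inter (isOpen_lt Complex.continuous_im continuous_const)

section
variable {ι : Type*} [Fintype ι] {ε κ : ℝ} {k : ι → ℂ} {s : ι → ℂ → 𝔸}

theorem PoleData.re_ne (h : PoleData ε κ k s) {z b : ℂ} {m j : ι} (hz : z ∈ halfStripAt ε (k m))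
    (hb : b ∈ halfStrip ε) (hj : j ≠ m) : z.re ≠ (k j + b).re := by
  intro he
  have h1 := h.sep j m hj
  have h2 := hz.1
  have h3 := hb.1
  rw [add_re] at he
  rw [sub_re, he] at h2
  grind

theorem PoleData.mem_cutC (h : PoleData ε κ k s) {z b : ℂ} {m : ι} (hz : z ∈ halfStripAt ε (k m))
    (hb : b ∈ halfStrip ε) (hne : b.re ≠ (z - k m).re) : z ∈ cutC fun j => k j + b := by
  rw [mem_cutC_iff]
  intro j
  left
  by_cases hj : j = m
  · subst hj
    intro he
    apply hne
    rw [sub_re, he, add_re]; ring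
  · exact h.re_ne hz hb hj

theorem PoleData.sub_ne_zero_of_low (h : PoleData ε κ k s) {z b : ℂ} {m : ι}
    (hz : z ∈ halfStripAt ε (k m)) (hb : b ∈ lowStrip ε (z - k m).im) (j : ι) :
    z - (k j + b) ≠ 0 := by
  intro he
  rw [sub_eq_zero] at he
  by_cases hj : j = m
  · subst hj
    have := hb.2
    rw [he] at this
    simp at this
  · exact h.re_ne hz hb.1 hj (by rw [he])

theorem PoleData.differentiableOn_poleSum (h : PoleData ε κ k s) {z : ℂ} {m : ι}
    (hz : z ∈ halfStripAt ε (k m)) :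
    DifferentiableOn ℂ (poleSum k s z) (lowStrip ε (z - k m).im) :=
  DifferentiableOn.fun_sum fun j _ => (DifferentiableOn.inv (by fun_prop)
    fun _ hb => h.sub_ne_zero_of_low hz hb j).smul ((h.holo j).mono fun _ hb => hb.1)

/-- The ordered exponential at `b`, transported to the reference point `i y`. -/
noncomputable def connection (k : ι → ℂ) (s : ι → ℂ → 𝔸) (y : ℝ) (b z : ℂ) : 𝔸 :=
  Ring.inverse (starSol (poleSum k s z) (y * I) b) * flowSol k s b z

theorem inverse_mul_cancel_left {P T F : 𝔸} (hP : IsUnit P) (hT : IsUnit T) :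
    Ring.inverse (P * T) * (P * F) = Ring.inverse T * F := by
  obtain ⟨P, rfl⟩ := hP
  obtain ⟨T, rfl⟩ := hT
  rw [← Units.val_mul, Ring.inverse_unit, Ring.inverse_unit, mul_inv_rev, Units.val_mul, mul_assoc,
    Units.inv_mul_cancel_left]

theorem mem_lowStrip_mul_I {y y' : ℝ} (hε : 0 < ε) (hy : 0 < y) (h : y < y') :
    (y * I : ℂ) ∈ lowStrip ε y' := ⟨⟨by simpa using hε, by simpa using hy⟩, by simpa using h⟩

theorem hairpin_of_le {b : ℂ} {δ t : ℝ} (hδ : 0 < δ) (ht : t ≤ -δ) :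
    hairpin b δ t = b - δ + (-δ - t : ℝ) * I := by
  rw [hairpin, min_eq_left (by linarith), max_eq_left ht, abs_of_neg (by linarith),
    max_eq_left (by linarith)]
  push_cast; ring

theorem hairpin_of_ge {b : ℂ} {δ t : ℝ} (hδ : 0 < δ) (ht : δ ≤ t) :
    hairpin b δ t = b + δ + (t - δ : ℝ) * I := by
  rw [hairpin, min_eq_right ht, max_eq_right (by linarith), abs_of_pos (by linarith),
    max_eq_left (by linarith)]

theorem hairpin_of_abs_le {b : ℂ} {δ t : ℝ} (ht : |t| ≤ δ) : hairpin b δ t = b + t := by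
  have := abs_le.1 ht
  rw [hairpin, min_eq_left this.2, max_eq_right this.1, max_eq_right (by linarith)]
  simp

variable [IsDedekindFiniteMonoid 𝔸] (h : PoleData ε κ k s) {m : ι} {y : ℝ} (hy : 0 < y)
include h hy

theorem PoleData.connection_eq {z : ℂ} (hz : z ∈ halfStripAt ε (k m)) (hyz : y < (z - k m).im)
    {D : Set ℂ} (hD : Convex ℝ D) (hDs : D ⊆ lowStrip ε (z - k m).im)
    (hDre : ∀ b ∈ D, b.re ≠ (z - k m).re) {b b' : ℂ} (hb : b ∈ D) (hb' : b' ∈ D) :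
    connection k s y b z = connection k s y b' z := by
  have hG := h.differentiableOn_poleSum hz
  have h0 := mem_lowStrip_mul_I h.eps_pos hy hyz
  have h1 := eq_starSol_mul hD (hG.continuousOn.mono hDs) hb hb'
    (X := fun b => flowSol k s b z) fun w hw => h.hasDerivAt_flowSol (hDs hw).1
      (h.mem_cutC hz (hDs hw).1 (hDre w hw))
  have h2 := eq_starSol_mul hD (hG.continuousOn.mono hDs) hb hb'
    (X := starSol (poleSum k s z) (y * I)) fun w hw =>
      hasDerivAt_starSol (isOpen_lowStrip _ _) (convex_lowStrip _ _) hG h0 (hDs hw)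
  rw [connection, connection, h1, h2, inverse_mul_cancel_left
    (isUnit_starSol hD (hG.continuousOn.mono hDs) hb hb')
    (isUnit_starSol (convex_lowStrip _ _) hG.continuousOn h0 (hDs hb))]

theorem PoleData.connection_left {z : ℂ} (hz : z ∈ halfStripAt ε (k m)) (hyz : y < (z - k m).im)
    {b b' : ℂ} (hb : b ∈ lowStrip ε (z - k m).im) (hb' : b' ∈ lowStrip ε (z - k m).im)
    (hr : b.re < (z - k m).re) (hr' : b'.re < (z - k m).re) :
    connection k s y b z = connection k s y b' z :=
  h.connection_eq hy hz hyz ((convex_lowStrip ε _).inter (convex_halfSpace_re_lt (z - k m).re))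
    inter_subset_left (fun _ hw => ne_of_lt hw.2) ⟨hb, hr⟩ ⟨hb', hr'⟩

theorem PoleData.connection_right {z : ℂ} (hz : z ∈ halfStripAt ε (k m)) (hyz : y < (z - k m).im)
    {b b' : ℂ} (hb : b ∈ lowStrip ε (z - k m).im) (hb' : b' ∈ lowStrip ε (z - k m).im)
    (hr : (z - k m).re < b.re) (hr' : (z - k m).re < b'.re) :
    connection k s y b z = connection k s y b' z :=
  h.connection_eq hy hz hyz ((convex_lowStrip ε _).inter (convex_halfSpace_re_gt (z - k m).re))
    inter_subset_left (fun _ hw => ne_of_gt hw.2) ⟨hb, hr⟩ ⟨hb', hr'⟩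

theorem PoleData.isUnit_connection {z b : ℂ} (hz : z ∈ halfStripAt ε (k m))
    (hyz : y < (z - k m).im) (hb : b ∈ lowStrip ε (z - k m).im) (hne : b.re ≠ (z - k m).re) :
    IsUnit (connection k s y b z) :=
  (isUnit_starSol (convex_lowStrip _ _) (h.differentiableOn_poleSum hz).continuousOn
    (mem_lowStrip_mul_I h.eps_pos hy hyz) hb).ringInverse.mul
    (h.isUnit_flowSol hb.1 (h.mem_cutC hz hb.1 hne))

theorem PoleData.differentiableAt_starSol {z b : ℂ} (hz : z ∈ halfStripAt ε (k m))
    (hyz : y < (z - k m).im) (hb : b ∈ lowStrip ε (z - k m).im) :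
    DifferentiableAt ℂ (fun z => starSol (poleSum k s z) (y * I) b) z := by
  obtain ⟨y', hy1, hy2⟩ := exists_between (max_lt hyz hb.2)
  have hlow : ∀ z' : ℂ, y' < (z' - k m).im → lowStrip ε y' ⊆ lowStrip ε (z' - k m).im :=
    fun z' hz' w hw => ⟨hw.1, hw.2.trans hz'⟩
  set O : Set ℂ := halfStripAt ε (k m) ∩ {z | y' < (z - k m).im} with hO
  have hOo : IsOpen O := (isOpen_halfStripAt _ _).inter (isOpen_lt continuous_const (by fun_prop))
  refine (differentiableOn_starSol_param hOo (convex_lowStrip ε y') (G := poleSum k s) ?_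
    (fun w hw => ?_) (mem_lowStrip_mul_I h.eps_pos hy ((le_max_left _ _).trans_lt hy1))
    ⟨hb.1, (le_max_right _ _).trans_lt hy1⟩).differentiableAt (hOo.mem_nhds ⟨hz, hy2⟩)
  · refine continuousOn_finsetSum _ fun j _ => ContinuousOn.smul (ContinuousOn.inv₀ (by fun_prop)
      fun q hq => h.sub_ne_zero_of_low hq.1.1 (hlow _ hq.1.2 hq.2) j) ?_
    exact (h.holo j).continuousOn.comp continuousOn_snd fun q hq => hq.2.1
  · exact DifferentiableOn.fun_sum fun j _ => (DifferentiableOn.inv (by fun_prop)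
      fun z' hz' => h.sub_ne_zero_of_low hz'.1 (hlow _ hz'.2 hw) j).smul (differentiableOn_const _)

theorem PoleData.differentiableAt_connection {z b : ℂ} (hz : z ∈ halfStripAt ε (k m))
    (hyz : y < (z - k m).im) (hb : b ∈ lowStrip ε (z - k m).im) (hne : b.re ≠ (z - k m).re) :
    DifferentiableAt ℂ (fun z => connection k s y b z) z := by
  have h1 := h.differentiableAt_starSol hy hz hyz hb
  have hu := isUnit_starSol (convex_lowStrip _ _) (h.differentiableOn_poleSum hz).continuousOn
    (mem_lowStrip_mul_I h.eps_pos hy hyz) hb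
  have h2 : DifferentiableAt ℂ (fun z => Ring.inverse (starSol (poleSum k s z) (y * I) b)) z :=
    h1.inverse hu
  exact h2.mul (h.differentiableAt_flowSol (β := fun _ => b) (ζ := id)
    (Eventually.of_forall fun _ => differentiableAt_const _)
    (Eventually.of_forall fun _ => differentiableAt_id) hb.1 (h.mem_cutC hz hb.1 hne))

/-- The ordered exponential along the hairpin compares the transported ordered exponentials on the
two sides of the pole. -/
theorem PoleData.connection_mul_of_hairpin {z b : ℂ} {δ : ℝ} {E : 𝔸}
    (hz : z ∈ halfStripAt ε (k m)) (hzre : (z - k m).re = 0) (hyz : y < (z - k m).im)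
    (hb : b ∈ imagHalfLine) (hbz : b.im < (z - k m).im) (hδ : 0 < δ) (hδε : δ < ε)
    (hE : HasOrderedExpIn (hairpin b δ) (poleSum k s z) E) :
    connection k s y (b - δ) z = connection k s y (b + δ) z * E := by
  obtain ⟨X, hXc, hX0, hX1, T, hT⟩ := hE
  have hstrip : ∀ t : ℝ, |t| ≤ δ → b + t ∈ lowStrip ε (z - k m).im := fun t ht =>
    ⟨⟨by simp [hb.1]; linarith, by simpa using hb.2⟩, by simpa using hbz⟩
  have hl : b - δ ∈ lowStrip ε (z - k m).im := by
    simpa [sub_eq_add_neg] using hstrip (-δ) (by rw [abs_neg, abs_of_pos hδ])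
  have hr : b + δ ∈ lowStrip ε (z - k m).im := hstrip δ (abs_of_pos hδ).le
  obtain ⟨g, hg⟩ := h.exists_volBound_self hl.1
    (h.mem_cutC hz hl.1 (by rw [hzre, sub_re, hb.1, ofReal_re]; exact (by linarith : 0 - δ < 0).ne))
  obtain ⟨g', hg'⟩ := h.exists_volBound_self hr.1
    (h.mem_cutC hz hr.1 (by rw [hzre, add_re, hb.1, ofReal_re]; exact (by linarith : 0 < 0 + δ).ne'))
  have e1 : X (-δ) = flowSol k s (b - δ) z := by
    have := hg.eq_volSol_mul le_rfl (Y := fun u => X (-δ - u)) (E := 1) (by fun_prop)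
      (T.image fun t => -δ - t) (fun u hu huT => ?_)
      (hX0.comp (tendsto_atBot_add_const_left _ _ tendsto_neg_atTop_atBot))
    · simpa [flowSol] using this
    · obtain ⟨γ', hγ, hX⟩ := hT (-δ - u) fun hh => huT (Finset.mem_image.2 ⟨_, hh, by ring⟩)
      have hd : HasDerivAt (hairpin b δ) (-I) (-δ - u) := by
        have : HasDerivAt (fun t : ℝ => b - δ + (-δ - t : ℝ) * I) (-I) (-δ - u) := by
          simpa using ((((hasDerivAt_id (-δ - u)).const_sub (-δ)).ofReal_comp).mul_const I).const_add
            (b - δ)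
        refine this.congr_of_eventuallyEq ?_
        filter_upwards [eventually_lt_nhds (by linarith : -δ - u < -δ)] with t ht
        exact hairpin_of_le hδ ht.le
      rw [hγ.unique hd, hairpin_of_le hδ (by linarith)] at hX
      refine (hX.scomp u ((hasDerivAt_id u).const_sub (-δ))).congr_deriv ?_
      rw [flowCoef, smul_mul_assoc]
      simp
  have e2 : X δ = flowSol k s (b + δ) z * E := by
    have := hg'.eq_volSol_mul le_rfl (Y := fun u => X (δ + u)) (E := E) (by fun_prop)
      (T.image fun t => t - δ) (fun u hu huT => ?_)
      (hX1.comp (tendsto_atTop_add_const_left _ _ tendsto_id))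
    · simpa [flowSol] using this
    · obtain ⟨γ', hγ, hX⟩ := hT (δ + u) fun hh => huT (Finset.mem_image.2 ⟨_, hh, by ring⟩)
      have hd : HasDerivAt (hairpin b δ) I (δ + u) := by
        have : HasDerivAt (fun t : ℝ => b + δ + (t - δ : ℝ) * I) I (δ + u) := by
          simpa using ((((hasDerivAt_id (δ + u)).sub_const δ).ofReal_comp).mul_const I).const_add
            (b + δ)
        refine this.congr_of_eventuallyEq ?_
        filter_upwards [eventually_gt_nhds (by linarith : δ < δ + u)] with t ht
        exact hairpin_of_ge hδ ht.le
      rw [hγ.unique hd, hairpin_of_ge hδ (by linarith)] at hX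
      refine (hX.comp_const_add δ u).congr_deriv ?_
      rw [flowCoef, smul_mul_assoc]
      simp
  have hG := h.differentiableOn_poleSum hz
  have e3 : X δ = starSol (poleSum k s z) (b - δ) (b + δ) * X (-δ) := by
    have hsubt : ∀ t : ℝ, b - δ + t * (b + δ - (b - δ)) = b + (-δ + t * (2 * δ) : ℝ) := fun t => by
      push_cast; ring
    have habs : ∀ t ∈ Icc (0 : ℝ) 1, |-δ + t * (2 * δ)| ≤ δ := fun t ht =>
      abs_le.2 ⟨by nlinarith [ht.1], by nlinarith [ht.2]⟩
    have := eq_segSol_mul (Y := fun t => X (-δ + t * (2 * δ)))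
      ((continuousOn_starCoef (convex_lowStrip _ _) hG.continuousOn hl).comp
        (f := fun t : ℝ => (b + δ, t)) (by fun_prop) fun _ ht => ⟨hr, ht⟩)
      (by fun_prop) (T.image fun t => (t + δ) / (2 * δ)) fun t ht htT => ?_
    · simpa [starSol, Function.comp_def, show -δ + 2 * δ = δ by ring] using this
    · obtain ⟨γ', hγ, hX⟩ := hT (-δ + t * (2 * δ)) fun hh =>
        htT (Finset.mem_image.2 ⟨_, hh, by field_simp; ring⟩)
      have hlt : |-δ + t * (2 * δ)| < δ := abs_lt.2 ⟨by nlinarith [ht.1], by nlinarith [ht.2]⟩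
      have hd : HasDerivAt (hairpin b δ) 1 (-δ + t * (2 * δ)) := by
        have : HasDerivAt (fun t : ℝ => b + (t : ℂ)) 1 (-δ + t * (2 * δ)) := by
          simpa using (hasDerivAt_id (-δ + t * (2 * δ))).ofReal_comp.const_add b
        refine this.congr_of_eventuallyEq ?_
        filter_upwards [continuous_abs.continuousAt.eventually_lt continuousAt_const hlt] with t ht
        exact hairpin_of_abs_le ht.le
      rw [hγ.unique hd, hairpin_of_abs_le hlt.le, one_smul] at hX
      have hl : HasDerivAt (fun t : ℝ => -δ + t * (2 * δ)) (2 * δ) t := by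
        simpa using ((hasDerivAt_id t).mul_const (2 * δ)).const_add (-δ)
      refine (hX.scomp t hl).congr_deriv ?_
      simp only [Function.comp_apply]
      rw [hsubt, ← coe_smul, smul_mul_assoc]
      congr 1
      push_cast; ring
  have h0 := mem_lowStrip_mul_I h.eps_pos hy hyz
  have h2 := eq_starSol_mul (convex_lowStrip _ _) hG.continuousOn hl hr
    (X := starSol (poleSum k s z) (y * I)) fun w hw =>
      hasDerivAt_starSol (isOpen_lowStrip _ _) (convex_lowStrip _ _) hG h0 hw
  rw [connection, connection, mul_assoc, ← e2, e3, h2, inverse_mul_cancel_left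
    (isUnit_starSol (convex_lowStrip _ _) hG.continuousOn hl hr)
    (isUnit_starSol (convex_lowStrip _ _) hG.continuousOn h0 hl), e1]

end

end

section

section
variable {ι : Type*} [Fintype ι] {ε κ : ℝ} {k : ι → ℂ} {s H : ι → ℂ → 𝔸}
variable [IsDedekindFiniteMonoid 𝔸] (h : PoleData ε κ k s)
  (hH : ∀ m, DifferentiableOn ℂ (H m) (halfStripAt ε (k m)))
  (hhp : ∀ m, ∀ z ∈ ray (k m), ∃ b ∈ imagHalfLine, ∃ δ : ℝ, b.im < (z - k m).im ∧ 0 < δ ∧ δ < ε ∧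
    HasOrderedExpIn (hairpin b δ) (poleSum k s z) (H m z))
include h hH hhp

/-- The hairpin condition on the centre line of the strip determines the jump everywhere. -/
theorem PoleData.connection_jump {m : ι} {y : ℝ} (hy : 0 < y) {z : ℂ} (hz : z ∈ halfStripAt ε (k m))
    (hyz : y < (z - k m).im) {b b' : ℂ} (hb : b ∈ lowStrip ε (z - k m).im)
    (hb' : b' ∈ lowStrip ε (z - k m).im) (hr : b.re < (z - k m).re) (hr' : (z - k m).re < b'.re) :
    connection k s y b z = connection k s y b' z * H m z := by
  set S : Set ℂ := halfStripAt ε (k m) ∩ {z | y < (z - k m).im} with hS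
  have hSo : IsOpen S := (isOpen_halfStripAt _ _).inter (isOpen_lt continuous_const (by fun_prop))
  have hSc : Convex ℝ S := by
    have : S = halfStripAt ε (k m) ∩ {z | y + (k m).im < z.im} := by
      ext z; simp [hS, lt_sub_iff_add_lt]
    rw [this]
    exact (convex_halfStripAt _ _).inter (convex_halfSpace_im_gt _)
  set β : ℝ → ℂ → ℂ := fun σ z => ⟨((z - k m).re + σ * ε) / 2, y⟩ with hβ
  have hβlow : ∀ σ : ℝ, |σ| ≤ 1 → ∀ z ∈ S, β σ z ∈ lowStrip ε (z - k m).im := by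
    intro σ hσ z hz
    have h1 := abs_lt.1 hz.1.1
    have h2 := abs_le.1 hσ
    have := h.eps_pos
    refine ⟨⟨abs_lt.2 ⟨?_, ?_⟩, hy⟩, hz.2⟩ <;> simp only [hβ] <;> nlinarith
  have hβl : ∀ z ∈ S, (β (-1) z).re < (z - k m).re := fun z hz => by
    have := (abs_lt.1 hz.1.1).1
    simp only [hβ]; linarith
  have hβr : ∀ z ∈ S, (z - k m).re < (β 1 z).re := fun z hz => by
    have := (abs_lt.1 hz.1.1).2
    simp only [hβ]; linarith
  have hre : Continuous fun z : ℂ => (z - k m).re := by fun_prop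
  have him : Continuous fun z : ℂ => (z - k m).im := by fun_prop
  have hA : DifferentiableOn ℂ (fun z => connection k s y (β (-1) z) z) S := fun z hz => by
    refine ((h.differentiableAt_connection hy hz.1 hz.2 (hβlow _ (by simp) z hz)
      (hβl z hz).ne).congr_of_eventuallyEq ?_).differentiableWithinAt
    filter_upwards [hSo.mem_nhds hz, continuousAt_const.eventually_lt hre.continuousAt (hβl z hz)]
      with w hw hwr
    exact h.connection_left hy hw.1 hw.2 (hβlow _ (by simp) w hw)
      ⟨(hβlow _ (by simp) z hz).1, hw.2⟩ (hβl w hw) hwr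
  have hB : DifferentiableOn ℂ (fun z => connection k s y (β 1 z) z) S := fun z hz => by
    refine ((h.differentiableAt_connection hy hz.1 hz.2 (hβlow _ (by simp) z hz)
      (hβr z hz).ne').congr_of_eventuallyEq ?_).differentiableWithinAt
    filter_upwards [hSo.mem_nhds hz, hre.continuousAt.eventually_lt continuousAt_const (hβr z hz)]
      with w hw hwr
    exact h.connection_right hy hw.1 hw.2 (hβlow _ (by simp) w hw)
      ⟨(hβlow _ (by simp) z hz).1, hw.2⟩ (hβr w hw) hwr
  have han : AnalyticOnNhd ℂ (fun z => connection k s y (β (-1) z) z -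
      connection k s y (β 1 z) z * H m z) S :=
    (hA.sub (hB.mul ((hH m).mono inter_subset_left))).analyticOnNhd hSo
  have hline : ∀ t : ℝ, y < t → k m + t * I ∈ S ∧ connection k s y (β (-1) (k m + t * I)) (k m + t * I)
      - connection k s y (β 1 (k m + t * I)) (k m + t * I) * H m (k m + t * I) = 0 := by
    intro t ht
    have hε := h.eps_pos
    have hwS : k m + t * I ∈ S := ⟨⟨by simpa using hε, by simp; linarith⟩, by simpa using ht⟩
    obtain ⟨b, hb, δ, hbz, hδ, hδε, hE⟩ := hhp m (k m + t * I) ⟨by simp, by simp; linarith⟩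
    have hre0 : (k m + t * I - k m).re = 0 := by simp
    have hst : ∀ x : ℝ, |x| < ε → b + x ∈ lowStrip ε (k m + t * I - k m).im := fun x hx =>
      ⟨⟨by simpa [hb.1] using hx, by simpa using hb.2⟩, by simpa using hbz⟩
    have hm := h.connection_mul_of_hairpin hy hwS.1 hre0 hwS.2 hb hbz hδ hδε hE
    have e1 := h.connection_left hy hwS.1 hwS.2 (hβlow (-1) (by simp) _ hwS)
      (b' := b - δ) (by simpa [sub_eq_add_neg] using hst (-δ) (by rwa [abs_neg, abs_of_pos hδ]))
      (hβl _ hwS) (by rw [hre0, sub_re, hb.1, ofReal_re]; linarith)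
    have e2 := h.connection_right hy hwS.1 hwS.2 (hβlow 1 (by simp) _ hwS)
      (b' := b + δ) (hst δ (by rwa [abs_of_pos hδ]))
      (hβr _ hwS) (by rw [hre0, add_re, hb.1, ofReal_re]; linarith)
    exact ⟨hwS, by rw [e1, e2, hm, sub_self]⟩
  have hfreq : ∃ᶠ w in 𝓝[≠] (k m + ((y + 1 : ℝ) : ℂ) * I), connection k s y (β (-1) w) w -
      connection k s y (β 1 w) w * H m w = 0 := by
    have ht : Tendsto (fun t : ℝ => k m + (t : ℂ) * I) (𝓝[≠] (y + 1))
        (𝓝[≠] (k m + ((y + 1 : ℝ) : ℂ) * I)) := by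
      refine tendsto_nhdsWithin_iff.2 ⟨((by fun_prop : Continuous fun t : ℝ =>
        k m + (t : ℂ) * I).tendsto (y + 1)).mono_left nhdsWithin_le_nhds, ?_⟩
      filter_upwards [self_mem_nhdsWithin] with t ht heq
      refine ht ?_
      have := congrArg Complex.im (add_left_cancel (heq : k m + (t : ℂ) * I = _))
      simpa using this
    refine ht.frequently (Eventually.frequently ?_)
    filter_upwards [nhdsWithin_le_nhds (lt_mem_nhds (by linarith : y < y + 1))] with t ht'
    exact (hline t ht').2
  have h0 := han.eqOn_zero_of_preconnected_of_frequently_eq_zero hSc.isPreconnected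
    (hline (y + 1) (by linarith)).1 hfreq ⟨hz, hyz⟩
  have hzS : z ∈ S := ⟨hz, hyz⟩
  rw [h.connection_left hy hz hyz hb (hβlow (-1) (by simp) z hzS) hr (hβl z hzS),
    h.connection_right hy hz hyz hb' (hβlow 1 (by simp) z hzS) hr' (hβr z hzS)]
  exact sub_eq_zero.1 h0

/-- Right of the cut the ordered exponential is the transported value from parameters left of the pole,
and conversely; both factors are continuous across the cut. -/
theorem PoleData.rhJump {b : ℂ} (hb : b ∈ halfStrip ε) :
    RHJump (fun j => k j + b) H (flowSol k s b) := by
  refine ⟨fun z hz => (h.differentiableAt_flowSol (β := fun _ => b) (ζ := id)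
    (Eventually.of_forall fun _ => differentiableAt_const _)
    (Eventually.of_forall fun _ => differentiableAt_id) hb hz).differentiableWithinAt,
    fun z hz => h.isUnit_flowSol hb hz, fun m z₀ hz₀ => ?_⟩
  have hre₀ : (z₀ - k m).re = b.re := by have := hz₀.1; simp at this ⊢; linarith
  have him₀ : b.im < (z₀ - k m).im := by have := hz₀.2; simp at this ⊢; linarith
  have hy := hb.2
  have hzS : z₀ ∈ halfStripAt ε (k m) := ⟨by rw [hre₀]; exact hb.1, hy.trans him₀⟩
  have hbl : b ∈ lowStrip ε (z₀ - k m).im := ⟨hb, him₀⟩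
  set x : ℝ → ℂ := fun σ => ⟨(b.re + σ * ε) / 2, b.im⟩ with hx
  have hxlow : ∀ σ : ℝ, |σ| ≤ 1 → ∀ z : ℂ, b.im < (z - k m).im → x σ ∈ lowStrip ε (z - k m).im := by
    intro σ hσ z hz
    have h1 := abs_lt.1 hb.1
    have h2 := abs_le.1 hσ
    have := h.eps_pos
    refine ⟨⟨abs_lt.2 ⟨?_, ?_⟩, hy⟩, hz⟩ <;> simp only [hx] <;> nlinarith
  have hxl : (x (-1)).re < b.re := by have := (abs_lt.1 hb.1).1; simp only [hx]; linarith
  have hxr : b.re < (x 1).re := by have := (abs_lt.1 hb.1).2; simp only [hx]; linarith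
  have hre : Continuous fun z : ℂ => (z - k m).re := by fun_prop
  have hnear : ∀ᶠ z in 𝓝 z₀, z ∈ halfStripAt ε (k m) ∧ b.im < (z - k m).im ∧
      (x (-1)).re < (z - k m).re ∧ (z - k m).re < (x 1).re := by
    filter_upwards [(isOpen_halfStripAt _ _).mem_nhds hzS,
      ((by fun_prop : Continuous fun z : ℂ => (z - k m).im).tendsto z₀).eventually_const_lt him₀,
      (hre.tendsto z₀).eventually_const_lt (by rwa [hre₀]),
      (hre.tendsto z₀).eventually_lt_const (by rwa [hre₀])] with z h1 h2 h3 h4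
      using ⟨h1, h2, h3, h4⟩
  have hsplit : ∀ z, z ∈ halfStripAt ε (k m) → b.im < (z - k m).im →
      flowSol k s b z = starSol (poleSum k s z) (b.im * I) b * connection k s b.im b z := by
    intro z hz hzi
    rw [connection, ← mul_assoc, Ring.mul_inverse_cancel, one_mul]
    exact isUnit_starSol (convex_lowStrip _ _) (h.differentiableOn_poleSum hz).continuousOn
      (mem_lowStrip_mul_I h.eps_pos hy hzi) ⟨hb, hzi⟩
  have hT := (h.differentiableAt_starSol hy hzS him₀ hbl).continuousAt.tendsto
  have hu := isUnit_starSol (convex_lowStrip _ _) (h.differentiableOn_poleSum hzS).continuousOn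
    (mem_lowStrip_mul_I h.eps_pos hy him₀) hbl
  have hC : ∀ σ : ℝ, |σ| ≤ 1 → (x σ).re ≠ b.re →
      Tendsto (fun z => starSol (poleSum k s z) (b.im * I) b * connection k s b.im (x σ) z) (𝓝 z₀)
        (𝓝 (starSol (poleSum k s z₀) (b.im * I) b * connection k s b.im (x σ) z₀)) :=
    fun σ hσ hne => hT.mul (h.differentiableAt_connection hy hzS him₀ (hxlow σ hσ _ him₀)
      (by rwa [hre₀])).continuousAt
  refine ⟨_, _, ((hC (-1) (by simp) hxl.ne).mono_left nhdsWithin_le_nhds).congr' ?_,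
    ((hC 1 (by simp) hxr.ne').mono_left nhdsWithin_le_nhds).congr' ?_,
    hu.mul (h.isUnit_connection hy hzS him₀ (hxlow (-1) (by simp) _ him₀) (by rw [hre₀]; exact hxl.ne)),
    hu.mul (h.isUnit_connection hy hzS him₀ (hxlow 1 (by simp) _ him₀) (by rw [hre₀]; exact hxr.ne')),
    ?_⟩
  · filter_upwards [self_mem_nhdsWithin, nhdsWithin_le_nhds hnear] with z hz hzn
    have hzr : z₀.re < z.re := hz
    have : b.re < (z - k m).re := by rw [← hre₀, sub_re, sub_re]; linarith
    rw [hsplit z hzn.1 hzn.2.1, h.connection_left hy hzn.1 hzn.2.1 (hxlow (-1) (by simp) _ hzn.2.1)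
      ⟨hb, hzn.2.1⟩ hzn.2.2.1 this]
  · filter_upwards [self_mem_nhdsWithin, nhdsWithin_le_nhds hnear] with z hz hzn
    have hzr : z.re < z₀.re := hz
    have : (z - k m).re < b.re := by rw [← hre₀, sub_re, sub_re]; linarith
    rw [hsplit z hzn.1 hzn.2.1, h.connection_right hy hzn.1 hzn.2.1 (hxlow 1 (by simp) _ hzn.2.1)
      ⟨hb, hzn.2.1⟩ hzn.2.2.2 this]
  · rw [mul_assoc, h.connection_jump hH hhp hy hzS him₀ (hxlow (-1) (by simp) _ him₀)
      (hxlow 1 (by simp) _ him₀) (by rw [hre₀]; exact hxl) (by rw [hre₀]; exact hxr)]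

end

end

section

/-! ### Estimates along paths that avoid the end points -/

/-- A sign `σ` such that subtracting `σ * y` from the smallest `a j` only increases its distance from
`0`; the other `a j` are at least `ε` away from `0`. -/
theorem exists_side_real {ι : Type*} [Finite ι] {ε : ℝ} {a : ι → ℝ}
    (h : ∀ i j, i ≠ j → 2 * ε ≤ |a i - a j|) : ∃ σ : ℝ, |σ| = 1 ∧
      ∀ j, (∀ y : ℝ, 0 ≤ y → |a j - σ * y| = |a j| + y) ∨ ε ≤ |a j| := by
  rcases isEmpty_or_nonempty ι with h0 | h0
  · exact ⟨1, by simp, fun j => h0.elim j⟩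
  obtain ⟨i, hi⟩ := Finite.exists_min fun j => |a j|
  have hfar : ∀ j, j ≠ i → ε ≤ |a j| := fun j hj => by
    have h1 := h j i hj
    have h2 := hi j
    have h3 := abs_sub (a j) (a i)
    linarith
  rcases le_or_gt 0 (a i) with hp | hn
  · refine ⟨-1, by simp, fun j => ?_⟩
    rcases eq_or_ne j i with rfl | hj
    · exact Or.inl fun y hy => by rw [abs_of_nonneg hp, abs_of_nonneg (by linarith)]; ring
    · exact Or.inr (hfar j hj)
  · refine ⟨1, by simp, fun j => ?_⟩
    rcases eq_or_ne j i with rfl | hj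
    · exact Or.inl fun y hy => by rw [abs_of_neg hn, abs_of_neg (by linarith)]; ring
    · exact Or.inr (hfar j hj)

theorem exists_vertical_kernel_bound {κ : ℝ} (h0 : 0 < κ) (h1 : κ ≤ 1) {d : ℝ} (hd : 0 < d) :
    ∃ K : ℝ, 0 ≤ K ∧ ∀ u : ℂ, d ≤ |u.re| →
      IntegrableOn (fun v : ℝ => ‖u - v * I‖⁻¹ * wt κ v) (Ioi 0) ∧
        ∫ v in Ioi (0 : ℝ), ‖u - v * I‖⁻¹ * wt κ v ≤ K := by
  obtain ⟨K, hK, H⟩ := exists_kernel_bound h0 h1 hd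
  refine ⟨K, hK, fun u hu => H u.im (Ioi 0) (fun v => ‖u - v * I‖) measurableSet_Ioi
    (by fun_prop) fun v _ => ⟨hu.trans ?_, ?_⟩⟩
  · simpa using abs_re_le_norm (u - v * I)
  · rw [abs_sub_comm]; simpa using abs_im_le_norm (u - v * I)

/-- The kernel of the vertical integrals is small for distant points. -/
theorem exists_vertical_kernel_le {κ : ℝ} (h0 : 0 < κ) (h1 : κ ≤ 1) {d e : ℝ} (hd : 0 < d)
    (he : 0 < e) : ∃ R : ℝ, ∀ u : ℂ, d ≤ |u.re| → R ≤ ‖u‖ →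
      ∫ v in Ioi (0 : ℝ), ‖u - v * I‖⁻¹ * wt κ v ≤ e := by
  obtain ⟨K, hK, H⟩ := exists_vertical_kernel_bound (half_pos h0) (by linarith) hd
  obtain ⟨K', hK', H'⟩ := exists_vertical_kernel_bound h0 h1 hd
  have ht : Tendsto (fun A : ℝ => wt (κ / 2) A * K) atTop (𝓝 0) := by
    have : Tendsto (wt (κ / 2)) atTop (𝓝 0) :=
      ((tendsto_rpow_neg_atTop (half_pos h0)).comp
        (tendsto_atTop_add_const_left atTop (1 : ℝ) tendsto_id)).congr' (by
          filter_upwards [eventually_ge_atTop 0] with A hA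
          simp [wt, abs_of_nonneg hA])
    simpa using this.mul_const K
  obtain ⟨A, hA, hA0⟩ :=
    ((ht.eventually_le_const (half_pos he)).and (eventually_ge_atTop 0)).exists
  set J := ∫ v in Ioi (0 : ℝ), wt 2 v with hJ
  have hJ0 : 0 ≤ J := integral_nonneg fun v => (wt_pos _ _).le
  refine ⟨A + 1 + (1 + A) ^ 2 * J * (2 / e), fun u hu hR => ?_⟩
  have hQ : 0 ≤ (1 + A) ^ 2 * J * (2 / e) := by positivity
  have hu0 : 0 < ‖u‖ - A := by linarith
  have i1 := (H u hu).1
  have i2 : IntegrableOn (wt 2) (Ioi 0) := (integrable_wt one_lt_two).integrableOn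
  have hle : ∀ v : ℝ, v ∈ Ioi (0 : ℝ) → ‖u - v * I‖⁻¹ * wt κ v ≤
      wt (κ / 2) A * (‖u - v * I‖⁻¹ * wt (κ / 2) v) + ((‖u‖ - A)⁻¹ * (1 + A) ^ 2) * wt 2 v := by
    intro v hv
    replace hv : 0 < v := hv
    have hp := wt_pos (κ / 2) A
    have hp2 := wt_pos (κ / 2) v
    have hp3 := wt_pos 2 v
    rcases le_or_gt v A with hvA | hvA
    · refine le_add_of_nonneg_of_le (by positivity) ?_
      rw [mul_assoc]
      have h2 : ‖u‖ - A ≤ ‖u - v * I‖ := by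
        have := norm_sub_norm_le u (v * I)
        rw [norm_mul, norm_I, mul_one, norm_real, Real.norm_of_nonneg hv.le] at this
        linarith
      refine mul_le_mul (inv_anti₀ hu0 h2) ((wt_le_one h0.le v).trans ?_) (wt_pos _ _).le
        (by positivity)
      have := one_le_mul_wt (κ := 2) zero_le_two (by rwa [abs_of_pos hv] : |v| ≤ A)
      exact_mod_cast this
    · refine le_add_of_le_of_nonneg ?_ (by positivity)
      rw [← add_halves κ, ← wt_mul, add_halves, mul_left_comm]
      refine mul_le_mul_of_nonneg_right ?_ (by positivity)
      rw [wt, wt, abs_of_pos hv, abs_of_nonneg hA0]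
      exact Real.rpow_le_rpow_of_nonpos (by positivity) (by linarith) (by linarith)
  calc _ ≤ ∫ v in Ioi (0 : ℝ), (wt (κ / 2) A * (‖u - v * I‖⁻¹ * wt (κ / 2) v) +
        ((‖u‖ - A)⁻¹ * (1 + A) ^ 2) * wt 2 v) :=
        setIntegral_mono_on (H' u hu).1
          (by exact (i1.const_mul _).add (i2.const_mul _)) measurableSet_Ioi hle
    _ = wt (κ / 2) A * (∫ v in Ioi (0 : ℝ), ‖u - v * I‖⁻¹ * wt (κ / 2) v) +
        ((‖u‖ - A)⁻¹ * (1 + A) ^ 2) * J := by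
        rw [integral_add (i1.const_mul _) (i2.const_mul _), integral_const_mul, integral_const_mul]
    _ ≤ e / 2 + e / 2 := by
        refine add_le_add ((mul_le_mul_of_nonneg_left (H u hu).2 (wt_pos _ _).le).trans hA) ?_
        rw [mul_assoc, inv_mul_le_iff₀ hu0]
        have : (1 + A) ^ 2 * J * (2 / e) * (e / 2) = (1 + A) ^ 2 * J := by field_simp
        nlinarith [mul_le_mul_of_nonneg_right (by linarith : (1 + A) ^ 2 * J * (2 / e) ≤ ‖u‖ - A)
          (half_pos he).le]
    _ = e := add_halves e

theorem norm_segSol_inverse_le [IsDedekindFiniteMonoid 𝔸] {φ : ℝ → 𝔸} {M : ℝ}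
    (hc : ContinuousOn φ (Icc 0 1)) (hM : ∀ t ∈ Icc (0 : ℝ) 1, ‖φ t‖ ≤ M) :
    ‖Ring.inverse (segSol φ)‖ ≤ ‖(1 : 𝔸)‖ * Real.exp M := by
  have h := volBound_expCoef hc hM
  have e : Ring.inverse (segSol φ) = volInv (expCoef φ) 0 :=
    Ring.inverse_unit ⟨_, _, h.volSol_mul_volInv le_rfl, h.volInv_mul_volSol le_rfl⟩
  rw [e]
  have := h.norm_volInv_le le_rfl
  rwa [tail, integral_const_mul, integral_exp_neg_Ioi_zero, mul_one] at this

theorem inverse_mul_of_isUnit {R : Type*} [Ring R] {x y : R} (hx : IsUnit x) (hy : IsUnit y) :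
    Ring.inverse (x * y) = Ring.inverse y * Ring.inverse x := by
  obtain ⟨u, rfl⟩ := hx
  obtain ⟨v, rfl⟩ := hy
  rw [← Units.val_mul, Ring.inverse_unit, Ring.inverse_unit, Ring.inverse_unit, mul_inv_rev,
    Units.val_mul]

section
variable {ι : Type*} [Fintype ι] {ε κ : ℝ} {k : ι → ℂ} {s : ι → ℂ → 𝔸}

/-- A horizontal direction in which a parameter can be moved away from all the cuts: along it the
distances from `z` to the end points do not become small. -/
theorem PoleData.exists_side (h : PoleData ε κ k s) {b z : ℂ} (hz : z ∈ cutC fun j => k j + b)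
    {δ : ℝ} (hδ : 0 < δ) (hδε : δ ≤ ε / 2) : ∃ σ : ℝ, |σ| = 1 ∧ ∀ y ∈ Icc 0 δ,
      (z ∈ cutC fun j => k j + (b + (σ * y : ℝ))) ∧ ∀ j,
        (‖z - (k j + b)‖ ≤ ‖z - (k j + (b + (σ * y : ℝ)))‖ ∧
          y ≤ |(z - (k j + (b + (σ * y : ℝ)))).re|) ∨
        δ ≤ |(z - (k j + (b + (σ * y : ℝ)))).re| := by
  obtain ⟨σ, hσ, H⟩ := exists_side_real (a := fun j => (z - (k j + b)).re) (ε := ε) (by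
    intro i j hij
    have := h.sep j i hij.symm
    simpa [sub_re, add_re] using this)
  have hre : ∀ (y : ℝ) j, (z - (k j + (b + (σ * y : ℝ)))).re = (z - (k j + b)).re - σ * y := by
    intro y j
    rw [show z - (k j + (b + (σ * y : ℝ))) = z - (k j + b) - (σ * y : ℝ) by ring, sub_re, ofReal_re]
  have him : ∀ (y : ℝ) j, (z - (k j + (b + (σ * y : ℝ)))).im = (z - (k j + b)).im := by simp
  refine ⟨σ, hσ, fun y hy => ?_⟩
  have hfar : ∀ j, ε ≤ |(z - (k j + b)).re| → δ ≤ |(z - (k j + b)).re - σ * y| := fun j hj => by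
    have h1 := abs_sub_abs_le_abs_sub (z - (k j + b)).re (σ * y)
    rw [abs_mul, hσ, one_mul, abs_of_nonneg hy.1] at h1
    linarith [hy.2]
  refine ⟨mem_cutC_iff.2 fun j => ?_, fun j => ?_⟩
  · have h2 : (z - (k j + (b + (σ * y : ℝ)))).re ≠ 0 ∨ (z - (k j + (b + (σ * y : ℝ)))).im < 0 := by
      rw [hre, him]
      rcases lc_sub_ne hz (j := j) with h1 | h1
      · left
        rw [← abs_pos]
        rcases H j with h3 | h3
        · rw [h3 y hy.1]; have := abs_pos.2 h1; linarith [hy.1]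
        · linarith [hfar j h3]
      · exact Or.inr h1
    rcases h2 with h2 | h2
    · exact Or.inl fun h3 => h2 (by rw [sub_re, h3, sub_self])
    · rw [sub_im] at h2; exact Or.inr (by linarith)
  · rw [hre]
    rcases H j with h3 | h3
    · left
      rw [h3 y hy.1]
      refine ⟨?_, by linarith [abs_nonneg (z - (k j + b)).re]⟩
      rw [norm_def, norm_def, normSq_apply, normSq_apply, him, hre]
      have := sq_le_sq.2
        (by linarith [h3 y hy.1, hy.1] : |(z - (k j + b)).re| ≤ |(z - (k j + b)).re - σ * y|)
      gcongr √(?_ + _)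
      simpa only [sq] using this
    · exact Or.inr (hfar j h3)

variable [IsDedekindFiniteMonoid 𝔸]

/-- The bounds on the residues in a horizontal neighbourhood of a half-line. -/
def ResBound (ε δ M κ' : ℝ) (s : ι → ℂ → 𝔸) (b : ℂ) : Prop :=
  ∀ x : ℝ, |x| ≤ δ → b + x ∈ halfStrip ε ∧ ∀ j, ∀ v : ℝ, 0 ≤ v → ‖s j (b + x + v * I)‖ ≤ M * wt κ' v

/-- Bounds for the ordered exponential, with `D` and `K` bounding the kernels on the horizontal and
on the vertical part of the path. The horizontal part is parametrized so that the speed is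
proportional to the distance from the point `ρ` units beyond its end. -/
theorem PoleData.flowSol_bounds (h : PoleData ε κ k s) {b z : ℂ} (hz : z ∈ cutC fun j => k j + b)
    {δ ρ κ' M K D E : ℝ} (hδ : 0 < δ) (hδε : δ ≤ ε / 2) (hρ : 0 < ρ) (hκ' : 0 ≤ κ') (hM0 : 0 ≤ M)
    (hD : 0 ≤ D) (hR : ResBound ε δ M κ' s b)
    (hdist : ∀ x : ℝ, |x| ≤ δ → ∀ j, (‖z - (k j + b)‖ ≤ ‖z - (k j + (b + x))‖ ∧
      |x| ≤ |(z - (k j + (b + x))).re|) ∨ δ ≤ |(z - (k j + (b + x))).re| →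
        (|x| + ρ) * ‖z - (k j + (b + x))‖⁻¹ ≤ D)
    (hK : ∀ x : ℝ, |x| ≤ δ → ∀ j, δ ≤ |(z - (k j + (b + x))).re| →
      IntegrableOn (fun v : ℝ => ‖z - (k j + (b + x)) - v * I‖⁻¹ * wt κ' v) (Ioi 0) ∧
        ∫ v in Ioi (0 : ℝ), ‖z - (k j + (b + x)) - v * I‖⁻¹ * wt κ' v ≤ K)
    (hE : Fintype.card ι * (M * (Real.log ((δ + ρ) / ρ) * D + K)) ≤ E) :
    ‖flowSol k s b z - 1‖ ≤ (1 + ‖(1 : 𝔸)‖) ^ 2 * (Real.exp E - 1) ∧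
      ‖Ring.inverse (flowSol k s b z)‖ ≤ (1 + ‖(1 : 𝔸)‖) ^ 2 * Real.exp E := by
  obtain ⟨σ, hσ, H⟩ := h.exists_side hz hδ hδε
  have hσy : ∀ y ∈ Icc 0 δ, |σ * y| = y := fun y hy => by
    rw [abs_mul, hσ, one_mul, abs_of_nonneg hy.1]
  have hRy := fun y (hy : y ∈ Icc 0 δ) => hR (σ * y) ((hσy y hy).trans_le hy.2)
  have hy : ∀ y ∈ Icc 0 δ, b + (σ * y : ℝ) ∈ halfStrip ε ∧
    z ∈ cutC fun j => k j + (b + (σ * y : ℝ)) := fun y hy => ⟨(hRy y hy).1, (H y hy).1⟩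
  set B := Fintype.card ι * (M * D) with hBdef
  have hB : ∀ y ∈ Icc 0 δ, (y + ρ) * ‖poleSum k s z (b + (σ * y : ℝ))‖ ≤ B := fun y hy => by
    have h0 : 0 ≤ y + ρ := by linarith [hy.1]
    refine (mul_le_mul_of_nonneg_left (norm_sum_le _ _) h0).trans ?_
    rw [Finset.mul_sum]
    refine (Finset.sum_le_card_nsmul _ _ (M * D) fun j _ => ?_).trans (by simp [hBdef])
    have h1 := hdist _ ((hσy y hy).trans_le hy.2) j (by rw [hσy y hy]; exact (H y hy).2 j)
    rw [hσy y hy] at h1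
    have h2 := (hRy y hy).2 j 0 le_rfl
    simp only [ofReal_zero, zero_mul, add_zero] at h2
    rw [norm_smul, norm_inv, ← mul_assoc, mul_comm M]
    exact mul_le_mul h1 (h2.trans (mul_le_of_le_one_right hM0 (wt_le_one hκ' _))) (norm_nonneg _) hD
  have hδm : δ ∈ Icc 0 δ := ⟨hδ.le, le_rfl⟩
  have hKj := fun j => hK _ (hσy δ hδm).le j (((H δ hδm).2 j).elim (fun h => (hσy δ hδm).symm.trans_le
    ((hσy δ hδm).trans_le h.2)) id)
  obtain ⟨g, hg, hgt⟩ : ∃ g, VolBound (flowCoef k s (b + (σ * δ : ℝ)) z) g ∧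
      tail g 0 ≤ Fintype.card ι * (M * K) := by
    refine ⟨_, ⟨h.continuousOn_flowCoef (hy δ hδm).1 (hy δ hδm).2, ?_, ?_, fun v hv =>
      norm_flowCoef_le fun j => (hRy δ hδm).2 j v hv⟩, ?_⟩
    · refine continuousOn_finsetSum _ fun j _ => continuousOn_const.mul (ContinuousOn.mul
        (ContinuousOn.inv₀ (by fun_prop) fun v hv => norm_ne_zero_iff.2 ?_)
        (continuous_wt κ').continuousOn)
      simpa only [add_assoc, sub_sub] using sub_ne_zero_of_cutC (hy δ hδm).2 hv j
    · exact integrable_finsetSum _ fun j _ => (hKj j).1.const_mul _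
    · rw [tail, integral_finsetSum _ fun j _ => (hKj j).1.const_mul _]
      refine (Finset.sum_le_card_nsmul _ _ (M * K) fun j _ => ?_).trans (by simp)
      rw [integral_const_mul]
      exact mul_le_mul_of_nonneg_left (hKj j).2 hM0
  replace hE : Real.log ((δ + ρ) / ρ) * B + tail g 0 ≤ E := by
    rw [hBdef]; linarith
  set Λ := Real.log ((δ + ρ) / ρ) with hΛ
  have hΛ0 : 0 ≤ Λ := Real.log_nonneg (by rw [le_div_iff₀ hρ]; linarith)
  have hexp : Real.exp (-Λ) = ρ / (δ + ρ) := by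
    rw [Real.exp_neg, hΛ, Real.exp_log (by positivity), inv_div]
  set P : ℝ → ℝ := fun t => (δ + ρ) * Real.exp (-(t * Λ)) - ρ with hP
  have hPmem : ∀ t ∈ Icc (0 : ℝ) 1, P t ∈ Icc 0 δ := by
    intro t ht
    have h1 : Real.exp (-Λ) ≤ Real.exp (-(t * Λ)) := Real.exp_le_exp.2 (by nlinarith [ht.2])
    have h2 : Real.exp (-(t * Λ)) ≤ 1 := Real.exp_le_one_iff.2 (by nlinarith [ht.1])
    have h3 := mul_le_mul_of_nonneg_left h1 (by positivity : 0 ≤ δ + ρ)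
    have h4 := mul_le_mul_of_nonneg_left h2 (by positivity : 0 ≤ δ + ρ)
    rw [hexp, mul_div_cancel₀ _ (by positivity)] at h3
    exact ⟨by simp only [hP]; linarith, by simp only [hP]; linarith⟩
  have hPd : ∀ t, HasDerivAt P (-Λ * (P t + ρ)) t := by
    intro t
    have := ((((hasDerivAt_id t).mul_const Λ).fun_neg.exp).const_mul (δ + ρ)).sub_const ρ
    refine this.congr_deriv ?_
    simp only [hP, id]
    ring
  set τ : ℝ → ℂ := fun t => b + (σ * P t : ℝ) with hτ
  have hτd : ∀ t, HasDerivAt τ ((σ * (-Λ * (P t + ρ)) : ℝ) : ℂ) t := fun t =>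
    (((hPd t).const_mul σ).ofReal_comp).const_add b
  set φ : ℝ → 𝔸 := fun t => ((σ * (-Λ * (P t + ρ)) : ℝ) : ℂ) • poleSum k s z (τ t) with hφ
  have hPc : Continuous P := by fun_prop
  have hφc : ContinuousOn φ (Icc 0 1) := by
    refine ContinuousOn.smul (by fun_prop) (continuousOn_finsetSum _ fun j _ => ContinuousOn.smul
      (ContinuousOn.inv₀ (by fun_prop) fun t ht => ?_)
      ((h.holo j).continuousOn.comp (by fun_prop) fun t ht => (hy _ (hPmem t ht)).1))
    simpa [hτ] using sub_ne_zero_of_cutC (hy _ (hPmem t ht)).2 le_rfl j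
  have hφM : ∀ t ∈ Icc (0 : ℝ) 1, ‖φ t‖ ≤ Λ * B := by
    intro t ht
    have h0 := (hPmem t ht).1
    rw [hφ, norm_smul, norm_real, Real.norm_eq_abs, abs_mul, hσ, one_mul, abs_mul, abs_neg,
      abs_of_nonneg hΛ0, abs_of_nonneg (by linarith), mul_assoc]
    exact mul_le_mul_of_nonneg_left (hB _ (hPmem t ht)) hΛ0
  have hYd : ∀ t ∈ Icc (0 : ℝ) 1, HasDerivAt (fun t => flowSol k s (τ t) z)
      (φ t * flowSol k s (τ t) z) t := by
    intro t ht
    obtain ⟨h1, h2⟩ := hy _ (hPmem t ht)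
    have := HasDerivAt.scomp (g₁ := fun b => flowSol k s b z) t (h.hasDerivAt_flowSol h1 h2) (hτd t)
    rwa [← smul_mul_assoc] at this
  have hmain := eq_segSol_mul hφc (fun t ht => (hYd t ht).continuousAt.continuousWithinAt) ∅
    fun t ht _ => hYd t (Ioo_subset_Icc_self ht)
  have e0 : τ 0 = b + (σ * δ : ℝ) := by simp [hτ, hP]
  have e1 : τ 1 = b := by
    simp only [hτ, hP, one_mul, hexp]
    rw [mul_div_cancel₀ _ (by positivity)]
    simp
  rw [e0, e1] at hmain
  set X := segSol φ
  set Y := flowSol k s (b + (σ * δ : ℝ)) z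
  have hX := norm_segSol_sub_one_le hφc hφM
  have hY : ‖Y - 1‖ ≤ ‖(1 : 𝔸)‖ * (Real.exp (tail g 0) - 1) := hg.norm_volSol_sub_one_le le_rfl
  have hX' := norm_segSol_inverse_le hφc hφM
  have hY' : ‖Ring.inverse Y‖ ≤ ‖(1 : 𝔸)‖ * Real.exp (tail g 0) := by
    have e : Ring.inverse Y = volInv (flowCoef k s (b + (σ * δ : ℝ)) z) 0 :=
      Ring.inverse_unit ⟨_, _, hg.volSol_mul_volInv le_rfl, hg.volInv_mul_volSol le_rfl⟩
    rw [e]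
    exact hg.norm_volInv_le le_rfl
  have hXu : IsUnit X := isUnit_segSol hφc
  have hYu : IsUnit Y := hg.isUnit_volSol le_rfl
  set x := Real.exp (Λ * B)
  set y := Real.exp (tail g 0) with hyd
  have hy1 : 1 ≤ y := Real.one_le_exp (tail_le hg.gint hg.nonneg le_rfl).1
  have hx1 : 1 ≤ x := Real.one_le_exp ((norm_nonneg _).trans (hφM 0 ⟨le_rfl, zero_le_one⟩))
  have hxy : x * y ≤ Real.exp E := by rw [← Real.exp_add]; exact Real.exp_le_exp.2 hE
  set n := ‖(1 : 𝔸)‖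
  have hn : 0 ≤ n := norm_nonneg _
  rw [hmain]
  constructor
  · have e : X * Y - 1 = (X - 1) * (Y - 1) + (X - 1) + (Y - 1) := by noncomm_ring
    rw [e]
    have h3 : ‖(X - 1) * (Y - 1)‖ ≤ (n * (x - 1)) * (n * (y - 1)) :=
      (norm_mul_le _ _).trans (mul_le_mul hX hY (norm_nonneg _) (mul_nonneg hn (by linarith)))
    refine (norm_add₃_le).trans ((add_le_add (add_le_add h3 hX) hY).trans ?_)
    have h5 := mul_nonneg (sub_nonneg.2 hx1) (sub_nonneg.2 hy1)
    calc _ = n ^ 2 * ((x - 1) * (y - 1)) + n * ((x - 1) + (y - 1)) := by ring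
      _ ≤ (1 + n) ^ 2 * ((x - 1) * (y - 1)) + (1 + n) ^ 2 * ((x - 1) + (y - 1)) :=
        add_le_add (mul_le_mul_of_nonneg_right (by nlinarith) h5)
          (mul_le_mul_of_nonneg_right (by nlinarith) (by linarith))
      _ = (1 + n) ^ 2 * (x * y - 1) := by ring
      _ ≤ _ := mul_le_mul_of_nonneg_left (by linarith) (by positivity)
  · rw [inverse_mul_of_isUnit hXu hYu]
    refine (norm_mul_le _ _).trans ((mul_le_mul hY' hX' (norm_nonneg _)
      (mul_nonneg hn (by linarith))).trans ?_)
    calc _ = n ^ 2 * (x * y) := by ring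
      _ ≤ (1 + n) ^ 2 * Real.exp E :=
        mul_le_mul (by nlinarith) hxy (by positivity) (by positivity)

/-- For large `z` the path is moved sideways by a fixed `δ`, so that its vertical part stays away from the
poles; the integrals of the coefficient along both parts are then small. -/
theorem PoleData.tendsto_flowSol (h : PoleData ε κ k s) {b : ℂ} (hb : b ∈ halfStrip ε) :
    Tendsto (flowSol k s b) (Bornology.cobounded ℂ ⊓ 𝓟 (cutC fun j => k j + b)) (𝓝 1) := by
  have hε := h.eps_pos
  obtain ⟨δ, hδ, hδε, hδ1, hδ2⟩ : ∃ δ > 0, δ ≤ ε / 2 ∧ |b.re| + δ < ε ∧ δ < b.im := by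
    have h1 := hb.1
    have h2 := hb.2
    exact ⟨min (ε / 2) (min (ε - |b.re|) b.im / 2), by grind, by grind, by grind, by grind⟩
  have hbox : ∀ w ∈ closedBox δ, b + w ∈ halfStrip ε := fun w hw =>
    ⟨by rw [add_re]; linarith [abs_add_le b.re w.re, hw.1], by rw [add_im]; linarith [hw.2]⟩
  obtain ⟨M, hM0, hM⟩ := h.exists_bound_box hδ.le hbox
  obtain ⟨D, hD1, hD⟩ := exists_le_of_finite fun j => ‖k j + b‖
  set c : ℝ := (Fintype.card ι : ℝ) with hc
  have hc0 : 0 ≤ c := Nat.cast_nonneg _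
  rw [Metric.tendsto_nhds]
  intro e he
  obtain ⟨η, hηe, hη : 0 < η⟩ := (((((by fun_prop : Continuous fun η : ℝ =>
    (1 + ‖(1 : 𝔸)‖) ^ 2 * (Real.exp η - 1)).tendsto' 0 0 (by simp)).mono_left
      nhdsWithin_le_nhds).eventually_lt_const he).and (self_mem_nhdsWithin (s := Ioi 0))).exists
  obtain ⟨K, hK0, hK⟩ := exists_vertical_kernel_bound h.pos h.le_one hδ
  obtain ⟨R, hR⟩ := exists_vertical_kernel_le h.pos h.le_one hδ
    (by positivity : 0 < η / 2 / (c * M + 1))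
  set d := max (max R 1) (Real.log 2 * (2 * δ * (c * M)) * (2 / η)) with hd
  rw [eventually_inf_principal, (Filter.hasBasis_cobounded_norm (E := ℂ)).eventually_iff]
  refine ⟨D + δ + d, trivial, fun z (hzn : D + δ + d ≤ ‖z‖) hz => ?_⟩
  have hdist : ∀ x : ℝ, |x| ≤ δ → ∀ j, d ≤ ‖z - (k j + (b + x))‖ := fun x hx j => by
    have h1 := norm_sub_norm_le z (k j + (b + x))
    have h2 : ‖k j + (b + x)‖ ≤ D + δ := by
      rw [← add_assoc]
      exact (norm_add_le _ _).trans (add_le_add (hD j) (by simpa using hx))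
    linarith
  have hd0 : 0 < d := lt_of_lt_of_le one_pos ((le_max_right _ _).trans (le_max_left _ _))
  have hfin := (h.flowSol_bounds hz hδ hδε hδ h.pos.le hM0 (D := 2 * δ * d⁻¹) (by positivity)
    (fun x hx => ⟨hbox _ ⟨by simpa using hx, by simpa using hδ.le⟩,
      hM _ (by simpa using hx) (by simpa using hδ.le)⟩)
    (fun x hx j _ => mul_le_mul (by linarith) (inv_anti₀ hd0 (hdist x hx j)) (by positivity)
      (by positivity))
    (fun x hx j hre => ⟨(hK _ hre).1, hR _ hre
      (((le_max_left _ _).trans (le_max_left _ _)).trans (hdist x hx j))⟩) (E := η) ?_).1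
  · rw [dist_eq_norm]
    exact hfin.trans_lt hηe
  · rw [show (δ + δ) / δ = 2 by field_simp; ring]
    have h1 : c * (M * (Real.log 2 * (2 * δ * d⁻¹))) ≤ η / 2 := by
      have h2 : Real.log 2 * (2 * δ * (c * M)) * (2 / η) ≤ d := le_max_right _ _
      rw [show c * (M * (Real.log 2 * (2 * δ * d⁻¹))) = Real.log 2 * (2 * δ * (c * M)) / d by ring,
        div_le_iff₀ hd0]
      calc _ = Real.log 2 * (2 * δ * (c * M)) * (2 / η) * (η / 2) := by field_simp
        _ ≤ d * (η / 2) := by gcongr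
        _ = _ := mul_comm _ _
    have h2 : c * (M * (η / 2 / (c * M + 1))) ≤ η / 2 := by
      rw [← mul_assoc, mul_div_assoc', div_le_iff₀ (by positivity)]
      nlinarith
    linarith

/-- The growth of the ordered exponential at the end points. -/
theorem PoleData.exists_bound_end (h : PoleData ε κ k s) {δ κ' : ℝ} (hδ : 0 < δ) (hδε : δ ≤ ε / 2)
    (hκ : 0 < κ') (hκ1 : κ' ≤ 1) : ∃ K : ℝ, 0 ≤ K ∧ ∀ M, 0 ≤ M → ∀ b, ResBound ε δ M κ' s b →
      ∀ m, ∀ w : ℂ, ‖w‖ ≤ δ → k m + b + w ∈ (cutC fun j => k j + b) →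
        ‖flowSol k s b (k m + b + w)‖ ≤ K * Real.exp (M * (K + K * Real.log (2 * δ / ‖w‖))) ∧
        ‖Ring.inverse (flowSol k s b (k m + b + w))‖ ≤
          K * Real.exp (M * (K + K * Real.log (2 * δ / ‖w‖))) := by
  obtain ⟨K, hK0, hK⟩ := exists_vertical_kernel_bound hκ hκ1 hδ
  set c : ℝ := (Fintype.card ι : ℝ) with hc
  have hc0 : 0 ≤ c := Nat.cast_nonneg _
  set n := ‖(1 : 𝔸)‖ with hn
  have hn0 : 0 ≤ n := norm_nonneg _
  refine ⟨(1 + n) ^ 2 + c * K + 2 * c, by positivity, fun M hM0 b hMb m w hw hz => ?_⟩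
  set z := k m + b + w with hzdef
  set K' := (1 + n) ^ 2 + c * K + 2 * c with hK'
  have hzm0 : z - (k m + b) = w := by rw [hzdef]; ring
  have hw0 : 0 < ‖w‖ := norm_pos_iff.2 fun h0 => by
    have := lc_sub_ne hz (j := m)
    simp [hzm0, h0] at this
  set l := Real.log (2 * δ / ‖w‖) with hl
  have hl0 : 0 ≤ l := Real.log_nonneg (by rw [le_div_iff₀ hw0]; linarith)
  have hfin := h.flowSol_bounds hz hδ hδε hw0 hκ.le hM0 zero_le_two hMb (fun x hx j hj => ?_)
    (fun x _ j => hK _) (E := M * (K' + K' * l)) ?_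
  · refine ⟨?_, hfin.2.trans (mul_le_mul_of_nonneg_right ?_ (Real.exp_pos _).le)⟩
    · have h1 := norm_le_norm_sub_add (flowSol k s b z) 1
      have h2 : (1 + n) ^ 2 * Real.exp (M * (K' + K' * l)) ≤ K' * Real.exp (M * (K' + K' * l)) :=
        mul_le_mul_of_nonneg_right (by rw [hK']; nlinarith [mul_nonneg hc0 hK0]) (Real.exp_pos _).le
      nlinarith [hfin.1]
    · rw [hK']; nlinarith [mul_nonneg hc0 hK0]
  · have h3 := abs_re_le_norm (z - (k j + (b + x)))
    have h8 : |x| + ‖w‖ ≤ 2 * ‖z - (k j + (b + x))‖ := by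
      rcases hj with ⟨h1, h2⟩ | h1
      · have h4 : ‖w‖ ≤ ‖z - (k j + b)‖ := by
          rcases eq_or_ne j m with rfl | hj
          · rw [hzm0]
          · have h5 := h.sep m j hj.symm
            have h6 : (z - (k j + b)).re = ((k m).re - (k j).re) - -w.re := by
              simp [hzdef]; ring
            have h7 := abs_sub_abs_le_abs_sub ((k m).re - (k j).re) (-w.re)
            rw [← h6, abs_neg] at h7
            linarith [abs_re_le_norm w, abs_re_le_norm (z - (k j + b))]
        linarith
      · linarith
    exact mul_inv_le_of_le_mul₀ (norm_nonneg _) zero_le_two h8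
  · have h1 : Real.log ((δ + ‖w‖) / ‖w‖) ≤ l :=
      Real.log_le_log (by positivity) (by gcongr; linarith)
    have hcM := mul_nonneg hc0 hM0
    have h2 := mul_le_mul_of_nonneg_right h1 (by positivity : 0 ≤ 2 * (c * M))
    have h3 : M * (K' + K' * l) = (1 + n) ^ 2 * (M * (1 + l)) + c * (M * K) + 2 * (c * M) +
      c * (M * K) * l + l * (2 * (c * M)) := by rw [hK']; ring
    have h4 : 0 ≤ (1 + n) ^ 2 * (M * (1 + l)) := by positivity
    have h5 : 0 ≤ c * (M * K) * l := by positivity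
    linarith

end

end

section

/-! ### The behaviour at the end points -/

/-- The plane cut along the half-line `[0, i∞)`. -/
def offCut : Set ℂ := {w | w.re ≠ 0 ∨ w.im < 0}

theorem offCut_eq : offCut = cutC fun _ : Unit => (0 : ℂ) := by
  ext w
  rw [mem_cutC_iff]
  simp [offCut]

instance neBot_offCut (z : ℂ) : (𝓝[offCut] z).NeBot := by rw [offCut_eq]; infer_instance

/-- A family of functions with isolated singularities at `0`, holomorphic in a parameter, has
removable singularities for all parameters if it has them near one parameter. In the family,
`f b` is given by the Cauchy integral near one parameter, hence everywhere. -/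
theorem exists_tendsto_of_removable {E : Type*} [NormedAddCommGroup E] [NormedSpace ℂ E]
    [CompleteSpace E] {O : Set ℂ} (hO : IsOpen O) (hOc : IsPreconnected O) {r r' : ℝ} (hr : 0 < r)
    (hr' : r < r') {f : ℂ → ℂ → E}
    (h1 : ∀ b ∈ O, DifferentiableOn ℂ (f b) (ball 0 r' \ {0}))
    (h2 : ∀ w ∈ offCut, ‖w‖ ≤ r → DifferentiableOn ℂ (fun b => f b w) O)
    (h3 : ∀ b₀ ∈ O, ∃ ρ > 0, ∃ M, ∀ b ∈ ball b₀ ρ ∩ O, ∀ w ∈ offCut, ‖w‖ = r → ‖f b w‖ ≤ M)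
    {b₁ : ℂ} (hb₁ : b₁ ∈ O)
    (h4 : ∀ᶠ b in 𝓝 b₁, ∃ C, ∀ w ∈ offCut, ‖w‖ < r → ‖w‖ * ‖f b w‖ ≤ C * √‖w‖) {b : ℂ}
    (hb : b ∈ O) : ∃ K, Tendsto (f b) (𝓝[offCut] 0) (𝓝 K) := by
  set G : ℂ → ℂ → E := fun b w => (2 * Real.pi * I : ℂ)⁻¹ • ∮ z in C(0, r), (z - w)⁻¹ • f b z with hG
  have hsph : ∀ z ∈ sphere (0 : ℂ) r, z ∈ ball (0 : ℂ) r' \ {0} := fun z hz => by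
    rw [mem_sphere_zero_iff_norm] at hz
    refine ⟨by rw [mem_ball_zero_iff]; linarith, fun h0 => ?_⟩
    rw [mem_singleton_iff] at h0
    rw [h0, norm_zero] at hz
    linarith
  have hci : ∀ b ∈ O, CircleIntegrable (f b) 0 r := fun b hb =>
    (((h1 b hb).continuousOn).mono hsph).circleIntegrable hr.le
  have hcm : ∀ θ, circleMap 0 r θ ∈ sphere (0 : ℂ) r := fun θ => circleMap_mem_sphere 0 hr.le θ
  have hae : ∀ᵐ θ : ℝ, circleMap 0 r θ ∈ offCut := by
    have hc : (range fun n : ℤ => (2 * (n : ℝ) + 1) * Real.pi / 2).Countable := countable_range _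
    filter_upwards [hc.ae_notMem volume] with θ hθ
    refine Or.inl fun h0 => hθ ?_
    rw [circleMap_zero, re_ofReal_mul, exp_ofReal_mul_I_re] at h0
    obtain ⟨n, hn⟩ := Real.cos_eq_zero_iff.1 ((mul_eq_zero.1 h0).resolve_left hr.ne')
    exact ⟨n, hn.symm⟩
  have hGd : ∀ w, ‖w‖ < r → DifferentiableOn ℂ (fun b => G b w) O := by
    intro w hw
    have hne : ∀ θ, r - ‖w‖ ≤ ‖circleMap 0 r θ - w‖ := fun θ => by
      have h5 := norm_sub_norm_le (circleMap 0 r θ) w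
      rwa [mem_sphere_zero_iff_norm.1 (hcm θ)] at h5
    refine DifferentiableOn.fun_const_smul ?_ _
    simp only [circleIntegral, intervalIntegral.integral_of_le Real.two_pi_pos.le]
    refine differentiableOn_integral_param hO ?_ (fun b hb => ?_) fun b₀ hb₀ => ?_
    · filter_upwards [ae_restrict_of_ae hae] with θ hθ
      exact ((h2 _ hθ (mem_sphere_zero_iff_norm.1 (hcm θ)).le).fun_const_smul _).fun_const_smul _
    · refine ContinuousOn.aestronglyMeasurable (s := Ioc 0 (2 * Real.pi)) ?_ measurableSet_Ioc
      have hcc : Continuous (circleMap 0 r) := continuous_circleMap 0 r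
      simp only [deriv_circleMap]
      refine ((by fun_prop : Continuous fun θ => circleMap 0 r θ * I).continuousOn).smul
        (ContinuousOn.smul (ContinuousOn.inv₀ (by fun_prop) fun θ _ => ?_)
        ((h1 b hb).continuousOn.comp hcc.continuousOn fun θ _ => hsph _ (hcm θ)))
      exact norm_pos_iff.1 (by linarith [hne θ])
    · obtain ⟨ρ, hρ, M, hM⟩ := h3 b₀ hb₀
      refine ⟨ρ, hρ, fun _ => r * ((r - ‖w‖)⁻¹ * M), integrable_const _, ?_⟩
      filter_upwards [ae_restrict_of_ae hae] with θ hθ b hb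
      have h5 := hM b hb _ hθ (mem_sphere_zero_iff_norm.1 (hcm θ))
      rw [deriv_circleMap, norm_smul, norm_smul, norm_mul, norm_I, mul_one,
        mem_sphere_zero_iff_norm.1 (hcm θ), norm_inv]
      exact mul_le_mul_of_nonneg_left (mul_le_mul (inv_anti₀ (by linarith) (hne θ)) h5
        (norm_nonneg _) (inv_nonneg.2 (by linarith))) hr.le
  have hloc : ∀ᶠ b in 𝓝 b₁, ∀ w ∈ offCut, ‖w‖ < r → f b w = G b w := by
    filter_upwards [h4, hO.mem_nhds hb₁] with b hb hbO w hw hwr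
    obtain ⟨C, hC⟩ := hb
    have hC' : ∀ z ∈ ball (0 : ℂ) r \ {0}, ‖z‖ * ‖f b z‖ ≤ C * √‖z‖ := by
      intro z hz
      have hcz : ContinuousAt (f b) z := ((h1 b hbO).differentiableAt
        ((isOpen_ball.sdiff isClosed_singleton).mem_nhds
          ⟨ball_subset_ball hr'.le hz.1, hz.2⟩)).continuousAt
      refine le_of_tendsto_of_tendsto (b := 𝓝[offCut] z)
        (((continuous_norm.continuousAt).mul hcz.norm).mono_left nhdsWithin_le_nhds)
        ((by fun_prop : Continuous fun z : ℂ => C * √‖z‖).continuousAt.mono_left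
          nhdsWithin_le_nhds) ?_
      filter_upwards [self_mem_nhdsWithin, nhdsWithin_le_nhds (isOpen_ball.mem_nhds hz.1)] with x h5 h6
      exact hC x h5 (mem_ball_zero_iff.1 h6)
    have hlo : (fun z => f b z - f b 0) =o[𝓝[≠] 0] fun z => (z - 0 : ℂ)⁻¹ := by
      rw [Asymptotics.isLittleO_iff]
      intro c hc
      have ht : Tendsto (fun z : ℂ => C * √‖z‖ + ‖z‖ * ‖f b 0‖) (𝓝[≠] 0) (𝓝 0) :=
        ((by fun_prop : Continuous fun z : ℂ => C * √‖z‖ + ‖z‖ * ‖f b 0‖).tendsto' _ _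
          (by simp)).mono_left nhdsWithin_le_nhds
      filter_upwards [ht.eventually_le_const hc, self_mem_nhdsWithin,
        nhdsWithin_le_nhds (ball_mem_nhds (0 : ℂ) hr)] with z h5 h6 h7
      have h8 : 0 < ‖z‖ := norm_pos_iff.2 h6
      rw [sub_zero, norm_inv, ← div_eq_mul_inv, le_div_iff₀ h8]
      have h9 := hC' z ⟨h7, h6⟩
      nlinarith [norm_sub_le (f b z) (f b 0)]
    have hg := differentiableOn_update_limUnder_of_isLittleO
      (ball_mem_nhds (0 : ℂ) (hr.trans hr')) (h1 b hbO) hlo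
    set g := Function.update (f b) 0 (limUnder (𝓝[≠] 0) (f b)) with hgdef
    have hgf : ∀ z, z ≠ 0 → g z = f b z := fun z hz => Function.update_of_ne hz _ _
    have hdc : DiffContOnCl ℂ g (ball 0 r) :=
      (hg.mono (by rw [closure_ball _ hr.ne']; exact closedBall_subset_ball hr')).diffContOnCl
    have := hdc.two_pi_i_inv_smul_circleIntegral_sub_inv_smul (mem_ball_zero_iff.2 hwr)
    have hw0 : w ≠ 0 := by rintro rfl; simp [offCut] at hw
    rw [← hgf w hw0, ← this, hG]
    simp only
    congr 1
    exact circleIntegral.integral_congr hr.le fun z hz => by rw [hgf z (hsph z hz).2]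
  have heq : ∀ w ∈ offCut, ‖w‖ < r → f b w = G b w := fun w hw hwr =>
    ((h2 w hw hwr.le).analyticOnNhd hO).eqOn_of_preconnected_of_eventuallyEq
      ((hGd w hwr).analyticOnNhd hO) hOc hb₁ (hloc.mono fun b hb => hb w hw hwr) hb
  refine ⟨G b 0, Tendsto.congr' ?_ ((hasFPowerSeriesOn_cauchy_integral (R := ⟨r, hr.le⟩)
    (hci b hb) hr).analyticAt.continuousAt.tendsto.mono_left nhdsWithin_le_nhds)⟩
  filter_upwards [self_mem_nhdsWithin, nhdsWithin_le_nhds (ball_mem_nhds (0 : ℂ) hr)] with w hw hwr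
  exact (heq w hw (mem_ball_zero_iff.1 hwr)).symm

end

section

theorem norm_ex_le (a : ℂ) (A : 𝔸) : ‖ex a A‖ ≤ (1 + ‖(1 : 𝔸)‖) * Real.exp (‖a‖ * ‖A‖) := by
  have h1 := norm_ex_sub_one_le a A
  have h2 := norm_le_norm_sub_add (ex a A) 1
  have h3 : 1 ≤ Real.exp (‖a‖ * ‖A‖) := Real.one_le_exp (by positivity)
  nlinarith [norm_nonneg (1 : 𝔸)]

theorem exists_norm_le_of_decaysOn {S : Set ℂ} {κ : ℝ} {f : ℂ → 𝔸} (h : DecaysOn S κ f) (hκ : 0 < κ)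
    {η : ℝ} (hη : 0 < η) : ∃ R : ℝ, ∀ z ∈ S, R ≤ z.im → ‖f z‖ ≤ η := by
  obtain ⟨C, R, hR, H⟩ := h
  have ht : Tendsto (fun y : ℝ => C * y ^ (-κ)) atTop (𝓝 0) := by
    simpa using (tendsto_rpow_neg_atTop hκ).const_mul C
  obtain ⟨R', hR'⟩ := eventually_atTop.1 (ht.eventually_le_const hη)
  exact ⟨max R R', fun z hz hzi => (H z hz ((le_max_left _ _).trans hzi)).trans
    (hR' _ ((le_max_right _ _).trans hzi))⟩

section
variable {ι : Type*} [Fintype ι] {ε κ κ' : ℝ} {k : ι → ℂ} {s H L : ι → ℂ → 𝔸}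
variable [IsDedekindFiniteMonoid 𝔸]

theorem mul_exp_log_le {K M Q n x a : ℝ} (hK : 0 ≤ K) (hn : 0 ≤ n) (hx : 0 < x) (hx1 : x ≤ 1)
    (ha : 0 < a) (hM : M * K ≤ 1 / 4) (hQ : Q ≤ 1 / 4) :
    x * ((K * Real.exp (M * (K + K * Real.log (a / x)))) *
      ((1 + n) * Real.exp ((|Real.log x| + 5) * Q))) ≤
    (K * (1 + n) * Real.exp (M * K + M * K * Real.log a + 5 * Q)) * √x := by
  have hl : Real.log x ≤ 0 := Real.log_nonpos hx.le hx1
  have h1 : √x = Real.exp (Real.log x / 2) := by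
    rw [← Real.log_sqrt hx.le, Real.exp_log (Real.sqrt_pos.2 hx)]
  have h2 : x * (Real.exp (M * (K + K * Real.log (a / x))) * Real.exp ((|Real.log x| + 5) * Q)) ≤
      Real.exp (M * K + M * K * Real.log a + 5 * Q) * √x := by
    rw [h1, ← Real.exp_add, ← Real.exp_add]
    nth_rw 1 [← Real.exp_log hx]
    rw [← Real.exp_add, Real.exp_le_exp, Real.log_div ha.ne' hx.ne', abs_of_nonpos hl]
    nlinarith [mul_nonneg (neg_nonneg.2 hl) (sub_nonneg.2 hM),
      mul_nonneg (neg_nonneg.2 hl) (sub_nonneg.2 hQ)]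
  calc _ = (K * (1 + n)) * (x * (Real.exp (M * (K + K * Real.log (a / x))) *
        Real.exp ((|Real.log x| + 5) * Q))) := by ring
    _ ≤ (K * (1 + n)) * (Real.exp (M * K + M * K * Real.log a + 5 * Q) * √x) :=
        mul_le_mul_of_nonneg_left h2 (by positivity)
    _ = _ := by ring

/-- The behaviour of the ordered exponential at the end points. -/
theorem PoleData.exists_endpoint (h : PoleData ε κ k s) (hd : StripData ε κ' k H L)
    (hJ : ∀ b ∈ halfStrip ε, RHJump (fun j => k j + b) H (flowSol k s b)) {b : ℂ}
    (hb : b ∈ halfStrip ε) (m : ι) : ∃ K : 𝔸, IsUnit K ∧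
      Tendsto (fun z => flowSol k s b z * ex (-(lc (z - (k m + b)))) (L m z))
        (𝓝[cutC fun j => k j + b] (k m + b)) (𝓝 K) := by
  have hε := h.eps_pos
  have hκ := h.pos
  obtain ⟨r', hr', hr'1, hr'ε, hr'2, hr'3⟩ : ∃ r' > 0, r' ≤ 1 ∧ r' ≤ ε / 2 ∧ |b.re| < ε - r' ∧
      r' < b.im := by
    have h1 := hb.1
    have h2 := hb.2
    have h7 := abs_nonneg b.re
    exact ⟨min (ε - |b.re|) (min b.im 1) / 2, by grind, by grind, by grind, by grind, by grind⟩
  set O : Set ℂ := halfStripAt (ε - r') (r' * I) with hOdef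
  have hOmem : ∀ {x : ℂ}, x ∈ O ↔ |x.re| < ε - r' ∧ r' < x.im := by
    intro x; simp [hOdef, halfStripAt, halfStrip]
  have hO : IsOpen O := isOpen_halfStripAt _ _
  have hOc : IsPreconnected O := (convex_halfStripAt _ _).isPreconnected
  have hbO : b ∈ O := hOmem.2 ⟨hr'2, hr'3⟩
  have hOΩ : ∀ x ∈ O, x ∈ halfStrip ε := fun x hx =>
    ⟨by linarith [(hOmem.1 hx).1], by linarith [(hOmem.1 hx).2]⟩
  have hS : ∀ x ∈ O, ∀ w : ℂ, ‖w‖ ≤ r' → k m + x + w ∈ halfStripAt ε (k m) := by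
    intro x hx w hw
    have h1 := hOmem.1 hx
    have h2 := (abs_re_le_norm w).trans hw
    have h3 := (abs_le.1 ((abs_im_le_norm w).trans hw)).1
    rw [halfStripAt, mem_ofPred_eq, show k m + x + w - k m = x + w by ring]
    exact ⟨by rw [add_re]; linarith [abs_add_le x.re w.re], by rw [add_im]; linarith⟩
  have hcut := fun x (hx : x ∈ O) => hd.cutNhd (hOΩ x hx) m
  have hmemC : ∀ x ∈ O, ∀ w ∈ offCut, ‖w‖ ≤ r' → k m + x + w ∈ cutC fun j => k j + x := by
    intro x hx w hw hwr
    exact (hcut x hx).mem_cutC (hS x hx w hwr) (by simpa [offCut] using hw)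
  set f : ℂ → ℂ → 𝔸 := fun x w => regPart (fun j => k j + x) L (flowSol k s x) m (k m + x + w)
    with hf
  have hfe : ∀ x ∈ O, ∀ w ∈ offCut, ‖w‖ ≤ r' →
      f x w = flowSol k s x (k m + x + w) * ex (-(lc w)) (L m (k m + x + w)) := by
    intro x hx w hw hwr
    simp only [hf]
    rw [(hcut x hx).regPart_eq (hJ x (hOΩ x hx)) (hS x hx w hwr) (hmemC x hx w hw hwr),
      add_sub_cancel_left]
  set r := r' / 2 with hr
  have hr0 : 0 < r := by positivity
  have hrr : r < r' := by rw [hr]; linarith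
  have hpt : ∀ x : ℂ, ∀ w ∈ ball (0 : ℂ) r' \ {0}, k m + x + w ≠ k m + x := fun x w hw h0 =>
    hw.2 (add_eq_left.1 h0)
  have h1 : ∀ x ∈ O, DifferentiableOn ℂ (f x) (ball 0 r' \ {0}) := fun x hx =>
    ((hcut x hx).differentiableOn_regPart_of_ne (hJ x (hOΩ x hx))).comp
      (by fun_prop : Differentiable ℂ fun w => k m + x + w).differentiableOn
      fun w hw => ⟨hS x hx w (mem_ball_zero_iff.1 hw.1).le, hpt x w hw⟩
  have h1i : ∀ x ∈ O, DifferentiableOn ℂ (fun w => Ring.inverse (f x w)) (ball 0 r' \ {0}) :=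
    fun x hx w hw => (((h1 x hx).differentiableAt
      ((isOpen_ball.sdiff isClosed_singleton).mem_nhds hw)).inverse
      ((hcut x hx).isUnit_regPart_of_ne (hJ x (hOΩ x hx))
        (hS x hx w (mem_ball_zero_iff.1 hw.1).le) (hpt x w hw))).differentiableWithinAt
  have h2 : ∀ w ∈ offCut, ‖w‖ ≤ r → DifferentiableOn ℂ (fun x => f x w) O := by
    intro w hw hwr
    have hw' : ‖w‖ ≤ r' := hwr.trans hrr.le
    refine DifferentiableOn.congr ?_ fun x hx => hfe x hx w hw hw'
    refine DifferentiableOn.fun_mul (fun x hx => ?_) (DifferentiableOn.ex (differentiableOn_const _)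
      ((hd.log_holo m).comp (by fun_prop) fun x hx => hS x hx w hw'))
    exact (h.differentiableAt_flowSol (β := id) (ζ := fun x => k m + x + w)
      (Eventually.of_forall fun _ => differentiableAt_id)
      (Eventually.of_forall fun _ => by fun_prop) (hOΩ x hx)
      (hmemC x hx w hw hw')).differentiableWithinAt
  have hu : ∀ x ∈ O, ∀ w ∈ offCut, ‖w‖ ≤ r' → IsUnit (f x w) := fun x hx w hw hwr => by
    rw [hfe x hx w hw hwr]
    exact ((hJ x (hOΩ x hx)).unit _ (hmemC x hx w hw hwr)).mul (isUnit_ex _ _)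
  have h2i : ∀ w ∈ offCut, ‖w‖ ≤ r → DifferentiableOn ℂ (fun x => Ring.inverse (f x w)) O :=
    fun w hw hwr x hx => (((h2 w hw hwr).differentiableAt (hO.mem_nhds hx)).inverse
      (hu x hx w hw (hwr.trans hrr.le))).differentiableWithinAt
  -- the bounds for the functions and their inverses
  obtain ⟨K, hK0, hK⟩ := h.exists_bound_end hr' hr'ε (half_pos hκ) (by linarith [h.le_one])
  set T : ℝ → ℝ → ℝ → ℝ := fun M Q x => (K * Real.exp (M * (K + K * Real.log (2 * r' / x)))) *
    ((1 + ‖(1 : 𝔸)‖) * Real.exp ((|Real.log x| + 5) * Q)) with hT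
  have hbd : ∀ M Q, 0 ≤ M → ∀ x ∈ O, ResBound ε r' M (κ / 2) s x → ∀ w ∈ offCut, ‖w‖ ≤ r' →
      ‖L m (k m + x + w)‖ ≤ Q → ‖f x w‖ ≤ T M Q ‖w‖ ∧ ‖Ring.inverse (f x w)‖ ≤ T M Q ‖w‖ := by
    intro M Q hM x hx hres w hw hwr hQ
    obtain ⟨e1, e2⟩ := hK M hM x hres m w hwr (hmemC x hx w hw hwr)
    have hex : ∀ a : ℂ, ‖a‖ = ‖lc w‖ → ‖ex a (L m (k m + x + w))‖ ≤
        (1 + ‖(1 : 𝔸)‖) * Real.exp ((|Real.log ‖w‖| + 5) * Q) := fun a ha => by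
      refine (norm_ex_le _ _).trans (mul_le_mul_of_nonneg_left (Real.exp_le_exp.2 ?_)
        (by positivity))
      rw [ha]
      exact mul_le_mul (norm_lc_le w) hQ (norm_nonneg _) (by positivity)
    have hu1 := (hJ x (hOΩ x hx)).unit _ (hmemC x hx w hw hwr)
    have hei : Ring.inverse (ex (-(lc w)) (L m (k m + x + w))) = ex (lc w) (L m (k m + x + w)) :=
      Ring.inverse_unit ⟨_, _, ex_neg_mul_ex _ _, ex_mul_ex_neg _ _⟩
    rw [hfe x hx w hw hwr, inverse_mul_of_isUnit hu1 (isUnit_ex _ _), hei, hT]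
    refine ⟨norm_mul_le_of_le e1 (hex _ (norm_neg _)), ?_⟩
    exact (norm_mul_le_of_le (hex _ rfl) e2).trans_eq (mul_comm _ _)
  have h3 : ∀ x₀ ∈ O, ∃ ρ > 0, ∃ D, ∀ x ∈ ball x₀ ρ ∩ O, ∀ w ∈ offCut, ‖w‖ = r →
      ‖f x w‖ ≤ D ∧ ‖Ring.inverse (f x w)‖ ≤ D := by
    intro x₀ hx₀
    obtain ⟨g1, g2⟩ := hOmem.1 hx₀
    obtain ⟨ρ, hρ, hρ1, hρ2⟩ : ∃ ρ > 0, |x₀.re| + r' + ρ < ε ∧ r' + ρ < x₀.im := by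
      exact ⟨min (ε - r' - |x₀.re|) (x₀.im - r') / 2, by grind, by grind, by grind⟩
    have hbox : ∀ w ∈ closedBox (r' + ρ), x₀ + w ∈ halfStrip ε := fun w hw =>
      ⟨by rw [add_re]; linarith [abs_add_le x₀.re w.re, hw.1], by rw [add_im]; linarith [hw.2]⟩
    obtain ⟨M, hM0, hM⟩ := h.exists_bound_box (by positivity : 0 ≤ r' + ρ) hbox
    obtain ⟨Q, hQ0, hQ⟩ := (hd.decay m).exists_wt_bound (δ := r' + ρ) (a := k m + x₀) hd.pos.le
      (hd.log_holo m).continuousOn fun w hw => by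
        rw [halfStripAt, mem_ofPred_eq, show k m + x₀ + w - k m = x₀ + w by ring]
        exact hbox w hw
    have hclose : ∀ x ∈ ball x₀ ρ, ∀ w : ℂ, ‖w‖ ≤ r' →
        |((x - x₀) + w).re| ≤ r' + ρ ∧ |((x - x₀) + w).im| ≤ r' + ρ := by
      intro x hx w hw
      have e : ‖x - x₀ + w‖ ≤ r' + ρ := by
        have e1 : ‖x - x₀‖ < ρ := by rw [← dist_eq_norm]; exact hx
        linarith [norm_add_le (x - x₀) w]
      exact ⟨(abs_re_le_norm _).trans e, (abs_im_le_norm _).trans e⟩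
    refine ⟨ρ, hρ, T M Q r, fun x hx w hw hwr => ?_⟩
    rw [← hwr]
    have hwr' : ‖w‖ ≤ r' := hwr.le.trans hrr.le
    refine hbd M Q hM0 x hx.2 (fun y hy => ?_) w hw hwr' ?_
    · obtain ⟨e1, e2⟩ := hclose x hx.1 y (by simpa using hy)
      have e3 : x + y = x₀ + (x - x₀ + y) := by ring
      refine ⟨by rw [e3]; exact hbox _ ⟨e1, (abs_le.1 e2).1⟩, fun j v hv => ?_⟩
      rw [e3]
      refine (hM _ e1 e2 j v hv).trans (mul_le_mul_of_nonneg_left ?_ hM0)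
      rw [← add_halves κ, ← wt_mul, add_halves]
      exact mul_le_of_le_one_right (wt_pos _ _).le (wt_le_one (by positivity) _)
    · obtain ⟨e1, e2⟩ := hclose x hx.1 w hwr'
      rw [show k m + x + w = k m + x₀ + (x - x₀ + w) by ring]
      exact (hQ _ ⟨e1, (abs_le.1 e2).1⟩).trans
        (mul_le_of_le_one_right hQ0 (wt_le_one hd.pos.le _))
  obtain ⟨R₁, -, hR₁⟩ := h.exists_bound_far (by positivity : 0 < 1 / (4 * (K + 1)))
  obtain ⟨R₂, hR₂⟩ := exists_norm_le_of_decaysOn (hd.decay m) hd.pos (by norm_num : (0 : ℝ) < 1 / 4)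
  set b₁ : ℂ := ((max (max R₁ (R₂ + |(k m).im| + 1)) 1 + 1 : ℝ) : ℂ) * I with hb₁
  have hb₁im : b₁.im = max (max R₁ (R₂ + |(k m).im| + 1)) 1 + 1 := by simp [hb₁]
  have hb₁O : b₁ ∈ O := hOmem.2 ⟨by simp [hb₁]; linarith, by
    rw [hb₁im]; linarith [le_max_right (max R₁ (R₂ + |(k m).im| + 1)) 1]⟩
  have h4 : ∀ᶠ x in 𝓝 b₁, ∃ C, ∀ w ∈ offCut, ‖w‖ < r →
      ‖w‖ * ‖f x w‖ ≤ C * √‖w‖ ∧ ‖w‖ * ‖Ring.inverse (f x w)‖ ≤ C * √‖w‖ := by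
    filter_upwards [hO.mem_nhds hb₁O, ball_mem_nhds b₁ one_pos] with x hx hx1
    have him : max (max R₁ (R₂ + |(k m).im| + 1)) 1 ≤ x.im := by
      have e1 : ‖x - b₁‖ < 1 := by rw [← dist_eq_norm]; exact hx1
      have e2 := (abs_le.1 ((abs_im_le_norm _).trans e1.le)).1
      rw [sub_im, hb₁im] at e2
      linarith
    have him1 : R₁ ≤ x.im := ((le_max_left _ _).trans (le_max_left _ _)).trans him
    have him2 : R₂ + |(k m).im| + 1 ≤ x.im := ((le_max_right _ _).trans (le_max_left _ _)).trans him
    refine ⟨K * (1 + ‖(1 : 𝔸)‖) * Real.exp (1 / (4 * (K + 1)) * K +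
      1 / (4 * (K + 1)) * K * Real.log (2 * r') + 5 * (1 / 4)), fun w hw hwr => ?_⟩
    have hwr' : ‖w‖ ≤ r' := (hwr.trans hrr).le
    have hw0 : 0 < ‖w‖ := norm_pos_iff.2 (by rintro rfl; simp [offCut] at hw)
    have hxs : ∀ y : ℝ, |y| ≤ r' → x + y ∈ halfStrip ε := fun y hy =>
      ⟨by rw [add_re, ofReal_re]; linarith [abs_add_le x.re y, (hOmem.1 hx).1],
        by simpa using (hOΩ x hx).2⟩
    have hb3 := hbd (1 / (4 * (K + 1))) (1 / 4) (by positivity) x hx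
      (fun y hy => ⟨hxs y hy, hR₁ _ (hxs y hy) (by simpa using him1)⟩) w hw hwr' (by
        refine hR₂ _ (hS x hx w hwr') ?_
        rw [add_im, add_im]
        have e1 := (abs_le.1 ((abs_im_le_norm w).trans hwr')).1
        have e2 := neg_abs_le (k m).im
        linarith)
    have hTle := mul_exp_log_le (K := K) (M := 1 / (4 * (K + 1))) (Q := 1 / 4)
      (n := ‖(1 : 𝔸)‖) (x := ‖w‖) (a := 2 * r') hK0 (norm_nonneg _) hw0 (hwr'.trans hr'1)
      (by positivity) (by rw [div_mul_eq_mul_div, div_le_div_iff₀ (by positivity) (by norm_num)]; linarith)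
      le_rfl
    exact ⟨(mul_le_mul_of_nonneg_left hb3.1 hw0.le).trans hTle,
      (mul_le_mul_of_nonneg_left hb3.2 hw0.le).trans hTle⟩
  obtain ⟨A, hA⟩ := exists_tendsto_of_removable hO hOc hr0 hrr h1 h2
    (fun x hx => let ⟨ρ, hρ, D, hD⟩ := h3 x hx; ⟨ρ, hρ, D, fun y hy w hw hwr => (hD y hy w hw hwr).1⟩)
    hb₁O (h4.mono fun x ⟨C, hC⟩ => ⟨C, fun w hw hwr => (hC w hw hwr).1⟩) hbO
  obtain ⟨B, hB⟩ := exists_tendsto_of_removable (f := fun x w => Ring.inverse (f x w)) hO hOc hr0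
    hrr h1i h2i
    (fun x hx => let ⟨ρ, hρ, D, hD⟩ := h3 x hx; ⟨ρ, hρ, D, fun y hy w hw hwr => (hD y hy w hw hwr).2⟩)
    hb₁O (h4.mono fun x ⟨C, hC⟩ => ⟨C, fun w hw hwr => (hC w hw hwr).2⟩) hbO
  have hnear : ∀ᶠ w in 𝓝[offCut] (0 : ℂ), w ∈ offCut ∧ ‖w‖ ≤ r' := by
    filter_upwards [self_mem_nhdsWithin, nhdsWithin_le_nhds (ball_mem_nhds (0 : ℂ) hr')] with w hw hwr
    exact ⟨hw, (mem_ball_zero_iff.1 hwr).le⟩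
  have hAB : A * B = 1 := tendsto_nhds_unique ((hA.mul hB).congr' (hnear.mono fun w hw =>
    Ring.mul_inverse_cancel _ (hu b hbO w hw.1 hw.2))) tendsto_const_nhds
  have hBA : B * A = 1 := tendsto_nhds_unique ((hB.mul hA).congr' (hnear.mono fun w hw =>
    Ring.inverse_mul_cancel _ (hu b hbO w hw.1 hw.2))) tendsto_const_nhds
  refine ⟨A, ⟨⟨A, B, hAB, hBA⟩, rfl⟩, ?_⟩
  have ht : Tendsto (fun z => z - (k m + b)) (𝓝[cutC fun j => k j + b] (k m + b))
      (𝓝[offCut] 0) := by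
    refine tendsto_nhdsWithin_iff.2 ⟨?_, ?_⟩
    · exact ((by fun_prop : Continuous fun z : ℂ => z - (k m + b)).tendsto' _ _
        (sub_self _)).mono_left nhdsWithin_le_nhds
    · filter_upwards [self_mem_nhdsWithin] with z hz
      exact lc_sub_ne (c := fun j => k j + b) (j := m) hz
  refine (hA.comp ht).congr' ?_
  filter_upwards [ht.eventually hnear] with z hz
  rw [Function.comp_apply, hfe b hbO _ hz.1 hz.2, add_sub_cancel]

theorem PoleData.rhSol (h : PoleData ε κ k s) (hd : StripData ε κ' k H L)
    (hJ : ∀ b ∈ halfStrip ε, RHJump (fun j => k j + b) H (flowSol k s b)) {b : ℂ}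
    (hb : b ∈ halfStrip ε) : RHSol (fun j => k j + b) H L (flowSol k s b) :=
  ⟨hJ b hb, h.tendsto_flowSol hb, h.exists_endpoint hd hJ hb⟩

end

end

section

/-! ### Matrices -/

theorem PoleData.hasOrderedExpIn_pathTo {ι : Type*} [Fintype ι] {ε κ : ℝ} {k : ι → ℂ}
    {s : ι → ℂ → 𝔸} (h : PoleData ε κ k s) {b z : ℂ} (hb : b ∈ halfStrip ε)
    (hz : z ∈ cutC fun j => k j + b) :
    HasOrderedExpIn (pathTo b) (poleSum k s z) (flowSol k s b z) := by
  obtain ⟨g, hg⟩ := h.exists_volBound_self hb hz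
  refine ⟨fun t => volSol (flowCoef k s b z) (max (-t) 0), ?_, ?_, ?_, {0}, fun t ht => ?_⟩
  · exact hg.continuousOn_volSol.comp_continuous (by fun_prop)
      fun t => mem_Ici.2 (le_max_right _ _)
  · exact hg.tendsto_volSol.comp (tendsto_atTop_mono (fun t => le_max_left _ _)
      tendsto_neg_atBot_atTop)
  · refine tendsto_const_nhds.congr' ?_
    filter_upwards [eventually_ge_atTop 0] with t ht
    rw [max_eq_right (by linarith), flowSol]
  · rw [Finset.mem_singleton] at ht
    rcases lt_or_gt_of_ne ht with ht | ht
    · have hev : ∀ᶠ u : ℝ in 𝓝 t, max (-u) 0 = -u := by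
        filter_upwards [eventually_lt_nhds ht] with u hu using max_eq_left (by linarith)
      refine ⟨-I, ?_, ?_⟩
      · have h1 : HasDerivAt (fun u : ℝ => b + ((-u : ℝ) : ℂ) * I) (-I) t := by
          simpa using (((hasDerivAt_neg t).ofReal_comp).mul_const I).const_add b
        exact h1.congr_of_eventuallyEq (hev.mono fun u hu => by simp only [pathTo, hu])
      · have h1 := (hg.hasDerivAt_volSol (u := -t) (by linarith)).scomp t (hasDerivAt_neg t)
        refine (h1.congr_of_eventuallyEq (hev.mono fun u hu => by
          simp only [hu, Function.comp_apply])).congr_deriv ?_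
        simp only [hev.self_of_nhds, pathTo, flowCoef]
        simp
    · refine ⟨0, ?_, ?_⟩
      · refine (hasDerivAt_const t b).congr_of_eventuallyEq ?_
        filter_upwards [eventually_gt_nhds ht] with u hu
        simp [pathTo, max_eq_right (by linarith : -u ≤ 0)]
      · rw [zero_smul]
        refine (hasDerivAt_const t (volSol (flowCoef k s b z) 0)).congr_of_eventuallyEq ?_
        filter_upwards [eventually_gt_nhds ht] with u hu
        rw [max_eq_right (by linarith : -u ≤ 0)]

section MatrixNorm

attribute [local instance] Matrix.linftyOpNormedRing Matrix.linftyOpNormedAlgebra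

variable {p N : ℕ} {ε κ : ℝ} {k : Fin p → ℂ} {s H L : Fin p → ℂ → Matrix (Fin N) (Fin N) ℂ}

theorem hasDerivAt_real_matrix_iff {f : ℝ → Matrix (Fin N) (Fin N) ℂ}
    {f' : Matrix (Fin N) (Fin N) ℂ} {t : ℝ} :
    HasDerivAt f f' t ↔ ∀ a c, HasDerivAt (fun u => f u a c) (f' a c) t :=
  (hasDerivAt_pi (φ := f)).trans (forall_congr' fun _ => hasDerivAt_pi)

theorem hasOrderedExpIn_iff {γ : ℝ → ℂ} {C : ℂ → Matrix (Fin N) (Fin N) ℂ}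
    {E : Matrix (Fin N) (Fin N) ℂ} : HasOrderedExpIn γ C E ↔ HasOrderedExp γ C E := by
  simp only [HasOrderedExp, ← hasDerivAt_real_matrix_iff]
  rfl

theorem isUnit_matrix_iff {A : Matrix (Fin N) (Fin N) ℂ} : IsUnit A ↔ A.det ≠ 0 := by
  rw [Matrix.isUnit_iff_isUnit_det, isUnit_iff_ne_zero]

theorem matCpow_inv (w : ℂ) (A : Matrix (Fin N) (Fin N) ℂ) : (matCpow w A)⁻¹ = ex (-(lc w)) A :=
  Matrix.inv_eq_right_inv (ex_mul_ex_neg (lc w) A)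

/-- The solutions of the problem for matrices are those in the Banach algebra of matrices; determinants
are replaced by invertibility and the power by `ex`. -/
theorem isRHSolution_iff {b : ℂ} {U : ℂ → Matrix (Fin N) (Fin N) ℂ} :
    IsRHSolution k H L b U ↔ RHSol (fun j => k j + b) H L U := by
  constructor
  · rintro ⟨h1, h2, h3, h4, h5⟩
    refine ⟨⟨matHolomorphicOn_iff.1 h1, fun z hz => isUnit_matrix_iff.2 (h2 z hz),
      fun j z hz => ?_⟩, h4, fun j => ?_⟩
    · obtain ⟨A, B, hA, hB, dA, dB, e⟩ := h3 j z hz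
      exact ⟨A, B, hA, hB, isUnit_matrix_iff.2 dA, isUnit_matrix_iff.2 dB, e⟩
    · obtain ⟨K, dK, hK⟩ := h5 j
      simp only [matCpow_inv] at hK
      exact ⟨K, isUnit_matrix_iff.2 dK, hK⟩
  · rintro ⟨⟨h1, h2, h3⟩, h4, h5⟩
    refine ⟨matHolomorphicOn_iff.2 h1, fun z hz => isUnit_matrix_iff.1 (h2 z hz),
      fun j z hz => ?_, h4, fun j => ?_⟩
    · obtain ⟨A, B, hA, hB, dA, dB, e⟩ := h3 j z hz
      exact ⟨A, B, hA, hB, isUnit_matrix_iff.1 dA, isUnit_matrix_iff.1 dB, e⟩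
    · obtain ⟨K, dK, hK⟩ := h5 j
      refine ⟨K, isUnit_matrix_iff.1 dK, ?_⟩
      simp only [matCpow_inv]
      exact hK

theorem IsJumpData.stripData (h : IsJumpData ε k H L) {R C : ℝ}
    {Lt : Fin p → ℂ → Matrix (Fin N) (Fin N) ℂ} (hF : FarLog ε κ R C k L Lt) :
    StripData ε κ k H L where
  eps_pos := h.eps_pos
  sep := h.disjoint_strips
  log_holo j := matHolomorphicOn_iff.1 (h.log_holomorphic j)
  exp_log j z hz := by rw [ex, one_smul]; exact h.exp_log j z hz
  pos := hF.pos
  le_one := hF.le_one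
  decay := hF.decaysOn h.eps_pos

theorem IsJumpData.exists_residues (h : IsJumpData ε k H L)
    {U : ℂ → ℂ → Matrix (Fin N) (Fin N) ℂ} (hU : ∀ b ∈ halfStrip ε, IsRHSolution k H L b (U b)) :
    ∃ s : Fin p → ℂ → Matrix (Fin N) (Fin N) ℂ, (∀ j, MatHolomorphicOn (s j) (halfStrip ε)) ∧
      ∀ b ∈ halfStrip ε, ∀ z ∈ cutPlane k b,
        MatHasDerivAt (fun β => U β z) (odeCoeff k s z b * U b z) b := by
  obtain ⟨κ, R, C, Lt, hF⟩ := h.exists_farLog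
  have hd := h.stripData hF
  have hU' := fun b hb => isRHSolution_iff.1 (hU b hb)
  refine ⟨sCoef k L U, fun j => matHolomorphicOn_iff.2 fun b hb => ?_, fun b hb z hz => ?_⟩
  · obtain ⟨r, hr, s, hs, hsd, hse⟩ := hd.exists_sCoef_continuation Subset.rfl hU' hb j
    refine DifferentiableAt.differentiableWithinAt ((hsd.differentiableAt
      (ball_mem_nhds b hr)).congr_of_eventuallyEq ?_)
    filter_upwards [ball_mem_nhds b hr] with x hx using (hse x ⟨hs hx, hx⟩).symm
  · obtain ⟨V, hV, hVd⟩ := hd.exists_hasDerivAt Subset.rfl hU' hb hz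
    rw [(isOpen_halfStrip ε).nhdsWithin_eq hb] at hV
    exact hasDerivAt_matrix_iff.1 (hVd.congr_of_eventuallyEq hV)

theorem IsJumpData.tendsto_family (h : IsJumpData ε k H L) {B : Set ℂ} (hB : B ⊆ halfStrip ε)
    {U : ℂ → ℂ → Matrix (Fin N) (Fin N) ℂ} (hU : ∀ b ∈ B, IsRHSolution k H L b (U b)) (z : ℂ) :
    Tendsto (fun b => U b z) (toImInfty B) (𝓝 1) := by
  obtain ⟨κ, R, C, Lt, hF⟩ := h.exists_farLog
  exact hF.tendsto_one (h.stripData hF) hB (fun b hb => isRHSolution_iff.1 (hU b hb)) z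

theorem imagHalfLine_subset (hε : 0 < ε) : imagHalfLine ⊆ halfStrip ε := fun b hb =>
  ⟨by rw [hb.1, abs_zero]; exact hε, hb.2⟩

theorem IsJumpData.exists_residues_line (h : IsJumpData ε k H L)
    {U : ℂ → ℂ → Matrix (Fin N) (Fin N) ℂ} (hU : ∀ b ∈ imagHalfLine, IsRHSolution k H L b (U b)) :
    ∃ s : Fin p → ℂ → Matrix (Fin N) (Fin N) ℂ,
      (∃ O : Set ℂ, IsOpen O ∧ imagHalfLine ⊆ O ∧ O ⊆ halfStrip ε ∧
        ∀ j, MatHolomorphicOn (s j) O) ∧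
      ∀ b ∈ imagHalfLine, ∀ z ∈ cutPlane k b,
        MatHasDerivWithinAt (fun β => U β z) (odeCoeff k s z b * U b z) imagHalfLine b := by
  obtain ⟨κ, R, C, Lt, hF⟩ := h.exists_farLog
  have hd := h.stripData hF
  have hB := imagHalfLine_subset h.eps_pos
  have hU' := fun b hb => isRHSolution_iff.1 (hU b hb)
  choose O hO hlO hOS s hs hse using fun j : Fin p => exists_continuation_line
    (fun b hb => hd.exists_sCoef_continuation hB hU' hb j) fun b hb => hb.2
  refine ⟨s, ⟨(⋂ j, O j) ∩ halfStrip ε, (isOpen_iInter_of_finite hO).inter (isOpen_halfStrip ε),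
    subset_inter (subset_iInter hlO) hB, inter_subset_right, fun j => matHolomorphicOn_iff.2
      ((hs j).mono (inter_subset_left.trans (iInter_subset O j)))⟩, fun b hb z hz a c => ?_⟩
  obtain ⟨V, hV, hVd⟩ := hd.exists_hasDerivAt hB hU' hb hz
  have e : odeCoeff k s z b = ∑ j, (z - (k j + b))⁻¹ • sCoef k L U j b :=
    Finset.sum_congr rfl fun j _ => by rw [hse j b hb]
  rw [e]
  exact (hasDerivAt_matrix_iff.1 hVd a c).hasDerivWithinAt.congr_of_eventuallyEq
    (hV.mono fun x hx => congrArg (fun A => A a c) hx)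
    (congrArg (fun A => A a c) (hV.self_of_nhdsWithin hb))

theorem exists_decaysOn_of_isBigO {α : ℝ} (hα : 0 < α) {S : Set ℂ}
    {f : ℂ → Matrix (Fin N) (Fin N) ℂ}
    (h : ∀ a c, (fun τ => f τ a c) =O[toImInfty S] fun τ => ‖τ‖ ^ (-α)) :
    DecaysOn S (min α 1) f := by
  choose C hC using fun q : Fin N × Fin N => (h q.1 q.2).bound
  obtain ⟨C', hC'1, hC'⟩ := exists_le_of_finite C
  obtain ⟨R, hR⟩ := eventually_toImInfty (eventually_all.2 hC)
  refine ⟨N * C', max R 1, by positivity, fun z hz hzR => ?_⟩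
  have h1 : 1 ≤ z.im := (le_max_right _ _).trans hzR
  rw [mul_assoc]
  refine norm_matrix_le (fun a c => (hR z hz ((le_max_left _ _).trans hzR) (a, c)).trans ?_)
    (by positivity)
  have h2 : z.im ≤ ‖z‖ := (le_abs_self _).trans (abs_im_le_norm z)
  rw [Real.norm_of_nonneg (by positivity)]
  refine mul_le_mul (hC' _) ?_ (by positivity) (by positivity)
  exact (Real.rpow_le_rpow_of_nonpos (by linarith) h2 (by linarith)).trans
    (rpow_neg_le_of_le h1 (min_le_left _ _))

/-- The ordered exponentials solve the Riemann–Hilbert problems. -/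
theorem IsJumpData.exists_isRHSolution (h : IsJumpData ε k H L)
    (hs : ∀ j, MatHolomorphicOn (s j) (halfStrip ε))
    (hdec : ∃ α : ℝ, 0 < α ∧ ∀ j a c,
      (fun τ => s j τ a c) =O[toImInfty (halfStrip ε)] fun τ => ‖τ‖ ^ (-α))
    (hhp : ∀ m, ∀ z ∈ ray (k m), ∃ b ∈ imagHalfLine, ∃ δ : ℝ, b.im < (z - k m).im ∧ 0 < δ ∧ δ < ε ∧
      HasOrderedExp (hairpin b δ) (fun τ => odeCoeff k s z τ) (H m z)) :
    ∃ U : ℂ → ℂ → Matrix (Fin N) (Fin N) ℂ,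
      (∀ b ∈ halfStrip ε, IsRHSolution k H L b (U b)) ∧
      (∀ b ∈ halfStrip ε, ∀ V, IsRHSolution k H L b V → ∀ z ∈ cutPlane k b, V z = U b z) ∧
      ∀ b ∈ halfStrip ε, ∀ z ∈ cutPlane k b,
        HasOrderedExp (pathTo b) (fun τ => odeCoeff k s z τ) (U b z) := by
  obtain ⟨κ, R, C, Lt, hF⟩ := h.exists_farLog
  have hd := h.stripData hF
  obtain ⟨α, hα, hO⟩ := hdec
  have hP : PoleData ε (min α 1) k s := ⟨h.eps_pos, h.disjoint_strips, lt_min hα one_pos,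
    min_le_right _ _, fun j => matHolomorphicOn_iff.1 (hs j),
    fun j => exists_decaysOn_of_isBigO hα (hO j)⟩
  have hJ : ∀ b ∈ halfStrip ε, RHJump (fun j => k j + b) H (flowSol k s b) := fun b hb =>
    hP.rhJump (fun j => matHolomorphicOn_iff.1 (h.holomorphic j)) (fun m z hz => by
      obtain ⟨b, hb, δ, h1, h2, h3, h4⟩ := hhp m z hz
      exact ⟨b, hb, δ, h1, h2, h3, hasOrderedExpIn_iff.2 h4⟩) hb
  have hsol := fun b (hb : b ∈ halfStrip ε) => hP.rhSol hd hJ hb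
  refine ⟨flowSol k s, fun b hb => isRHSolution_iff.2 (hsol b hb), fun b hb V hV z hz => ?_,
    fun b hb z hz => hasOrderedExpIn_iff.1 (hP.hasOrderedExpIn_pathTo hb hz)⟩
  refine RHSol.unique (fun j => hd.cutNhd hb j) (fun j z hre him => ?_) (isRHSolution_iff.1 hV)
    (hsol b hb) hz
  rw [add_re] at hre
  rw [add_im] at him
  have h1 := hb.2
  exact ⟨by rw [sub_re, hre, add_sub_cancel_left]; exact hb.1, by rw [sub_im]; linarith⟩

end MatrixNorm

end

end WienerHopfODE

open WienerHopfODE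
theorem theorem1 {p N : ℕ} (ε : ℝ) (k : Fin p → ℂ)
    (H L : Fin p → ℂ → Matrix (Fin N) (Fin N) ℂ) (hH : IsJumpData ε k H L) :
    -- (a), the family being indexed by the whole half-strip
    (∀ U : ℂ → ℂ → Matrix (Fin N) (Fin N) ℂ,
      (∀ b ∈ halfStrip ε, IsRHSolution k H L b (U b)) →
      (∃ s : Fin p → ℂ → Matrix (Fin N) (Fin N) ℂ,
        (∀ j, MatHolomorphicOn (s j) (halfStrip ε)) ∧
        ∀ b ∈ halfStrip ε, ∀ z ∈ cutPlane k b,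
          MatHasDerivAt (fun β => U β z) (odeCoeff k s z b * U b z) b) ∧
      ∀ z, Tendsto (fun b => U b z) (toImInfty (halfStrip ε)) (𝓝 1)) ∧
    -- (a), the family being indexed by the half-line only
    (∀ U : ℂ → ℂ → Matrix (Fin N) (Fin N) ℂ,
      (∀ b ∈ imagHalfLine, IsRHSolution k H L b (U b)) →
      (∃ s : Fin p → ℂ → Matrix (Fin N) (Fin N) ℂ,
        (∃ O : Set ℂ, IsOpen O ∧ imagHalfLine ⊆ O ∧ O ⊆ halfStrip ε ∧
          ∀ j, MatHolomorphicOn (s j) O) ∧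
        ∀ b ∈ imagHalfLine, ∀ z ∈ cutPlane k b,
          MatHasDerivWithinAt (fun β => U β z) (odeCoeff k s z b * U b z) imagHalfLine b) ∧
      ∀ z, Tendsto (fun b => U b z) (toImInfty imagHalfLine) (𝓝 1)) ∧
    -- (b)
    (∀ s : Fin p → ℂ → Matrix (Fin N) (Fin N) ℂ,
      (∀ j, MatHolomorphicOn (s j) (halfStrip ε)) →
      (∃ α : ℝ, 0 < α ∧ ∀ j a c,
        (fun τ => s j τ a c) =O[toImInfty (halfStrip ε)] fun τ => ‖τ‖ ^ (-α)) →
      (∀ m, ∀ z ∈ ray (k m), ∃ b ∈ imagHalfLine, ∃ δ : ℝ,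
        b.im < (z - k m).im ∧ 0 < δ ∧ δ < ε ∧
          HasOrderedExp (hairpin b δ) (fun τ => odeCoeff k s z τ) (H m z)) →
      ∃ U : ℂ → ℂ → Matrix (Fin N) (Fin N) ℂ,
        (∀ b ∈ halfStrip ε, IsRHSolution k H L b (U b)) ∧
        (∀ b ∈ halfStrip ε, ∀ V, IsRHSolution k H L b V → ∀ z ∈ cutPlane k b, V z = U b z) ∧
        ∀ b ∈ halfStrip ε, ∀ z ∈ cutPlane k b,
          HasOrderedExp (pathTo b) (fun τ => odeCoeff k s z τ) (U b z)) := by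
  exact ⟨fun U hU => ⟨hH.exists_residues hU, hH.tendsto_family Subset.rfl hU⟩,
    fun U hU => ⟨hH.exists_residues_line hU,
      hH.tendsto_family (imagHalfLine_subset hH.eps_pos) hU⟩,
    fun s hs hdec hhp => hH.exists_isRHSolution hs hdec hhp⟩
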